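/- **Setting.** Let $d_2,g\ge 1$ be integers, $n=2d_2+g-1$, and let $\Delta=\{L_1,\dots,L_{d_2}\}$ be a multiset of integers with $\sum_i L_i=0$ (a leaky degree). *Tropical stable maps.* A (cut) tropical stable map to $E_{\mathbb T}\times\mathbb P^1_{\mathbb T}$ of leaky degree $\Delta$ is a map $f:\Gamma\to\mathbb R^2$ from a (possibly disconnected) abstract tropical curve, affine with integer direction vector on each edge and balanced at each vertex, with $n$ contracted marked ends $x_1,\dots,x_n$, whose other ends are: $d_2$ ends of direction $(0,-1)$, one end of direction $(L_i,1)$ for each $i$, and ends of directions $(\pm w,0)$, $w\ge 1$; together with a pairing of the ends of direction $(w,0)$ with those of direction $(-w,0)$, paired ends having the same expansion factor $w$ and the same $y$-coordinate. (A connected component of $\Gamma$ may be a single horizontal line, which has one end of each direction.) Gluing paired ends gives a graph $\Gamma'$. The map is connected if $\Gamma'$ is, its genus is the first Betti number of $\Gamma'$, and its bidegree is $(d_1,d_2)$, where $d_1\ge 0$ is the sum of the expansion factors of the ends of primitive direction $(1,0)$. It satisfies the point conditions $p=(p_1,\dots,p_n)$ if $f(x_i)=p_i$ for all $i$. Maps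 are considered up to isometries of $\Gamma$ respecting $f$, the $x_i$ and the gluing. If $\Gamma$ is 3-valent and $f$ is an embedding locally around each vertex not adjacent to a contracted marked end, the multiplicity of the map is $\prod_V|\det(v_1,v_2)|$ over the vertices $V$ not adjacent to a contracted marked end, where $v_1,v_2$ are the directions of two edges at $V$. Let $N^{trop}_{(\Delta,d_1,d_2,g)}(p)$ be the number of connected such (3-valent, locally embedded) maps of leaky degree $\Delta$, bidegree $(d_1,d_2)$ and genus $g$ satisfying the conditions $p$, counted with multiplicity. *Pearl chains.* A pearl chain of type $(d_2,g)$ is a connected graph of genus $g$ with $d_2$ white and $d_2+g-1$ black vertices, whose edges join only vertices of different colours, whose black vertices are 2-valent, and which has no cycle of length two. $\mathrm{Aut}(\mathcal P)$ is the group of colour-preserving automorphisms. Let $N^{trop,\mathcal P}_{(\Delta,d_1,d_2,g)}(p)$ be the part of the count above given by those maps for which $\mathcal P$ is obtained from $\Gamma'$ by shrinking to a white vertex each floor (component of $\Gamma$ minus the edges of primitive direction $(\pm1,0)$ that has a non-horizontal edge), shrinking each contracted marked end that lies on horizontal edges to a black vertex, and forgetting the metric; the edges of $\mathcal P$ are the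 horizontal edges of $\Gamma'$. *Feynman integrals.* Label the vertices of $\mathcal P$ by $x_1,\dots,x_n$ and its edges by $1,\dots,r$. A suitable leaking vector $v\in\mathbb Z^n$ associates the leakings $L_1,\dots,L_{d_2}$ to the white vertices (the multiset of the entries of $v$ at white vertices is $\Delta$) and $0$ to the black ones; equal vectors are counted once. For a total order $\Omega$ of the vertices let $x_{k^1}<x_{k^2}$ be the vertices of the edge $k$, and put $$I^v_{\mathcal P,\Omega}(q)=\mathrm{Coef}_{[x_1^{v_1}\cdots x_n^{v_n}]}\prod_{k=1}^r P\Big(\frac{x_{k^1}}{x_{k^2}},q\Big),\qquad P(x,q)=-\sum_{d\ge1}d\,x^d-\sum_{a\ge1}\Big(\sum_{d\mid a}d\,(x^d+x^{-d})\Big)q^a .$$ **Statement.** There are constants $B_{d_1}\in\mathbb N$, $d_1\ge 0$, depending only on $\Delta,d_2,g,d_1$, such that the following holds. For each $d_1\ge0$ let $p^{(d_1)}=(p_1,\dots,p_n)$ be points of $\mathbb R^2$ which are in sufficiently general position (their $2n$ coordinates satisfy no nontrivial linear relation with integer coefficients of absolute value at most $B_{d_1}$) and sufficiently horizontally stretched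 ($|x(p_i)-x(p_j)|>B_{d_1}\,|y(p_k)-y(p_l)|$ for all $i\ne j$ and all $k,l$). Then for each $d_1$ only finitely many maps contribute to $N^{trop}_{(\Delta,d_1,d_2,g)}(p^{(d_1)})$, and $$\sum_{d_1\ge0}N^{trop}_{(\Delta,d_1,d_2,g)}(p^{(d_1)})\,q^{d_1}=\sum_{\mathcal P}\frac1{|\mathrm{Aut}(\mathcal P)|}\sum_v\sum_\Omega I^v_{\mathcal P,\Omega}(q),$$ where $\mathcal P$ runs over the isomorphism classes of pearl chains of type $(d_2,g)$, $v$ over the suitable leaking vectors and $\Omega$ over all $n!$ orders of the vertices. The equality also holds summand by summand: for each pearl chain $\mathcal P$ of type $(d_2,g)$, $$\sum_{d_1\ge0}N^{trop,\mathcal P}_{(\Delta,d_1,d_2,g)}(p^{(d_1)})\,q^{d_1}=\frac1{|\mathrm{Aut}(\mathcal P)|}\sum_v\sum_\Omega I^v_{\mathcal P,\Omega}(q).$$ -/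

import Mathlib

namespace TropEP

open scoped Classical in
/-- A tropical stable map `f : Γ → ℝ²` from a (not necessarily connected) abstract tropical curve
with `n` contracted marked ends.

`V` is the set of inner vertices and `H` the set of flags `(v, e)` at inner vertices. The involution
`opp` exchanges the two flags of a bounded edge and fixes the flag of an end. `dir h` is the
direction `v(V, e) ∈ ℤ²` of the flag, pointing away from its vertex. A line (an element of `Ln`) is a
connected component of `Γ` without inner vertices; it is mapped to the horizontal line of height
`lineHeight` with expansion factor `lineWeight`, and its two halves are ends of directions
`(w, 0)` and `(-w, 0)`. (Components without inner vertices of another direction would be whole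
connected components after gluing, without marked points, so they never occur in connected maps.) -/
structure PlaneMap (n : ℕ) where
  V : Type
  H : Type
  Ln : Type
  [fintypeV : Fintype V]
  [fintypeH : Fintype H]
  [fintypeLn : Fintype Ln]
  root : H → V
  opp : H → H
  opp_opp : ∀ h, opp (opp h) = h
  len : H → ENNReal
  len_pos : ∀ h, 0 < len h
  len_opp : ∀ h, len (opp h) = len h
  len_eq_top : ∀ h, len h = ⊤ ↔ opp h = h
  three_le_valence : ∀ v, 3 ≤ (Finset.univ.filter fun h => root h = v).card
  pos : V → ℝ × ℝ
  dir : H → ℤ × ℤ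
  dir_opp : ∀ h, opp h ≠ h → dir (opp h) = -dir h
  pos_opp_fst : ∀ h, opp h ≠ h →
    (pos (root (opp h))).1 = (pos (root h)).1 + (len h).toReal * ((dir h).1 : ℝ)
  pos_opp_snd : ∀ h, opp h ≠ h →
    (pos (root (opp h))).2 = (pos (root h)).2 + (len h).toReal * ((dir h).2 : ℝ)
  balanced : ∀ v, ∑ h ∈ Finset.univ.filter (fun h => root h = v), dir h = 0
  mark : Fin n → H
  mark_injective : Function.Injective mark
  mark_end : ∀ i, opp (mark i) = mark i
  mark_contracted : ∀ i, dir (mark i) = 0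
  lineWeight : Ln → ℕ
  lineWeight_pos : ∀ l, 0 < lineWeight l
  lineHeight : Ln → ℝ

attribute [instance] PlaneMap.fintypeV PlaneMap.fintypeH PlaneMap.fintypeLn

namespace PlaneMap

variable {n : ℕ} (A : PlaneMap n)

/-- Ends of primitive direction `(1, 0)`: flags of ends, and the right halves of the lines. -/
def rightEnds : Set (A.H ⊕ A.Ln) :=
  {s | Sum.elim (fun h => A.opp h = h ∧ 0 < (A.dir h).1 ∧ (A.dir h).2 = 0) (fun _ => True) s}

/-- Ends of primitive direction `(-1, 0)`: flags of ends, and the left halves of the lines. -/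
def leftEnds : Set (A.H ⊕ A.Ln) :=
  {s | Sum.elim (fun h => A.opp h = h ∧ (A.dir h).1 < 0 ∧ (A.dir h).2 = 0) (fun _ => True) s}

/-- The expansion factor of a horizontal end. -/
def endWeight : A.H ⊕ A.Ln → ℕ := Sum.elim (fun h => (A.dir h).1.natAbs) A.lineWeight

/-- The `y`-coordinate of a horizontal end. -/
def endHeight : A.H ⊕ A.Ln → ℝ := Sum.elim (fun h => (A.pos (A.root h)).2) A.lineHeight

/-- The inner vertex, or the line, to which an end belongs. -/
def endNode : A.H ⊕ A.Ln → A.V ⊕ A.Ln := Sum.map A.root id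

/-- The flag belongs to an edge of primitive direction `(±1, 0)`. -/
def IsHorizontal (h : A.H) : Prop := (A.dir h).2 = 0 ∧ (A.dir h).1 ≠ 0

/-- The vertex is adjacent to a contracted marked end. -/
def IsMarked (v : A.V) : Prop := ∃ i, A.root (A.mark i) = v

/-- `Γ` is `3`-valent and `f` is an embedding locally around each vertex which is not adjacent to a
contracted marked end: the flags there have nonzero directions that span pairwise distinct rays. -/
def IsSimple : Prop :=
  (∀ v, Nat.card {h // A.root h = v} = 3) ∧
  ∀ h h', A.root h = A.root h' → h ≠ h' → ¬ A.IsMarked (A.root h) →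
    ¬ SameRay ℤ (A.dir h) (A.dir h')

/-- The leaky degree is `Δ = {L₁, …, L_d}`: there are `d` ends of direction `(0, -1)`, the ends whose
direction has second coordinate `1` have directions `(L₁, 1), …, (L_d, 1)`, and all other unmarked
ends have primitive direction `(±1, 0)`. -/
def HasLeakyDegree (Δ : Multiset ℤ) : Prop :=
  Nat.card {h // A.opp h = h ∧ A.dir h = (0, -1)} = Δ.card ∧
  (open scoped Classical in
    ((Finset.univ.filter fun h => A.opp h = h ∧ (A.dir h).2 = 1).val.map
      fun h => (A.dir h).1) = Δ) ∧
  ∀ h, A.opp h = h → (∀ i, A.mark i ≠ h) →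
    A.dir h = (0, -1) ∨ (A.dir h).2 = 1 ∨ A.IsHorizontal h

/-- The image of the `i`-th marked end is `p i`. -/
def PassesThrough (p : Fin n → ℝ × ℝ) : Prop := ∀ i, A.pos (A.root (A.mark i)) = p i

open scoped Classical in
/-- `|det(u, w)|` for the directions `u, w` of two adjacent edges. At a balanced `3`-valent vertex
any two distinct flags give the same value (and a flag paired with itself gives `0`), so this is
written as a maximum over all pairs. -/
noncomputable def vertexMult (v : A.V) : ℕ :=
  Finset.univ.sup fun k : A.H × A.H =>
    if A.root k.1 = v ∧ A.root k.2 = v then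
      ((A.dir k.1).1 * (A.dir k.2).2 - (A.dir k.1).2 * (A.dir k.2).1).natAbs
    else 0

open scoped Classical in
/-- The product of the vertex multiplicities over all vertices not adjacent to marked ends. -/
noncomputable def mult : ℕ := ∏ v : A.V, if A.IsMarked v then 1 else A.vertexMult v

end PlaneMap

/-- A cut tropical stable map to `E_𝕋 × ℙ¹_𝕋`: a tropical stable map to the plane together with a
pairing of its ends of direction `(w, 0)` with its ends of direction `(-w, 0)` that respects
expansion factors and `y`-coordinates. -/
structure CutMap (n : ℕ) extends PlaneMap n where
  glue : toPlaneMap.rightEnds ≃ toPlaneMap.leftEnds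
  glue_weight : ∀ e, toPlaneMap.endWeight (glue e) = toPlaneMap.endWeight e
  glue_height : ∀ e, toPlaneMap.endHeight (glue e) = toPlaneMap.endHeight e

/-- An isomorphism of cut tropical stable maps: an isometry of the curves that respects the maps, the
contracted marked ends and the gluing. Labels of horizontal ends beyond the gluing are not part of
the data, so this is the equivalence under which tropical stable maps are counted. -/
structure CutMap.Iso {n : ℕ} (A B : CutMap n) where
  onV : A.V ≃ B.V
  onH : A.H ≃ B.H
  onLn : A.Ln ≃ B.Ln
  root_eq : ∀ h, B.root (onH h) = onV (A.root h)
  opp_eq : ∀ h, B.opp (onH h) = onH (A.opp h)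
  len_eq : ∀ h, B.len (onH h) = A.len h
  dir_eq : ∀ h, B.dir (onH h) = A.dir h
  pos_eq : ∀ v, B.pos (onV v) = A.pos v
  mark_eq : ∀ i, B.mark i = onH (A.mark i)
  lineWeight_eq : ∀ l, B.lineWeight (onLn l) = A.lineWeight l
  lineHeight_eq : ∀ l, B.lineHeight (onLn l) = A.lineHeight l
  glue_eq : ∀ (e : A.rightEnds) (e' : B.rightEnds), (e' : B.H ⊕ B.Ln) = Sum.map onH onLn e →
    (B.glue e' : B.H ⊕ B.Ln) = Sum.map onH onLn (A.glue e)

theorem PlaneMap.vertexMult_eq {n : ℕ} {A B : CutMap n} (φ : A.Iso B) (v : A.V) :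
    B.vertexMult (φ.onV v) = A.vertexMult v := by
  classical
  unfold PlaneMap.vertexMult
  rw [← Finset.map_univ_equiv (φ.onH.prodCongr φ.onH), Finset.sup_map]
  refine Finset.sup_congr rfl fun k _ => ?_
  simp [φ.root_eq, φ.dir_eq]

theorem PlaneMap.isMarked_iff {n : ℕ} {A B : CutMap n} (φ : A.Iso B) (v : A.V) :
    B.IsMarked (φ.onV v) ↔ A.IsMarked v := by
  simp [PlaneMap.IsMarked, φ.mark_eq, φ.root_eq]

theorem PlaneMap.mult_eq {n : ℕ} {A B : CutMap n} (φ : A.Iso B) : A.mult = B.mult := by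
  classical
  unfold PlaneMap.mult
  refine Fintype.prod_equiv φ.onV _ _ fun v => ?_
  simp only [PlaneMap.isMarked_iff φ v, PlaneMap.vertexMult_eq φ v]

namespace CutMap

variable {n : ℕ} (A : CutMap n)

/-- The glued graph `Γ'`, with every line subdivided by one point and with unbounded ends omitted:
`gluedAdj` says that two points are joined by a bounded edge of `Γ` or by a pair of glued ends. -/
def gluedAdj (a b : A.V ⊕ A.Ln) : Prop :=
  (∃ h, A.opp h ≠ h ∧ a = Sum.inl (A.root h) ∧ b = Sum.inl (A.root (A.opp h))) ∨
  ∃ e : A.rightEnds, a = A.endNode e ∧ b = A.endNode (A.glue e)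

/-- The glued graph without loops and multiplicities of edges, used for its components. -/
def gluedGraph : SimpleGraph (A.V ⊕ A.Ln) := SimpleGraph.fromRel A.gluedAdj

/-- The map is connected if the glued graph is. -/
def IsConnected : Prop := A.gluedGraph.Connected

/-- The first Betti number of `Γ'`: edges (bounded edges, which have two flags each, and glued pairs)
minus vertices plus components. -/
noncomputable def genus : ℤ :=
  ((Nat.card {h // A.opp h ≠ h} / 2 + Nat.card A.rightEnds : ℕ) : ℤ)
    - (Nat.card (A.V ⊕ A.Ln) : ℤ) + (Nat.card A.gluedGraph.ConnectedComponent : ℤ)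

/-- The first entry of the bidegree: the sum of the expansion factors of the ends of primitive
direction `(1, 0)` (equivalently, of those of primitive direction `(-1, 0)`). -/
noncomputable def degree : ℕ := ∑ᶠ e : A.rightEnds, A.endWeight e

/-- One end is glued to the other. -/
def Glued (a b : A.H ⊕ A.Ln) : Prop := ∃ e : A.rightEnds, (e : A.H ⊕ A.Ln) = a ∧
  (A.glue e : A.H ⊕ A.Ln) = b

/-- The flags `h`, pointing to the right, and `h'`, pointing to the left, are the two flags of one
horizontal edge of `Γ'`: a bounded edge of `Γ`, or an end `h` glued to an end `h'`, possibly through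
a chain of lines. -/
def Elevator (h h' : A.H) : Prop :=
  (A.opp h ≠ h ∧ h' = A.opp h) ∨ Relation.TransGen A.Glued (Sum.inl h) (Sum.inl h')

/-- The flags from which the horizontal edges of `Γ'` go to the right, one for each such edge. -/
def RightFlag : Type := {h : A.H // (A.dir h).2 = 0 ∧ 0 < (A.dir h).1}

/-- Two vertices are joined by an edge of `Γ` which is not of primitive direction `(±1, 0)`. -/
def FloorAdj (v w : A.V) : Prop :=
  ∃ h, A.opp h ≠ h ∧ ¬ A.IsHorizontal h ∧ A.root h = v ∧ A.root (A.opp h) = w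

end CutMap

/-- A pearl chain of type `(d₂, g)`, with its vertices labelled by `Fin (2 * d₂ + g - 1)`. A graph
whose edges join only vertices of different colours and that has no cycle of length two is simple. -/
@[ext]
structure PearlChain (d₂ g : ℕ) where
  graph : SimpleGraph (Fin (2 * d₂ + g - 1))
  white : Set (Fin (2 * d₂ + g - 1))
  connected : graph.Connected
  genus_eq : (graph.edgeSet.ncard : ℤ) - (2 * d₂ + g - 1 : ℕ) + 1 = g
  white_card : white.ncard = d₂
  black_card : whiteᶜ.ncard = d₂ + g - 1
  bipartite : ∀ a b, graph.Adj a b → (a ∈ white ↔ b ∉ white)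
  black_valence : ∀ a, a ∉ white → (graph.neighborSet a).ncard = 2

namespace PearlChain

variable {d₂ g : ℕ}

/-- Isomorphisms of pearl chains: graph isomorphisms preserving the colours. -/
def Iso (P Q : PearlChain d₂ g) : Type :=
  {σ : P.graph ≃g Q.graph // ∀ a, σ a ∈ Q.white ↔ a ∈ P.white}

instance isoSetoid (d₂ g : ℕ) : Setoid (PearlChain d₂ g) where
  r P Q := Nonempty (P.Iso Q)
  iseqv :=
    { refl := fun P => ⟨⟨SimpleGraph.Iso.refl, fun _ => Iff.rfl⟩⟩
      symm := by
        rintro P Q ⟨σ, hσ⟩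
        refine ⟨⟨σ.symm, fun a => ?_⟩⟩
        have := hσ (σ.symm a)
        simpa using this.symm
      trans := by
        rintro P Q R ⟨σ, hσ⟩ ⟨τ, hτ⟩
        exact ⟨⟨σ.trans τ, fun a => (hτ (σ a)).trans (hσ a)⟩⟩ }

instance : Finite (PearlChain d₂ g) :=
  Finite.of_injective (fun P => (P.graph, P.white)) fun P Q h => by
    simp only [Prod.mk.injEq] at h
    exact PearlChain.ext h.1 h.2

noncomputable instance : Fintype (Quotient (isoSetoid d₂ g)) := Fintype.ofFinite _

/-- `|Aut(𝒫)|`. -/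
noncomputable def autCard (P : PearlChain d₂ g) : ℕ := Nat.card (P.Iso P)

/-- A suitable leaking vector: it associates the leakings in `Δ` to the white vertices and `0` to
the black vertices. -/
def IsLeaking (P : PearlChain d₂ g) (Δ : Multiset ℤ) (v : Fin (2 * d₂ + g - 1) → ℤ) : Prop :=
  (∀ a, a ∉ P.white → v a = 0) ∧
  open scoped Classical in (Finset.univ.filter fun a => a ∈ P.white).val.map v = Δ

open scoped Classical in
/-- The finite set of all suitable leaking vectors. -/
noncomputable def leakingVectors (P : PearlChain d₂ g) (Δ : Multiset ℤ) :
    Finset (Fin (2 * d₂ + g - 1) → ℤ) :=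
  (Fintype.piFinset fun _ => insert 0 Δ.toFinset).filter fun v => P.IsLeaking Δ v

theorem mem_leakingVectors (P : PearlChain d₂ g) (Δ : Multiset ℤ)
    (v : Fin (2 * d₂ + g - 1) → ℤ) : v ∈ P.leakingVectors Δ ↔ P.IsLeaking Δ v := by
  classical
  simp only [leakingVectors, Finset.mem_filter, Fintype.mem_piFinset, Finset.mem_insert,
    Multiset.mem_toFinset, and_iff_right_iff_imp]
  intro h a
  by_cases ha : a ∈ P.white
  · right
    rw [← h.2]
    exact Multiset.mem_map_of_mem v (by simpa using ha)
  · exact Or.inl (h.1 a ha)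

end PearlChain

/-- The coefficient of `x ^ m * q ^ a` in the propagator
`P(x, q) = - ∑_{d ≥ 1} d x ^ d - ∑_{a ≥ 1} (∑_{d ∣ a} d (x ^ d + x ^ (-d))) q ^ a`. -/
def propagatorCoeff (m : ℤ) (a : ℕ) : ℤ :=
  if a = 0 then (if 0 < m then -m else 0) else (if m.natAbs ∣ a then -(m.natAbs : ℤ) else 0)

namespace PearlChain

variable {d₂ g : ℕ} (P : PearlChain d₂ g) (Ω : Equiv.Perm (Fin (2 * d₂ + g - 1)))

/-- The edges `k` of `𝒫`, written as the pair `(k¹, k²)` of their vertices with `k¹ < k²` in the order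
`Ω`, where the vertex `a` takes the place `Ω a`. -/
def OrderedEdge : Type :=
  {k : Fin (2 * d₂ + g - 1) × Fin (2 * d₂ + g - 1) // P.graph.Adj k.1 k.2 ∧ Ω k.1 < Ω k.2}

noncomputable instance : Fintype (P.OrderedEdge Ω) :=
  open scoped Classical in inferInstanceAs (Fintype {k : _ × _ // _})

/-- The exponent of `x_a` in the monomial `∏ₖ (x_{k¹} / x_{k²}) ^ (m k)`. -/
noncomputable def exponent (m : P.OrderedEdge Ω → ℤ) (a : Fin (2 * d₂ + g - 1)) : ℤ :=
  ∑ k, m k * ((if k.1.1 = a then 1 else 0) - (if k.1.2 = a then 1 else 0))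

/-- The Feynman integral `I^l_{𝒫,Ω}(q)`: the coefficient of `∏ₐ x_a ^ (l a)` in
`∏ₖ P(x_{k¹} / x_{k²}, q)`. Its coefficient of `q ^ d` is the (finite) sum over all choices of a term
`x ^ (s k).1 * q ^ (s k).2` of the propagator for each edge `k` for which the product of these terms
is the monomial in question. -/
noncomputable def feynman (l : Fin (2 * d₂ + g - 1) → ℤ) : PowerSeries ℚ :=
  PowerSeries.mk fun d =>
    ((∑ᶠ (s : P.OrderedEdge Ω → ℤ × ℕ)
        (_ : P.exponent Ω (fun k => (s k).1) = l ∧ ∑ k, (s k).2 = d),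
      ∏ k, propagatorCoeff (s k).1 (s k).2 : ℤ) : ℚ)

/-- The summand `1 / |Aut(𝒫)| ∑_v ∑_Ω I^v_{𝒫,Ω}(q)` of a pearl chain. -/
noncomputable def feynmanSum (Δ : Multiset ℤ) : PowerSeries ℚ :=
  ((P.autCard : ℚ)⁻¹) • ∑ v ∈ P.leakingVectors Δ,
    ∑ Ω : Equiv.Perm (Fin (2 * d₂ + g - 1)), P.feynman Ω v

end PearlChain

/-- The pearl chain `P` is obtained from the glued graph `Γ'` by shrinking each floor to a white
vertex and each contracted marked end on a horizontal edge to a black vertex: `φ` identifies exactly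
the vertices that are joined by non-horizontal edges of `Γ`, and the horizontal edges of `Γ'`
correspond to the edges of `P`. -/
def CutMap.HasPearlChain {d₂ g : ℕ} (A : CutMap (2 * d₂ + g - 1)) (P : PearlChain d₂ g) : Prop :=
  ∃ φ : A.V → Fin (2 * d₂ + g - 1), Function.Surjective φ ∧
    (∀ v w, φ v = φ w ↔ Relation.EqvGen A.FloorAdj v w) ∧
    (∀ v, φ v ∈ P.white ↔ ∃ h, A.root h = v ∧ (A.dir h).2 ≠ 0) ∧
    ∃ ψ : A.RightFlag ≃ P.graph.edgeSet, ∀ (h : A.RightFlag) (h' : A.H), A.Elevator h.1 h' →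
      (ψ h : Sym2 (Fin (2 * d₂ + g - 1))) = s(φ (A.root h.1), φ (A.root h'))

/-- The tropical stable maps that are counted: connected, of leaky degree `Δ`, bidegree
`(d₁, Δ.card)` and genus `g`, satisfying the point conditions `p`, and such that `Γ` is `3`-valent
and `f` locally an embedding, as required for the multiplicity to be defined. -/
def CutMap.IsCounted {n : ℕ} (Δ : Multiset ℤ) (d₁ g : ℕ) (p : Fin n → ℝ × ℝ) (A : CutMap n) :
    Prop :=
  A.IsConnected ∧ A.HasLeakyDegree Δ ∧ A.degree = d₁ ∧ A.genus = g ∧ A.PassesThrough p ∧ A.IsSimple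

/-- Tropical stable maps up to equivalence. -/
def MapClass (n : ℕ) : Type 1 := Quot fun A B : CutMap n => Nonempty (A.Iso B)

/-- The multiplicity of an equivalence class. -/
noncomputable def MapClass.mult {n : ℕ} : MapClass n → ℕ :=
  Quot.lift (fun A => A.mult) fun _ _ h => h.elim PlaneMap.mult_eq

/-- The set of equivalence classes of the counted maps. -/
def countedClasses {n : ℕ} (Δ : Multiset ℤ) (d₁ g : ℕ) (p : Fin n → ℝ × ℝ) : Set (MapClass n) :=
  Quot.mk _ '' {A | A.IsCounted Δ d₁ g p}

/-- The number `N^trop_{(Δ,d₁,d₂,g)}`, where `d₂ = Δ.card`, computed with the points `p`. -/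
noncomputable def tropCount {n : ℕ} (Δ : Multiset ℤ) (d₁ g : ℕ) (p : Fin n → ℝ × ℝ) : ℕ :=
  ∑ᶠ c ∈ countedClasses Δ d₁ g p, c.mult

/-- The number `N^{trop,𝒫}_{(Δ,d₁,d₂,g)}`: only maps with underlying pearl chain `𝒫` are counted. -/
noncomputable def tropCountOf {d₂ g : ℕ} (P : PearlChain d₂ g) (Δ : Multiset ℤ) (d₁ : ℕ)
    (p : Fin (2 * d₂ + g - 1) → ℝ × ℝ) : ℕ :=
  ∑ᶠ c ∈ (Quot.mk _ '' {A | A.IsCounted Δ d₁ g p ∧ A.HasPearlChain P} :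
    Set (MapClass (2 * d₂ + g - 1))), c.mult

/-- The points are in general position up to order `B`: their coordinates satisfy no nontrivial
linear relation with integer coefficients of absolute value at most `B`. -/
def InGeneralPosition {n : ℕ} (B : ℕ) (p : Fin n → ℝ × ℝ) : Prop :=
  ∀ c : Fin n → ℤ × ℤ, c ≠ 0 → (∀ i, |(c i).1| ≤ B ∧ |(c i).2| ≤ B) →
    ∑ i, (((c i).1 : ℝ) * (p i).1 + ((c i).2 : ℝ) * (p i).2) ≠ 0

/-- The points are horizontally stretched: their differences in `x`-direction exceed `B` times their
differences in `y`-direction. -/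
def HorizontallyStretched {n : ℕ} (B : ℕ) (p : Fin n → ℝ × ℝ) : Prop :=
  ∀ i j k l, i ≠ j → B * |(p k).2 - (p l).2| < |(p i).1 - (p j).1|

end TropEP

/-! Both sides count the same combinatorial objects, called diagrams. A diagram is a pearl chain
whose vertices are labelled by the marked points, together with a nonzero antisymmetric integer
weight and a symmetric winding number on each edge. The divergence of the weights is minus a
suitable leaking vector, and an edge that does not wind goes from a smaller to a larger x-coordinate
in the direction of its positive weight. Its multiplicity is the product of the absolute weights,
its degree the sum of absolute weight times winding number.

Feynman side. A term `x ^ m * q ^ a` with nonzero coefficient in the propagator of an edge has `m ≠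
0` and `|m|` dividing `a`; so it encodes a weight `-m` and a winding number `a / |m|`. The terms
with `a = 0` exist only for `m > 0`, which is the condition on straight edges. The exponents of the
`x_a` encode the divergence. Every coefficient is `-|m|`, and the signs cancel because a pearl chain
has the even number `2 * (d₂ + g - 1)` of edges (`Diagram.sum_feynman`). Summing over all orders of
the vertices amounts to keeping the order given by the points and summing over all relabellings of
the pearl chain; each labelled chain arises `|Aut|` times, which explains the prefactor
(`Diagram.coeff_feynmanSum`).

Tropical side, from maps to diagrams. Cut the glued graph at the marked points. Its Euler
characteristic forces at least `2 * d₂` components. A component without vertical ends would give, by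
the tropical Menelaus theorem, a forbidden linear relation between the coordinates of the points
(`menelaus`). As there are exactly `2 * d₂` vertical ends, every component has exactly one
(`cls_injective`). Consequently no vertex lies above or below all points, so that the stretching
makes each floor too narrow for two marked points (`abs_fst_sub_lt`), while a floor without marked
point would be a piece of a single component with two vertical ends. A floor thus meets only two
components and has one end up and one end down; the flux through a horizontal line is at most one,
and the floor is a path of vertices with one flag up, one down and one level flag (`floor_flags`).
Horizontal edges join a floor to a marked point off the floors (`linked_floor_iff`), and this gives
the pearl chain and the diagram.

From diagrams to maps. The height of a horizontal edge is the height of its black vertex, the slope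
of a floor is determined by the weights of the edges attached below, and its position by its marked
point. These formulas define a map (`Diagram.toCutMap`); the stretching ensures that straight
horizontal edges have positive length. An edge that winds `t > 0` times passes through `t - 1`
lines. Every map with the same diagram is isomorphic to the constructed one
(`nonempty_iso_toCutMap`). The unmarked vertices correspond to the horizontal edges, with the
absolute weight as vertex multiplicity, so the multiplicities agree. -/

namespace TropEP

/-! ### Sums and products over edges do not depend on orientations -/

section Orientation

variable {ι : Type*} {adj O O' : ι → ι → Prop}

open scoped Classical in
/-- If `O` and `O'` select exactly one of the two orientations of every edge, then the selected
oriented edges correspond to each other. -/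
noncomputable def orientationMap (hadj : ∀ i j, adj i j → adj j i)
    (hO' : ∀ i j, adj i j → (O' i j ↔ ¬ O' j i)) (k : {k : ι × ι // adj k.1 k.2 ∧ O k.1 k.2}) :
    {k : ι × ι // adj k.1 k.2 ∧ O' k.1 k.2} :=
  if h : O' k.1.1 k.1.2 then ⟨k.1, k.2.1, h⟩
  else ⟨k.1.swap, hadj _ _ k.2.1, by
    have := hO' _ _ k.2.1
    by_contra h'
    exact h (this.2 h')⟩

theorem orientationMap_bijective (hadj : ∀ i j, adj i j → adj j i)
    (hO : ∀ i j, adj i j → (O i j ↔ ¬ O j i))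
    (hO' : ∀ i j, adj i j → (O' i j ↔ ¬ O' j i)) :
    Function.Bijective (orientationMap (O := O) hadj hO') := by
  refine Function.bijective_iff_has_inverse.2 ⟨orientationMap hadj hO, ?_, ?_⟩
  · rintro ⟨⟨i, j⟩, h, h'⟩
    by_cases h1 : O' i j
    · simp [orientationMap, h1, h']
    · have := (hO _ _ h).1 h'
      simp [orientationMap, h1, this]
  · rintro ⟨⟨i, j⟩, h, h'⟩
    by_cases h1 : O i j
    · simp [orientationMap, h1, h']
    · have := (hO' _ _ h).1 h'
      simp [orientationMap, h1, this]

/-- Edges get oriented in three ways: by the order `Ω`, from white to black, and along the positive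
weight. This lemma passes between them. -/
theorem prod_orientation {M : Type*} [CommMonoid M]
    [Fintype {k : ι × ι // adj k.1 k.2 ∧ O k.1 k.2}]
    [Fintype {k : ι × ι // adj k.1 k.2 ∧ O' k.1 k.2}]
    (hadj : ∀ i j, adj i j → adj j i)
    (hO : ∀ i j, adj i j → (O i j ↔ ¬ O j i)) (hO' : ∀ i j, adj i j → (O' i j ↔ ¬ O' j i))
    (f : ι → ι → M) (hf : ∀ i j, f j i = f i j) :
    ∏ k : {k : ι × ι // adj k.1 k.2 ∧ O k.1 k.2}, f k.1.1 k.1.2 =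
      ∏ k : {k : ι × ι // adj k.1 k.2 ∧ O' k.1 k.2}, f k.1.1 k.1.2 := by
  refine Fintype.prod_bijective _ (orientationMap_bijective hadj hO hO') _ _ fun k => ?_
  unfold orientationMap
  split_ifs
  · rfl
  · exact (hf _ _).symm

theorem sum_orientation {M : Type*} [AddCommMonoid M]
    [Fintype {k : ι × ι // adj k.1 k.2 ∧ O k.1 k.2}]
    [Fintype {k : ι × ι // adj k.1 k.2 ∧ O' k.1 k.2}]
    (hadj : ∀ i j, adj i j → adj j i)
    (hO : ∀ i j, adj i j → (O i j ↔ ¬ O j i)) (hO' : ∀ i j, adj i j → (O' i j ↔ ¬ O' j i))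
    (f : ι → ι → M) (hf : ∀ i j, f j i = f i j) :
    ∑ k : {k : ι × ι // adj k.1 k.2 ∧ O k.1 k.2}, f k.1.1 k.1.2 =
      ∑ k : {k : ι × ι // adj k.1 k.2 ∧ O' k.1 k.2}, f k.1.1 k.1.2 :=
  prod_orientation (M := Multiplicative M) hadj hO hO' f hf

end Orientation

/-! ### Edges of a pearl chain and exponents of monomials -/

namespace PearlChain

variable {d₂ g : ℕ} (Q : PearlChain d₂ g)

/-- The edges of a pearl chain, oriented from their white to their black vertex. -/
abbrev WhitePair : Type :=
  {k : Fin (2 * d₂ + g - 1) × Fin (2 * d₂ + g - 1) // Q.graph.Adj k.1 k.2 ∧ k.1 ∈ Q.white}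

noncomputable instance : Fintype Q.WhitePair := Fintype.ofFinite _

variable {Q}

theorem adj_symm (i j : Fin (2 * d₂ + g - 1)) : Q.graph.Adj i j → Q.graph.Adj j i := fun h => h.symm

theorem white_orientation (i j : Fin (2 * d₂ + g - 1)) (h : Q.graph.Adj i j) :
    i ∈ Q.white ↔ ¬ j ∈ Q.white := Q.bipartite i j h

theorem order_orientation (Ω : Equiv.Perm (Fin (2 * d₂ + g - 1))) (i j : Fin (2 * d₂ + g - 1))
    (h : Q.graph.Adj i j) : Ω i < Ω j ↔ ¬ Ω j < Ω i := by
  have : Ω i ≠ Ω j := fun e => h.ne (Ω.injective e)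
  omega

variable (Q)

/-- Each edge has exactly one black vertex and black vertices are 2-valent, so the edges are counted
from the black side. What matters later is that the number is even. -/
theorem card_whitePair : Fintype.card Q.WhitePair = 2 * (d₂ + g - 1) := by
  classical
  have h1 : Fintype.card Q.WhitePair =
      Fintype.card {k : Fin (2 * d₂ + g - 1) × Fin (2 * d₂ + g - 1) //
        Q.graph.Adj k.1 k.2 ∧ k.1 ∉ Q.white} :=
    Fintype.card_of_bijective (orientationMap_bijective (O := fun i _ => i ∈ Q.white)
      (O' := fun i _ => i ∉ Q.white) adj_symm white_orientation
      (fun i j h => by have := Q.white_orientation i j h; tauto))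
  have e : {k : Fin (2 * d₂ + g - 1) × Fin (2 * d₂ + g - 1) //
        Q.graph.Adj k.1 k.2 ∧ k.1 ∉ Q.white} ≃ Σ a : (Q.whiteᶜ : Set _), Q.graph.neighborSet a.1 :=
    { toFun := fun k => ⟨⟨k.1.1, k.2.2⟩, ⟨k.1.2, k.2.1⟩⟩
      invFun := fun s => ⟨(s.1.1, s.2.1), s.2.2, s.1.2⟩
      left_inv := fun _ => rfl
      right_inv := fun _ => rfl }
  rw [h1, Fintype.card_congr e, Fintype.card_sigma]
  have : ∀ a : (Q.whiteᶜ : Set _), Fintype.card (Q.graph.neighborSet a.1) = 2 := fun a => by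
    have := Q.black_valence a.1 a.2
    rwa [← Nat.card_coe_set_eq, Nat.card_eq_fintype_card] at this
  rw [Finset.sum_congr rfl fun a _ => this a, Finset.sum_const, Finset.card_univ,
    ← Nat.card_eq_fintype_card, Nat.card_coe_set_eq, Q.black_card, smul_eq_mul, mul_comm]

/-- Reversing an edge changes the sign of both `w` and of its incidence at `a`. Hence the order only
affects how the edges at `a` are written, and the exponent is the negative divergence of `w` at `a`.
-/
theorem exponent_eq (Ω : Equiv.Perm (Fin (2 * d₂ + g - 1)))
    (w : Fin (2 * d₂ + g - 1) → Fin (2 * d₂ + g - 1) → ℤ) (hw : ∀ i j, w j i = - w i j)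
    (hadj : ∀ i j, ¬ Q.graph.Adj i j → w i j = 0) (a : Fin (2 * d₂ + g - 1)) :
    Q.exponent Ω (fun k => - w k.1.1 k.1.2) a = - ∑ j, w a j := by
  classical
  unfold exponent OrderedEdge
  have h1 : ∀ f : Fin (2 * d₂ + g - 1) × Fin (2 * d₂ + g - 1) → ℤ,
      ∑ k : Q.OrderedEdge Ω, f k.1 =
        ∑ k, if Q.graph.Adj k.1 k.2 ∧ Ω k.1 < Ω k.2 then f k else 0 := fun f => by
    rw [← Finset.sum_filter]
    exact (Finset.sum_subtype (p := fun k : Fin (2 * d₂ + g - 1) × Fin (2 * d₂ + g - 1) =>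
      Q.graph.Adj k.1 k.2 ∧ Ω k.1 < Ω k.2) _ (by simp) f).symm
  refine (h1 fun k => -w k.1 k.2 * ((if k.1 = a then 1 else 0) - if k.2 = a then 1 else 0)).trans ?_
  have h2 : ∀ k : Fin (2 * d₂ + g - 1) × Fin (2 * d₂ + g - 1),
      (if Q.graph.Adj k.1 k.2 ∧ Ω k.1 < Ω k.2 then
        -w k.1 k.2 * ((if k.1 = a then 1 else 0) - if k.2 = a then 1 else 0) else 0) =
      (if k.1 = a ∧ Ω k.1 < Ω k.2 then - w k.1 k.2 else 0) +
        (if k.2 = a ∧ Ω k.1 < Ω k.2 then - w k.2 k.1 else 0) := fun k => by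
    rw [hw k.1 k.2]
    by_cases hk : Q.graph.Adj k.1 k.2
    · by_cases hl : Ω k.1 < Ω k.2
      · simp only [hk, hl, and_self, and_true, if_true]
        by_cases e1 : k.1 = a <;> by_cases e2 : k.2 = a <;> simp [e1, e2]
      · simp [hl]
    · simp [hk, hadj _ _ hk]
  rw [Finset.sum_congr rfl fun k _ => h2 k, Finset.sum_add_distrib, Fintype.sum_prod_type,
    Fintype.sum_prod_type_right, ← Finset.sum_add_distrib]
  have h3 : ∀ i, ((∑ j, if i = a ∧ Ω i < Ω j then - w i j else 0) +
      ∑ j, if i = a ∧ Ω j < Ω i then - w i j else 0) = if i = a then - ∑ j, w i j else 0 := fun i => by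
    by_cases hi : i = a
    · simp only [hi, true_and, if_true]
      rw [← Finset.sum_add_distrib, ← Finset.sum_neg_distrib]
      refine Finset.sum_congr rfl fun j _ => ?_
      rcases lt_trichotomy (Ω a) (Ω j) with h | h | h
      · simp [h, h.not_gt]
      · have h' := Ω.injective h
        subst h'
        have := hw a a
        have : w a a = 0 := by omega
        simp [this]
      · simp [h, h.not_gt]
    · simp [hi]
  rw [Finset.sum_congr rfl fun i _ => h3 i]
  simp

end PearlChain

/-- The combinatorial data of a floor decomposed map with underlying pearl chain `Q`: `weight i j` is
the first coordinate of the direction of the horizontal edge from `i` to `j`, and `wind i j` the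
number of times that this edge crosses the cut. The marked points have the `x`-coordinates `x`. -/
@[ext]
structure Diagram {d₂ g : ℕ} (Q : PearlChain d₂ g) (Δ : Multiset ℤ)
    (x : Fin (2 * d₂ + g - 1) → ℝ) where
  weight : Fin (2 * d₂ + g - 1) → Fin (2 * d₂ + g - 1) → ℤ
  wind : Fin (2 * d₂ + g - 1) → Fin (2 * d₂ + g - 1) → ℕ
  weight_swap : ∀ i j, weight j i = - weight i j
  wind_swap : ∀ i j, wind j i = wind i j
  weight_ne_zero : ∀ i j, weight i j ≠ 0 ↔ Q.graph.Adj i j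
  wind_eq_zero : ∀ i j, ¬ Q.graph.Adj i j → wind i j = 0
  lt_of_straight : ∀ i j, wind i j = 0 → 0 < weight i j → x i < x j
  leaking : Q.IsLeaking Δ fun i => - ∑ j, weight i j

/-! ### Diagrams as choices of terms of the propagators -/

namespace Diagram

variable {d₂ g : ℕ} {Q : PearlChain d₂ g} {Δ : Multiset ℤ} {x : Fin (2 * d₂ + g - 1) → ℝ}
  (D : Diagram Q Δ x)

noncomputable def mult : ℕ := ∏ k : Q.WhitePair, (D.weight k.1.1 k.1.2).natAbs

noncomputable def degree : ℕ :=
  ∑ k : Q.WhitePair, (D.weight k.1.1 k.1.2).natAbs * D.wind k.1.1 k.1.2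

theorem weight_eq_zero {i j : Fin (2 * d₂ + g - 1)} (h : ¬ Q.graph.Adj i j) : D.weight i j = 0 := by
  by_contra h'
  exact h ((D.weight_ne_zero i j).1 h')

theorem weight_self (i : Fin (2 * d₂ + g - 1)) : D.weight i i = 0 := D.weight_eq_zero (by simp)

theorem weight_pos_orientation (i j : Fin (2 * d₂ + g - 1)) (h : Q.graph.Adj i j) :
    0 < D.weight i j ↔ ¬ 0 < D.weight j i := by
  have := (D.weight_ne_zero i j).2 h
  have := D.weight_swap i j
  omega

theorem natAbs_swap (i j : Fin (2 * d₂ + g - 1)) :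
    (D.weight j i).natAbs = (D.weight i j).natAbs := by
  rw [D.weight_swap i j, Int.natAbs_neg]

variable (Ω : Equiv.Perm (Fin (2 * d₂ + g - 1)))

/-- The terms of the propagators that correspond to a diagram. -/
def terms (k : Q.OrderedEdge Ω) : ℤ × ℕ :=
  (- D.weight k.1.1 k.1.2, (D.weight k.1.1 k.1.2).natAbs * D.wind k.1.1 k.1.2)

theorem exponent_terms : Q.exponent Ω (fun k => (D.terms Ω k).1) = fun i => - ∑ j, D.weight i j := by
  funext a
  exact Q.exponent_eq Ω D.weight D.weight_swap (fun i j h => D.weight_eq_zero h) a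

theorem sum_terms : ∑ k, (D.terms Ω k).2 = D.degree :=
  let _ : Fintype {k : Fin (2 * d₂ + g - 1) × Fin (2 * d₂ + g - 1) //
    Q.graph.Adj k.1 k.2 ∧ Ω k.1 < Ω k.2} :=
    (inferInstance : Fintype (Q.OrderedEdge Ω))
  sum_orientation (adj := Q.graph.Adj) (O := fun i j => Ω i < Ω j) (O' := fun i _ => i ∈ Q.white)
    PearlChain.adj_symm (PearlChain.order_orientation Ω) PearlChain.white_orientation
    (fun i j => (D.weight i j).natAbs * D.wind i j)
    (fun i j => by rw [D.natAbs_swap, D.wind_swap])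

variable {Ω} (hΩ : ∀ i j, Ω i < Ω j ↔ x j < x i)

include hΩ in
-- `Ω` runs against the x-coordinates. A straight edge goes to the right along its positive weight,
-- so from `k¹` to `k²` its weight is negative and the exponent of `x` is positive, the only sign
-- that occurs at `q ^ 0`. For winding edges both signs are allowed.
theorem propagatorCoeff_terms (k : Q.OrderedEdge Ω) :
    propagatorCoeff (D.terms Ω k).1 (D.terms Ω k).2 = -((D.weight k.1.1 k.1.2).natAbs : ℤ) := by
  have h0 := (D.weight_ne_zero _ _).2 k.2.1
  unfold propagatorCoeff terms
  by_cases ht : D.wind k.1.1 k.1.2 = 0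
  · have h1 : ¬ 0 < D.weight k.1.1 k.1.2 := fun h =>
      lt_asymm (D.lt_of_straight _ _ ht h) ((hΩ _ _).1 k.2.2)
    have h2 : 0 < - D.weight k.1.1 k.1.2 := by omega
    simp only [ht, mul_zero, if_true, h2]
    omega
  · have h3 : (D.weight k.1.1 k.1.2).natAbs * D.wind k.1.1 k.1.2 ≠ 0 :=
      mul_ne_zero (by omega) ht
    simp [h3]

include hΩ in
-- One sign `-1` per edge, and the number of edges is even.
theorem prod_terms : ∏ k, propagatorCoeff (D.terms Ω k).1 (D.terms Ω k).2 = (D.mult : ℤ) := by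
  rw [Finset.prod_congr rfl fun k _ => D.propagatorCoeff_terms hΩ k]
  let _ : Fintype {k : Fin (2 * d₂ + g - 1) × Fin (2 * d₂ + g - 1) //
    Q.graph.Adj k.1 k.2 ∧ Ω k.1 < Ω k.2} :=
    (inferInstance : Fintype (Q.OrderedEdge Ω))
  have := prod_orientation (adj := Q.graph.Adj) (O := fun i j => Ω i < Ω j)
    (O' := fun i _ => i ∈ Q.white) PearlChain.adj_symm (PearlChain.order_orientation Ω) PearlChain.white_orientation
    (fun i j => -((D.weight i j).natAbs : ℤ)) (fun i j => by rw [D.natAbs_swap])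
  refine this.trans ?_
  rw [Finset.prod_neg, Finset.card_univ, Q.card_whitePair, mult]
  push_cast
  rw [Even.neg_one_pow ⟨d₂ + g - 1, by ring⟩, one_mul]

/-- The winding number is recovered from the exponent of `q` upon division by the absolute weight,
which is nonzero on edges. -/
theorem terms_injective : Function.Injective fun D : Diagram Q Δ x => D.terms Ω := by
  intro D E h
  have key : ∀ i j, Ω i < Ω j → D.weight i j = E.weight i j ∧ D.wind i j = E.wind i j := by
    intro i j hij
    by_cases hadj : Q.graph.Adj i j
    · have := congrFun h ⟨(i, j), hadj, hij⟩
      simp only [terms, Prod.mk.injEq, neg_inj] at this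
      refine ⟨this.1, ?_⟩
      rw [this.1] at this
      have h0 := (E.weight_ne_zero _ _).2 hadj
      exact Nat.eq_of_mul_eq_mul_left (by omega) this.2
    · rw [D.weight_eq_zero hadj, E.weight_eq_zero hadj, D.wind_eq_zero _ _ hadj,
        E.wind_eq_zero _ _ hadj]
      exact ⟨rfl, rfl⟩
  have all : ∀ i j, D.weight i j = E.weight i j ∧ D.wind i j = E.wind i j := by
    intro i j
    rcases lt_trichotomy (Ω i) (Ω j) with hij | hij | hij
    · exact key i j hij
    · have := Ω.injective hij
      subst this
      rw [D.weight_self, E.weight_self, D.wind_eq_zero i i (by simp), E.wind_eq_zero i i (by simp)]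
      exact ⟨rfl, rfl⟩
    · rw [D.weight_swap j i, E.weight_swap j i, D.wind_swap j i, E.wind_swap j i, (key j i hij).1,
        (key j i hij).2]
      exact ⟨rfl, rfl⟩
  ext i j
  · exact (all i j).1
  · exact (all i j).2

theorem propagatorCoeff_ne_zero {m : ℤ} {a : ℕ} (h : propagatorCoeff m a ≠ 0) :
    m ≠ 0 ∧ m.natAbs ∣ a ∧ (a = 0 → 0 < m) := by
  unfold propagatorCoeff at h
  split_ifs at h with h1 h2 h3
  · subst h1
    exact ⟨h2.ne', dvd_zero _, fun _ => h2⟩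
  · exact absurd rfl h
  · refine ⟨?_, h3, fun e => absurd e h1⟩
    rintro rfl
    simp at h
  · exact absurd rfl h

include hΩ in
open scoped Classical in
-- A choice of terms with nonzero coefficients is decoded by weight `-m` and winding number `a /
-- |m|`, extended to both orientations. The division is exact on the support of the propagator.
theorem exists_terms_eq {v : Fin (2 * d₂ + g - 1) → ℤ} (hv : Q.IsLeaking Δ v)
    (s : Q.OrderedEdge Ω → ℤ × ℕ) (hs : Q.exponent Ω (fun k => (s k).1) = v)
    (hne : ∏ k, propagatorCoeff (s k).1 (s k).2 ≠ 0) : ∃ D : Diagram Q Δ x, D.terms Ω = s := by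
  have hne' := fun k => propagatorCoeff_ne_zero (Finset.prod_ne_zero_iff.1 hne k (Finset.mem_univ k))
  let w : Fin (2 * d₂ + g - 1) → Fin (2 * d₂ + g - 1) → ℤ := fun i j =>
    if h : Q.graph.Adj i j ∧ Ω i < Ω j then - (s ⟨(i, j), h⟩).1 else
      if h : Q.graph.Adj j i ∧ Ω j < Ω i then (s ⟨(j, i), h⟩).1 else 0
  let t : Fin (2 * d₂ + g - 1) → Fin (2 * d₂ + g - 1) → ℕ := fun i j =>
    if h : Q.graph.Adj i j ∧ Ω i < Ω j then (s ⟨(i, j), h⟩).2 / (s ⟨(i, j), h⟩).1.natAbs else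
      if h : Q.graph.Adj j i ∧ Ω j < Ω i then (s ⟨(j, i), h⟩).2 / (s ⟨(j, i), h⟩).1.natAbs else 0
  have w1 : ∀ k : Q.OrderedEdge Ω, w k.1.1 k.1.2 = - (s k).1 := fun k => by
    simp only [w]
    rw [dif_pos k.2]
    rfl
  have t1 : ∀ k : Q.OrderedEdge Ω, t k.1.1 k.1.2 = (s k).2 / (s k).1.natAbs := fun k => by
    simp only [t]
    rw [dif_pos k.2]
    rfl
  have wswap : ∀ i j, w j i = - w i j := by
    intro i j
    by_cases h : Q.graph.Adj i j ∧ Ω i < Ω j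
    · have h' : ¬ (Q.graph.Adj j i ∧ Ω j < Ω i) := fun h'' => lt_asymm h.2 h''.2
      simp only [w, dif_pos h, dif_neg h', neg_neg]
    · by_cases h' : Q.graph.Adj j i ∧ Ω j < Ω i
      · simp only [w, dif_pos h', dif_neg h]
      · simp only [w, dif_neg h', dif_neg h, neg_zero]
  have tswap : ∀ i j, t j i = t i j := by
    intro i j
    by_cases h : Q.graph.Adj i j ∧ Ω i < Ω j
    · have h' : ¬ (Q.graph.Adj j i ∧ Ω j < Ω i) := fun h'' => lt_asymm h.2 h''.2
      simp only [t, dif_pos h, dif_neg h']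
    · by_cases h' : Q.graph.Adj j i ∧ Ω j < Ω i
      · simp only [t, dif_pos h', dif_neg h]
      · simp only [t, dif_neg h', dif_neg h]
  have cases_adj : ∀ i j, Q.graph.Adj i j → (∃ h, ∃ k : Q.OrderedEdge Ω, k = ⟨(i, j), h⟩) ∨
      ∃ h, ∃ k : Q.OrderedEdge Ω, k = ⟨(j, i), h⟩ := fun i j h => by
    by_cases hl : Ω i < Ω j
    · exact Or.inl ⟨⟨h, hl⟩, _, rfl⟩
    · exact Or.inr ⟨⟨h.symm, by have := PearlChain.order_orientation Ω j i h.symm; tauto⟩, _, rfl⟩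
  have wadj : ∀ i j, ¬ Q.graph.Adj i j → w i j = 0 := fun i j h => by
    have h' : ¬ Q.graph.Adj j i := fun e => h e.symm
    simp [w, h, h']
  have wexp : (fun i => - ∑ j, w i j) = v := by
    rw [← hs]
    funext a
    rw [← Q.exponent_eq Ω w wswap wadj a]
    congr 1
    funext k
    rw [w1, neg_neg]
  refine ⟨⟨w, t, wswap, tswap, ?_, ?_, ?_, by rw [wexp]; exact hv⟩, ?_⟩
  · intro i j
    refine ⟨fun h => by_contra fun h' => h (wadj i j h'), fun h => ?_⟩
    rcases cases_adj i j h with ⟨hk, k, rfl⟩ | ⟨hk, k, rfl⟩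
    · have h1 := w1 ⟨(i, j), hk⟩
      have h2 := (hne' ⟨(i, j), hk⟩).1
      exact fun e => h2 (neg_eq_zero.1 (h1.symm.trans e))
    · have h1 := w1 ⟨(j, i), hk⟩
      have h2 := (hne' ⟨(j, i), hk⟩).1
      rw [wswap j i]
      exact fun e => h2 (neg_eq_zero.1 (h1.symm.trans (neg_eq_zero.1 e)))
  · intro i j h
    have h' : ¬ Q.graph.Adj j i := fun e => h e.symm
    simp [t, h, h']
  · intro i j ht hw
    have hij : Q.graph.Adj i j := by
      by_contra h
      rw [wadj i j h] at hw
      exact lt_irrefl _ hw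
    -- Winding number zero means `a = 0`, since `|m|` divides `a`; the propagator then requires `m >
    -- 0`.
    have pos : ∀ k : Q.OrderedEdge Ω, t k.1.1 k.1.2 = 0 → 0 < (s k).1 := fun k hk => by
      rw [t1] at hk
      refine (hne' k).2.2 ?_
      rw [← Nat.div_mul_cancel (hne' k).2.1, hk, zero_mul]
    rcases cases_adj i j hij with ⟨hk, k, rfl⟩ | ⟨hk, k, rfl⟩
    · have h1 := pos ⟨(i, j), hk⟩ ht
      have h2 := w1 ⟨(i, j), hk⟩
      simp only at h2
      omega
    · exact (hΩ _ _).1 hk.2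
  · funext k
    unfold terms
    simp only [w1, t1, neg_neg, Int.natAbs_neg]
    rw [Nat.mul_div_cancel' (hne' k).2.1]

end Diagram

end TropEP

namespace TropEP

variable {d₂ g : ℕ}

/-! ### Finiteness of diagrams of given degree, and the Feynman integral for a fixed order -/

namespace Diagram

variable {Q : PearlChain d₂ g} {Δ : Multiset ℤ} {x : Fin (2 * d₂ + g - 1) → ℝ}

theorem sum_natAbs_leaking {v : Fin (2 * d₂ + g - 1) → ℤ} (hv : Q.IsLeaking Δ v) :
    ∑ a, (v a).natAbs = (Δ.map Int.natAbs).sum := by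
  classical
  rw [← hv.2, Multiset.map_map, ← Finset.sum_filter_of_ne (p := fun a => a ∈ Q.white)
    (fun a _ h => by by_contra h'; simp [hv.1 a h'] at h)]
  rfl

theorem weight_mul_wind_le (D : Diagram Q Δ x) :
    ∑ i, ∑ j, (if 0 < D.weight i j then (D.weight i j).natAbs * D.wind i j else 0) = D.degree := by
  classical
  have := sum_orientation (adj := Q.graph.Adj) (O := fun i _ => i ∈ Q.white)
    (O' := fun i j => 0 < D.weight i j) PearlChain.adj_symm PearlChain.white_orientation
    D.weight_pos_orientation (fun i j => (D.weight i j).natAbs * D.wind i j)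
    (fun i j => by rw [D.natAbs_swap, D.wind_swap])
  rw [degree, this, ← Fintype.sum_prod_type', ← Finset.sum_filter]
  refine (Finset.sum_subtype _ (fun k => ?_) _)
  simp only [Finset.mem_filter, Finset.mem_univ, true_and]
  exact ⟨fun h => ⟨(D.weight_ne_zero _ _).1 h.ne', h⟩, fun h => h.2⟩

/-- Conservation of flux through a vertical line. A winding edge is bounded by the degree alone. For
a straight edge, the weights leaving the half plane to the left of `x j` sum up to at most the total
leaking, and whatever flows back into it winds and is bounded by the degree. -/
theorem weight_le (D : Diagram Q Δ x) (i j : Fin (2 * d₂ + g - 1)) :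
    D.weight i j ≤ D.degree + (Δ.map Int.natAbs).sum := by
  classical
  have hdeg := D.weight_mul_wind_le
  rcases le_or_gt (D.weight i j) 0 with h0 | h0
  · exact h0.trans (by positivity)
  by_cases ht : D.wind i j = 0
  swap
  · have h1 : (if 0 < D.weight i j then (D.weight i j).natAbs * D.wind i j else 0) ≤ D.degree := by
      rw [← hdeg]
      exact (Finset.single_le_sum (f := fun j => if 0 < D.weight i j then
        (D.weight i j).natAbs * D.wind i j else 0) (fun _ _ => Nat.zero_le _)
        (Finset.mem_univ j)).trans (Finset.single_le_sum (f := fun i => ∑ j, if 0 < D.weight i j then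
        (D.weight i j).natAbs * D.wind i j else 0) (fun _ _ => Nat.zero_le _) (Finset.mem_univ i))
    rw [if_pos h0] at h1
    have h2 : (D.weight i j).natAbs ≤ (D.weight i j).natAbs * D.wind i j :=
      Nat.le_mul_of_pos_right _ (Nat.pos_of_ne_zero ht)
    omega
  have hx := D.lt_of_straight i j ht h0
  -- The edge from `i` to `j` leaves this set.
  let S := Finset.univ.filter fun a => x a < x j
  have h1 : ∑ a ∈ S, ∑ b ∈ S, D.weight a b = 0 := by
    have : ∑ a ∈ S, ∑ b ∈ S, D.weight a b = - ∑ a ∈ S, ∑ b ∈ S, D.weight a b := by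
      conv_lhs => rw [Finset.sum_comm]
      simp only [← Finset.sum_neg_distrib]
      exact Finset.sum_congr rfl fun a _ => Finset.sum_congr rfl fun b _ => D.weight_swap _ _
    omega
  have h2 : ∑ a ∈ S, ∑ b, D.weight a b ≤ (Δ.map Int.natAbs).sum := by
    rw [← sum_natAbs_leaking D.leaking]
    push_cast
    calc ∑ a ∈ S, ∑ b, D.weight a b ≤ ∑ a ∈ S, |-∑ b, D.weight a b| :=
          Finset.sum_le_sum fun a _ => by rw [abs_neg]; exact le_abs_self _
      _ ≤ _ := Finset.sum_le_sum_of_subset_of_nonneg (Finset.subset_univ _)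
          fun _ _ _ => abs_nonneg _
  -- A positive weight from `b` outside `S` to `a` inside goes to the left, so this edge winds and
  -- its share of the degree outweighs its negative contribution to the flux.
  have h3 : ∀ a ∈ S, ∀ b ∈ Sᶜ, (if a = i ∧ b = j then D.weight i j else 0) ≤ D.weight a b +
      ((if 0 < D.weight b a then (D.weight b a).natAbs * D.wind b a else 0 : ℕ) : ℤ) := by
    intro a ha b hb
    simp only [S, Finset.mem_filter, Finset.mem_univ, true_and, Finset.mem_compl, not_lt] at ha hb
    have hw := D.weight_swap a b
    by_cases h : a = i ∧ b = j
    · obtain ⟨rfl, rfl⟩ := h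
      rw [if_pos ⟨rfl, rfl⟩]
      exact le_add_of_nonneg_right (Int.natCast_nonneg _)
    · rw [if_neg h]
      by_cases h4 : 0 < D.weight b a
      · rw [if_pos h4]
        have h5 : D.wind b a ≠ 0 := fun e => by
          have := D.lt_of_straight _ _ e h4
          linarith
        have h6 : (D.weight b a).natAbs ≤ (D.weight b a).natAbs * D.wind b a :=
          Nat.le_mul_of_pos_right _ (Nat.pos_of_ne_zero h5)
        omega
      · rw [if_neg h4]
        omega
  have h4 : ∑ a ∈ S, ∑ b ∈ Sᶜ, (if a = i ∧ b = j then D.weight i j else 0) = D.weight i j := by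
    have hi : i ∈ S := by simpa [S] using hx
    have hj : j ∈ Sᶜ := by simp [S]
    rw [Finset.sum_eq_single_of_mem i hi fun a _ h => by simp [h],
      Finset.sum_eq_single_of_mem j hj fun b _ h => by simp [h]]
    simp
  have h5 : ∑ a ∈ S, ∑ b ∈ Sᶜ,
      (if 0 < D.weight b a then (D.weight b a).natAbs * D.wind b a else 0) ≤ D.degree := by
    rw [← hdeg, Finset.sum_comm]
    calc _ ≤ ∑ b ∈ Sᶜ, ∑ a, (if 0 < D.weight b a then (D.weight b a).natAbs * D.wind b a else 0) :=
          Finset.sum_le_sum fun b _ => Finset.sum_le_sum_of_subset (Finset.subset_univ _)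
      _ ≤ _ := Finset.sum_le_sum_of_subset (Finset.subset_univ _)
  have h6 : ∑ a ∈ S, ∑ b, D.weight a b = ∑ a ∈ S, ∑ b ∈ Sᶜ, D.weight a b := by
    rw [← zero_add (∑ a ∈ S, ∑ b ∈ Sᶜ, D.weight a b), ← h1, ← Finset.sum_add_distrib]
    exact Finset.sum_congr rfl fun a _ => (Finset.sum_add_sum_compl S _).symm
  have h7 := Finset.sum_le_sum fun a ha => Finset.sum_le_sum (h3 a ha)
  simp only [Finset.sum_add_distrib] at h7
  rw [h4, ← h6] at h7
  have h8 : (∑ a ∈ S, ∑ b ∈ Sᶜ, ((if 0 < D.weight b a then (D.weight b a).natAbs * D.wind b a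
      else 0 : ℕ) : ℤ)) ≤ D.degree := by exact_mod_cast h5
  linarith

theorem abs_weight_le (D : Diagram Q Δ x) (i j : Fin (2 * d₂ + g - 1)) :
    |D.weight i j| ≤ D.degree + (Δ.map Int.natAbs).sum :=
  abs_le.2 ⟨by have := D.weight_le j i; rw [D.weight_swap i j] at this; linarith, D.weight_le i j⟩

theorem wind_le (D : Diagram Q Δ x) (i j : Fin (2 * d₂ + g - 1)) : D.wind i j ≤ D.degree := by
  classical
  have key : ∀ i j, 0 < D.weight i j → D.wind i j ≤ D.degree := fun i j h0 => by
    rw [← D.weight_mul_wind_le]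
    refine le_trans ?_ ((Finset.single_le_sum (f := fun j => if 0 < D.weight i j then
        (D.weight i j).natAbs * D.wind i j else 0) (fun _ _ => Nat.zero_le _)
        (Finset.mem_univ j)).trans (Finset.single_le_sum (f := fun i => ∑ j, if 0 < D.weight i j then
        (D.weight i j).natAbs * D.wind i j else 0) (fun _ _ => Nat.zero_le _) (Finset.mem_univ i)))
    simp only [h0, if_true]
    exact Nat.le_mul_of_pos_left _ (by omega)
  rcases lt_trichotomy 0 (D.weight i j) with h | h | h
  · exact key i j h
  · rw [D.wind_eq_zero i j fun e => (D.weight_ne_zero i j).2 e h.symm]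
    exact Nat.zero_le _
  · rw [← D.wind_swap]
    exact key j i (by rw [D.weight_swap i j]; omega)

instance (d : ℕ) : Finite {D : Diagram Q Δ x // D.degree = d} := by
  let I := Fin (2 * d₂ + g - 1)
  let c : ℤ := d + (Δ.map Int.natAbs).sum
  let f : {D : Diagram Q Δ x // D.degree = d} → (I → I → Set.Icc (-c) c) × (I → I → Set.Iic d) :=
    fun D => (fun i j => ⟨D.1.weight i j, by
      have := abs_le.1 (D.1.abs_weight_le i j)
      rw [D.2] at this
      exact this⟩, fun i j => ⟨D.1.wind i j, (D.1.wind_le i j).trans_eq D.2⟩)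
  refine Finite.of_injective f fun D E h => ?_
  simp only [f, Prod.mk.injEq] at h
  refine Subtype.ext (Diagram.ext ?_ ?_)
  · funext i j
    exact congrArg Subtype.val (congrFun (congrFun h.1 i) j)
  · funext i j
    exact congrArg Subtype.val (congrFun (congrFun h.2 i) j)

noncomputable instance (d : ℕ) : Fintype {D : Diagram Q Δ x // D.degree = d} := Fintype.ofFinite _

variable (Q Δ x)

/-- The number of diagrams of degree `d`, counted with multiplicity. -/
noncomputable def count (d : ℕ) : ℕ := ∑ D : {D : Diagram Q Δ x // D.degree = d}, D.1.mult

variable {x}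

/-- Every diagram has exactly one leaking vector, so the sum over `v` collects each diagram once.
Choices of terms that come from no diagram have a vanishing coefficient. -/
theorem sum_feynman {Ω : Equiv.Perm (Fin (2 * d₂ + g - 1))} (hΩ : ∀ i j, Ω i < Ω j ↔ x j < x i)
    (d : ℕ) :
    PowerSeries.coeff d (∑ v ∈ Q.leakingVectors Δ, Q.feynman Ω v) = (count Q Δ x d : ℚ) := by
  classical
  rw [map_sum]
  simp only [PearlChain.feynman, PowerSeries.coeff_mk]
  let T := {D : Diagram Q Δ x // D.degree = d}
  let c : (Q.OrderedEdge Ω → ℤ × ℕ) → ℤ := fun s => ∏ k, propagatorCoeff (s k).1 (s k).2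
  have h1 : ∀ v ∈ Q.leakingVectors Δ,
      (∑ᶠ (s : Q.OrderedEdge Ω → ℤ × ℕ)
        (_ : Q.exponent Ω (fun k => (s k).1) = v ∧ ∑ k, (s k).2 = d), c s) =
      ∑ D : T with (fun i => - ∑ j, D.1.weight i j) = v, (D.1.mult : ℤ) := by
    intro v hv
    rw [PearlChain.mem_leakingVectors] at hv
    have h2 : (∑ᶠ s ∈ {s : Q.OrderedEdge Ω → ℤ × ℕ | Q.exponent Ω (fun k => (s k).1) = v ∧
        ∑ k, (s k).2 = d}, c s) = ∑ᶠ s ∈ (fun D : T => D.1.terms Ω) ''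
          {D : T | (fun i => - ∑ j, D.1.weight i j) = v}, c s := by
      -- The two index sets agree where the product of the coefficients is nonzero, which is all
      -- that the sums see.
      refine finsum_mem_inter_support_eq _ _ _ (Set.ext fun s => ?_)
      simp only [Set.mem_inter_iff, Set.mem_ofPred_eq, Function.mem_support, Set.mem_image]
      refine ⟨fun ⟨⟨ha, hb⟩, hc⟩ => ⟨?_, hc⟩, ?_⟩
      · obtain ⟨D, rfl⟩ := exists_terms_eq (Δ := Δ) hΩ hv s ha hc
        rw [sum_terms] at hb
        rw [exponent_terms] at ha
        exact ⟨⟨D, hb⟩, ha, rfl⟩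
      · rintro ⟨⟨D, hD, rfl⟩, hc⟩
        exact ⟨⟨by rw [exponent_terms]; exact hD, by rw [sum_terms]; exact D.2⟩, hc⟩
    refine h2.trans ?_
    rw [finsum_mem_image fun D _ E _ h => Subtype.ext (terms_injective h)]
    rw [finsum_mem_eq_finite_toFinset_sum _ (Set.toFinite _)]
    refine Finset.sum_congr (by ext; simp) fun D _ => D.1.prod_terms hΩ
  have h3 : (∑ v ∈ Q.leakingVectors Δ, ∑ᶠ (s : Q.OrderedEdge Ω → ℤ × ℕ)
        (_ : Q.exponent Ω (fun k => (s k).1) = v ∧ ∑ k, (s k).2 = d), c s) = (count Q Δ x d : ℤ) := by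
    rw [Finset.sum_congr rfl h1, Finset.sum_fiberwise_of_maps_to, count, Nat.cast_sum]
    intro D _
    rw [PearlChain.mem_leakingVectors]
    exact D.1.leaking
  exact_mod_cast h3

end Diagram

/-! ### Relabelling of pearl chains and the automorphism factor -/

namespace PearlChain

/-- The pearl chain `P` with its vertices renamed by `τ`. -/
def relabel (P : PearlChain d₂ g) (τ : Equiv.Perm (Fin (2 * d₂ + g - 1))) : PearlChain d₂ g where
  graph := P.graph.comap τ.symm
  white := τ.symm ⁻¹' P.white
  connected := (SimpleGraph.Iso.comap τ.symm P.graph).connected_iff.2 P.connected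
  genus_eq := by
    rw [← P.genus_eq]
    congr 3
    have := Nat.card_congr (SimpleGraph.Iso.comap τ.symm P.graph).mapEdgeSet
    rwa [Nat.card_coe_set_eq, Nat.card_coe_set_eq] at this
  white_card := by
    refine Eq.trans ?_ P.white_card
    exact Set.ncard_preimage_of_injective_subset_range τ.symm.injective (by simp)
  black_card := by
    refine Eq.trans ?_ P.black_card
    rw [← Set.preimage_compl]
    exact Set.ncard_preimage_of_injective_subset_range τ.symm.injective (by simp)
  bipartite a b h := P.bipartite _ _ h
  black_valence a h := by
    refine Eq.trans ?_ (P.black_valence _ h)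
    exact Set.ncard_preimage_of_injective_subset_range
      (s := P.graph.neighborSet (τ.symm a)) τ.symm.injective (by simp)

theorem relabel_adj (P : PearlChain d₂ g) (τ : Equiv.Perm (Fin (2 * d₂ + g - 1)))
    (i j : Fin (2 * d₂ + g - 1)) : (P.relabel τ).graph.Adj (τ i) (τ j) ↔ P.graph.Adj i j := by
  simp [relabel]

theorem mem_relabel_white (P : PearlChain d₂ g) (τ : Equiv.Perm (Fin (2 * d₂ + g - 1)))
    (i : Fin (2 * d₂ + g - 1)) : τ i ∈ (P.relabel τ).white ↔ i ∈ P.white := by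
  simp [relabel]

/-- Isomorphisms from `P` to `Q` are the permutations that rename `P` to `Q`. -/
def isoEquiv (P Q : PearlChain d₂ g) :
    {τ : Equiv.Perm (Fin (2 * d₂ + g - 1)) // P.relabel τ = Q} ≃ P.Iso Q where
  toFun τ := ⟨⟨τ.1, by
    obtain ⟨τ, rfl⟩ := τ
    exact P.relabel_adj τ _ _⟩, by
    obtain ⟨τ, rfl⟩ := τ
    exact P.mem_relabel_white τ⟩
  invFun σ := ⟨σ.1.toEquiv, by
    refine PearlChain.ext ?_ ?_
    · ext a b
      have := σ.1.map_rel_iff (a := σ.1.toEquiv.symm a) (b := σ.1.toEquiv.symm b)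
      rw [show ∀ c, σ.1 (σ.1.toEquiv.symm c) = c from σ.1.toEquiv.apply_symm_apply,
        show ∀ c, σ.1 (σ.1.toEquiv.symm c) = c from σ.1.toEquiv.apply_symm_apply] at this
      exact this.symm
    · ext a
      have := σ.2 (σ.1.toEquiv.symm a)
      rw [show σ.1 (σ.1.toEquiv.symm a) = a from σ.1.toEquiv.apply_symm_apply a] at this
      exact this.symm⟩
  left_inv _ := rfl
  right_inv _ := rfl

noncomputable instance : Fintype (PearlChain d₂ g) := Fintype.ofFinite _

open scoped Classical in
-- These permutations are the isomorphisms from `P` to `Q`; composition with the inverse of a fixed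
-- one identifies them with the automorphisms of `P`.
theorem card_relabel_eq (P Q : PearlChain d₂ g) (h : P ≈ Q) :
    (Finset.univ.filter fun τ => P.relabel τ = Q).card = P.autCard := by
  obtain ⟨τ₀⟩ : Nonempty (P.Iso Q) := h
  rw [autCard, ← Nat.card_congr (isoEquiv P P), ← Fintype.card_subtype, ← Nat.card_eq_fintype_card]
  let τ₁ : Q.Iso P := ⟨τ₀.1.symm, fun a => by
    have := τ₀.2 (τ₀.1.symm a)
    simpa using this.symm⟩
  refine Nat.card_congr ((isoEquiv P Q).trans (Equiv.trans ?_ (isoEquiv P P).symm))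
  exact {
    toFun := fun σ => ⟨σ.1.trans τ₁.1, fun a => (τ₁.2 (σ.1 a)).trans (σ.2 a)⟩
    invFun := fun σ => ⟨σ.1.trans τ₀.1, fun a => (τ₀.2 (σ.1 a)).trans (σ.2 a)⟩
    left_inv := fun σ => Subtype.ext (RelIso.ext fun a => by simp [τ₁])
    right_inv := fun σ => Subtype.ext (RelIso.ext fun a => by simp [τ₁]) }

end PearlChain

namespace Diagram

variable {Q : PearlChain d₂ g} {Δ : Multiset ℤ} {x : Fin (2 * d₂ + g - 1) → ℝ}

theorem isLeaking_relabel {v : Fin (2 * d₂ + g - 1) → ℤ} (τ : Equiv.Perm (Fin (2 * d₂ + g - 1))) :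
    (Q.relabel τ).IsLeaking Δ (v ∘ τ.symm) ↔ Q.IsLeaking Δ v := by
  classical
  refine and_congr ⟨fun h a ha => ?_, fun h a ha => h _ ha⟩ ?_
  · have := h (τ a) (by rwa [Q.mem_relabel_white])
    simpa using this
  · rw [← Multiset.map_map]
    have : ∀ s : Finset (Fin (2 * d₂ + g - 1)), s.val.map τ.symm = (s.map τ.symm.toEmbedding).val :=
      fun _ => rfl
    rw [this]
    have h2 : (Finset.univ.filter fun a => a ∈ (Q.relabel τ).white).map τ.symm.toEmbedding =
        Finset.univ.filter fun a => a ∈ Q.white := by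
      ext a
      simp [PearlChain.relabel]
    rw [h2]

/-- Renaming the vertices of the pearl chain of a diagram. -/
def relabelEquiv (τ : Equiv.Perm (Fin (2 * d₂ + g - 1))) :
    Diagram Q Δ (x ∘ τ) ≃ Diagram (Q.relabel τ) Δ x where
  toFun D :=
    { weight := fun i j => D.weight (τ.symm i) (τ.symm j)
      wind := fun i j => D.wind (τ.symm i) (τ.symm j)
      weight_swap := fun _ _ => D.weight_swap _ _
      wind_swap := fun _ _ => D.wind_swap _ _
      weight_ne_zero := fun _ _ => D.weight_ne_zero _ _
      wind_eq_zero := fun _ _ h => D.wind_eq_zero _ _ h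
      lt_of_straight := fun _ _ h h' => by simpa using D.lt_of_straight _ _ h h'
      leaking := by
        have := (isLeaking_relabel τ).2 D.leaking
        refine (iff_of_eq (congrArg _ ?_)).1 this
        funext i
        exact congrArg Neg.neg (Equiv.sum_comp τ.symm fun j => D.weight (τ.symm i) j).symm }
  invFun D :=
    { weight := fun i j => D.weight (τ i) (τ j)
      wind := fun i j => D.wind (τ i) (τ j)
      weight_swap := fun _ _ => D.weight_swap _ _
      wind_swap := fun _ _ => D.wind_swap _ _
      weight_ne_zero := fun i j => (D.weight_ne_zero _ _).trans (Q.relabel_adj τ i j)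
      wind_eq_zero := fun i j h => D.wind_eq_zero _ _ (by rwa [Q.relabel_adj])
      lt_of_straight := fun _ _ h h' => D.lt_of_straight _ _ h h'
      leaking := by
        rw [← isLeaking_relabel τ]
        refine (iff_of_eq (congrArg _ ?_)).1 D.leaking
        funext i
        simp only [Function.comp, Equiv.apply_symm_apply]
        exact congrArg Neg.neg (Equiv.sum_comp τ fun j => D.weight i j).symm }
  left_inv D := by ext <;> simp
  right_inv D := by ext <;> simp

/-- Renaming the oriented edges. -/
def whitePairEquiv (τ : Equiv.Perm (Fin (2 * d₂ + g - 1))) : Q.WhitePair ≃ (Q.relabel τ).WhitePair :=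
  (τ.prodCongr τ).subtypeEquiv fun k =>
    and_congr (Q.relabel_adj τ k.1 k.2).symm (Q.mem_relabel_white τ k.1).symm

theorem mult_relabel (τ : Equiv.Perm (Fin (2 * d₂ + g - 1))) (D : Diagram Q Δ (x ∘ τ)) :
    (relabelEquiv τ D).mult = D.mult :=
  (Fintype.prod_equiv (whitePairEquiv τ) _ _ fun k => by
    simp [relabelEquiv, whitePairEquiv]).symm

theorem degree_relabel (τ : Equiv.Perm (Fin (2 * d₂ + g - 1))) (D : Diagram Q Δ (x ∘ τ)) :
    (relabelEquiv τ D).degree = D.degree :=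
  (Fintype.sum_equiv (whitePairEquiv τ) _ _ fun k => by
    simp [relabelEquiv, whitePairEquiv]).symm

theorem count_relabel (τ : Equiv.Perm (Fin (2 * d₂ + g - 1))) (d : ℕ) :
    count Q Δ (x ∘ τ) d = count (Q.relabel τ) Δ x d :=
  Fintype.sum_equiv ((relabelEquiv τ).subtypeEquiv fun D => by rw [degree_relabel]) _ _
    fun D => (mult_relabel τ D.1).symm

variable (Q Δ)

open scoped Classical in
-- Write every order as `ρ * τ` with `ρ` the order of the points. Moving `τ` from the order to the
-- labels replaces the sum over orders by a sum over the relabellings of `Q`, each of which is hit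
-- `|Aut(Q)|` times.
theorem coeff_feynmanSum (hx : Function.Injective x) (d : ℕ) :
    PowerSeries.coeff d (Q.feynmanSum Δ) =
      ∑ P : PearlChain d₂ g with Q ≈ P, (count P Δ x d : ℚ) := by
  -- Sorting lists the indices by increasing `-x`; the inverse permutation gives the place of each
  -- index, with the largest `x` in front.
  let ρ : Equiv.Perm (Fin (2 * d₂ + g - 1)) := (Tuple.sort fun i => - x i).symm
  have hρ : ∀ i j, ρ i < ρ j ↔ x j < x i := fun i j => by
    have hm : StrictMono ((fun i => - x i) ∘ Tuple.sort fun i => - x i) :=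
      (Tuple.monotone_sort fun i => - x i).strictMono_of_injective
        ((neg_injective.comp hx).comp (Equiv.injective _))
    rw [← hm.lt_iff_lt]
    simp [ρ]
  have h0 : Q.autCard ≠ 0 := by
    have : Nonempty (Q.Iso Q) := (PearlChain.isoSetoid d₂ g).refl Q
    have : Finite (Q.Iso Q) := Finite.of_equiv _ (Q.isoEquiv Q)
    exact Nat.card_pos.ne'
  have h1 : ∀ τ : Equiv.Perm (Fin (2 * d₂ + g - 1)),
      PowerSeries.coeff d (∑ v ∈ Q.leakingVectors Δ, Q.feynman (ρ * τ) v) =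
        (count (Q.relabel τ) Δ x d : ℚ) := fun τ => by
    rw [← count_relabel]
    exact sum_feynman Q Δ (fun i j => hρ (τ i) (τ j)) d
  rw [PearlChain.feynmanSum, Finset.sum_comm, PowerSeries.coeff_smul, map_sum,
    ← Equiv.sum_comp (Equiv.mulLeft ρ)]
  simp only [Equiv.coe_mulLeft, h1]
  rw [← Finset.sum_fiberwise_of_maps_to (s := Finset.univ) (t := {P | Q ≈ P})
    (g := fun τ => Q.relabel τ) (fun τ _ => by
      simp only [Finset.mem_filter, Finset.mem_univ, true_and]
      exact ⟨Q.isoEquiv _ ⟨τ, rfl⟩⟩), Finset.smul_sum]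
  refine Finset.sum_congr rfl fun P hP => ?_
  have hc := PearlChain.card_relabel_eq Q P (by simpa using hP)
  rw [Finset.sum_congr rfl fun τ hτ => by rw [(Finset.mem_filter.1 hτ).2], Finset.sum_const,
    hc, smul_eq_mul, nsmul_eq_mul, ← mul_assoc,
    inv_mul_cancel₀ (by exact_mod_cast h0), one_mul]

end Diagram

end TropEP

/-! ### Iterated gluing, flux through sets of vertices, and Euler characteristics -/

section

open scoped Classical

namespace TropEP

section Iterate

variable {X : Type*} [Finite X] {R L : Set X} (e : R ≃ L)

/-- The partially defined bijection `e`, extended by the identity. -/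
noncomputable def advance (x : X) : X := if h : x ∈ R then e ⟨x, h⟩ else x

omit [Finite X] in
theorem advance_of_mem {x : X} (h : x ∈ R) : advance e x = e ⟨x, h⟩ := dif_pos h

omit [Finite X] in
theorem advance_mem {x : X} (h : x ∈ R) : advance e x ∈ L := by
  rw [advance_of_mem e h]
  exact (e _).2

omit [Finite X] in
theorem advance_symm {x : X} (h : x ∈ R) : advance e.symm (advance e x) = x := by
  rw [advance_of_mem e.symm (advance_mem e h)]
  have : (⟨advance e x, advance_mem e h⟩ : L) = e ⟨x, h⟩ := Subtype.ext (advance_of_mem e h)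
  rw [this, Equiv.symm_apply_apply]

/-- Unless the iteration leaves the domain, the orbit is closed under the inverse. -/
theorem exists_advance_eq {x : X} (h : ∀ k, (advance e)^[k] x ∈ R) (k : ℕ) :
    ∃ m, advance e ((advance e)^[m] x) = (advance e)^[k] x := by
  let S := Set.range fun k => (advance e)^[k] x
  let f : S → S := fun y => ⟨advance e y.1, by
    obtain ⟨_, k, rfl⟩ := y
    exact ⟨k + 1, Function.iterate_succ_apply' _ _ _⟩⟩
  -- An injective self-map of a finite orbit is surjective; injectivity holds because the orbit
  -- stays where `advance e` can be undone.
  have hf : Function.Injective f := by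
    rintro ⟨_, k, rfl⟩ ⟨_, m, rfl⟩ hy
    have hy' := congrArg (advance e.symm) (congrArg Subtype.val hy)
    simp only [f, advance_symm e (h _)] at hy'
    exact Subtype.ext hy'
  obtain ⟨⟨_, m, rfl⟩, hm⟩ := Finite.surjective_of_injective hf ⟨_, k, rfl⟩
  exact ⟨m, congrArg Subtype.val hm⟩

/-- If the orbit stayed in `R` forever, its starting point would itself be a value of `e` and lie in
`L`. -/
theorem exists_iterate_notMem {x : X} (hx : x ∉ L) : ∃ k, (advance e)^[k] x ∉ R := by
  by_contra! h
  obtain ⟨m, hm⟩ := exists_advance_eq e h 0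
  have := advance_mem e (h m)
  rw [hm] at this
  exact hx this

end Iterate

/-- A graph has at least `#W - #E` components. Rank-nullity for the coboundary `D`: its kernel
consists of functions that are constant on the components. -/
theorem card_le_card_quot_add {W E : Type*} [Fintype W] [Fintype E] (s t : E → W) :
    Nat.card W ≤ Nat.card (Quot fun a b => ∃ e, s e = a ∧ t e = b) + Nat.card E := by
  let r : W → W → Prop := fun a b => ∃ e, s e = a ∧ t e = b
  let D : (W → ℚ) →ₗ[ℚ] (E → ℚ) := LinearMap.funLeft ℚ ℚ s - LinearMap.funLeft ℚ ℚ t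
  let L : (Quot r → ℚ) →ₗ[ℚ] (W → ℚ) := LinearMap.funLeft ℚ ℚ (Quot.mk r)
  have hker : LinearMap.ker D ≤ LinearMap.range L := by
    intro f hf
    refine ⟨Quot.lift f ?_, ?_⟩
    · rintro a b ⟨e, rfl, rfl⟩
      have := congrFun (LinearMap.mem_ker.1 hf) e
      simp only [D, LinearMap.sub_apply, Pi.sub_apply, LinearMap.funLeft_apply, Pi.zero_apply] at this
      linarith
    · rfl
  have h1 := D.finrank_range_add_finrank_ker
  have h2 := Submodule.finrank_mono hker
  have h3 := L.finrank_range_le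
  have h4 := Submodule.finrank_le (LinearMap.range D)
  have : Fintype (Quot r) := Fintype.ofFinite _
  simp only [Module.finrank_fintype_fun_eq_card] at h1 h3 h4
  change _ ≤ Nat.card (Quot r) + _
  simp only [Nat.card_eq_fintype_card]
  omega

namespace PlaneMap

variable {n : ℕ} (A : PlaneMap n)

theorem len_toReal_pos {h : A.H} (hh : A.opp h ≠ h) : 0 < (A.len h).toReal :=
  ENNReal.toReal_pos (A.len_pos h).ne' fun e => hh ((A.len_eq_top h).1 e)

theorem opp_opp_ne {h : A.H} (hh : A.opp h ≠ h) : A.opp (A.opp h) ≠ A.opp h := by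
  rw [A.opp_opp]
  exact hh.symm

/-- The directions of the flags that leave a set of vertices sum up to zero. -/
theorem flux (S : Finset A.V) :
    ∑ h with A.root h ∈ S ∧ (A.opp h = h ∨ A.root (A.opp h) ∉ S), A.dir h = 0 := by
  have h1 : ∑ h with A.root h ∈ S, A.dir h = 0 := by
    rw [← Finset.sum_fiberwise_of_maps_to (t := S) (g := A.root) (by simp)]
    refine Finset.sum_eq_zero fun v hv => ?_
    rw [← A.balanced v, Finset.filter_filter]
    refine Finset.sum_congr (Finset.filter_congr fun h _ => ?_) fun _ _ => rfl
    exact ⟨fun h => h.2, fun h => ⟨h ▸ hv, h⟩⟩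
  rw [← Finset.sum_filter_add_sum_filter_not _
    (fun h => A.opp h = h ∨ A.root (A.opp h) ∉ S), Finset.filter_filter, Finset.filter_filter] at h1
  rw [← h1, left_eq_add]
  -- Edges with both vertices in `S` contribute two opposite directions.
  refine Finset.sum_involution (fun h _ => A.opp h) ?_ ?_ ?_ ?_
  · intro h hh
    simp only [Finset.mem_filter, not_or] at hh
    rw [A.dir_opp h hh.2.2.1, add_neg_cancel]
  · intro h hh _
    simp only [Finset.mem_filter, not_or] at hh
    exact hh.2.2.1
  · intro h hh
    simp only [Finset.mem_filter, Finset.mem_univ, true_and, not_or, not_not] at hh ⊢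
    exact ⟨hh.2.2, A.opp_opp_ne hh.2.1, by rw [A.opp_opp]; exact hh.1⟩
  · intro h _
    exact A.opp_opp h

/-- Let `ℓ` be a coordinate of the directions and `y` the corresponding coordinate of the positions.
All bounded edges that leave a sublevel set of `y` have positive `ℓ`, so each of them is bounded by
what the ends contribute to the flux. This makes all directions of counted maps bounded in terms of
the numerical data. -/
theorem abs_dir_le_sum_ends (ℓ : ℤ × ℤ →+ ℤ) (y : A.V → ℝ)
    (hy : ∀ h, A.opp h ≠ h → y (A.root (A.opp h)) = y (A.root h) + (A.len h).toReal * (ℓ (A.dir h) : ℤ))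
    (h : A.H) : |ℓ (A.dir h)| ≤ ∑ k with A.opp k = k, |ℓ (A.dir k)| := by
  have hlt : ∀ k, A.opp k ≠ k → y (A.root k) < y (A.root (A.opp k)) → 0 < ℓ (A.dir k) := by
    intro k hk hk'
    rw [hy k hk, lt_add_iff_pos_right] at hk'
    exact_mod_cast pos_of_mul_pos_right hk' (A.len_toReal_pos hk).le
  have key : ∀ h, A.opp h ≠ h → ℓ (A.dir h) ≤ ∑ k with A.opp k = k, |ℓ (A.dir k)| := by
    intro h hh
    rcases le_or_gt (ℓ (A.dir h)) 0 with h0 | h0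
    · exact h0.trans (Finset.sum_nonneg fun _ _ => abs_nonneg _)
    -- The threshold is the far vertex of `h`, so that `h` leaves `S`.
    let S := Finset.univ.filter fun v => y v < y (A.root (A.opp h))
    have h1 := congrArg ℓ (A.flux S)
    rw [map_sum, map_zero] at h1
    have hS : A.root h ∈ S := by
      simp only [S, Finset.mem_filter, Finset.mem_univ, true_and]
      rw [hy h hh, lt_add_iff_pos_right]
      exact mul_pos (A.len_toReal_pos hh) (by exact_mod_cast h0)
    have h2 : ∑ k with A.root k ∈ S ∧ (A.opp k = k ∨ A.root (A.opp k) ∉ S),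
        ((if k = h then ℓ (A.dir h) else 0) - if A.opp k = k then |ℓ (A.dir k)| else 0) ≤
        ∑ k with A.root k ∈ S ∧ (A.opp k = k ∨ A.root (A.opp k) ∉ S), ℓ (A.dir k) := by
      refine Finset.sum_le_sum fun k hk => ?_
      simp only [Finset.mem_filter, Finset.mem_univ, true_and, S, not_lt] at hk
      by_cases hk' : A.opp k = k
      · have : k ≠ h := by rintro rfl; exact hh hk'
        rw [if_neg this, if_pos hk']
        have := neg_abs_le (ℓ (A.dir k))
        omega
      · have h3 := hlt k hk' (hk.1.trans_le (hk.2.resolve_left hk'))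
        rw [if_neg hk']
        by_cases e : k = h
        · subst e
          simp
        · rw [if_neg e]
          omega
    rw [h1, Finset.sum_sub_distrib, Finset.sum_ite_eq' _ h, if_pos (by
      simp only [Finset.mem_filter, Finset.mem_univ, true_and]
      exact ⟨hS, Or.inr (by simp [S])⟩), ← Finset.sum_filter, Finset.filter_filter] at h2
    have h3 : ∑ k with (A.root k ∈ S ∧ (A.opp k = k ∨ A.root (A.opp k) ∉ S)) ∧ A.opp k = k,
        |ℓ (A.dir k)| ≤ ∑ k with A.opp k = k, |ℓ (A.dir k)| :=
      Finset.sum_le_sum_of_subset_of_nonneg (fun k hk => by simp_all) fun _ _ _ => abs_nonneg _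
    linarith
  by_cases hh : A.opp h = h
  · exact Finset.single_le_sum (f := fun k => |ℓ (A.dir k)|) (fun _ _ => abs_nonneg _) (by simpa using hh)
  · refine abs_le.2 ⟨?_, key h hh⟩
    have := key (A.opp h) (A.opp_opp_ne hh)
    rw [A.dir_opp h hh, map_neg] at this
    linarith

theorem abs_dir_fst_le (h : A.H) : |(A.dir h).1| ≤ ∑ k with A.opp k = k, |(A.dir k).1| :=
  A.abs_dir_le_sum_ends (AddMonoidHom.fst ℤ ℤ) (fun v => (A.pos v).1) A.pos_opp_fst h

theorem abs_dir_snd_le (h : A.H) : |(A.dir h).2| ≤ ∑ k with A.opp k = k, |(A.dir k).2| :=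
  A.abs_dir_le_sum_ends (AddMonoidHom.snd ℤ ℤ) (fun v => (A.pos v).2) A.pos_opp_snd h

/-- Flags of ends of direction `(w, 0)`. -/
def IsRightEnd (h : A.H) : Prop := A.opp h = h ∧ 0 < (A.dir h).1 ∧ (A.dir h).2 = 0

/-- Flags of ends of direction `(-w, 0)`. -/
def IsLeftEnd (h : A.H) : Prop := A.opp h = h ∧ (A.dir h).1 < 0 ∧ (A.dir h).2 = 0

theorem inl_mem_rightEnds {h : A.H} : Sum.inl h ∈ A.rightEnds ↔ A.IsRightEnd h := Iff.rfl

theorem inl_mem_leftEnds {h : A.H} : Sum.inl h ∈ A.leftEnds ↔ A.IsLeftEnd h := Iff.rfl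

theorem inr_mem_rightEnds {l : A.Ln} : Sum.inr l ∈ A.rightEnds := trivial

theorem inr_mem_leftEnds {l : A.Ln} : Sum.inr l ∈ A.leftEnds := trivial

theorem sum_rightEnds {M : Type*} [AddCommMonoid M] (f : A.H ⊕ A.Ln → M) :
    ∑ e : A.rightEnds, f e = ∑ h with A.IsRightEnd h, f (Sum.inl h) + ∑ l, f (Sum.inr l) := by
  refine (Finset.sum_subtype (p := fun x => x ∈ A.rightEnds)
    (Finset.univ.filter fun x => x ∈ A.rightEnds) (by simp) f).symm.trans ?_
  rw [Finset.sum_filter, Fintype.sum_sum_type, Finset.sum_filter]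
  simp [inl_mem_rightEnds, inr_mem_rightEnds]

theorem sum_leftEnds {M : Type*} [AddCommMonoid M] (f : A.H ⊕ A.Ln → M) :
    ∑ e : A.leftEnds, f e = ∑ h with A.IsLeftEnd h, f (Sum.inl h) + ∑ l, f (Sum.inr l) := by
  refine (Finset.sum_subtype (p := fun x => x ∈ A.leftEnds)
    (Finset.univ.filter fun x => x ∈ A.leftEnds) (by simp) f).symm.trans ?_
  rw [Finset.sum_filter, Fintype.sum_sum_type, Finset.sum_filter]
  simp [inl_mem_leftEnds, inr_mem_leftEnds]

variable {A}

/-- Flags of unbounded ends that are not horizontal. -/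
def IsVerticalEnd (A : PlaneMap n) (h : A.H) : Prop := A.opp h = h ∧ (A.dir h).2 ≠ 0

namespace HasLeakyDegree

variable {Δ : Multiset ℤ} (hΔ : A.HasLeakyDegree Δ)

include hΔ

theorem end_cases {h : A.H} (hh : A.opp h = h) :
    (∃ i, A.mark i = h) ∨ A.dir h = (0, -1) ∨ (A.dir h).2 = 1 ∨ A.IsRightEnd h ∨ A.IsLeftEnd h := by
  by_cases hm : ∃ i, A.mark i = h
  · exact Or.inl hm
  push Not at hm
  rcases hΔ.2.2 h hh hm with h1 | h1 | ⟨h1, h2⟩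
  · exact Or.inr (Or.inl h1)
  · exact Or.inr (Or.inr (Or.inl h1))
  · rcases lt_or_gt_of_ne h2 with h3 | h3
    · exact Or.inr (Or.inr (Or.inr (Or.inr ⟨hh, h3, h1⟩)))
    · exact Or.inr (Or.inr (Or.inr (Or.inl ⟨hh, h3, h1⟩)))

theorem verticalEnd_cases {h : A.H} (hh : A.IsVerticalEnd h) :
    A.dir h = (0, -1) ∨ (A.dir h).2 = 1 := by
  rcases hΔ.end_cases hh.1 with ⟨i, rfl⟩ | h1 | h1 | h1 | h1
  · exact absurd (by rw [A.mark_contracted i]; rfl) hh.2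
  · exact Or.inl h1
  · exact Or.inr h1
  · exact absurd h1.2.2 hh.2
  · exact absurd h1.2.2 hh.2

theorem card_down : (Finset.univ.filter fun h => A.opp h = h ∧ A.dir h = (0, -1)).card = Δ.card := by
  rw [← hΔ.1, Nat.card_eq_fintype_card, Fintype.card_subtype]

theorem card_up : (Finset.univ.filter fun h => A.opp h = h ∧ (A.dir h).2 = 1).card = Δ.card := by
  rw [← hΔ.2.1, Multiset.card_map]
  rfl

theorem card_verticalEnd : (Finset.univ.filter fun h => A.IsVerticalEnd h).card = 2 * Δ.card := by
  rw [two_mul]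
  nth_rw 1 [← hΔ.card_down]
  rw [← hΔ.card_up, ← Finset.card_union_of_disjoint]
  · congr 1
    ext h
    simp only [Finset.mem_filter, Finset.mem_univ, true_and, Finset.mem_union]
    refine ⟨fun hh => (hΔ.verticalEnd_cases hh).imp (fun h1 => ⟨hh.1, h1⟩) fun h1 => ⟨hh.1, h1⟩, ?_⟩
    rintro (⟨h1, h2⟩ | ⟨h1, h2⟩)
    · exact ⟨h1, by rw [h2]; decide⟩
    · exact ⟨h1, by rw [h2]; decide⟩
  · rw [Finset.disjoint_filter]
    rintro h _ ⟨_, h1⟩ ⟨_, h2⟩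
    rw [h1] at h2
    exact absurd h2 (by decide)

theorem sum_ends {M : Type*} [AddCommMonoid M] (f : A.H → M) :
    ∑ h with A.opp h = h, f h = ∑ i, f (A.mark i) + ∑ h with A.IsVerticalEnd h, f h +
      ∑ h with A.IsRightEnd h, f h + ∑ h with A.IsLeftEnd h, f h := by
  have h1 : ∑ i, f (A.mark i) = ∑ h with ∃ i, A.mark i = h, f h := by
    rw [← Finset.sum_image (s := Finset.univ) (g := A.mark) (f := f) A.mark_injective.injOn]
    congr 1
    ext h
    simp
  have h0 : ∀ i, A.dir (A.mark i) = 0 := A.mark_contracted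
  rw [h1, Finset.sum_filter, Finset.sum_filter, Finset.sum_filter, Finset.sum_filter,
    Finset.sum_filter, ← Finset.sum_add_distrib, ← Finset.sum_add_distrib, ← Finset.sum_add_distrib]
  refine Finset.sum_congr rfl fun h _ => ?_
  by_cases hh : A.opp h = h
  · by_cases hm : ∃ i, A.mark i = h
    · obtain ⟨i, rfl⟩ := hm
      simp [IsVerticalEnd, IsRightEnd, IsLeftEnd, h0, hh]
    · by_cases h2 : (A.dir h).2 = 0
      · rcases (hΔ.end_cases hh).resolve_left hm with h3 | h3 | h3 | h3
        · rw [h3] at h2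
          exact absurd h2 (by decide)
        · omega
        · simp [IsVerticalEnd, IsRightEnd, IsLeftEnd, hh, hm, h2, h3.2.1, h3.2.1.not_gt]
        · simp [IsVerticalEnd, IsRightEnd, IsLeftEnd, hh, hm, h2, h3.2.1, h3.2.1.not_gt]
      · simp [IsVerticalEnd, IsRightEnd, IsLeftEnd, hh, hm, h2]
  · have hm : ¬ ∃ i, A.mark i = h := by
      rintro ⟨i, rfl⟩
      exact hh (A.mark_end i)
    simp [IsVerticalEnd, IsRightEnd, IsLeftEnd, hh, hm]

end HasLeakyDegree

theorem IsSimple.card_flags (hs : A.IsSimple) : Nat.card A.H = 3 * Nat.card A.V := by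
  rw [Nat.card_eq_fintype_card, ← Finset.card_univ,
    Finset.card_eq_sum_card_fiberwise (f := A.root) (t := Finset.univ) (by simp),
    Finset.sum_congr rfl fun v _ => (show _ = 3 by
      rw [← hs.1 v, Nat.card_eq_fintype_card, Fintype.card_subtype])]
  simp [mul_comm]

theorem two_dvd_card_bounded (A : PlaneMap n) : 2 ∣ Nat.card {h // A.opp h ≠ h} := by
  let σ : Equiv.Perm A.H := ⟨A.opp, A.opp, A.opp_opp, A.opp_opp⟩
  have := Equiv.Perm.two_dvd_card_support (σ := σ) (by ext h; exact A.opp_opp h)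
  rw [Nat.card_eq_fintype_card, Fintype.card_subtype]
  exact this

end PlaneMap

namespace CutMap

variable {n : ℕ} {A : CutMap n} {Δ : Multiset ℤ}

theorem degree_eq (A : CutMap n) : A.degree = ∑ e : A.rightEnds, A.endWeight e :=
  finsum_eq_sum_of_fintype _

theorem degree_eq_left (A : CutMap n) : A.degree = ∑ e : A.leftEnds, A.endWeight e := by
  rw [degree_eq]
  exact Fintype.sum_equiv A.glue _ _ fun e => (A.glue_weight e).symm

theorem card_rightEnds (A : CutMap n) : Nat.card A.rightEnds =
    (Finset.univ.filter fun h => A.IsRightEnd h).card + Nat.card A.Ln := by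
  have := A.sum_rightEnds fun _ => 1
  simpa using this

theorem card_rightEnd_eq_card_leftEnd (A : CutMap n) :
    (Finset.univ.filter fun h => A.IsRightEnd h).card =
      (Finset.univ.filter fun h => A.IsLeftEnd h).card := by
  have h1 := A.sum_rightEnds fun _ => 1
  have h2 := A.sum_leftEnds fun _ => 1
  have h3 := Fintype.card_congr A.glue
  simp only [Finset.sum_const, Finset.card_univ, smul_eq_mul, mul_one] at h1 h2
  omega

/-- Down ends contribute nothing, up ends the leakings, and the ends to the right and to the left at
most the degree each, since the lines use up a part of it. -/
theorem sum_abs_fst_ends_le (hΔ : A.HasLeakyDegree Δ) :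
    ∑ k with A.opp k = k, |(A.dir k).1| ≤ 2 * A.degree + (Δ.map Int.natAbs).sum := by
  rw [hΔ.sum_ends]
  have h1 : ∑ i, |(A.dir (A.mark i)).1| = 0 :=
    Finset.sum_eq_zero fun i _ => by rw [A.mark_contracted i]; rfl
  have h2 : ∑ h with A.IsVerticalEnd h, |(A.dir h).1| ≤ (Δ.map Int.natAbs).sum := by
    rw [← hΔ.2.1, Multiset.map_map, Nat.cast_multiset_sum, Multiset.map_map]
    change _ ≤ ∑ h with A.opp h = h ∧ (A.dir h).2 = 1, (((A.dir h).1.natAbs : ℕ) : ℤ)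
    rw [Finset.sum_filter, Finset.sum_filter]
    refine Finset.sum_le_sum fun h _ => ?_
    by_cases hv : A.IsVerticalEnd h
    · rw [if_pos hv]
      rcases hΔ.verticalEnd_cases hv with h3 | h3
      · rw [h3]
        split_ifs <;> simp
      · rw [if_pos ⟨hv.1, h3⟩, Int.natCast_natAbs]
    · rw [if_neg hv]
      split_ifs <;> positivity
  have h3 : ∑ h with A.IsRightEnd h, |(A.dir h).1| ≤ A.degree := by
    rw [degree_eq, A.sum_rightEnds]
    push_cast
    refine le_add_of_le_of_nonneg (le_of_eq (Finset.sum_congr rfl fun h _ => ?_)) (by positivity)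
    simp [PlaneMap.endWeight]
  have h4 : ∑ h with A.IsLeftEnd h, |(A.dir h).1| ≤ A.degree := by
    rw [degree_eq_left, A.sum_leftEnds]
    push_cast
    refine le_add_of_le_of_nonneg (le_of_eq (Finset.sum_congr rfl fun h _ => ?_)) (by positivity)
    simp [PlaneMap.endWeight]
  linarith

theorem sum_abs_snd_ends (hΔ : A.HasLeakyDegree Δ) :
    ∑ k with A.opp k = k, |(A.dir k).2| = 2 * Δ.card := by
  rw [hΔ.sum_ends]
  have h1 : ∑ i, |(A.dir (A.mark i)).2| = 0 :=
    Finset.sum_eq_zero fun i _ => by rw [A.mark_contracted i]; rfl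
  have h2 : ∑ h with A.IsVerticalEnd h, |(A.dir h).2| = 2 * Δ.card := by
    rw [Finset.sum_congr rfl (g := fun _ => 1) fun h hh => ?_]
    · rw [Finset.sum_const, hΔ.card_verticalEnd]
      simp
    · rcases hΔ.verticalEnd_cases (Finset.mem_filter.1 hh).2 with h3 | h3 <;> rw [h3] <;> rfl
  have h3 : ∑ h with A.IsRightEnd h, |(A.dir h).2| = 0 :=
    Finset.sum_eq_zero fun h hh => by rw [(Finset.mem_filter.1 hh).2.2.2]; rfl
  have h4 : ∑ h with A.IsLeftEnd h, |(A.dir h).2| = 0 :=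
    Finset.sum_eq_zero fun h hh => by rw [(Finset.mem_filter.1 hh).2.2.2]; rfl
  linarith

theorem card_connectedComponent (hc : A.IsConnected) :
    Nat.card A.gluedGraph.ConnectedComponent = 1 := by
  have := hc.preconnected.subsingleton_connectedComponent
  obtain ⟨v⟩ := hc.nonempty
  have : Nonempty A.gluedGraph.ConnectedComponent := ⟨A.gluedGraph.connectedComponentMk v⟩
  exact Nat.card_eq_one_iff_unique.2 ⟨inferInstance, inferInstance⟩

theorem card_bounded_add (hΔ : A.HasLeakyDegree Δ) (hs : A.IsSimple) :
    Nat.card {h // A.opp h ≠ h} + (n + 2 * Δ.card +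
      2 * (Finset.univ.filter fun h => A.IsRightEnd h).card) = 3 * Nat.card A.V := by
  have h1 := hΔ.sum_ends fun _ => 1
  have h2 := A.card_rightEnd_eq_card_leftEnd
  have h3 := Finset.card_filter_add_card_filter_not (s := (Finset.univ : Finset A.H)) fun h => A.opp h = h
  have h4 := hΔ.card_verticalEnd
  simp only [Finset.sum_const, Finset.card_univ, smul_eq_mul, mul_one, Fintype.card_fin] at h1
  have h5 : Nat.card {h // A.opp h ≠ h} = (Finset.univ.filter fun h => ¬ A.opp h = h).card := by
    rw [Nat.card_eq_fintype_card, Fintype.card_subtype]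
  have h6 := hs.card_flags
  rw [Nat.card_eq_fintype_card, ← Finset.card_univ] at h6
  omega

/-- Trivalence expresses the number of bounded flags by the numbers of vertices and ends. In the
Betti number each line adds one edge and one vertex and the horizontal ends cancel, so the genus
amounts to a count of inner vertices. -/
theorem genus_eq_iff (hc : A.IsConnected) (hΔ : A.HasLeakyDegree Δ) (hs : A.IsSimple) (g : ℕ) :
    A.genus = g ↔ Nat.card A.V + 2 = n + 2 * Δ.card + 2 * g := by
  have h1 := card_bounded_add hΔ hs
  have h2 := A.two_dvd_card_bounded
  have h3 := A.card_rightEnds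
  rw [genus, card_connectedComponent hc, h3, Nat.card_sum]
  push_cast
  omega

end CutMap

end TropEP

end

/-! ### Bounds for the points, and the horizontal edges of the glued graph -/

section

open scoped Classical

namespace TropEP

/-- A bound for the entries of the directions of the flags of counted maps. -/
def dirBound (Δ : Multiset ℤ) (d₁ : ℕ) : ℕ := 2 * d₁ + (Δ.map Int.natAbs).sum + 2 * Δ.card

/-- The bound up to which the points have to be general and stretched. -/
def pointBound (Δ : Multiset ℤ) (d₁ g : ℕ) : ℕ :=
  -- A counted map has `4 * Δ.card + 3 * g - 3` inner vertices, which bounds the length of a path in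
  -- a floor; each edge of the path changes `x` by at most `dirBound` times the range of heights.
  (dirBound Δ d₁ + 1) * (4 * Δ.card + 3 * g + 3)

/-- The standing assumptions on the points and the numerical data. -/
structure Admissible {n : ℕ} (Δ : Multiset ℤ) (d₁ g : ℕ) (p : Fin n → ℝ × ℝ) : Prop where
  card_pos : 0 < Δ.card
  card_points : n + 1 = 2 * Δ.card + g
  general : InGeneralPosition (pointBound Δ d₁ g) p
  stretched : HorizontallyStretched (pointBound Δ d₁ g) p

namespace Admissible

variable {n : ℕ} {Δ : Multiset ℤ} {d₁ g : ℕ} {p : Fin n → ℝ × ℝ} (hp : Admissible Δ d₁ g p)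

theorem one_le_pointBound (Δ : Multiset ℤ) (d₁ g : ℕ) : 1 ≤ pointBound Δ d₁ g :=
  Nat.succ_le_of_lt (Nat.mul_pos (Nat.succ_pos _) (Nat.succ_pos _))

theorem dirBound_le_pointBound (Δ : Multiset ℤ) (d₁ g : ℕ) : dirBound Δ d₁ ≤ pointBound Δ d₁ g :=
  (Nat.le_succ _).trans (Nat.le_mul_of_pos_right _ (Nat.succ_pos _))

include hp

theorem fst_injective {i j : Fin n} (h : (p i).1 = (p j).1) : i = j := by
  by_contra hij
  have h1 : (1 : ℤ) ≤ pointBound Δ d₁ g := by exact_mod_cast one_le_pointBound Δ d₁ g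
  refine hp.general (fun k => ((if k = i then 1 else 0) - (if k = j then 1 else 0), 0)) ?_ ?_ ?_
  · intro h0
    have := congrArg Prod.fst (congrFun h0 i)
    simp [hij] at this
  · intro k
    constructor
    · simp only
      split_ifs <;> simp <;> omega
    · simp
  · simp [sub_mul, Finset.sum_sub_distrib, h]

theorem snd_injective {i j : Fin n} (h : (p i).2 = (p j).2) : i = j := by
  by_contra hij
  have h1 : (1 : ℤ) ≤ pointBound Δ d₁ g := by exact_mod_cast one_le_pointBound Δ d₁ g
  refine hp.general (fun k => (0, (if k = i then 1 else 0) - (if k = j then 1 else 0))) ?_ ?_ ?_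
  · intro h0
    have := congrArg Prod.snd (congrFun h0 i)
    simp [hij] at this
  · intro k
    constructor
    · simp
    · simp only
      split_ifs <;> simp <;> omega
  · simp [sub_mul, Finset.sum_sub_distrib, h]

end Admissible

section Chain

variable {X : Type*} {R L : Set X} (e : R ≃ L)

theorem transGen_iterate {a : X} (k : ℕ) (h : ∀ j ≤ k, (advance e)^[j] a ∈ R) :
    Relation.TransGen (fun x y => x ∈ R ∧ advance e x = y) a ((advance e)^[k + 1] a) := by
  induction k with
  | zero => exact .single ⟨h 0 le_rfl, rfl⟩
  | succ k ih =>
    rw [Function.iterate_succ_apply']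
    exact (ih fun j hj => h j (by omega)).tail ⟨h _ le_rfl, rfl⟩

end Chain

namespace CutMap

variable {n : ℕ} (A : CutMap n)

theorem glued_iff {a b : A.H ⊕ A.Ln} : A.Glued a b ↔ a ∈ A.rightEnds ∧ advance A.glue a = b := by
  constructor
  · rintro ⟨e, rfl, rfl⟩
    exact ⟨e.2, advance_of_mem _ e.2⟩
  · rintro ⟨h, rfl⟩
    exact ⟨⟨a, h⟩, rfl, (advance_of_mem _ h).symm⟩

theorem glued_iff_symm {a b : A.H ⊕ A.Ln} :
    A.Glued a b ↔ b ∈ A.leftEnds ∧ advance A.glue.symm b = a := by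
  rw [glued_iff]
  constructor
  · rintro ⟨h, rfl⟩
    exact ⟨advance_mem _ h, advance_symm _ h⟩
  · rintro ⟨h, rfl⟩
    refine ⟨advance_mem A.glue.symm h, ?_⟩
    have := advance_symm A.glue.symm h
    rwa [Equiv.symm_symm] at this

variable {A}

theorem Glued.mem_left {a b : A.H ⊕ A.Ln} (h : A.Glued a b) : b ∈ A.leftEnds :=
  (A.glued_iff_symm.1 h).1

theorem Glued.mem_right {a b : A.H ⊕ A.Ln} (h : A.Glued a b) : a ∈ A.rightEnds :=
  (A.glued_iff.1 h).1

theorem Glued.right_unique {a b c : A.H ⊕ A.Ln} (h : A.Glued a b) (h' : A.Glued a c) : b = c :=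
  (A.glued_iff.1 h).2.symm.trans (A.glued_iff.1 h').2

theorem Glued.left_unique {a b c : A.H ⊕ A.Ln} (h : A.Glued a c) (h' : A.Glued b c) : a = b :=
  (A.glued_iff_symm.1 h).2.symm.trans (A.glued_iff_symm.1 h').2

theorem transGen_glued_eq {a b : A.H ⊕ A.Ln} (h : Relation.TransGen A.Glued a b) :
    a ∈ A.rightEnds ∧ b ∈ A.leftEnds ∧ A.endWeight b = A.endWeight a ∧
      A.endHeight b = A.endHeight a := by
  induction h with
  | single h =>
    obtain ⟨e, rfl, rfl⟩ := h
    exact ⟨e.2, (A.glue e).2, A.glue_weight e, A.glue_height e⟩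
  | tail _ h ih =>
    obtain ⟨e, rfl, rfl⟩ := h
    exact ⟨ih.1, (A.glue e).2, (A.glue_weight e).trans ih.2.2.1, (A.glue_height e).trans ih.2.2.2⟩

/-- Flags of horizontal edges that go to the right. -/
def IsRight (A : CutMap n) (h : A.H) : Prop := (A.dir h).2 = 0 ∧ 0 < (A.dir h).1

theorem inl_mem_left_or_right {h : A.H} : ¬ (Sum.inl h ∈ A.leftEnds ∧ Sum.inl h ∈ A.rightEnds) :=
  fun ⟨h1, h2⟩ => lt_asymm h1.2.1 h2.2.1

theorem IsRight.notMem_leftEnds {h : A.H} (hh : A.IsRight h) : Sum.inl h ∉ A.leftEnds :=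
  fun h1 => lt_asymm h1.2.1 hh.2

/-- The number of times that the horizontal edge starting with the flag `h` crosses the cut. -/
noncomputable def crossings (A : CutMap n) (h : A.H) : ℕ :=
  sInf {k | (advance A.glue)^[k] (Sum.inl h) ∉ A.rightEnds}

theorem IsRight.crossings_spec {h : A.H} (hh : A.IsRight h) :
    (advance A.glue)^[A.crossings h] (Sum.inl h) ∉ A.rightEnds :=
  Nat.sInf_mem (exists_iterate_notMem A.glue hh.notMem_leftEnds)

theorem iterate_mem_rightEnds {h : A.H} {k : ℕ} (hk : k < A.crossings h) :
    (advance A.glue)^[k] (Sum.inl h) ∈ A.rightEnds := by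
  by_contra h'
  exact Nat.notMem_of_lt_sInf hk h'

theorem IsRight.crossings_eq_zero_iff {h : A.H} (hh : A.IsRight h) :
    A.crossings h = 0 ↔ A.opp h ≠ h := by
  constructor
  · intro h0 h1
    have := hh.crossings_spec
    rw [h0] at this
    exact this ⟨h1, hh.2, hh.1⟩
  · intro h1
    by_contra h0
    exact h1 (iterate_mem_rightEnds (Nat.pos_of_ne_zero h0)).1

theorem exists_inl_of_notMem_right {x : A.H ⊕ A.Ln} (h : x ∉ A.rightEnds) : ∃ h, x = Sum.inl h := by
  rcases x with h' | l
  · exact ⟨h', rfl⟩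
  · exact absurd A.inr_mem_rightEnds h

theorem IsRight.transGen {h h' : A.H} (hh : A.IsRight h)
    (hk : (advance A.glue)^[A.crossings h] (Sum.inl h) = Sum.inl h') (he : A.opp h = h) :
    Relation.TransGen A.Glued (Sum.inl h) (Sum.inl h') := by
  have h0 : A.crossings h ≠ 0 := fun e => hh.crossings_eq_zero_iff.1 e he
  obtain ⟨k, hk'⟩ := Nat.exists_eq_succ_of_ne_zero h0
  have := transGen_iterate A.glue (a := Sum.inl h) k fun j hj => iterate_mem_rightEnds (by omega)
  rw [← Nat.succ_eq_add_one, ← hk', hk] at this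
  exact Relation.TransGen.mono (fun _ _ h => A.glued_iff.2 h) _ _ this

theorem elevator_right {h h' : A.H} (hh : A.IsRight h) (he : A.Elevator h h') :
    A.dir h' = - A.dir h ∧ (A.pos (A.root h')).2 = (A.pos (A.root h)).2 := by
  rcases he with ⟨h1, rfl⟩ | h1
  · refine ⟨A.dir_opp h h1, ?_⟩
    rw [A.pos_opp_snd h h1, hh.1]
    simp
  · obtain ⟨h2, h3, h4, h5⟩ := transGen_glued_eq h1
    refine ⟨?_, h5⟩
    have h6 : (A.dir h').1.natAbs = (A.dir h).1.natAbs := h4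
    have h7 := h3.2.1
    have h8 := hh.2
    refine Prod.ext ?_ ?_
    · rw [Prod.fst_neg]
      omega
    · rw [Prod.snd_neg, hh.1, h3.2.2, neg_zero]

/-- The flags `h` and `h'` are the two flags of one horizontal edge of the glued graph. -/
def Linked (A : CutMap n) (h h' : A.H) : Prop :=
  (A.IsRight h ∧ A.Elevator h h') ∨ (A.IsRight h' ∧ A.Elevator h' h)

theorem Linked.symm {h h' : A.H} (hl : A.Linked h h') : A.Linked h' h := hl.elim Or.inr Or.inl

theorem Linked.dir_eq {h h' : A.H} (hl : A.Linked h h') : A.dir h' = - A.dir h := by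
  rcases hl with ⟨h1, h2⟩ | ⟨h1, h2⟩
  · exact (elevator_right h1 h2).1
  · rw [(elevator_right h1 h2).1, neg_neg]

theorem Linked.height_eq {h h' : A.H} (hl : A.Linked h h') :
    (A.pos (A.root h')).2 = (A.pos (A.root h)).2 := by
  rcases hl with ⟨h1, h2⟩ | ⟨h1, h2⟩
  · exact (elevator_right h1 h2).2
  · exact (elevator_right h1 h2).2.symm

theorem Linked.isHorizontal {h h' : A.H} (hl : A.Linked h h') : A.IsHorizontal h := by
  rcases hl with ⟨h1, h2⟩ | ⟨h1, h2⟩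
  · exact ⟨h1.1, h1.2.ne'⟩
  · have := (elevator_right h1 h2).1
    refine ⟨by rw [this, Prod.snd_neg, h1.1, neg_zero], ?_⟩
    rw [this, Prod.fst_neg]
    exact neg_ne_zero.2 h1.2.ne'

theorem exists_elevator {h : A.H} (hh : A.IsRight h) : ∃ h', A.Elevator h h' := by
  by_cases he : A.opp h = h
  · obtain ⟨h', h1⟩ := exists_inl_of_notMem_right hh.crossings_spec
    exact ⟨h', Or.inr (hh.transGen h1 he)⟩
  · exact ⟨A.opp h, Or.inl ⟨he, rfl⟩⟩

theorem exists_linked {h : A.H} (hh : A.IsHorizontal h) : ∃ h', A.Linked h h' := by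
  rcases lt_or_gt_of_ne hh.2 with h0 | h0
  · by_cases he : A.opp h = h
    · have hl : Sum.inl h ∈ A.leftEnds := ⟨he, h0, hh.1⟩
      have hr : Sum.inl h ∉ A.rightEnds := fun hr => A.inl_mem_left_or_right ⟨hl, hr⟩
      -- Follow the gluing backwards until it arrives at an end that is not a left end. Lines are
      -- left ends too, so this is a flag at an inner vertex.
      have hex := exists_iterate_notMem A.glue.symm hr
      have h1 := Nat.find_spec hex
      have h2 : ∀ j < Nat.find hex, (advance A.glue.symm)^[j] (Sum.inl h) ∈ A.leftEnds :=
        fun j hj => not_not.1 (Nat.find_min hex hj)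
      obtain ⟨k, hk⟩ := Nat.exists_eq_succ_of_ne_zero (n := Nat.find hex)
        fun e => by rw [e] at h1; exact h1 hl
      rw [hk] at h1 h2
      have h3 := transGen_iterate A.glue.symm (a := Sum.inl h) k fun j hj => h2 j (by omega)
      have h4 : Relation.TransGen A.Glued ((advance A.glue.symm)^[k + 1] (Sum.inl h)) (Sum.inl h) :=
        Relation.transGen_swap.1 (Relation.TransGen.mono (fun _ _ h => A.glued_iff_symm.2 h) _ _ h3)
      obtain ⟨h', h5⟩ : ∃ h', (advance A.glue.symm)^[k + 1] (Sum.inl h) = Sum.inl h' := by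
        rcases hx : (advance A.glue.symm)^[k + 1] (Sum.inl h) with h' | l
        · exact ⟨h', rfl⟩
        · rw [Nat.succ_eq_add_one, hx] at h1
          exact absurd A.inr_mem_leftEnds h1
      rw [h5] at h4
      have h6 := (transGen_glued_eq h4).1
      exact ⟨h', Or.inr ⟨⟨h6.2.2, h6.2.1⟩, Or.inr h4⟩⟩
    · refine ⟨A.opp h, Or.inr ⟨⟨?_, ?_⟩, Or.inl ⟨A.opp_opp_ne he, (A.opp_opp h).symm⟩⟩⟩
      · rw [A.dir_opp h he, Prod.snd_neg, hh.1, neg_zero]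
      · rw [A.dir_opp h he, Prod.fst_neg]
        omega
  · obtain ⟨h', he⟩ := exists_elevator ⟨hh.1, h0⟩
    exact ⟨h', Or.inl ⟨⟨hh.1, h0⟩, he⟩⟩

/-- Gluing is functional, so of two chains with the same start one extends the other. The shorter
one stops at a flag that is a left end; such a flag is no right end and the chain cannot go on. -/
theorem elevator_unique_right {h h₁ h₂ : A.H} (h1 : A.Elevator h h₁)
    (h2 : A.Elevator h h₂) : h₁ = h₂ := by
  rcases h1 with ⟨h1, rfl⟩ | h1 <;> rcases h2 with ⟨h2, rfl⟩ | h2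
  · rfl
  · exact absurd (transGen_glued_eq h2).1.1 h1
  · exact absurd (transGen_glued_eq h1).1.1 h2
  · have hu : Relator.RightUnique A.Glued := fun _ _ _ h h' => h.right_unique h'
    have l1 := (transGen_glued_eq h1).2.1
    have l2 := (transGen_glued_eq h2).2.1
    rcases Relation.ReflTransGen.total_of_right_unique hu h1.to_reflTransGen h2.to_reflTransGen
      with h3 | h3 <;> rcases h3.cases_head with h4 | ⟨c, h4, _⟩
    · exact Sum.inl_injective h4
    · exact absurd ⟨l1, h4.mem_right⟩ A.inl_mem_left_or_right
    · exact (Sum.inl_injective h4).symm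
    · exact absurd ⟨l2, h4.mem_right⟩ A.inl_mem_left_or_right

theorem elevator_unique_left {h₁ h₂ h : A.H} (h1 : A.Elevator h₁ h) (h2 : A.Elevator h₂ h) : h₁ = h₂ := by
  rcases h1 with ⟨h1, rfl⟩ | h1 <;> rcases h2 with ⟨h2, h3⟩ | h2
  · rw [← A.opp_opp h₁, h3, A.opp_opp]
  · exact absurd (transGen_glued_eq h2).2.1.1 (A.opp_opp_ne h1)
  · rw [h3] at h1
    exact absurd (transGen_glued_eq h1).2.1.1 (A.opp_opp_ne h2)
  · have hu : Relator.RightUnique (Function.swap A.Glued) := fun _ _ _ h h' => h.left_unique h'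
    have l1 := (transGen_glued_eq h1).1
    have l2 := (transGen_glued_eq h2).1
    rcases Relation.ReflTransGen.total_of_right_unique hu
      (Relation.transGen_swap.2 h1).to_reflTransGen (Relation.transGen_swap.2 h2).to_reflTransGen
      with h3 | h3 <;> rcases h3.cases_head with h4 | ⟨c, h4, _⟩
    · exact Sum.inl_injective h4
    · exact absurd ⟨Glued.mem_left h4, l1⟩ A.inl_mem_left_or_right
    · exact (Sum.inl_injective h4).symm
    · exact absurd ⟨Glued.mem_left h4, l2⟩ A.inl_mem_left_or_right

theorem Linked.unique {h h₁ h₂ : A.H} (h1 : A.Linked h h₁) (h2 : A.Linked h h₂) : h₁ = h₂ := by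
  rcases h1 with ⟨r1, h1⟩ | ⟨r1, h1⟩ <;> rcases h2 with ⟨r2, h2⟩ | ⟨r2, h2⟩
  · exact elevator_unique_right h1 h2
  · have := (elevator_right r2 h2).1
    have := r1.2
    have := r2.2
    simp_all
    omega
  · have := (elevator_right r1 h1).1
    have := r1.2
    have := r2.2
    simp_all
    omega
  · exact elevator_unique_left h1 h2

/-- The form in which connectedness is used: the invariant sets below are pieces of the curve that
turn out to be everything. -/
theorem IsConnected.closed (hc : A.IsConnected) {S : A.V ⊕ A.Ln → Prop}
    (hS : ∀ a b, A.gluedAdj a b → (S a ↔ S b)) (a b : A.V ⊕ A.Ln) (ha : S a) : S b := by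
  obtain ⟨w⟩ := hc.preconnected a b
  induction w with
  | nil => exact ha
  | cons h _ ih =>
    refine ih ?_
    rw [gluedGraph, SimpleGraph.fromRel_adj] at h
    rcases h.2 with h1 | h1
    · exact (hS _ _ h1).1 ha
    · exact (hS _ _ h1).2 ha

/-- A closed chain of glued lines is a connected component. -/
theorem exists_iterate_eq_inr (hc : A.IsConnected) [Nonempty A.V] (l : A.Ln) :
    ∃ h k, A.IsRight h ∧ A.opp h = h ∧ k + 1 < A.crossings h ∧
      (advance A.glue)^[k + 1] (Sum.inl h) = Sum.inr l := by
  by_cases hex : ∃ k, (advance A.glue.symm)^[k] (Sum.inr l) ∉ A.leftEnds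
  · have h1 := Nat.find_spec hex
    have h2 : ∀ j < Nat.find hex, (advance A.glue.symm)^[j] (Sum.inr l) ∈ A.leftEnds :=
      fun j hj => not_not.1 (Nat.find_min hex hj)
    obtain ⟨k, hk⟩ := Nat.exists_eq_succ_of_ne_zero (n := Nat.find hex)
      fun e => by rw [e] at h1; exact h1 A.inr_mem_leftEnds
    rw [hk] at h1 h2
    -- Going forward retraces the backward orbit, which exhibits the line as a later position on the
    -- edge that starts at the flag found.
    have back : ∀ j ≤ k + 1, (advance A.glue)^[j] ((advance A.glue.symm)^[k + 1] (Sum.inr l)) =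
        (advance A.glue.symm)^[k + 1 - j] (Sum.inr l) := by
      intro j
      induction j with
      | zero => intro _; rfl
      | succ j ih =>
        intro hj
        rw [Function.iterate_succ_apply', ih (by omega)]
        obtain ⟨m, hm⟩ : ∃ m, k + 1 - j = m + 1 := ⟨k - j, by omega⟩
        rw [hm, Function.iterate_succ_apply', show k + 1 - (j + 1) = m by omega]
        have := advance_symm A.glue.symm (h2 m (by omega))
        rwa [Equiv.symm_symm] at this
    have hmem : ∀ j ≤ k + 1, (advance A.glue)^[j]
        ((advance A.glue.symm)^[k + 1] (Sum.inr l)) ∈ A.rightEnds := by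
      intro j hj
      rw [back j hj]
      by_cases e : j = k + 1
      · subst e
        simp [A.inr_mem_rightEnds]
      · obtain ⟨m, hm⟩ : ∃ m, k + 1 - j = m + 1 := ⟨k - j, by omega⟩
        rw [hm, Function.iterate_succ_apply']
        exact advance_mem _ (h2 m (by omega))
    have h0 := hmem 0 (by omega)
    obtain ⟨h', h5⟩ : ∃ h', (advance A.glue.symm)^[k + 1] (Sum.inr l) = Sum.inl h' := by
      rcases hx : (advance A.glue.symm)^[k + 1] (Sum.inr l) with h' | l
      · exact ⟨h', rfl⟩
      · rw [Nat.succ_eq_add_one, hx] at h1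
        exact absurd A.inr_mem_leftEnds h1
    rw [h5] at hmem back h0
    have hr : A.IsRight h' := ⟨h0.2.2, h0.2.1⟩
    refine ⟨h', k, hr, h0.1, ?_, ?_⟩
    · by_contra hlt
      exact hr.crossings_spec (hmem _ (by omega))
    · rw [back (k + 1) le_rfl]
      simp
  · exfalso
    push Not at hex
    have hr : ∀ k, (advance A.glue.symm)^[k] (Sum.inr l) ∈ A.rightEnds := by
      intro k
      rcases k with _ | k
      · exact A.inr_mem_rightEnds
      · rw [Function.iterate_succ_apply']
        exact advance_mem _ (hex k)
    have hl : ∀ k, ∃ l', (advance A.glue.symm)^[k] (Sum.inr l) = Sum.inr l' := by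
      intro k
      rcases hx : (advance A.glue.symm)^[k] (Sum.inr l) with h' | l'
      · have h1 := hex k
        have h2 := hr k
        rw [hx] at h1 h2
        exact absurd ⟨h1, h2⟩ A.inl_mem_left_or_right
      · exact ⟨l', rfl⟩
    -- If the backward orbit never stops it is a cycle of lines, closed under gluing in both
    -- directions. It would be the whole glued graph, which however has a vertex.
    let S : A.V ⊕ A.Ln → Prop := fun a => ∃ k l', a = Sum.inr l' ∧
      (advance A.glue.symm)^[k] (Sum.inr l) = Sum.inr l'
    obtain ⟨v⟩ := ‹Nonempty A.V›
    have hS : ∀ a b, A.gluedAdj a b → (S a ↔ S b) := by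
      rintro a b (⟨h, _, rfl, rfl⟩ | ⟨e, rfl, rfl⟩)
      · simp [S]
      · constructor
        · rintro ⟨k, l', h1, h2⟩
          obtain ⟨m, hm⟩ := exists_advance_eq A.glue.symm hex k
          have he : e.1 = Sum.inr l' := by
            rcases hx : e.1 with h' | l''
            · rw [hx] at h1
              cases h1
            · rw [hx] at h1
              exact congrArg Sum.inr (Sum.inr_injective h1)
          obtain ⟨l'', hl''⟩ := hl m
          refine ⟨m, l'', ?_, hl''⟩
          rw [h2, ← he] at hm
          have h3 := A.glued_iff_symm.2 ⟨hex m, hm⟩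
          have h4 := (A.glued_iff.2 ⟨e.2, advance_of_mem A.glue e.2⟩).right_unique h3
          rw [h4, hl'']
          rfl
        · rintro ⟨k, l', h1, h2⟩
          have he : (A.glue e).1 = Sum.inr l' := by
            rcases hx : (A.glue e).1 with h' | l''
            · rw [hx] at h1
              cases h1
            · rw [hx] at h1
              exact congrArg Sum.inr (Sum.inr_injective h1)
          obtain ⟨l'', hl''⟩ := hl (k + 1)
          refine ⟨k + 1, l'', ?_, hl''⟩
          rw [Function.iterate_succ_apply', h2, ← he, advance_of_mem _ (A.glue e).2,
            Equiv.symm_apply_apply] at hl''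
          rw [hl'']
          rfl
    obtain ⟨_, _, h, _⟩ := hc.closed hS (Sum.inr l) (Sum.inl v) ⟨0, l, rfl, rfl⟩
    cases h

end CutMap

end TropEP

end

/-! ### Nonzero directions and the tropical Menelaus relation -/

section

open scoped Classical

namespace TropEP

namespace PlaneMap

variable {n : ℕ} {A : PlaneMap n}

theorem IsSimple.star (hs : A.IsSimple) (h : A.H) : ∃ b c, b ≠ h ∧ c ≠ h ∧ b ≠ c ∧
    A.root b = A.root h ∧ A.root c = A.root h ∧
    (∀ k, A.root k = A.root h → k = h ∨ k = b ∨ k = c) ∧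
    (Finset.univ.filter fun k => A.root k = A.root h) = {h, b, c} ∧
    A.dir h + A.dir b + A.dir c = 0 := by
  have h1 : (Finset.univ.filter fun k => A.root k = A.root h).card = 3 := by
    rw [← hs.1 (A.root h), Nat.card_eq_fintype_card, Fintype.card_subtype]
  have h2 : h ∈ Finset.univ.filter fun k => A.root k = A.root h := by simp
  have h3 := Finset.card_erase_of_mem h2
  rw [h1] at h3
  obtain ⟨b, c, hbc, h4⟩ := Finset.card_eq_two.1 h3
  have h5 : (Finset.univ.filter fun k => A.root k = A.root h) = {h, b, c} := by
    rw [← Finset.insert_erase h2, h4]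
  have h6 : ∀ k, A.root k = A.root h ↔ k = h ∨ k = b ∨ k = c := fun k => by
    have : k ∈ (Finset.univ.filter fun k => A.root k = A.root h) ↔ k ∈ ({h, b, c} : Finset A.H) := by
      rw [h5]
    simpa using this
  have h7 : ∀ k, k ∈ ({b, c} : Finset A.H) → k ≠ h := fun k hk => by
    rw [← h4] at hk
    exact Finset.ne_of_mem_erase hk
  have hb := h7 b (by simp)
  have hc := h7 c (by simp)
  refine ⟨b, c, hb, hc, hbc, (h6 b).2 (by simp), (h6 c).2 (by simp), fun k => (h6 k).1, h5, ?_⟩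
  have h8 := A.balanced (A.root h)
  rw [h5, Finset.sum_insert (by simp [hb.symm, hc.symm]), Finset.sum_pair hbc, ← add_assoc] at h8
  exact h8

end PlaneMap

variable {n : ℕ} {Δ : Multiset ℤ} {d₁ g : ℕ} {p : Fin n → ℝ × ℝ} {A : CutMap n}

namespace CutMap.IsCounted

section

variable (hA : A.IsCounted Δ d₁ g p)

include hA

theorem connected : A.IsConnected := hA.1

theorem leaky : A.HasLeakyDegree Δ := hA.2.1

theorem simple : A.IsSimple := hA.2.2.2.2.2

theorem pos_mark (i : Fin n) : A.pos (A.root (A.mark i)) = p i := hA.2.2.2.2.1 i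

theorem abs_dir_fst_le (h : A.H) : |(A.dir h).1| ≤ dirBound Δ d₁ := by
  have h1 := (A.abs_dir_fst_le h).trans (sum_abs_fst_ends_le hA.leaky)
  rw [hA.2.2.1] at h1
  unfold dirBound
  simp only [Nat.cast_add, Nat.cast_mul, Nat.cast_ofNat]
  omega

theorem abs_dir_snd_le (h : A.H) : |(A.dir h).2| ≤ dirBound Δ d₁ := by
  have h1 := (A.abs_dir_snd_le h).trans_eq (sum_abs_snd_ends hA.leaky)
  unfold dirBound
  simp only [Nat.cast_add, Nat.cast_mul, Nat.cast_ofNat]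
  omega

theorem card_vertices : Nat.card A.V + 2 = n + 2 * Δ.card + 2 * g :=
  (genus_eq_iff hA.connected hA.leaky hA.simple g).1 hA.2.2.2.1

end

variable (hp : Admissible Δ d₁ g p) (hA : A.IsCounted Δ d₁ g p)

include hA hp

theorem exists_verticalEnd : ∃ h, A.IsVerticalEnd h := by
  have h1 := hA.leaky.card_verticalEnd
  have h2 : 0 < (Finset.univ.filter fun h => A.IsVerticalEnd h).card := by
    have := hp.card_pos
    omega
  obtain ⟨h, hh⟩ := Finset.card_pos.1 h2
  exact ⟨h, (Finset.mem_filter.1 hh).2⟩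

theorem root_mark_injective {i j : Fin n} (h : A.root (A.mark i) = A.root (A.mark j)) : i = j := by
  have := congrArg A.pos h
  rw [hA.pos_mark, hA.pos_mark] at this
  exact hp.fst_injective (congrArg Prod.fst this)

/-- Local embedding excludes direction zero at unmarked vertices. At a marked vertex, a second flag
of direction zero makes all three vanish by balancing. An edge there is contracted, and its other
vertex is marked with the same image, hence is the same vertex. So this vertex with its loops would
be the whole curve, without any vertical end. -/
theorem dir_ne_zero {h : A.H} (hm : ∀ i, A.mark i ≠ h) : A.dir h ≠ 0 := by
  have unm : ∀ h, ¬ A.IsMarked (A.root h) → A.dir h ≠ 0 := fun h hh h0 => by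
    obtain ⟨b, c, hb, hc, hbc, rb, rc, hall, -, hsum⟩ := hA.simple.star h
    refine hA.simple.2 h b rb.symm hb.symm hh ?_
    rw [h0]
    exact SameRay.zero_left _
  intro h0
  by_cases hv : A.IsMarked (A.root h)
  swap
  · exact unm h hv h0
  obtain ⟨i, hi⟩ := hv
  obtain ⟨b, c, hb, hc, hbc, rb, rc, hall, -, hsum⟩ := hA.simple.star h
  have bounded : ∀ k, A.dir k = 0 → (∀ j, A.mark j ≠ k) → A.opp k ≠ k := fun k hk hk' e => by
    rcases hA.leaky.end_cases e with ⟨j, hj⟩ | h1 | h1 | h1 | h1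
    · exact hk' j hj
    · rw [hk] at h1
      exact absurd h1 (by decide)
    · rw [hk] at h1
      exact absurd h1 (by decide)
    · have := h1.2.1
      rw [hk] at this
      exact absurd this (by decide)
    · have := h1.2.1
      rw [hk] at this
      exact absurd this (by decide)
  -- Positions of different marked vertices differ, and unmarked vertices have no flags of direction
  -- zero.
  have loop : ∀ k, A.root k = A.root h → A.dir k = 0 → A.root (A.opp k) = A.root h := by
    intro k rk hk
    by_cases e : A.opp k = k
    · rw [e, rk]
    have hpos : A.pos (A.root (A.opp k)) = A.pos (A.root k) := by
      refine Prod.ext ?_ ?_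
      · rw [A.pos_opp_fst k e, hk]
        simp
      · rw [A.pos_opp_snd k e, hk]
        simp
    by_cases hv : A.IsMarked (A.root (A.opp k))
    · obtain ⟨j, hj⟩ := hv
      rw [← hj, rk, ← hi, hA.pos_mark, hA.pos_mark] at hpos
      rw [← hj, ← hi, hp.fst_injective (congrArg Prod.fst hpos)]
    · refine absurd ?_ (unm _ hv)
      rw [A.dir_opp k e, hk, neg_zero]
  have all0 : ∀ k, A.root k = A.root h → A.dir k = 0 := by
    have h1 : ∀ k, A.root k = A.root h → k = h ∨ k = A.mark i ∨ A.dir k = 0 := by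
      rcases hall (A.mark i) hi with h1 | h1 | h1
      · exact absurd h1 (hm i)
      · rw [h0, ← h1, A.mark_contracted, zero_add, zero_add] at hsum
        intro k hk
        rcases hall k hk with h2 | h2 | h2
        · exact Or.inl h2
        · exact Or.inr (Or.inl (h2.trans h1.symm))
        · exact Or.inr (Or.inr (h2 ▸ hsum))
      · rw [h0, ← h1, A.mark_contracted, zero_add, add_zero] at hsum
        intro k hk
        rcases hall k hk with h2 | h2 | h2
        · exact Or.inl h2
        · exact Or.inr (Or.inr (h2 ▸ hsum))
        · exact Or.inr (Or.inl (h2.trans h1.symm))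
    intro k hk
    rcases h1 k hk with rfl | rfl | h2
    · exact h0
    · exact A.mark_contracted i
    · exact h2
  have hcl : ∀ a b, A.gluedAdj a b → (a = Sum.inl (A.root h) ↔ b = Sum.inl (A.root h)) := by
    rintro a b (⟨k, e, rfl, rfl⟩ | ⟨e, rfl, rfl⟩)
    · constructor
      · intro h1
        have h2 := Sum.inl_injective h1
        rw [loop k h2 (all0 k h2)]
      · intro h1
        have h2 := Sum.inl_injective h1
        have := loop _ h2 (all0 _ h2)
        rw [A.opp_opp] at this
        rw [this]
    · constructor
      · intro h1
        rcases hx : e.1 with k | l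
        · rw [hx] at h1
          have h2 := e.2
          rw [hx] at h2
          have h3 := h2.2.1
          rw [all0 k (Sum.inl_injective h1)] at h3
          exact absurd h3 (by decide)
        · rw [hx] at h1
          cases h1
      · intro h1
        rcases hx : (A.glue e).1 with k | l
        · rw [hx] at h1
          have h2 := (A.glue e).2
          rw [hx] at h2
          have h3 := h2.2.1
          rw [all0 k (Sum.inl_injective h1)] at h3
          exact absurd h3 (by decide)
        · rw [hx] at h1
          cases h1
  obtain ⟨k, hk⟩ := hA.exists_verticalEnd hp
  have := hA.connected.closed hcl _ (Sum.inl (A.root k)) rfl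
  exact hk.2 (by rw [all0 k (Sum.inl_injective this)]; rfl)

theorem mark_flags (i : Fin n) : ∃ a b, a ≠ b ∧ (∀ j, A.mark j ≠ a) ∧ (∀ j, A.mark j ≠ b) ∧
    A.root a = A.root (A.mark i) ∧ A.root b = A.root (A.mark i) ∧
    (∀ k, A.root k = A.root (A.mark i) → k = A.mark i ∨ k = a ∨ k = b) ∧
    (Finset.univ.filter fun k => A.root k = A.root (A.mark i)) = {A.mark i, a, b} ∧
    A.dir b = - A.dir a := by
  obtain ⟨b, c, hb, hc, hbc, rb, rc, hall, hf, hsum⟩ := hA.simple.star (A.mark i)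
  rw [A.mark_contracted, zero_add] at hsum
  refine ⟨b, c, hbc, ?_, ?_, rb, rc, hall, hf, (neg_eq_of_add_eq_zero_right hsum).symm⟩
  · rintro j rfl
    exact hb (by rw [hA.root_mark_injective hp rb])
  · rintro j rfl
    exact hc (by rw [hA.root_mark_injective hp rc])

/-- The tropical Menelaus relation for a union of components of the curve cut at its marked points. -/
theorem menelaus (c : A.H → ℤ) (cL : A.Ln → ℤ) (hopp : ∀ h, c (A.opp h) = c h)
    (hglue : ∀ e : A.rightEnds, Sum.elim c cL (A.glue e).1 = Sum.elim c cL e.1)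
    (hunm : ∀ h h', A.root h = A.root h' → ¬ A.IsMarked (A.root h) → c h = c h')
    (hvert : ∀ h, A.IsVerticalEnd h → c h = 0) (h01 : ∀ h, c h = 0 ∨ c h = 1)
    {h h' : A.H} (hm : ∀ i, A.mark i ≠ h) (hm' : ∀ i, A.mark i ≠ h') (hr : A.root h = A.root h') :
    c h = c h' := by
  -- The moment of the line through the flag about the origin. It is constant along an edge up to
  -- the sign change of the direction.
  let μ : A.H → ℝ := fun h => c h * ((A.dir h).1 * (A.pos (A.root h)).2 -
    (A.dir h).2 * (A.pos (A.root h)).1)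
  have h1 : ∑ h, μ h = 0 := by
    rw [← Finset.sum_filter_add_sum_filter_not _ (fun h => A.opp h = h), hA.leaky.sum_ends]
    have e1 : ∑ i, μ (A.mark i) = 0 := Finset.sum_eq_zero fun i _ => by
      simp [μ, A.mark_contracted]
    have e2 : ∑ h with A.IsVerticalEnd h, μ h = 0 := Finset.sum_eq_zero fun h hh => by
      simp [μ, hvert h (Finset.mem_filter.1 hh).2]
    have e3 : ∑ h with ¬ A.opp h = h, μ h = 0 := by
      refine Finset.sum_involution (fun h _ => A.opp h) ?_ ?_ ?_ ?_
      · intro h hh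
        have hh' := (Finset.mem_filter.1 hh).2
        simp only [μ, hopp, A.dir_opp h hh', A.pos_opp_fst h hh', A.pos_opp_snd h hh', Prod.fst_neg,
          Prod.snd_neg]
        push_cast
        ring
      · intro h hh _
        exact (Finset.mem_filter.1 hh).2
      · intro h hh
        exact Finset.mem_filter.2 ⟨Finset.mem_univ _, A.opp_opp_ne (Finset.mem_filter.1 hh).2⟩
      · intro h _
        exact A.opp_opp h
    -- A horizontal end has moment plus or minus weight times height. Gluing preserves both factors
    -- and pairs opposite signs; the lines occur on either side and drop out.
    have e4 : ∑ h with A.IsRightEnd h, μ h + ∑ h with A.IsLeftEnd h, μ h = 0 := by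
      let ν : A.H ⊕ A.Ln → ℝ := fun x => Sum.elim c cL x * (A.endWeight x * A.endHeight x)
      have f1 := A.sum_rightEnds ν
      have f2 := A.sum_leftEnds ν
      have f3 : ∑ e : A.rightEnds, ν e = ∑ e : A.leftEnds, ν e :=
        Fintype.sum_equiv A.glue _ _ fun e => by
          simp only [ν, hglue, A.glue_weight, A.glue_height]
      have f4 : ∑ h with A.IsRightEnd h, μ h = ∑ h with A.IsRightEnd h, ν (Sum.inl h) :=
        Finset.sum_congr rfl fun h hh => by
          obtain ⟨-, g1, g2⟩ := (Finset.mem_filter.1 hh).2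
          have : (((A.dir h).1.natAbs : ℕ) : ℝ) = (A.dir h).1 := by
            rw [← Int.cast_natCast, Int.natAbs_of_nonneg g1.le]
          simp [μ, ν, PlaneMap.endWeight, PlaneMap.endHeight, g2, this]
      have f5 : ∑ h with A.IsLeftEnd h, μ h = - ∑ h with A.IsLeftEnd h, ν (Sum.inl h) := by
        rw [← Finset.sum_neg_distrib]
        refine Finset.sum_congr rfl fun h hh => ?_
        obtain ⟨-, g1, g2⟩ := (Finset.mem_filter.1 hh).2
        have : (((A.dir h).1.natAbs : ℕ) : ℝ) = - (A.dir h).1 := by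
          rw [← Int.cast_natCast, Int.ofNat_natAbs_of_nonpos g1.le, Int.cast_neg]
        simp [μ, ν, PlaneMap.endWeight, PlaneMap.endHeight, g2, this]
      rw [f4, f5]
      linarith
    linarith
  -- The resultant of the selected directions at a vertex; by balancing it vanishes where all or
  -- none of the flags are selected.
  let C : A.V → ℤ × ℤ := fun v => ∑ h with A.root h = v, c h • A.dir h
  have h2 : ∀ v, ∑ h with A.root h = v, μ h = (C v).1 * (A.pos v).2 - (C v).2 * (A.pos v).1 := by
    intro v
    simp only [C, Prod.fst_sum, Prod.snd_sum]
    push_cast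
    rw [Finset.sum_mul, Finset.sum_mul, ← Finset.sum_sub_distrib]
    refine Finset.sum_congr rfl fun h hh => ?_
    rw [← (Finset.mem_filter.1 hh).2]
    simp only [μ, Prod.smul_fst, Prod.smul_snd, smul_eq_mul]
    push_cast
    ring
  have h3 : ∀ v, ¬ A.IsMarked v → C v = 0 := by
    intro v hv
    by_cases hne : ∃ k, A.root k = v
    · obtain ⟨k, rfl⟩ := hne
      simp only [C]
      rw [Finset.sum_congr rfl fun h hh => by
        rw [hunm h k (Finset.mem_filter.1 hh).2 (by rwa [(Finset.mem_filter.1 hh).2])],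
        ← Finset.smul_sum, A.balanced, smul_zero]
    · push Not at hne
      exact Finset.sum_eq_zero fun h hh => absurd (Finset.mem_filter.1 hh).2 (hne h)
  -- The moments grouped by vertices: only marked vertices remain, so this is an integral linear
  -- relation between the coordinates of the points.
  have h4 : ∑ i, ((C (A.root (A.mark i))).1 * (p i).2 - (C (A.root (A.mark i))).2 * (p i).1) = 0 := by
    rw [← h1, ← Finset.sum_fiberwise_of_maps_to (t := Finset.univ) (g := A.root) (by simp),
      Finset.sum_congr rfl fun v _ => h2 v]
    have : ∀ i ∈ Finset.univ, ((C (A.root (A.mark i))).1 * (p i).2 -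
        (C (A.root (A.mark i))).2 * (p i).1) = (fun v => (C v).1 * (A.pos v).2 -
        (C v).2 * (A.pos v).1) (A.root (A.mark i)) := fun i _ => by
      simp only [hA.pos_mark]
    rw [Finset.sum_congr rfl this, ← Finset.sum_image (s := Finset.univ)
      (g := fun i => A.root (A.mark i)) (f := fun v => (C v).1 * (A.pos v).2 -
        (C v).2 * (A.pos v).1) fun i _ j _ h => hA.root_mark_injective hp h]
    refine Finset.sum_subset (Finset.subset_univ _) fun v _ hv => ?_
    rw [h3 v fun ⟨i, hi⟩ => hv (Finset.mem_image.2 ⟨i, Finset.mem_univ _, hi⟩)]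
    simp
  have h5 : ∀ i a b, a ≠ b → (∀ j, A.mark j ≠ a) → (∀ j, A.mark j ≠ b) →
      (Finset.univ.filter fun k => A.root k = A.root (A.mark i)) = {A.mark i, a, b} →
      A.dir b = - A.dir a → C (A.root (A.mark i)) = (c a - c b) • A.dir a := by
    intro i a b hab ha hb hf hd
    simp only [C]
    rw [hf, Finset.sum_insert (by simp [ha i, hb i]), Finset.sum_pair hab, A.mark_contracted,
      hd, smul_zero, zero_add, smul_neg, sub_smul, sub_eq_add_neg]
  -- The coefficients are, up to sign, entries of directions or zero, so general position applies
  -- and all of them vanish.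
  have h6 : ∀ i, C (A.root (A.mark i)) = 0 := by
    have hbound : ∀ i, |(C (A.root (A.mark i))).1| ≤ pointBound Δ d₁ g ∧
        |(C (A.root (A.mark i))).2| ≤ pointBound Δ d₁ g := by
      intro i
      obtain ⟨a, b, hab, ha, hb, -, -, -, hf, hd⟩ := hA.mark_flags hp i
      rw [h5 i a b hab ha hb hf hd]
      have g0 : ((dirBound Δ d₁ : ℕ) : ℤ) ≤ pointBound Δ d₁ g := by
        exact_mod_cast Admissible.dirBound_le_pointBound Δ d₁ g
      have g1 := (hA.abs_dir_fst_le a).trans g0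
      have g2 := (hA.abs_dir_snd_le a).trans g0
      have g3 : |c a - c b| ≤ 1 := by
        rcases h01 a with e | e <;> rcases h01 b with e' | e' <;> rw [e, e'] <;> simp
      simp only [Prod.smul_fst, Prod.smul_snd, smul_eq_mul, abs_mul]
      exact ⟨(mul_le_of_le_one_left (abs_nonneg _) g3).trans g1,
        (mul_le_of_le_one_left (abs_nonneg _) g3).trans g2⟩
    by_contra hne
    push Not at hne
    obtain ⟨i, hi⟩ := hne
    refine hp.general (fun i => (- (C (A.root (A.mark i))).2, (C (A.root (A.mark i))).1))
      (fun e => hi ?_) (fun i => ⟨?_, (hbound i).1⟩) ?_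
    · have e1 := congrFun e i
      simp only [Pi.zero_apply, Prod.mk_eq_zero, neg_eq_zero] at e1
      exact Prod.ext e1.2 e1.1
    · simp only [abs_neg]
      exact (hbound i).2
    · rw [← h4]
      refine Finset.sum_congr rfl fun i _ => ?_
      push_cast
      ring
  by_cases hv : A.IsMarked (A.root h)
  · obtain ⟨i, hi⟩ := hv
    obtain ⟨a, b, hab, ha, hb, ra, rb, hall, hf, hd⟩ := hA.mark_flags hp i
    have e := h5 i a b hab ha hb hf hd
    rw [h6 i] at e
    have e1 : c a = c b := by
      rcases smul_eq_zero.1 e.symm with e | e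
      · omega
      · exact absurd e (hA.dir_ne_zero hp ha)
    rcases (hall h hi.symm).resolve_left (hm i).symm with rfl | rfl <;>
    rcases (hall h' (hr ▸ hi.symm)).resolve_left (hm' i).symm with rfl | rfl
    · rfl
    · exact e1
    · exact e1.symm
    · rfl
  · exact hunm h h' hr hv

end CutMap.IsCounted

end TropEP

end

/-! ### The curve cut at its marked points: one vertical end per component -/

section

open scoped Classical

namespace TropEP

variable {n : ℕ} {Δ : Multiset ℤ} {d₁ g : ℕ} {p : Fin n → ℝ × ℝ}

/-- The lexicographically negative directions. -/
def IsNegative (u : ℤ × ℤ) : Prop := u.1 < 0 ∨ u.1 = 0 ∧ u.2 < 0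

theorem isNegative_neg {u : ℤ × ℤ} (hu : u ≠ 0) : IsNegative (-u) ↔ ¬ IsNegative u := by
  have : u.1 = 0 → u.2 ≠ 0 := fun h1 h2 => hu (Prod.ext h1 h2)
  simp only [IsNegative, Prod.fst_neg, Prod.snd_neg]
  omega

namespace CutMap

variable (A : CutMap n)

/-- The vertices of the glued curve cut at its marked points: every marked vertex is replaced by two
vertices. -/
abbrev CutVertex : Type := A.V ⊕ {v // A.IsMarked v} ⊕ A.Ln

/-- The edges of the glued curve cut at its marked points. -/
abbrev CutEdge : Type := {h // A.opp h ≠ h ∧ ¬ IsNegative (A.dir h)} ⊕ A.rightEnds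

/-- The two uncontracted flags at a marked vertex of a counted map have opposite nonzero directions,
so exactly one is lexicographically negative; it is moved to the second copy of the vertex. The
contracted end stays at the first copy. -/
noncomputable def cutNode (h : A.H) : A.CutVertex :=
  if hm : A.IsMarked (A.root h) ∧ IsNegative (A.dir h) then Sum.inr (Sum.inl ⟨_, hm.1⟩)
  else Sum.inl (A.root h)

noncomputable def cutEndNode : A.H ⊕ A.Ln → A.CutVertex :=
  Sum.elim A.cutNode fun l => Sum.inr (Sum.inr l)

noncomputable def cutSource : A.CutEdge → A.CutVertex :=
  Sum.elim (fun h => A.cutNode h.1) fun e => A.cutEndNode e.1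

noncomputable def cutTarget : A.CutEdge → A.CutVertex :=
  Sum.elim (fun h => A.cutNode (A.opp h.1)) fun e => A.cutEndNode (A.glue e).1

/-- The components of the glued curve cut at its marked points. -/
def CutClass : Type := Quot fun a b => ∃ e, A.cutSource e = a ∧ A.cutTarget e = b

noncomputable def clsEnd (x : A.H ⊕ A.Ln) : A.CutClass := Quot.mk _ (A.cutEndNode x)

noncomputable def cls (h : A.H) : A.CutClass := A.clsEnd (Sum.inl h)

variable {A}

theorem cls_eq_mk {h : A.H} {w : A.CutVertex} (hw : A.cutNode h = w) : A.cls h = Quot.mk _ w := by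
  rw [← hw]
  rfl

theorem clsEnd_glue (e : A.rightEnds) : A.clsEnd (A.glue e).1 = A.clsEnd e.1 :=
  (Quot.sound ⟨Sum.inr e, rfl, rfl⟩).symm

theorem cls_eq_of_root_eq {h h' : A.H} (hr : A.root h = A.root h') (hm : ¬ A.IsMarked (A.root h)) :
    A.cls h = A.cls h' := by
  have hm' : ¬ A.IsMarked (A.root h') := hr ▸ hm
  have h1 : A.cutNode h = Sum.inl (A.root h) := dif_neg fun e => hm e.1
  have h2 : A.cutNode h' = Sum.inl (A.root h') := dif_neg fun e => hm' e.1
  rw [cls_eq_mk h1, cls_eq_mk h2, hr]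

theorem clsEnd_transGen {a b : A.H ⊕ A.Ln} (h : Relation.TransGen A.Glued a b) :
    A.clsEnd b = A.clsEnd a := by
  induction h with
  | single h =>
    obtain ⟨e, rfl, rfl⟩ := h
    exact clsEnd_glue e
  | tail _ h ih =>
    obtain ⟨e, rfl, rfl⟩ := h
    exact (clsEnd_glue e).trans ih

namespace IsCounted

variable (hp : Admissible Δ d₁ g p) (hA : A.IsCounted Δ d₁ g p)

include hA hp

theorem cls_opp (h : A.H) : A.cls (A.opp h) = A.cls h := by
  by_cases e : A.opp h = h
  · rw [e]
  have hne : A.dir h ≠ 0 := hA.dir_ne_zero hp fun i hi => e (hi ▸ A.mark_end i)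
  by_cases hn : IsNegative (A.dir h)
  · have hn' : ¬ IsNegative (A.dir (A.opp h)) := by
      rw [A.dir_opp h e, isNegative_neg hne, not_not]
      exact hn
    refine Quot.sound ⟨Sum.inl ⟨A.opp h, A.opp_opp_ne e, hn'⟩, rfl, ?_⟩
    simp [cutTarget, A.opp_opp, cutEndNode]
  · exact (Quot.sound ⟨Sum.inl ⟨h, e, hn⟩, rfl, rfl⟩).symm

theorem cls_linked {h h' : A.H} (hl : A.Linked h h') : A.cls h' = A.cls h := by
  have key : ∀ h h', A.Elevator h h' → A.cls h' = A.cls h := by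
    rintro h h' (⟨-, rfl⟩ | h1)
    · exact hA.cls_opp hp h
    · exact clsEnd_transGen h1
  rcases hl with ⟨-, h1⟩ | ⟨-, h1⟩
  · exact key _ _ h1
  · exact (key _ _ h1).symm

/-- Cutting adds `n` vertices and no edges, so vertices minus edges of the cut graph equal `n + 1 -
g = 2 * Δ.card`, a lower bound for the number of components. -/
theorem le_card_cutClass : 2 * Δ.card ≤ Nat.card A.CutClass := by
  have h1 := card_le_card_quot_add A.cutSource A.cutTarget
  have h2 : Nat.card {v // A.IsMarked v} = n := by
    have : Function.Bijective fun i : Fin n => (⟨A.root (A.mark i), i, rfl⟩ : {v // A.IsMarked v}) :=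
      ⟨fun i j h => hA.root_mark_injective hp (congrArg Subtype.val h),
        fun ⟨v, i, hi⟩ => ⟨i, Subtype.ext hi⟩⟩
    rw [← Nat.card_eq_of_bijective _ this, Nat.card_eq_fintype_card, Fintype.card_fin]
  have h3 : 2 * Nat.card {h // A.opp h ≠ h ∧ ¬ IsNegative (A.dir h)} =
      Nat.card {h // A.opp h ≠ h} := by
    have hsw : Nat.card {h // A.opp h ≠ h ∧ ¬ IsNegative (A.dir h)} =
        Nat.card {h // A.opp h ≠ h ∧ IsNegative (A.dir h)} := by
      have hne : ∀ h, A.opp h ≠ h → A.dir h ≠ 0 := fun h e =>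
        hA.dir_ne_zero hp fun i hi => e (hi ▸ A.mark_end i)
      refine Nat.card_congr
        { toFun := fun h => ⟨A.opp h.1, A.opp_opp_ne h.2.1, by
            rw [A.dir_opp _ h.2.1, isNegative_neg (hne _ h.2.1)]
            exact h.2.2⟩
          invFun := fun h => ⟨A.opp h.1, A.opp_opp_ne h.2.1, by
            rw [A.dir_opp _ h.2.1, isNegative_neg (hne _ h.2.1), not_not]
            exact h.2.2⟩
          left_inv := fun h => Subtype.ext (A.opp_opp _)
          right_inv := fun h => Subtype.ext (A.opp_opp _) }
    simp only [Nat.card_eq_fintype_card, Fintype.card_subtype] at hsw ⊢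
    rw [← Finset.card_filter_add_card_filter_not (s := Finset.univ.filter fun h => A.opp h ≠ h)
      (fun h => IsNegative (A.dir h)), Finset.filter_filter, Finset.filter_filter]
    omega
  have h4 := hA.2.2.2.1
  rw [genus, card_connectedComponent hA.connected] at h4
  simp only [Nat.card_sum] at h1 h4
  have h5 := hp.card_points
  push_cast at h4
  change _ ≤ Nat.card A.CutClass + _ at h1
  omega

/-- For a component without vertical ends, the Menelaus relation applied to its indicator function
shows that at each marked point it contains both sides or none. It would be closed in the connected
glued graph before cutting, hence everything, but vertical ends exist. -/
theorem cls_surjective (κ : A.CutClass) : ∃ h, A.IsVerticalEnd h ∧ A.cls h = κ := by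
  by_contra! hno
  let c : A.H → ℤ := fun h => if A.cls h = κ then 1 else 0
  let cL : A.Ln → ℤ := fun l => if A.clsEnd (Sum.inr l) = κ then 1 else 0
  have hc : ∀ x, Sum.elim c cL x = if A.clsEnd x = κ then 1 else 0 := by
    rintro (h | l) <;> rfl
  have same : ∀ h h', (∀ i, A.mark i ≠ h) → (∀ i, A.mark i ≠ h') → A.root h = A.root h' →
      (A.cls h = κ ↔ A.cls h' = κ) := by
    intro h h' hm hm' hr
    have := hA.menelaus hp c cL (fun h => by simp only [c, hA.cls_opp hp])
      (fun e => by rw [hc, hc, clsEnd_glue])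
      (fun h h' hr hm => by simp only [c, cls_eq_of_root_eq hr hm])
      (fun h hh => if_neg (hno h hh)) (fun h => by simp only [c]; split_ifs <;> simp) hm hm' hr
    simp only [c] at this
    by_cases e1 : A.cls h = κ <;> by_cases e2 : A.cls h' = κ <;> simp_all
  let S : A.V ⊕ A.Ln → Prop := Sum.elim (fun v => ∃ h, (∀ i, A.mark i ≠ h) ∧ A.root h = v ∧
    A.cls h = κ) fun l => A.clsEnd (Sum.inr l) = κ
  have hS : ∀ h, (∀ i, A.mark i ≠ h) → (S (Sum.inl (A.root h)) ↔ A.cls h = κ) := by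
    intro h hm
    constructor
    · rintro ⟨h', hm', hr, hk⟩
      exact (same h' h hm' hm hr).1 hk
    · intro hk
      exact ⟨h, hm, rfl, hk⟩
  have hne : ∀ h, A.opp h ≠ h → ∀ i, A.mark i ≠ h := fun h e i hi => e (hi ▸ A.mark_end i)
  have hdm : ∀ h, (A.dir h).1 ≠ 0 → ∀ i, A.mark i ≠ h := by
    rintro h h0 i rfl
    rw [A.mark_contracted] at h0
    exact h0 rfl
  have hcl : ∀ a b, A.gluedAdj a b → (S a ↔ S b) := by
    rintro a b (⟨h, e, rfl, rfl⟩ | ⟨e, rfl, rfl⟩)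
    · rw [hS h (hne h e), hS _ (hne _ (A.opp_opp_ne e)), hA.cls_opp hp]
    · have r1 : S (A.endNode e.1) ↔ A.clsEnd e.1 = κ := by
        have := e.2
        rcases hx : e.1 with h | l
        · rw [hx] at this
          exact hS h (hdm h this.2.1.ne')
        · exact Iff.rfl
      have r2 : S (A.endNode (A.glue e).1) ↔ A.clsEnd (A.glue e).1 = κ := by
        have := (A.glue e).2
        rcases hx : (A.glue e).1 with h | l
        · rw [hx] at this
          exact hS h (hdm h this.2.1.ne)
        · exact Iff.rfl
      rw [r1, r2, clsEnd_glue]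
  have hnonempty : ∃ a, S a := by
    obtain ⟨w, rfl⟩ := Quot.exists_rep κ
    rcases w with v | ⟨v, i, hi⟩ | l
    · by_cases hv : A.IsMarked v
      · obtain ⟨i, hi⟩ := hv
        obtain ⟨a, b, hab, ha, hb, ra, rb, -, -, hd⟩ := hA.mark_flags hp i
        by_cases hneg : IsNegative (A.dir a)
        · refine ⟨Sum.inl v, b, hb, rb.trans hi, ?_⟩
          have : ¬ IsNegative (A.dir b) := by
            rw [hd, isNegative_neg (hA.dir_ne_zero hp ha), not_not]
            exact hneg
          exact cls_eq_mk (by simp [cutNode, this, rb.trans hi])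
        · refine ⟨Sum.inl v, a, ha, ra.trans hi, ?_⟩
          exact cls_eq_mk (by simp [cutNode, hneg, ra.trans hi])
      · obtain ⟨h, hh⟩ := Finset.card_pos.1 (show 0 < _ from lt_of_lt_of_le (by norm_num)
          (A.three_le_valence v))
        have hr := (Finset.mem_filter.1 hh).2
        refine ⟨Sum.inl v, h, fun i hi => hv ⟨i, by rw [hi, hr]⟩, hr, ?_⟩
        exact cls_eq_mk (by simp [cutNode, hr, hv])
    · obtain ⟨a, b, hab, ha, hb, ra, rb, -, -, hd⟩ := hA.mark_flags hp i
      have hv : A.IsMarked v := ⟨i, hi⟩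
      by_cases hneg : IsNegative (A.dir a)
      · refine ⟨Sum.inl v, a, ha, ra.trans hi, ?_⟩
        exact cls_eq_mk (by simp [cutNode, hneg, ra.trans hi, hv])
      · refine ⟨Sum.inl v, b, hb, rb.trans hi, ?_⟩
        have : IsNegative (A.dir b) := by
          rw [hd, isNegative_neg (hA.dir_ne_zero hp ha)]
          exact hneg
        exact cls_eq_mk (by simp [cutNode, this, rb.trans hi, hv])
    · exact ⟨Sum.inr l, rfl⟩
  obtain ⟨a, ha⟩ := hnonempty
  obtain ⟨h, hh⟩ := hA.exists_verticalEnd hp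
  refine hno h hh ((hS h ?_).1 (hA.connected.closed hcl a _ ha))
  rintro i rfl
  exact hh.2 (by rw [A.mark_contracted]; rfl)

/-- Every component of the curve cut at its marked points has exactly one end that is not
horizontal. -/
theorem cls_injective {h h' : A.H} (hh : A.IsVerticalEnd h) (hh' : A.IsVerticalEnd h')
    (hc : A.cls h = A.cls h') : h = h' := by
  have h1 : Function.Surjective fun h : {h // A.IsVerticalEnd h} => A.cls h.1 := fun κ => by
    obtain ⟨h, hh, hk⟩ := hA.cls_surjective hp κ
    exact ⟨⟨h, hh⟩, hk⟩
  -- The `2 * Δ.card` vertical ends map onto at least as many components, so the map is bijective.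
  have h2 : Nat.card {h // A.IsVerticalEnd h} ≤ Nat.card A.CutClass := by
    rw [Nat.card_eq_fintype_card, Fintype.card_subtype, hA.leaky.card_verticalEnd]
    exact hA.le_card_cutClass hp
  exact congrArg Subtype.val ((h1.bijective_of_nat_card_le h2).1 (a₁ := ⟨h, hh⟩) (a₂ := ⟨h', hh'⟩) hc)

end IsCounted

end CutMap

end TropEP

end

/-! ### Heights of vertices, and marked points and ends of the floors -/

section

open scoped Classical

namespace TropEP

variable {n : ℕ} {Δ : Multiset ℤ} {d₁ g : ℕ} {p : Fin n → ℝ × ℝ}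

theorem sameRay_of_horizontal {u w : ℤ × ℤ} (hu : u.2 = 0) (hw : w.2 = 0) (h : 0 < u.1 * w.1) :
    SameRay ℤ u w := by
  refine Or.inr (Or.inr ?_)
  rcases pos_and_pos_or_neg_and_neg_of_mul_pos h with ⟨h1, h2⟩ | ⟨h1, h2⟩
  · exact ⟨w.1, u.1, h2, h1, by ext <;> simp [hu, hw, mul_comm]⟩
  · exact ⟨-w.1, -u.1, by omega, by omega, by ext <;> simp [hu, hw, mul_comm]⟩

theorem PlaneMap.exists_dir_pos (A : PlaneMap n) (ε : ℤ) (hε : ε ≠ 0) {v : A.V}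
    (hv : ∃ k, A.root k = v ∧ (A.dir k).2 ≠ 0) : ∃ k, A.root k = v ∧ 0 < ε * (A.dir k).2 := by
  obtain ⟨k, hk, hk'⟩ := hv
  have h1 : ∑ h with A.root h = v, ε * (A.dir h).2 = 0 := by
    rw [← Finset.mul_sum, ← Prod.snd_sum, A.balanced, Prod.snd_zero, mul_zero]
  obtain ⟨h, hh, h2⟩ := Finset.exists_pos_of_sum_zero_of_exists_nonzero _ h1
    ⟨k, by simpa using hk, mul_ne_zero hε hk'⟩
  exact ⟨h, (Finset.mem_filter.1 hh).2, h2⟩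

theorem PlaneMap.height_lt (A : PlaneMap n) {ε : ℤ} {h : A.H} (hh : A.opp h ≠ h)
    (hd : 0 < ε * (A.dir h).2) : ε * (A.pos (A.root h)).2 < ε * (A.pos (A.root (A.opp h))).2 := by
  rw [A.pos_opp_snd h hh, mul_add, lt_add_iff_pos_right, mul_left_comm]
  exact mul_pos (A.len_toReal_pos hh) (by exact_mod_cast hd)

namespace CutMap

variable (A : CutMap n)

/-- The graph formed by the edges that are not horizontal; its components are the floors and the
remaining marked vertices. -/
def floorGraph : SimpleGraph A.V := SimpleGraph.fromRel A.FloorAdj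

/-- Two vertices on the same floor. -/
def SameFloor (v w : A.V) : Prop := A.floorGraph.Reachable v w

/-- The vertices of the floors. -/
def IsFloorVertex (v : A.V) : Prop := ∃ k, A.root k = v ∧ (A.dir k).2 ≠ 0

variable {A}

theorem floorAdj_symm {v w : A.V} (h : A.FloorAdj v w) : A.FloorAdj w v := by
  obtain ⟨k, hk, hk', rfl, rfl⟩ := h
  refine ⟨A.opp k, A.opp_opp_ne hk, ?_, rfl, by rw [A.opp_opp]⟩
  simp only [PlaneMap.IsHorizontal, A.dir_opp k hk, Prod.snd_neg, Prod.fst_neg, neg_eq_zero, ne_eq]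
  exact hk'

theorem floorAdj_of_adj {v w : A.V} (h : A.floorGraph.Adj v w) : A.FloorAdj v w :=
  ((SimpleGraph.fromRel_adj _ _ _).1 h).2.elim id floorAdj_symm

theorem FloorAdj.sameFloor {v w : A.V} (h : A.FloorAdj v w) : A.SameFloor v w := by
  by_cases e : v = w
  · rw [e]
    exact SimpleGraph.Reachable.refl _
  · exact SimpleGraph.Adj.reachable ((SimpleGraph.fromRel_adj _ _ _).2 ⟨e, Or.inl h⟩)

theorem SameFloor.induction {v : A.V} {P : A.V → Prop} (h0 : P v)
    (hstep : ∀ k, A.opp k ≠ k → ¬ A.IsHorizontal k → A.SameFloor v (A.root k) → P (A.root k) →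
      P (A.root (A.opp k))) {w : A.V} (h : A.SameFloor v w) : P w := by
  have key : ∀ u w : A.V, ∀ q : A.floorGraph.Walk u w, A.SameFloor v u → P u → P w := by
    intro u w q
    induction q with
    | nil => exact fun _ h => h
    | cons hadj _ ih =>
      intro h1 h2
      obtain ⟨k, hk, hk', rfl, rfl⟩ := floorAdj_of_adj hadj
      exact ih (h1.trans hadj.reachable) (hstep k hk hk' h1 h2)
  obtain ⟨q⟩ := h
  exact key _ _ q (SimpleGraph.Reachable.refl _) h0

theorem sameFloor_iff {v w : A.V} : A.SameFloor v w ↔ Relation.EqvGen A.FloorAdj v w := by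
  constructor
  · intro h
    exact h.induction (P := fun w => Relation.EqvGen A.FloorAdj v w) (.refl _)
      fun k hk hk' _ h => h.trans _ _ _ (.rel _ _ ⟨k, hk, hk', rfl, rfl⟩)
  · intro h
    induction h with
    | rel _ _ h => exact h.sameFloor
    | refl _ => exact SimpleGraph.Reachable.refl _
    | symm _ _ _ ih => exact ih.symm
    | trans _ _ _ _ _ ih1 ih2 => exact ih1.trans ih2

namespace IsCounted

variable (hp : Admissible Δ d₁ g p) (hA : A.IsCounted Δ d₁ g p)

include hA hp

omit hp hA in
theorem ne_mark {h : A.H} (h0 : A.dir h ≠ 0) (i : Fin n) : A.mark i ≠ h := by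
  rintro rfl
  exact h0 (A.mark_contracted i)

theorem snd_ne_zero {k : A.H} (hk : A.opp k ≠ k) (hk' : ¬ A.IsHorizontal k) : (A.dir k).2 ≠ 0 := by
  intro h0
  have h1 := hA.dir_ne_zero hp (h := k) fun i hi => hk (hi ▸ A.mark_end i)
  exact hk' ⟨h0, fun h2 => h1 (Prod.ext h2 h0)⟩

/-- Among three nonzero horizontal directions two point to the same side, contrary to local
embedding. -/
theorem isFloorVertex_of_unmarked {v : A.V} (hv : ¬ A.IsMarked v) : A.IsFloorVertex v := by
  by_contra hno
  simp only [IsFloorVertex, not_exists, not_and, not_not] at hno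
  obtain ⟨h, hh⟩ := Finset.card_pos.1 (show 0 < _ from lt_of_lt_of_le (by norm_num)
    (A.three_le_valence v))
  obtain rfl := (Finset.mem_filter.1 hh).2
  obtain ⟨b, c, hb, hc, hbc, rb, rc, -, -, -⟩ := hA.simple.star h
  have key : ∀ k, A.root k = A.root h → (A.dir k).2 = 0 ∧ (A.dir k).1 ≠ 0 := fun k hk => by
    have h1 := hA.dir_ne_zero hp (h := k) fun i hi => hv ⟨i, by rw [hi, hk]⟩
    exact ⟨hno k hk, fun h2 => h1 (Prod.ext h2 (hno k hk))⟩
  have ray : ∀ k l, A.root k = A.root h → A.root l = A.root h → k ≠ l →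
      (A.dir k).1 * (A.dir l).1 ≤ 0 := fun k l hk hl hkl => by
    by_contra hlt
    exact hA.simple.2 k l (hk.trans hl.symm) hkl (hk ▸ hv)
      (sameRay_of_horizontal (key k hk).1 (key l hl).1 (not_le.1 hlt))
  have r1 := ray h b rfl rb hb.symm
  have r2 := ray h c rfl rc hc.symm
  have r3 := ray b c rb rc hbc
  have k1 := (key h rfl).2
  have k2 := (key b rb).2
  have k3 := (key c rc).2
  rcases lt_or_gt_of_ne k1 with h1 | h1 <;> rcases lt_or_gt_of_ne k2 with h2 | h2 <;>
    rcases lt_or_gt_of_ne k3 with h3 | h3 <;> nlinarith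

omit hp in
theorem abs_snd_verticalEnd {ε : ℤ} (hε : ε = 1 ∨ ε = -1) {h : A.H} (hh : A.IsVerticalEnd h)
    (hd : 0 < ε * (A.dir h).2) : ε * (A.dir h).2 = 1 := by
  rcases hA.leaky.verticalEnd_cases hh with h1 | h1
  · rw [h1] at hd ⊢
    simp only at hd ⊢
    omega
  · rw [h1] at hd ⊢
    omega

/-- Suppose that an extremal vertex lies beyond all marked points. It is unmarked and carries a
vertical end and one horizontal edge. At the other end of this edge sits a vertex of the same kind
in the same cut component, hence with the same vertical end. The horizontal edge would have both
flags at one vertex that has a single horizontal flag. -/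
theorem exists_mark_height (ε : ℤ) (hε : ε = 1 ∨ ε = -1) (v : A.V) :
    ∃ i, ε * (A.pos v).2 ≤ ε * (p i).2 := by
  have hε0 : ε ≠ 0 := by omega
  have hεR : (ε : ℝ) ≠ 0 := by exact_mod_cast hε0
  by_contra! hlt
  have : Nonempty A.V := ⟨v⟩
  obtain ⟨m, hm⟩ := Finite.exists_max fun v => (ε : ℝ) * (A.pos v).2
  have hend : ∀ k, (A.pos (A.root k)).2 = (A.pos m).2 → 0 < ε * (A.dir k).2 → A.IsVerticalEnd k := by
    intro k hk hd
    refine ⟨?_, fun h0 => by rw [h0, mul_zero] at hd; exact lt_irrefl _ hd⟩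
    by_contra he
    have := A.height_lt he hd
    rw [hk] at this
    exact absurd (hm (A.root (A.opp k))) (not_le.2 this)
  have hunm : ∀ w, (A.pos w).2 = (A.pos m).2 → ¬ A.IsMarked w := by
    rintro w hw ⟨i, rfl⟩
    rw [hA.pos_mark] at hw
    have := hlt i
    rw [hw] at this
    exact absurd (hm v) (not_le.2 this)
  -- A flag pointing outwards is an end of vertical speed one, and there is only one since two would
  -- share a cut component. Balancing leaves vertical speeds `0` and `-1` for the other two flags.
  have top : ∀ w, (A.pos w).2 = (A.pos m).2 → ∃ a b, A.root a = w ∧ A.IsVerticalEnd a ∧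
      A.root b = w ∧ A.IsHorizontal b ∧ ∀ k, A.root k = w → A.IsHorizontal k → k = b := by
    intro w hw
    obtain ⟨a, rfl, ha⟩ := A.exists_dir_pos ε hε0 (hA.isFloorVertex_of_unmarked hp (hunm w hw))
    obtain ⟨b, c, hb, hc, hbc, rb, rc, hall, -, hsum⟩ := hA.simple.star a
    have hva := hend a hw ha
    have h1 := hA.abs_snd_verticalEnd hε hva ha
    have hle : ∀ k, A.root k = A.root a → k ≠ a → ε * (A.dir k).2 ≤ 0 := by
      intro k hk hka
      by_contra hlt
      have hvk := hend k (by rw [hk, hw]) (not_le.1 hlt)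
      exact hka (hA.cls_injective hp hvk hva (cls_eq_of_root_eq hk (hk ▸ hunm _ hw)))
    have hne : ∀ k, A.root k = A.root a → A.dir k ≠ 0 := fun k hk =>
      hA.dir_ne_zero hp fun i hi => hunm _ hw ⟨i, by rw [hi, hk]⟩
    have h2 := hle b rb hb
    have h3 := hle c rc hc
    have h4 : ε * (A.dir a).2 + ε * (A.dir b).2 + ε * (A.dir c).2 = 0 := by
      have := congrArg Prod.snd hsum
      simp only [Prod.snd_add, Prod.snd_zero] at this
      rw [← mul_add, ← mul_add, this, mul_zero]
    have h5 : (ε * (A.dir b).2 = 0 ∧ ε * (A.dir c).2 ≠ 0) ∨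
        (ε * (A.dir c).2 = 0 ∧ ε * (A.dir b).2 ≠ 0) := by omega
    rcases h5 with ⟨h5, h6⟩ | ⟨h5, h6⟩
    · have h7 := (mul_eq_zero.1 h5).resolve_left hε0
      refine ⟨a, b, rfl, hva, rb, ⟨h7, fun e => hne b rb (Prod.ext e h7)⟩, fun k hk hk' => ?_⟩
      rcases hall k hk with rfl | rfl | rfl
      · exact absurd hk'.1 hva.2
      · rfl
      · exact absurd (by rw [hk'.1, mul_zero]) h6
    · have h7 := (mul_eq_zero.1 h5).resolve_left hε0
      refine ⟨a, c, rfl, hva, rc, ⟨h7, fun e => hne c rc (Prod.ext e h7)⟩, fun k hk hk' => ?_⟩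
      rcases hall k hk with rfl | rfl | rfl
      · exact absurd hk'.1 hva.2
      · exact absurd (by rw [hk'.1, mul_zero]) h6
      · rfl
  obtain ⟨a, b, ra, ha, rb, hb, hball⟩ := top m rfl
  obtain ⟨b', hl⟩ := exists_linked hb
  have hb' : (A.pos (A.root b')).2 = (A.pos m).2 := by rw [hl.height_eq, rb]
  obtain ⟨a', b'', ra', ha', rb'', hb'', hball'⟩ := top _ hb'
  have e1 : a' = a := by
    refine hA.cls_injective hp ha' ha ?_
    rw [cls_eq_of_root_eq ra' (ra'.symm ▸ hunm _ hb'), hA.cls_linked hp hl,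
      cls_eq_of_root_eq (rb.trans ra.symm) (rb.symm ▸ hunm m rfl)]
  have e2 : A.root b' = m := by rw [← ra', e1, ra]
  have e3 := hball b' e2 hl.symm.isHorizontal
  have e4 := congrArg Prod.fst hl.dir_eq
  rw [e3, Prod.fst_neg] at e4
  have := hb.2
  omega

theorem exists_height_bounds : ∃ k l, ∀ v, (p l).2 ≤ (A.pos v).2 ∧ (A.pos v).2 ≤ (p k).2 := by
  obtain ⟨h, -⟩ := hA.exists_verticalEnd hp
  obtain ⟨i, -⟩ := hA.exists_mark_height hp 1 (Or.inl rfl) (A.root h)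
  have : Nonempty (Fin n) := ⟨i⟩
  obtain ⟨k, hk⟩ := Finite.exists_max fun i => (p i).2
  obtain ⟨l, hl⟩ := Finite.exists_min fun i => (p i).2
  refine ⟨k, l, fun v => ⟨?_, ?_⟩⟩
  · obtain ⟨i, hi⟩ := hA.exists_mark_height hp (-1) (Or.inr rfl) v
    push_cast at hi
    linarith [hl i]
  · obtain ⟨i, hi⟩ := hA.exists_mark_height hp 1 (Or.inl rfl) v
    push_cast at hi
    linarith [hk i]

/-- Floors are narrow. -/
theorem abs_fst_sub_lt {v w : A.V} (h : A.SameFloor v w) {i j : Fin n} (hij : i ≠ j) :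
    |(A.pos w).1 - (A.pos v).1| < |(p i).1 - (p j).1| := by
  obtain ⟨k, l, hkl⟩ := hA.exists_height_bounds hp
  let Y := (p k).2 - (p l).2
  have hY : 0 ≤ Y := by linarith [hkl v]
  -- The vertical speed of an edge that is not horizontal is a nonzero integer, so the length of the
  -- edge is at most the range `Y` of heights.
  have step : ∀ v w, A.FloorAdj v w → |(A.pos w).1 - (A.pos v).1| ≤ dirBound Δ d₁ * Y := by
    rintro v w ⟨h, he, hh, rfl, rfl⟩
    have h1 := hA.snd_ne_zero hp he hh
    have h2 : (1 : ℝ) ≤ |((A.dir h).2 : ℝ)| := by exact_mod_cast Int.one_le_abs h1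
    have h3 : |((A.dir h).1 : ℝ)| ≤ dirBound Δ d₁ := by exact_mod_cast hA.abs_dir_fst_le h
    have h4 := A.pos_opp_snd h he
    have h5 := A.len_toReal_pos he
    have h6 : (A.len h).toReal ≤ Y := by
      calc (A.len h).toReal ≤ (A.len h).toReal * |((A.dir h).2 : ℝ)| := le_mul_of_one_le_right h5.le h2
        _ = |(A.len h).toReal * ((A.dir h).2 : ℝ)| := by rw [abs_mul, abs_of_pos h5]
        _ = |(A.pos (A.root (A.opp h))).2 - (A.pos (A.root h)).2| := by rw [h4, add_sub_cancel_left]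
        _ ≤ Y := abs_le.2 ⟨by linarith [hkl (A.root h), hkl (A.root (A.opp h))],
            by linarith [hkl (A.root h), hkl (A.root (A.opp h))]⟩
    rw [A.pos_opp_fst h he, add_sub_cancel_left, abs_mul, abs_of_pos h5, mul_comm]
    exact mul_le_mul h3 h6 h5.le (by positivity)
  have walk : ∀ v w, ∀ q : A.floorGraph.Walk v w,
      |(A.pos w).1 - (A.pos v).1| ≤ q.length * (dirBound Δ d₁ * Y) := by
    intro v w q
    induction q with
    | nil => simp
    | @cons a b c hadj q ih =>
      have h1 := step _ _ (floorAdj_of_adj hadj)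
      have h2 := abs_sub_le (A.pos c).1 (A.pos b).1 (A.pos a).1
      rw [SimpleGraph.Walk.length_cons]
      push_cast
      linarith
  obtain ⟨q, hq⟩ := h.exists_isPath
  have h1 := walk v w q
  have h2 : q.length < Nat.card A.V := by
    rw [Nat.card_eq_fintype_card]
    exact hq.length_lt
  -- A path has fewer edges than the curve has vertices, whose number was fixed by the genus.
  have h3 : q.length * dirBound Δ d₁ ≤ pointBound Δ d₁ g := by
    have h4 := hA.card_vertices
    have h5 := hp.card_points
    rw [pointBound, mul_comm]
    exact Nat.mul_le_mul (Nat.le_succ _) (by omega)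
  have h6 := hp.stretched i j k l hij
  rw [abs_of_nonneg hY] at h6
  calc _ ≤ (q.length * dirBound Δ d₁ : ℕ) * Y := by push_cast; linarith
    _ ≤ pointBound Δ d₁ g * Y := mul_le_mul_of_nonneg_right (by exact_mod_cast h3) hY
    _ < _ := h6

theorem eq_of_sameFloor_mark {i j : Fin n}
    (h : A.SameFloor (A.root (A.mark i)) (A.root (A.mark j))) : i = j := by
  by_contra hij
  have := hA.abs_fst_sub_lt hp h hij
  rw [hA.pos_mark, hA.pos_mark, abs_sub_comm] at this
  exact lt_irrefl _ this

theorem isFloorVertex_of_sameFloor {v w : A.V} (h : A.SameFloor v w) (hv : A.IsFloorVertex v) :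
    A.IsFloorVertex w := by
  refine h.induction hv fun k hk hk' _ _ => ⟨A.opp k, rfl, ?_⟩
  rw [A.dir_opp k hk, Prod.snd_neg, neg_ne_zero]
  exact hA.snd_ne_zero hp hk hk'

/-- At an extremal vertex of the floor, a flag pointing outwards cannot be bounded, because it would
lead to a more extremal vertex of the same floor. -/
theorem exists_floor_end {v : A.V} (hv : A.IsFloorVertex v) {ε : ℤ} (hε : ε = 1 ∨ ε = -1) :
    ∃ k, A.IsVerticalEnd k ∧ 0 < ε * (A.dir k).2 ∧ A.SameFloor v (A.root k) := by
  have : Nonempty {w // A.SameFloor v w} := ⟨⟨v, SimpleGraph.Reachable.refl _⟩⟩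
  obtain ⟨⟨m, hvm⟩, hm⟩ := Finite.exists_max fun w : {w // A.SameFloor v w} => (ε : ℝ) * (A.pos w.1).2
  obtain ⟨k, rfl, hk⟩ := A.exists_dir_pos ε (by omega) (hA.isFloorVertex_of_sameFloor hp hvm hv)
  have h0 : (A.dir k).2 ≠ 0 := fun h0 => by
    rw [h0, mul_zero] at hk
    exact lt_irrefl _ hk
  refine ⟨k, ⟨?_, h0⟩, hk, hvm⟩
  by_contra he
  have hadj : A.FloorAdj (A.root k) (A.root (A.opp k)) := ⟨k, he, fun e => h0 e.1, rfl, rfl⟩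
  exact absurd (hm ⟨_, hvm.trans hadj.sameFloor⟩) (not_le.2 (A.height_lt he hk))

/-- A floor without marked point is not cut, so its top and bottom ends would be two vertical ends
in one cut component. -/
theorem exists_sameFloor_mark (v : A.V) : ∃ i, A.SameFloor v (A.root (A.mark i)) := by
  by_contra! hno
  have hunm : ∀ w, A.SameFloor v w → ¬ A.IsMarked w := fun w hw ⟨i, hi⟩ => hno i (hi ▸ hw)
  have hv := hA.isFloorVertex_of_unmarked hp (hunm v (SimpleGraph.Reachable.refl _))
  obtain ⟨h, hh, -⟩ := id hv
  obtain ⟨e, he, he', hve⟩ := hA.exists_floor_end hp hv (ε := 1) (Or.inl rfl)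
  obtain ⟨f, hf, hf', hvf⟩ := hA.exists_floor_end hp hv (ε := -1) (Or.inr rfl)
  have key : ∀ w, A.SameFloor v w → ∀ k, A.root k = w → A.cls k = A.cls h := by
    intro w hw
    refine hw.induction (P := fun w => ∀ k, A.root k = w → A.cls k = A.cls h) ?_ ?_
    · intro k hk
      exact cls_eq_of_root_eq (hk.trans hh.symm) (hk ▸ hunm v (SimpleGraph.Reachable.refl _))
    · intro k hk hk' hvk ih l hl
      have hadj : A.FloorAdj (A.root k) (A.root (A.opp k)) := ⟨k, hk, hk', rfl, rfl⟩
      rw [cls_eq_of_root_eq hl (hl ▸ hunm _ (hvk.trans hadj.sameFloor)), hA.cls_opp hp, ih k rfl]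
  have := hA.cls_injective hp he hf ((key _ hve e rfl).trans (key _ hvf f rfl).symm)
  rw [this] at he'
  omega

/-- A floor contains a single marked vertex, and the cut component can change only there, between
the two sides of that vertex. -/
theorem exists_two_classes (v : A.V) : ∃ α β : A.CutClass, ∀ w, A.SameFloor v w →
    ∀ h, A.root h = w → (∀ i, A.mark i ≠ h) → A.cls h = α ∨ A.cls h = β := by
  obtain ⟨i, hi⟩ := hA.exists_sameFloor_mark hp v
  obtain ⟨a, b, -, ha, hb, ra, rb, hall, -, -⟩ := hA.mark_flags hp i
  refine ⟨A.cls a, A.cls b, fun w hw => ?_⟩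
  have base : ∀ h, A.root h = A.root (A.mark i) → (∀ i, A.mark i ≠ h) →
      A.cls h = A.cls a ∨ A.cls h = A.cls b := by
    intro h hr hm
    rcases (hall h hr).resolve_left (hm i).symm with rfl | rfl
    · exact Or.inl rfl
    · exact Or.inr rfl
  refine SameFloor.induction (v := A.root (A.mark i)) (P := fun w => ∀ h, A.root h = w →
    (∀ i, A.mark i ≠ h) → A.cls h = A.cls a ∨ A.cls h = A.cls b) base ?_ (hi.symm.trans hw)
  intro k hk hk' hvk ih h hr hm
  have hadj : A.FloorAdj (A.root k) (A.root (A.opp k)) := ⟨k, hk, hk', rfl, rfl⟩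
  by_cases hmk : A.IsMarked (A.root (A.opp k))
  · obtain ⟨j, hj⟩ := hmk
    have : i = j := hA.eq_of_sameFloor_mark hp (by rw [hj]; exact hvk.trans hadj.sameFloor)
    subst this
    exact base h (hr.trans hj.symm) hm
  · rw [cls_eq_of_root_eq hr (hr ▸ hmk), hA.cls_opp hp]
    exact ih k rfl fun j hj => hk (hj ▸ A.mark_end j)

omit hp hA in
theorem verticalEnd_ne_mark {e : A.H} (he : A.IsVerticalEnd e) (i : Fin n) : A.mark i ≠ e := by
  rintro rfl
  exact he.2 (by rw [A.mark_contracted]; rfl)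

/-- A floor has exactly one end in every vertical direction. -/
theorem floor_end_unique {ε : ℤ} (hε : ε = 1 ∨ ε = -1) {e e' : A.H} (he : A.IsVerticalEnd e)
    (he' : A.IsVerticalEnd e') (hd : 0 < ε * (A.dir e).2) (hd' : 0 < ε * (A.dir e').2)
    (h : A.SameFloor (A.root e) (A.root e')) : e = e' := by
  -- The opposite end of the floor occupies one of the two cut components that the floor meets, so
  -- `e` and `e'` share the remaining one.
  obtain ⟨f, hf, hfd, hef⟩ := hA.exists_floor_end hp ⟨e, rfl, he.2⟩ (ε := -ε) (by omega)
  obtain ⟨α, β, hαβ⟩ := hA.exists_two_classes hp (A.root e)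
  have h1 := hαβ _ (SimpleGraph.Reachable.refl _) e rfl (verticalEnd_ne_mark he)
  have h2 := hαβ _ h e' rfl (verticalEnd_ne_mark he')
  have h3 := hαβ _ hef f rfl (verticalEnd_ne_mark hf)
  have n1 : A.cls e ≠ A.cls f := fun e1 => by
    rw [hA.cls_injective hp he hf e1] at hd
    rw [neg_mul] at hfd
    omega
  have n2 : A.cls e' ≠ A.cls f := fun e1 => by
    rw [hA.cls_injective hp he' hf e1] at hd'
    rw [neg_mul] at hfd
    omega
  refine hA.cls_injective hp he he' ?_
  rcases h1 with h1 | h1 <;> rcases h2 with h2 | h2 <;> rcases h3 with h3 | h3 <;> simp_all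

/-- The top and the bottom end lie in different cut components and so exhaust the two that the floor
meets. -/
theorem exists_end_cls_eq {h : A.H} (hm : ∀ i, A.mark i ≠ h) (hv : A.IsFloorVertex (A.root h)) :
    ∃ e, A.IsVerticalEnd e ∧ A.SameFloor (A.root h) (A.root e) ∧ A.cls h = A.cls e := by
  obtain ⟨e, he, hed, hve⟩ := hA.exists_floor_end hp hv (ε := 1) (Or.inl rfl)
  obtain ⟨f, hf, hfd, hvf⟩ := hA.exists_floor_end hp hv (ε := -1) (Or.inr rfl)
  obtain ⟨α, β, hαβ⟩ := hA.exists_two_classes hp (A.root h)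
  have h1 := hαβ _ (SimpleGraph.Reachable.refl _) h rfl hm
  have h2 := hαβ _ hve e rfl (verticalEnd_ne_mark he)
  have h3 := hαβ _ hvf f rfl (verticalEnd_ne_mark hf)
  have n1 : A.cls e ≠ A.cls f := fun e1 => by
    rw [hA.cls_injective hp he hf e1] at hed
    omega
  by_cases e1 : A.cls h = A.cls e
  · exact ⟨e, he, hve, e1⟩
  · refine ⟨f, hf, hvf, ?_⟩
    rcases h1 with h1 | h1 <;> rcases h2 with h2 | h2 <;> rcases h3 with h3 | h3 <;> simp_all

end IsCounted

end CutMap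

end TropEP

end

/-! ### Floors are vertical paths, and horizontal edges join floors to points -/

section

open scoped Classical

namespace TropEP

variable {n : ℕ} {Δ : Multiset ℤ} {d₁ g : ℕ} {p : Fin n → ℝ × ℝ}

namespace CutMap

variable (A : CutMap n)

/-- The edge of the flag `h` leaves the closed half plane below `y` in upward direction. -/
def Crosses (y : ℝ) (h : A.H) : Prop :=
  0 < (A.dir h).2 ∧ (A.pos (A.root h)).2 ≤ y ∧ (A.opp h = h ∨ y < (A.pos (A.root (A.opp h))).2)

variable {A}

theorem crosses_of_pos {h : A.H} (hd : 0 < (A.dir h).2) : A.Crosses (A.pos (A.root h)).2 h := by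
  refine ⟨hd, le_rfl, ?_⟩
  by_cases e : A.opp h = h
  · exact Or.inl e
  · have := A.height_lt (ε := 1) e (by omega)
    push_cast at this
    exact Or.inr (by linarith)

theorem sameFloor_opp {h : A.H} (hd : (A.dir h).2 ≠ 0) :
    A.SameFloor (A.root h) (A.root (A.opp h)) := by
  by_cases e : A.opp h = h
  · rw [e]
    exact SimpleGraph.Reachable.refl _
  · exact FloorAdj.sameFloor ⟨h, e, fun e => hd e.1, rfl, rfl⟩

theorem sameFloor_refl (v : A.V) : A.SameFloor v v := SimpleGraph.Reachable.refl _

theorem SameFloor.symm {v w : A.V} (h : A.SameFloor v w) : A.SameFloor w v :=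
  SimpleGraph.Reachable.symm h

theorem SameFloor.trans {u v w : A.V} (h : A.SameFloor u v) (h' : A.SameFloor v w) :
    A.SameFloor u w := SimpleGraph.Reachable.trans h h'

namespace IsCounted

variable (hp : Admissible Δ d₁ g p) (hA : A.IsCounted Δ d₁ g p)

include hA hp

/-- Vertical flux out of the part of the floor at height at most `y`. Level flags contribute
nothing, and bounded flags pointing down do not leave this part. The upward flux can be compensated
only by the down end of the floor, which is unique and of speed one; so if there is any upward flux,
this end starts at height at most `y`. -/
theorem sum_crosses_le (v : A.V) (y : ℝ) :
    ∑ h with A.SameFloor v (A.root h) ∧ A.Crosses y h, (A.dir h).2 ≤ 1 ∧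
    ∀ h, A.SameFloor v (A.root h) → A.Crosses y h →
      ∃ e, A.IsVerticalEnd e ∧ (A.dir e).2 < 0 ∧ A.SameFloor v (A.root e) ∧
        (A.pos (A.root e)).2 ≤ y := by
  let S : Finset A.V := Finset.univ.filter fun w => A.SameFloor v w ∧ (A.pos w).2 ≤ y
  let F : Finset A.H := Finset.univ.filter fun h =>
    A.root h ∈ S ∧ (A.opp h = h ∨ A.root (A.opp h) ∉ S)
  have hF : ∀ h ∈ F, (A.SameFloor v (A.root h) ∧ A.Crosses y h) ∨ (A.dir h).2 = 0 ∨
      (A.IsVerticalEnd h ∧ (A.dir h).2 < 0 ∧ A.SameFloor v (A.root h) ∧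
        (A.pos (A.root h)).2 ≤ y) := by
    intro h hh
    obtain ⟨h1, h2⟩ := (Finset.mem_filter.1 hh).2
    obtain ⟨h3, h4⟩ := (Finset.mem_filter.1 h1).2
    rcases lt_trichotomy (A.dir h).2 0 with hd | hd | hd
    · refine Or.inr (Or.inr ⟨⟨?_, hd.ne⟩, hd, h3, h4⟩)
      refine h2.resolve_right fun h5 => h5 (Finset.mem_filter.2 ⟨Finset.mem_univ _,
        h3.trans (sameFloor_opp hd.ne), ?_⟩)
      by_cases e : A.opp h = h
      · rw [e]
        exact h4
      · have := A.height_lt (ε := -1) e (by omega)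
        push_cast at this
        linarith
    · exact Or.inr (Or.inl hd)
    · refine Or.inl ⟨h3, hd, h4, h2.imp_right fun h5 => ?_⟩
      by_contra hle
      exact h5 (Finset.mem_filter.2 ⟨Finset.mem_univ _, h3.trans (sameFloor_opp hd.ne'),
        not_lt.1 hle⟩)
  have hC : ∀ h, A.SameFloor v (A.root h) → A.Crosses y h → h ∈ F := by
    rintro h h1 ⟨h2, h3, h4⟩
    refine Finset.mem_filter.2 ⟨Finset.mem_univ _, Finset.mem_filter.2 ⟨Finset.mem_univ _, h1, h3⟩,
      h4.imp_right fun h5 h6 => ?_⟩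
    exact absurd (Finset.mem_filter.1 h6).2.2 (not_le.2 h5)
  have h0 : ∑ h ∈ F, (A.dir h).2 = 0 := by
    rw [← Prod.snd_sum, A.flux S, Prod.snd_zero]
  have h1 : ∑ h ∈ F, max (A.dir h).2 0 = ∑ h ∈ F, max (-(A.dir h).2) 0 := by
    rw [← sub_eq_zero, ← Finset.sum_sub_distrib, ← h0]
    exact Finset.sum_congr rfl fun h _ => by omega
  have hsub : (Finset.univ.filter fun h => A.SameFloor v (A.root h) ∧ A.Crosses y h) ⊆ F :=
    fun h hh => hC h (Finset.mem_filter.1 hh).2.1 (Finset.mem_filter.1 hh).2.2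
  have h2 : ∑ h with A.SameFloor v (A.root h) ∧ A.Crosses y h, (A.dir h).2 ≤
      ∑ h ∈ F, max (-(A.dir h).2) 0 := by
    rw [← h1]
    exact (Finset.sum_le_sum fun h _ => le_max_left _ _).trans
      (Finset.sum_le_sum_of_subset_of_nonneg hsub fun _ _ _ => le_max_right _ _)
  have hend : ∀ e ∈ F, (A.dir e).2 < 0 → A.IsVerticalEnd e ∧ (A.dir e).2 < 0 ∧
      A.SameFloor v (A.root e) ∧ (A.pos (A.root e)).2 ≤ y := by
    intro e he hd
    rcases hF e he with h3 | h3 | h3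
    · exact absurd h3.2.1 (not_lt.2 hd.le)
    · omega
    · exact h3
  by_cases hex : ∃ e ∈ F, (A.dir e).2 < 0
  · obtain ⟨e, he, hd⟩ := hex
    have he' := hend e he hd
    refine ⟨h2.trans ?_, fun _ _ _ => ⟨e, he'⟩⟩
    rw [Finset.sum_eq_single_of_mem e he]
    · have := hA.abs_snd_verticalEnd (ε := -1) (Or.inr rfl) he'.1 (by omega)
      omega
    · intro k hk hke
      refine max_eq_right ?_
      by_contra hlt
      have hk' := hend k hk (by omega)
      exact hke (hA.floor_end_unique hp (ε := -1) (Or.inr rfl) hk'.1 he'.1 (by omega) (by omega)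
        (hk'.2.2.1.symm.trans he'.2.2.1))
  · have h3 : ∑ h ∈ F, max (-(A.dir h).2) 0 = 0 :=
      Finset.sum_eq_zero fun k hk => by
        have : ¬ (A.dir k).2 < 0 := fun e => hex ⟨k, hk, e⟩
        omega
    refine ⟨by omega, fun h hv hc => ?_⟩
    have h4 : (A.dir h).2 ≤ ∑ h with A.SameFloor v (A.root h) ∧ A.Crosses y h, (A.dir h).2 :=
      Finset.single_le_sum (f := fun h => (A.dir h).2)
        (fun k hk => (Finset.mem_filter.1 hk).2.2.1.le) (by simpa using ⟨hv, hc⟩)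
    have := hc.1
    omega

/-- Each crossing flag carries at least one unit of a flux that is at most one. This makes the floor
a path. -/
theorem crosses_unique {y : ℝ} {h h' : A.H} (hs : A.SameFloor (A.root h) (A.root h'))
    (hh : A.Crosses y h) (hh' : A.Crosses y h') : h = h' := by
  by_contra hne
  have h1 := (hA.sum_crosses_le hp (A.root h) y).1
  have h2 : ∑ k ∈ {h, h'}, (A.dir k).2 ≤
      ∑ h_1 with A.SameFloor (A.root h) (A.root h_1) ∧ A.Crosses y h_1, (A.dir h_1).2 := by
    refine Finset.sum_le_sum_of_subset_of_nonneg ?_ fun k hk _ => (Finset.mem_filter.1 hk).2.2.1.le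
    intro k hk
    rcases Finset.mem_insert.1 hk with rfl | hk
    · simpa using ⟨sameFloor_refl _, hh⟩
    · rw [Finset.mem_singleton.1 hk]
      simpa using ⟨hs, hh'⟩
  rw [Finset.sum_pair hne] at h2
  have := hh.1
  have := hh'.1
  omega

theorem snd_eq_one {h : A.H} (hd : 0 < (A.dir h).2) : (A.dir h).2 = 1 := by
  have h1 := (hA.sum_crosses_le hp (A.root h) (A.pos (A.root h)).2).1
  have h2 := Finset.single_le_sum (f := fun h => (A.dir h).2)
    (s := Finset.univ.filter fun k => A.SameFloor (A.root h) (A.root k) ∧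
      A.Crosses (A.pos (A.root h)).2 k)
    (fun k hk => (Finset.mem_filter.1 hk).2.2.1.le) (a := h)
    (by simpa using ⟨sameFloor_refl _, crosses_of_pos hd⟩)
  omega

theorem up_unique {h h' : A.H} (hd : 0 < (A.dir h).2) (hd' : 0 < (A.dir h').2)
    (hs : A.SameFloor (A.root h) (A.root h'))
    (hy : (A.pos (A.root h)).2 = (A.pos (A.root h')).2) : h = h' :=
  hA.crosses_unique hp hs (crosses_of_pos hd) (hy ▸ crosses_of_pos hd')

theorem eq_of_height_eq {v w : A.V} (hv : A.IsFloorVertex v) (hs : A.SameFloor v w)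
    (hy : (A.pos v).2 = (A.pos w).2) : v = w := by
  obtain ⟨h, rfl, hd⟩ := A.exists_dir_pos 1 one_ne_zero hv
  obtain ⟨h', rfl, hd'⟩ := A.exists_dir_pos 1 one_ne_zero (hA.isFloorVertex_of_sameFloor hp hs hv)
  rw [one_mul] at hd hd'
  rw [hA.up_unique hp hd hd' hs hy]

/-- The up flag of a vertex ends at the next vertex of the floor. -/
theorem not_between {h : A.H} (hd : 0 < (A.dir h).2) {w : A.V} (hs : A.SameFloor (A.root h) w)
    (hw : (A.pos (A.root h)).2 < (A.pos w).2) :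
    A.opp h ≠ h ∧ (A.pos (A.root (A.opp h))).2 ≤ (A.pos w).2 := by
  by_contra hcon
  obtain ⟨h', rfl, hd'⟩ := A.exists_dir_pos 1 one_ne_zero
    (hA.isFloorVertex_of_sameFloor hp hs ⟨h, rfl, hd.ne'⟩)
  rw [one_mul] at hd'
  have hc : A.Crosses (A.pos (A.root h')).2 h := by
    refine ⟨hd, hw.le, ?_⟩
    by_cases e : A.opp h = h
    · exact Or.inl e
    · exact Or.inr (not_le.1 fun h1 => hcon ⟨e, h1⟩)
  rw [hA.crosses_unique hp hs hc (crosses_of_pos hd')] at hw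
  exact lt_irrefl _ hw

/-- Two bounded flags going down are, seen from their lower vertices, two upward flags crossing a
level just below the common vertex. If one flag is an end and the other is bounded, the upward flux
at the lower vertex of the latter forces the down end of the floor to start strictly below the
common vertex, where it does start. -/
theorem down_unique {h h' : A.H} (hd : (A.dir h).2 < 0) (hd' : (A.dir h').2 < 0)
    (hr : A.root h = A.root h') : h = h' := by
  have bounded : ∀ k, (A.dir k).2 < 0 → A.opp k ≠ k → 0 < (A.dir (A.opp k)).2 ∧
      (A.pos (A.root (A.opp k))).2 < (A.pos (A.root k)).2 := by
    intro k hk e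
    have := A.height_lt (ε := -1) e (by omega)
    push_cast at this
    rw [A.dir_opp k e, Prod.snd_neg]
    exact ⟨by omega, by linarith⟩
  have mixed : ∀ k k', (A.dir k).2 < 0 → (A.dir k').2 < 0 → A.root k = A.root k' → A.opp k = k →
      A.opp k' = k' := by
    intro k k' hk hk' hr e
    by_contra e'
    obtain ⟨h1, h2⟩ := bounded k' hk' e'
    obtain ⟨f, hf, hfd, hfs, hfy⟩ := (hA.sum_crosses_le hp (A.root (A.opp k'))
      (A.pos (A.root (A.opp k'))).2).2 _ (sameFloor_refl _) (crosses_of_pos h1)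
    have : f = k := hA.floor_end_unique hp (ε := -1) (Or.inr rfl) hf ⟨e, hk.ne⟩ (by omega)
      (by omega) (hfs.symm.trans ((sameFloor_opp hk'.ne).symm.trans (hr ▸ sameFloor_refl _)))
    rw [this, hr] at hfy
    linarith
  by_cases e : A.opp h = h
  · have e' := mixed h h' hd hd' hr e
    exact hA.floor_end_unique hp (ε := -1) (Or.inr rfl) ⟨e, hd.ne⟩ ⟨e', hd'.ne⟩ (by omega)
      (by omega) (hr ▸ sameFloor_refl _)
  · have e' : A.opp h' ≠ h' := fun e' => e (mixed h' h hd' hd hr.symm e')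
    obtain ⟨h1, h2⟩ := bounded h hd e
    obtain ⟨h3, h4⟩ := bounded h' hd' e'
    have hs : A.SameFloor (A.root (A.opp h)) (A.root (A.opp h')) :=
      (sameFloor_opp hd.ne).symm.trans (hr ▸ sameFloor_opp hd'.ne)
    -- The higher of the two lower vertices gives a level that is still below the common vertex.
    have := hA.crosses_unique hp
      (y := max (A.pos (A.root (A.opp h))).2 (A.pos (A.root (A.opp h'))).2) hs
      ⟨h1, le_max_left _ _, Or.inr (by rw [A.opp_opp]; exact max_lt h2 (hr ▸ h4))⟩
      ⟨h3, le_max_right _ _, Or.inr (by rw [A.opp_opp]; exact max_lt (hr ▸ h2) h4)⟩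
    rw [← A.opp_opp h, this, A.opp_opp]

/-- There are one flag up of speed one and one flag down; balancing leaves vertical speed `0` for
the third flag, which belongs to a horizontal edge or is the contracted end. -/
theorem floor_flags {v : A.V} (hv : A.IsFloorVertex v) : ∃ u d k, A.root u = v ∧ A.root d = v ∧
    A.root k = v ∧ (A.dir u).2 = 1 ∧ (A.dir d).2 = -1 ∧ (A.dir k).2 = 0 ∧
    (A.dir u).1 + (A.dir d).1 + (A.dir k).1 = 0 ∧
    ∀ h, A.root h = v → h = u ∨ h = d ∨ h = k := by
  obtain ⟨u, rfl, hu⟩ := A.exists_dir_pos 1 one_ne_zero hv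
  obtain ⟨d, hdr, hd⟩ := A.exists_dir_pos (-1) (by norm_num) hv
  obtain ⟨b, c, hb, hc, hbc, rb, rc, hall, -, hsum⟩ := hA.simple.star u
  have h1 := hA.snd_eq_one hp (h := u) (by omega)
  have key : ∀ b c, b ≠ u → c ≠ u → b ≠ c → A.root b = A.root u → A.root c = A.root u →
      A.dir u + A.dir b + A.dir c = 0 → d = b →
      (A.dir b).2 = -1 ∧ (A.dir c).2 = 0 ∧ (A.dir u).1 + (A.dir b).1 + (A.dir c).1 = 0 := by
    rintro b c hb hc hbc rb rc hsum rfl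
    have h2 := congrArg Prod.snd hsum
    have h3 := congrArg Prod.fst hsum
    simp only [Prod.snd_add, Prod.snd_zero, Prod.fst_add, Prod.fst_zero] at h2 h3
    have h4 : ¬ 0 < (A.dir c).2 := fun h4 =>
      hc (hA.up_unique hp h4 (by omega) (rc ▸ sameFloor_refl _) (by rw [rc]))
    have h5 : ¬ (A.dir c).2 < 0 := fun h5 =>
      hbc (hA.down_unique hp (by omega) h5 (rb.trans rc.symm))
    exact ⟨by omega, by omega, h3⟩
  rcases hall d hdr with e | e | e
  · rw [e] at hd
    omega
  · obtain ⟨k1, k2, k3⟩ := key b c hb hc hbc rb rc hsum e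
    exact ⟨u, b, c, rfl, rb, rc, h1, k1, k2, k3, hall⟩
  · obtain ⟨k1, k2, k3⟩ := key c b hc hb hbc.symm rc rb (by rw [← hsum]; abel) e
    exact ⟨u, c, b, rfl, rc, rb, h1, k1, k2, k3, fun h hh => by
      rcases hall h hh with r | r | r <;> simp [r]⟩

theorem level_unique {h h' : A.H} (hd : (A.dir h).2 = 0) (hd' : (A.dir h').2 = 0)
    (hr : A.root h = A.root h') (hv : A.IsFloorVertex (A.root h)) : h = h' := by
  obtain ⟨u, d, k, -, -, -, hu, hdn, hk, -, hall⟩ := hA.floor_flags hp hv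
  rcases hall h rfl with rfl | rfl | rfl <;> rcases hall h' hr.symm with rfl | rfl | rfl <;>
    first | rfl | omega

/-- The cut component of such an edge has a single vertical end, and it lies on both floors. So the
floors coincide; vertices of equal height on a floor coincide, and they have only one level flag,
which cannot be opposite to itself. -/
theorem not_both_floor {h h' : A.H} (hl : A.Linked h h') (hv : A.IsFloorVertex (A.root h)) :
    ¬ A.IsFloorVertex (A.root h') := by
  intro hv'
  have hne : ∀ {k}, A.IsHorizontal k → ∀ i, A.mark i ≠ k := fun hk =>
    ne_mark fun e => hk.2 (by rw [e]; rfl)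
  obtain ⟨e, he, hes, hec⟩ := hA.exists_end_cls_eq hp (hne hl.isHorizontal) hv
  obtain ⟨e', he', hes', hec'⟩ := hA.exists_end_cls_eq hp (hne hl.symm.isHorizontal) hv'
  have h1 : e = e' := hA.cls_injective hp he he' (by rw [← hec, ← hec', hA.cls_linked hp hl])
  have h2 := hA.eq_of_height_eq hp hv (hes.trans (h1 ▸ hes'.symm)) hl.height_eq.symm
  have h3 := hA.level_unique hp hl.isHorizontal.1 hl.symm.isHorizontal.1 h2 hv
  have h4 := congrArg Prod.fst hl.dir_eq
  have := hl.isHorizontal.2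
  rw [← h3, Prod.fst_neg] at h4
  omega

/-- Off the floors, a horizontal edge that returns to its vertex is, together with its lines, closed
in the glued graph. It would be the whole curve, leaving no room for vertical ends. -/
theorem no_horizontal_loop {r l : A.H} (hr : A.IsRight r) (he : A.Elevator r l)
    (hroot : A.root l = A.root r) (hv : ¬ A.IsFloorVertex (A.root r)) : False := by
  have hdir := (elevator_right hr he).1
  have hrl : r ≠ l := by
    intro e
    have h1 := congrArg Prod.fst hdir
    rw [← e, Prod.fst_neg] at h1
    have := hr.2
    omega
  have hmark : ∀ k, A.root k = A.root r → A.dir k ≠ 0 → k = r ∨ k = l := by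
    intro k hk hk0
    by_cases hm : A.IsMarked (A.root r)
    · obtain ⟨i, hi⟩ := hm
      obtain ⟨a, b, hab, ha, hb, ra, rb, hall, -, -⟩ := hA.mark_flags hp i
      have ne : ∀ k, A.dir k ≠ 0 → k ≠ A.mark i := fun k hk e => ne_mark hk i e.symm
      have r0 : A.dir r ≠ 0 := fun e => hr.2.ne' (by rw [e]; rfl)
      have l0 : A.dir l ≠ 0 := by rw [hdir, neg_ne_zero]; exact r0
      have h1 := (hall k (hk.trans hi.symm)).resolve_left (ne _ hk0)
      have h2 := (hall r hi.symm).resolve_left (ne _ r0)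
      have h3 := (hall l (hroot.trans hi.symm)).resolve_left (ne _ l0)
      rcases h1 with h1 | h1 <;> rcases h2 with h2 | h2 <;> rcases h3 with h3 | h3 <;>
        first
        | exact Or.inl (h1.trans h2.symm)
        | exact Or.inr (h1.trans h3.symm)
        | exact absurd (h2.trans h3.symm) hrl
    · exact absurd (hA.isFloorVertex_of_unmarked hp hm) hv
  let S : A.V ⊕ A.Ln → Prop := Sum.elim (fun v => v = A.root r)
    fun x => Relation.TransGen A.Glued (Sum.inl r) (Sum.inr x)
  have elev : ∀ a, Relation.ReflTransGen A.Glued (Sum.inl r) a → a ∈ A.rightEnds →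
      S (A.endNode a) := by
    intro a ha hmem
    rcases Relation.reflTransGen_iff_eq_or_transGen.1 ha with rfl | ha
    · exact rfl
    · rcases a with x | x
      · exact absurd ⟨(transGen_glued_eq ha).2.1, hmem⟩ inl_mem_left_or_right
      · exact ha
  have elev' : ∀ b, Relation.TransGen A.Glued (Sum.inl r) b → S (A.endNode b) := by
    intro b hb
    rcases b with x | x
    · have := elevator_unique_right he (Or.inr hb)
      subst this
      exact hroot
    · exact hb
  have hS : ∀ a b, A.gluedAdj a b → (S a ↔ S b) := by
    rintro a b (⟨k, hk, rfl, rfl⟩ | ⟨e, rfl, rfl⟩)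
    · have main : ∀ k, A.opp k ≠ k → A.root k = A.root r → A.root (A.opp k) = A.root r := by
        intro k hk hkr
        have hk0 := hA.dir_ne_zero hp (h := k) fun i hi => hk (hi ▸ A.mark_end i)
        rcases hmark k hkr hk0 with rfl | rfl
        · rw [elevator_unique_right (Or.inl ⟨hk, rfl⟩) he, hroot]
        · rw [elevator_unique_left (h₁ := A.opp k) (Or.inl ⟨A.opp_opp_ne hk, (A.opp_opp k).symm⟩) he]
      refine ⟨main k hk, fun h => ?_⟩
      have := main (A.opp k) (A.opp_opp_ne hk) h
      rwa [A.opp_opp] at this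
    · have hgl : A.Glued e.1 (A.glue e).1 := ⟨e, rfl, rfl⟩
      constructor
      · intro ha
        refine elev' _ ?_
        rcases hx : e.1 with x | x
        · have hmem := e.2
          rw [hx] at ha hmem
          have h0 : A.dir x ≠ 0 := fun e => hmem.2.1.ne' (by rw [e]; rfl)
          rcases hmark x ha h0 with rfl | rfl
          · rw [← hx]
            exact .single hgl
          · have h1 := congrArg Prod.fst hdir
            have h2 := hmem.2.1
            have h3 := hr.2
            rw [Prod.fst_neg] at h1
            omega
        · rw [hx] at ha hgl
          exact ha.tail hgl
      · intro hb
        suffices h : Relation.TransGen A.Glued (Sum.inl r) (A.glue e).1 by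
          obtain ⟨z, hz, hz'⟩ := Relation.TransGen.tail'_iff.1 h
          obtain rfl := hz'.left_unique hgl
          exact elev _ hz e.2
        rcases hx : (A.glue e).1 with x | x
        · have hmem := (A.glue e).2
          rw [hx] at hb hmem
          have h0 : A.dir x ≠ 0 := fun e => hmem.2.1.ne (by rw [e]; rfl)
          rcases hmark x hb h0 with rfl | rfl
          · exact absurd hr.2 (not_lt.2 hmem.2.1.le)
          · rcases he with ⟨h1, h2⟩ | he
            · exact absurd (h2 ▸ hmem.1) (by rw [A.opp_opp]; exact h1.symm)
            · exact he
        · rw [hx] at hb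
          exact hb
  obtain ⟨e, he⟩ := hA.exists_verticalEnd hp
  have : S (Sum.inl (A.root e)) := hA.connected.closed hS (Sum.inl (A.root r)) _ rfl
  exact hv ⟨e, this, he.2⟩

/-- Every horizontal edge of the glued graph joins a floor and a marked point. -/
theorem linked_floor_iff {h h' : A.H} (hl : A.Linked h h') :
    A.IsFloorVertex (A.root h) ↔ ¬ A.IsFloorVertex (A.root h') := by
  refine ⟨hA.not_both_floor hp hl, fun hv' => ?_⟩
  by_contra hv
  -- Off the floors both vertices are marked; they have the same height, so they are the same marked
  -- vertex and the edge is a loop.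
  obtain ⟨i, hi⟩ : A.IsMarked (A.root h) := by
    by_contra hm
    exact hv (hA.isFloorVertex_of_unmarked hp hm)
  obtain ⟨j, hj⟩ : A.IsMarked (A.root h') := by
    by_contra hm
    exact hv' (hA.isFloorVertex_of_unmarked hp hm)
  have h1 := hl.height_eq
  rw [← hi, ← hj, hA.pos_mark, hA.pos_mark] at h1
  obtain rfl := hp.snd_injective h1
  have hr := hi.symm.trans hj
  rcases hl with ⟨h2, h3⟩ | ⟨h2, h3⟩
  · exact hA.no_horizontal_loop hp h2 h3 hr.symm hv
  · exact hA.no_horizontal_loop hp h2 h3 hr hv'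

end IsCounted

end CutMap

end TropEP

end

/-! ### Positions on horizontal edges, the degree, and isomorphisms -/

section

open scoped Classical

namespace TropEP

variable {n : ℕ}

namespace CutMap

variable (A : CutMap n)

/-- The `k`-th end on the horizontal edge that starts with the flag `h`. -/
noncomputable def follow (h : A.H) (k : ℕ) : A.H ⊕ A.Ln := (advance A.glue)^[k] (Sum.inl h)

variable {A}

theorem follow_zero (h : A.H) : A.follow h 0 = Sum.inl h := rfl

theorem follow_succ (h : A.H) (k : ℕ) : A.follow h (k + 1) = advance A.glue (A.follow h k) :=
  Function.iterate_succ_apply' _ _ _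

theorem follow_mem {h : A.H} {k : ℕ} (hk : k < A.crossings h) : A.follow h k ∈ A.rightEnds :=
  iterate_mem_rightEnds hk

/-- The gluing can be undone step by step, and a flag pointing to the right is no left end, so
backward chains stop exactly at their start. -/
theorem follow_injective {h h' : A.H} (hh : A.IsRight h) (hh' : A.IsRight h') {k k' : ℕ}
    (hk : k ≤ A.crossings h) (hk' : k' ≤ A.crossings h') (he : A.follow h k = A.follow h' k') :
    h = h' ∧ k = k' := by
  have key : ∀ {h h' : A.H} (_ : A.IsRight h) {k : ℕ}, k + 1 ≤ A.crossings h' →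
      A.follow h 0 ≠ A.follow h' (k + 1) := by
    intro h h' hh k hk he
    rw [follow_succ, follow_zero] at he
    exact hh.notMem_leftEnds (he ▸ advance_mem A.glue (follow_mem hk))
  induction k generalizing k' with
  | zero =>
    rcases k' with _ | k'
    · exact ⟨Sum.inl_injective he, rfl⟩
    · exact absurd he (key hh hk')
  | succ k ih =>
    rcases k' with _ | k'
    · exact absurd he.symm (key hh' hk)
    · rw [follow_succ, follow_succ] at he
      have := congrArg (advance A.glue.symm) he
      rw [advance_symm _ (follow_mem hk), advance_symm _ (follow_mem hk')] at this
      obtain ⟨h1, h2⟩ := ih (by omega) (by omega) this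
      exact ⟨h1, by rw [h2]⟩

theorem exists_follow_eq (hc : A.IsConnected) [Nonempty A.V] (e : A.rightEnds) :
    ∃ h k, A.IsRight h ∧ k < A.crossings h ∧ A.follow h k = e := by
  obtain ⟨h | l, he⟩ := e
  · have hr : A.IsRight h := ⟨he.2.2, he.2.1⟩
    refine ⟨h, 0, hr, Nat.pos_of_ne_zero fun e => hr.crossings_eq_zero_iff.1 e he.1, rfl⟩
  · obtain ⟨h, k, hr, -, hk, h1⟩ := exists_iterate_eq_inr hc l
    exact ⟨h, k + 1, hr, hk, h1⟩

/-- An intermediate position is both a left and a right end, and only lines are both. -/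
theorem follow_line {h : A.H} {k : ℕ} (hk : k + 1 < A.crossings h) :
    ∃ l, A.follow h (k + 1) = Sum.inr l := by
  have h1 : A.follow h (k + 1) ∈ A.leftEnds := by
    rw [follow_succ]
    exact advance_mem A.glue (follow_mem (by omega))
  have h2 := follow_mem hk
  rcases hx : A.follow h (k + 1) with h' | l
  · rw [hx] at h1 h2
    exact absurd ⟨h1, h2⟩ A.inl_mem_left_or_right
  · exact ⟨l, rfl⟩

theorem follow_crossings {h h' : A.H} (hh : A.IsRight h) (h0 : A.crossings h ≠ 0)
    (he : A.Elevator h h') : A.follow h (A.crossings h) = Sum.inl h' := by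
  obtain ⟨h'', h1⟩ := exists_inl_of_notMem_right hh.crossings_spec
  have h2 : A.opp h = h := by
    by_contra e
    exact h0 (hh.crossings_eq_zero_iff.2 e)
  rw [follow, h1, elevator_unique_right (Or.inr (hh.transGen h1 h2)) he]

theorem endWeight_follow {h : A.H} {k : ℕ} (hk : k ≤ A.crossings h) :
    A.endWeight (A.follow h k) = (A.dir h).1.natAbs := by
  induction k with
  | zero => rfl
  | succ k ih =>
    rw [← ih (by omega), follow_succ, advance_of_mem _ (follow_mem (by omega))]
    exact A.glue_weight _

theorem endHeight_follow {h : A.H} {k : ℕ} (hk : k ≤ A.crossings h) :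
    A.endHeight (A.follow h k) = (A.pos (A.root h)).2 := by
  induction k with
  | zero => rfl
  | succ k ih =>
    rw [← ih (by omega), follow_succ, advance_of_mem _ (follow_mem (by omega))]
    exact A.glue_height _

/-- Every right end occurs exactly once as the start of a crossing of a horizontal edge, and the
expansion factor is constant along the edge. -/
theorem degree_eq_sum_crossings (hc : A.IsConnected) [Nonempty A.V] :
    A.degree = ∑ h : {h // A.IsRight h}, (A.dir h.1).1.natAbs * A.crossings h.1 := by
  let f : (Σ h : {h // A.IsRight h}, Fin (A.crossings h.1)) → A.rightEnds :=
    fun s => ⟨A.follow s.1.1 s.2, follow_mem s.2.2⟩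
  have hf : Function.Bijective f := by
    constructor
    · rintro ⟨⟨h, hh⟩, k⟩ ⟨⟨h', hh'⟩, k'⟩ he
      obtain ⟨h1, h2⟩ := follow_injective hh hh' k.2.le k'.2.le (congrArg Subtype.val he)
      subst h1
      simpa using Fin.ext h2
    · intro e
      obtain ⟨h, k, hr, hk, he⟩ := exists_follow_eq hc e
      exact ⟨⟨⟨h, hr⟩, ⟨k, hk⟩⟩, Subtype.ext he⟩
  rw [degree_eq, ← hf.sum_comp, Fintype.sum_sigma]
  refine Finset.sum_congr rfl fun h _ => ?_
  rw [Finset.sum_congr rfl fun k _ => endWeight_follow k.2.le]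
  simp [mul_comm]

/-- Connectedness with the lines eliminated: the property is extended to a line by its value at the
start of the horizontal edge containing it. -/
theorem IsConnected.closed_of_linked (hc : A.IsConnected) {S : A.V → Prop}
    (hopp : ∀ h, A.opp h ≠ h → S (A.root h) → S (A.root (A.opp h)))
    (hlink : ∀ h h', A.Linked h h' → S (A.root h) → S (A.root h')) (a b : A.V) (ha : S a) : S b := by
  let T : A.V ⊕ A.Ln → Prop := Sum.elim S fun l => ∃ h, A.IsRight h ∧
    Relation.TransGen A.Glued (Sum.inl h) (Sum.inr l) ∧ S (A.root h)
  have start : ∀ {h z w}, Relation.TransGen A.Glued (Sum.inl h) w → A.Glued z w → S (A.root h) →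
      T (A.endNode z) := by
    intro h z w hw hz hS
    obtain ⟨z', h1, h2⟩ := Relation.TransGen.tail'_iff.1 hw
    obtain rfl := h2.left_unique hz
    rcases Relation.reflTransGen_iff_eq_or_transGen.1 h1 with rfl | h1
    · exact hS
    · rcases z' with x | x
      · exact absurd ⟨(transGen_glued_eq h1).2.1, h2.mem_right⟩ inl_mem_left_or_right
      · have := (transGen_glued_eq h1).1
        exact ⟨h, ⟨this.2.2, this.2.1⟩, h1, hS⟩
  have reach : ∀ {h w}, A.IsRight h → Relation.TransGen A.Glued (Sum.inl h) w → S (A.root h) →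
      T (A.endNode w) := by
    intro h w hr hw hS
    rcases w with x | x
    · exact hlink h x (Or.inl ⟨hr, Or.inr hw⟩) hS
    · exact ⟨h, hr, hw, hS⟩
  refine hc.closed (S := T) ?_ (Sum.inl a) (Sum.inl b) ha
  rintro a b (⟨h, hh, rfl, rfl⟩ | ⟨e, rfl, rfl⟩)
  · refine ⟨hopp h hh, fun h1 => ?_⟩
    have := hopp _ (A.opp_opp_ne hh) h1
    rwa [A.opp_opp] at this
  · have hgl : A.Glued e.1 (A.glue e).1 := ⟨e, rfl, rfl⟩
    constructor
    · intro h1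
      rcases hx : e.1 with x | x
      · have hmem := e.2
        rw [hx] at h1 hgl hmem
        exact reach ⟨hmem.2.2, hmem.2.1⟩ (.single hgl) h1
      · rw [hx] at h1 hgl
        obtain ⟨h, hr, h2, h3⟩ := h1
        exact reach hr (h2.tail hgl) h3
    · intro h1
      rcases hx : (A.glue e).1 with x | x
      · have hmem := (A.glue e).2
        rw [hx] at h1 hgl hmem
        have hhor : A.IsHorizontal x := ⟨hmem.2.2, hmem.2.1.ne⟩
        obtain ⟨h, hl⟩ := exists_linked hhor
        have hS := hlink x h hl h1
        rcases hl with ⟨h2, -⟩ | ⟨h2, h3 | h3⟩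
        · exact absurd h2.2 (not_lt.2 hmem.2.1.le)
        · exact absurd hmem.1 (by rw [h3.2, A.opp_opp]; exact h3.1.symm)
        · exact start h3 hgl hS
      · rw [hx] at h1 hgl
        obtain ⟨h, hr, h2, h3⟩ := h1
        exact start h2 hgl h3

theorem len_eq_of_pos_eq {A B : PlaneMap n} {h : A.H} {k : B.H} (hd : B.dir k = A.dir h)
    (h0 : A.opp h ≠ h → A.dir h ≠ 0) (hk : B.opp k = k ↔ A.opp h = h)
    (h1 : B.pos (B.root k) = A.pos (A.root h))
    (h2 : B.pos (B.root (B.opp k)) = A.pos (A.root (A.opp h))) : B.len k = A.len h := by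
  by_cases e : A.opp h = h
  · rw [(A.len_eq_top h).2 e, (B.len_eq_top k).2 (hk.2 e)]
  · have e' : B.opp k ≠ k := fun e' => e (hk.1 e')
    refine (ENNReal.toReal_eq_toReal_iff' (fun t => e' ((B.len_eq_top k).1 t))
      (fun t => e ((A.len_eq_top h).1 t))).1 ?_
    have f1 := A.pos_opp_fst h e
    have f2 := B.pos_opp_fst k e'
    have s1 := A.pos_opp_snd h e
    have s2 := B.pos_opp_snd k e'
    rw [h1, h2, hd] at f2 s2
    by_cases h3 : (A.dir h).1 = 0
    · have h4 : (A.dir h).2 ≠ 0 := fun h4 => h0 e (Prod.ext h3 h4)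
      exact mul_right_cancel₀ (b := ((A.dir h).2 : ℝ)) (by exact_mod_cast h4) (by linarith)
    · exact mul_right_cancel₀ (b := ((A.dir h).1 : ℝ)) (by exact_mod_cast h3) (by linarith)

/-- An isomorphism is determined on the lines by its values on vertices and flags. -/
theorem nonempty_iso {A B : CutMap n} (hA : A.IsConnected) (hB : B.IsConnected) [Nonempty A.V]
    [Nonempty B.V] (onV : A.V ≃ B.V) (onH : A.H ≃ B.H) (hroot : ∀ h, B.root (onH h) = onV (A.root h))
    (hopp : ∀ h, B.opp (onH h) = onH (A.opp h)) (hdir : ∀ h, B.dir (onH h) = A.dir h)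
    (hpos : ∀ v, B.pos (onV v) = A.pos v) (hmark : ∀ i, B.mark i = onH (A.mark i))
    (h0 : ∀ h, A.opp h ≠ h → A.dir h ≠ 0)
    (helev : ∀ h h', A.IsRight h → A.Elevator h h' → B.Elevator (onH h) (onH h'))
    (hcr : ∀ h, A.IsRight h → B.crossings (onH h) = A.crossings h) : Nonempty (A.Iso B) := by
  have hright : ∀ h, A.IsRight h → B.IsRight (onH h) := fun h hh => by
    rw [IsRight, hdir]
    exact hh
  -- A line is a certain position on a horizontal edge; its image is the line at the same position
  -- on the image of the edge.
  have hex : ∀ l : A.Ln, ∃ m : B.Ln, ∃ h k, A.IsRight h ∧ k + 1 < A.crossings h ∧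
      A.follow h (k + 1) = Sum.inr l ∧ B.follow (onH h) (k + 1) = Sum.inr m := by
    intro l
    obtain ⟨h, k, hr, -, hk, h1⟩ := exists_iterate_eq_inr hA l
    obtain ⟨m, hm⟩ := follow_line (A := B) (h := onH h) (k := k) (by rw [hcr h hr]; exact hk)
    exact ⟨m, h, k, hr, hk, h1, hm⟩
  choose f hf using hex
  have hline : ∀ h k l, A.IsRight h → k + 1 < A.crossings h → A.follow h (k + 1) = Sum.inr l →
      B.follow (onH h) (k + 1) = Sum.inr (f l) := by
    intro h k l hr hk hl
    obtain ⟨h', k', hr', hk', h1, h2⟩ := hf l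
    obtain ⟨e1, e2⟩ := follow_injective hr hr' hk.le hk'.le (hl.trans h1.symm)
    rw [e1, e2, h2]
  have hbij : Function.Bijective f := by
    constructor
    · intro l l' he
      obtain ⟨h, k, hr, hk, h1, h2⟩ := hf l
      obtain ⟨h', k', hr', hk', h1', h2'⟩ := hf l'
      rw [← he] at h2'
      obtain ⟨e1, e2⟩ := follow_injective (hright h hr) (hright h' hr') (by rw [hcr h hr]; exact hk.le)
        (by rw [hcr h' hr']; exact hk'.le) (h2.trans h2'.symm)
      rw [onH.injective e1, e2, h1'] at h1
      exact (Sum.inr_injective h1).symm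
    · intro m
      obtain ⟨h, k, hr, -, hk, h1⟩ := exists_iterate_eq_inr hB m
      obtain ⟨h, rfl⟩ := onH.surjective h
      have hr' : A.IsRight h := by
        rw [IsRight, hdir] at hr
        exact hr
      rw [hcr h hr'] at hk
      obtain ⟨l, hl⟩ := follow_line hk
      have := hline h k l hr' hk hl
      exact ⟨l, Sum.inr_injective (this.symm.trans h1)⟩
  have hfollow : ∀ h k, A.IsRight h → k ≤ A.crossings h →
      B.follow (onH h) k = Sum.map onH f (A.follow h k) := by
    intro h k hr hk
    rcases k with _ | k
    · rfl
    · rcases hk.lt_or_eq with hk | hk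
      · obtain ⟨l, hl⟩ := follow_line hk
        rw [hline h k l hr hk hl, hl]
        rfl
      · obtain ⟨h', he⟩ := exists_elevator hr
        rw [hk, follow_crossings hr (by omega) he, ← hcr h hr,
          follow_crossings (hright h hr) (by rw [hcr h hr]; omega) (helev h h' hr he)]
        rfl
  have hoppiff : ∀ h, B.opp (onH h) = onH h ↔ A.opp h = h := fun h => by
    rw [hopp, onH.injective.eq_iff]
  have hln : ∀ l, B.lineWeight (f l) = A.lineWeight l ∧ B.lineHeight (f l) = A.lineHeight l := by
    intro l
    obtain ⟨h, k, hr, hk, h1, h2⟩ := hf l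
    have hk' : k + 1 ≤ B.crossings (onH h) := by rw [hcr h hr]; exact hk.le
    have w1 := endWeight_follow hk.le
    have w2 := endWeight_follow hk'
    have t1 := endHeight_follow hk.le
    have t2 := endHeight_follow hk'
    rw [h1] at w1 t1
    rw [h2, hdir] at w2
    rw [h2, hroot, hpos] at t2
    exact ⟨w2.trans w1.symm, t2.trans t1.symm⟩
  refine ⟨{
    onV := onV
    onH := onH
    onLn := Equiv.ofBijective f hbij
    root_eq := hroot
    opp_eq := hopp
    len_eq := fun h => ?_
    dir_eq := hdir
    pos_eq := hpos
    mark_eq := hmark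
    lineWeight_eq := fun l => (hln l).1
    lineHeight_eq := fun l => (hln l).2
    glue_eq := fun e e' he => ?_ }⟩
  · exact len_eq_of_pos_eq (hdir h) (h0 h) (hoppiff h) (by rw [hroot, hpos])
      (by rw [hopp, hroot, hpos])
  · obtain ⟨h, k, hr, hk, h1⟩ := exists_follow_eq hA e
    have h2 := hfollow h k hr hk.le
    have h3 := hfollow h (k + 1) hr hk
    have h4 : B.follow (onH h) k = e' := by
      rw [h2, h1]
      exact he.symm
    rw [follow_succ, follow_succ, h1, h4, advance_of_mem _ e.2, advance_of_mem _ e'.2] at h3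
    exact h3

end CutMap

end TropEP

end

/-! ### Weights of the horizontal edges and slopes of the floors -/

section

open scoped Classical

namespace TropEP

variable {n : ℕ} {Δ : Multiset ℤ} {d₁ g : ℕ} {p : Fin n → ℝ × ℝ}

namespace CutMap

variable (A : CutMap n)

/-- The flag `h` starts a horizontal edge from the floor or marked point `i` to the floor or marked
point `j`. -/
def Connects (i j : Fin n) (h : A.H) : Prop :=
  ∃ h', A.Linked h h' ∧ A.SameFloor (A.root h) (A.root (A.mark i)) ∧
    A.SameFloor (A.root h') (A.root (A.mark j))

/-- For counted maps the sum has at most one term by `connects_unique`; it vanishes if there is no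
edge. -/
noncomputable def edgeWeight (i j : Fin n) : ℤ := ∑ h with A.Connects i j h, (A.dir h).1

/-- Only flags to the right count, so for an edge between `i` and `j` exactly one of the values for
`(i, j)` and `(j, i)` carries its number of crossings; their sum is symmetric. -/
noncomputable def rightWind (i j : Fin n) : ℕ :=
  ∑ h with A.Connects i j h ∧ A.IsRight h, A.crossings h

variable {A}

theorem linked_opp {h : A.H} (hh : A.IsHorizontal h) (he : A.opp h ≠ h) : A.Linked h (A.opp h) := by
  rcases lt_or_gt_of_ne hh.2 with h0 | h0
  · refine Or.inr ⟨⟨?_, ?_⟩, Or.inl ⟨A.opp_opp_ne he, (A.opp_opp h).symm⟩⟩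
    · rw [A.dir_opp h he, Prod.snd_neg, hh.1, neg_zero]
    · rw [A.dir_opp h he, Prod.fst_neg]
      omega
  · exact Or.inl ⟨⟨hh.1, h0⟩, Or.inl ⟨he, rfl⟩⟩

theorem IsRight.isHorizontal {h : A.H} (hh : A.IsRight h) : A.IsHorizontal h := ⟨hh.1, hh.2.ne'⟩

theorem Connects.isHorizontal {i j : Fin n} {h : A.H} (hc : A.Connects i j h) : A.IsHorizontal h :=
  hc.choose_spec.1.isHorizontal

theorem Connects.swap {i j : Fin n} {h : A.H} (hc : A.Connects i j h) :
    ∃ h', A.Linked h h' ∧ A.Connects j i h' := by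
  obtain ⟨h', hl, h1, h2⟩ := hc
  exact ⟨h', hl, h, hl.symm, h2, h1⟩

theorem isRight_or_of_linked {h h' : A.H} (hl : A.Linked h h') :
    (A.IsRight h ∧ ¬ A.IsRight h') ∨ (A.IsRight h' ∧ ¬ A.IsRight h) := by
  have h0 := congrArg Prod.fst hl.dir_eq
  rw [Prod.fst_neg] at h0
  rcases hl with ⟨h1, -⟩ | ⟨h1, -⟩
  · exact Or.inl ⟨h1, fun h2 => by have := h1.2; have := h2.2; omega⟩
  · exact Or.inr ⟨h1, fun h2 => by have := h1.2; have := h2.2; omega⟩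

namespace IsCounted

variable (hp : Admissible Δ d₁ g p) (hA : A.IsCounted Δ d₁ g p)

include hA hp

theorem isFloorVertex_iff {v w : A.V} (h : A.SameFloor v w) :
    A.IsFloorVertex v ↔ A.IsFloorVertex w :=
  ⟨hA.isFloorVertex_of_sameFloor hp h, hA.isFloorVertex_of_sameFloor hp h.symm⟩

theorem eq_of_sameFloor {v w : A.V} (hv : ¬ A.IsFloorVertex v) (h : A.SameFloor v w) : w = v := by
  refine h.induction (P := fun w => w = v) rfl fun k hk hk' _ e => ?_
  exact absurd ⟨k, e, hA.snd_ne_zero hp hk hk'⟩ hv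

theorem mark_unique {v : A.V} {i j : Fin n} (hi : A.SameFloor v (A.root (A.mark i)))
    (hj : A.SameFloor v (A.root (A.mark j))) : i = j :=
  hA.eq_of_sameFloor_mark hp (hi.symm.trans hj)

theorem exists_connects {h : A.H} (hh : A.IsHorizontal h) : ∃ i j, A.Connects i j h := by
  obtain ⟨h', hl⟩ := exists_linked hh
  obtain ⟨i, hi⟩ := hA.exists_sameFloor_mark hp (A.root h)
  obtain ⟨j, hj⟩ := hA.exists_sameFloor_mark hp (A.root h')
  exact ⟨i, j, h', hl, hi, hj⟩

theorem connects_marks_unique {i j i' j' : Fin n} {h : A.H} (hc : A.Connects i j h)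
    (hc' : A.Connects i' j' h) : i = i' ∧ j = j' := by
  obtain ⟨k, hl, h1, h2⟩ := hc
  obtain ⟨k', hl', h1', h2'⟩ := hc'
  obtain rfl := hl.unique hl'
  exact ⟨hA.mark_unique hp h1 h1', hA.mark_unique hp h2 h2'⟩

theorem connects_floor_iff {i j : Fin n} {h : A.H} (hc : A.Connects i j h) :
    A.IsFloorVertex (A.root (A.mark i)) ↔ ¬ A.IsFloorVertex (A.root (A.mark j)) := by
  obtain ⟨k, hl, h1, h2⟩ := hc
  rw [← hA.isFloorVertex_iff hp h1, ← hA.isFloorVertex_iff hp h2]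
  exact hA.linked_floor_iff hp hl

theorem connects_ne {i j : Fin n} {h : A.H} (hc : A.Connects i j h) : i ≠ j := by
  rintro rfl
  have := hA.connects_floor_iff hp hc
  tauto

/-- The height of a horizontal edge is the height of its marked point. -/
theorem connects_height {i j : Fin n} {h : A.H} (hc : A.Connects i j h)
    (hi : A.IsFloorVertex (A.root (A.mark i))) : (A.pos (A.root h)).2 = (p j).2 := by
  have hj := (hA.connects_floor_iff hp hc).1 hi
  obtain ⟨k, hl, h1, h2⟩ := hc
  rw [← hl.height_eq, hA.eq_of_sameFloor hp hj h2.symm, hA.pos_mark]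

/-- The edges from a floor to the marked point `j` attach at the height of `p j`, where the floor
has a single vertex with a single level flag. So the pearl chain has no double edges. -/
theorem connects_unique {i j : Fin n} {h h' : A.H} (hc : A.Connects i j h)
    (hc' : A.Connects i j h') : h = h' := by
  have key : ∀ i j h h', A.Connects i j h → A.Connects i j h' →
      A.IsFloorVertex (A.root (A.mark i)) → h = h' := by
    intro i j h h' hc hc' hi
    have e1 := hA.connects_height hp hc hi
    have e2 := hA.connects_height hp hc' hi
    obtain ⟨k, hl, h1, h2⟩ := id hc
    obtain ⟨k', hl', h1', h2'⟩ := id hc'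
    have hv := (hA.isFloorVertex_iff hp h1).2 hi
    exact hA.level_unique hp hc.isHorizontal.1 hc'.isHorizontal.1
      (hA.eq_of_height_eq hp hv (h1.trans h1'.symm) (e1.trans e2.symm)) hv
  by_cases hi : A.IsFloorVertex (A.root (A.mark i))
  · exact key i j h h' hc hc' hi
  · obtain ⟨k, hl, hk⟩ := hc.swap
    obtain ⟨k', hl', hk'⟩ := hc'.swap
    have hj : A.IsFloorVertex (A.root (A.mark j)) := by
      by_contra hj
      exact hi ((hA.connects_floor_iff hp hc).2 hj)
    obtain rfl := key j i k k' hk hk' hj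
    exact hl.symm.unique hl'.symm

theorem filter_connects {i j : Fin n} {h : A.H} (hc : A.Connects i j h) :
    (Finset.univ.filter fun k => A.Connects i j k) = {h} := by
  ext k
  simp only [Finset.mem_filter, Finset.mem_univ, true_and, Finset.mem_singleton]
  exact ⟨fun hk => hA.connects_unique hp hk hc, fun hk => hk ▸ hc⟩

theorem edgeWeight_eq {i j : Fin n} {h : A.H} (hc : A.Connects i j h) :
    A.edgeWeight i j = (A.dir h).1 := by
  rw [edgeWeight, hA.filter_connects hp hc, Finset.sum_singleton]

theorem edgeWeight_ne_zero {i j : Fin n} : A.edgeWeight i j ≠ 0 ↔ ∃ h, A.Connects i j h := by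
  constructor
  · intro h0
    by_contra! hno
    exact h0 (Finset.sum_eq_zero fun h hh => absurd (Finset.mem_filter.1 hh).2 (hno h))
  · rintro ⟨h, hc⟩
    rw [hA.edgeWeight_eq hp hc]
    exact hc.isHorizontal.2

theorem sum_connects (i : Fin n) (f : A.H → ℤ) : ∑ j, ∑ h with A.Connects i j h, f h =
    ∑ h with A.IsHorizontal h ∧ A.SameFloor (A.root h) (A.root (A.mark i)), f h := by
  simp only [Finset.sum_filter]
  rw [Finset.sum_comm]
  refine Finset.sum_congr rfl fun h _ => ?_
  split_ifs with hh
  · obtain ⟨i', j, hc⟩ := hA.exists_connects hp hh.1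
    obtain rfl := hA.mark_unique hp hh.2 hc.choose_spec.2.1
    rw [Finset.sum_eq_single j (fun j' _ hj => if_neg fun hc' =>
      hj (hA.connects_marks_unique hp hc' hc).2) (fun h => absurd (Finset.mem_univ j) h), if_pos hc]
  · exact Finset.sum_eq_zero fun j _ => if_neg fun hc =>
      hh ⟨hc.isHorizontal, hc.choose_spec.2.1⟩

theorem sum_sum_connects (f : A.H → ℕ) : ∑ i, ∑ j, ∑ h with A.Connects i j h, f h =
    ∑ h with A.IsHorizontal h, f h := by
  rw [← Fintype.sum_prod_type' (fun i j => ∑ h with A.Connects i j h, f h)]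
  simp only [Finset.sum_filter]
  rw [Finset.sum_comm]
  refine Finset.sum_congr rfl fun h _ => ?_
  split_ifs with hh
  · obtain ⟨i, j, hc⟩ := hA.exists_connects hp hh
    rw [Finset.sum_eq_single (i, j) (fun k _ hk => if_neg fun hc' =>
      hk (Prod.ext (hA.connects_marks_unique hp hc' hc).1 (hA.connects_marks_unique hp hc' hc).2))
      (fun h => absurd (Finset.mem_univ (i, j)) h), if_pos hc]
  · exact Finset.sum_eq_zero fun k _ => if_neg fun hc => hh hc.isHorizontal

/-- The slope of the floor `i` is determined by the horizontal edges below. -/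
theorem dir_fst_up {i : Fin n} {u : A.H} (hu : 0 < (A.dir u).2)
    (hs : A.SameFloor (A.root u) (A.root (A.mark i))) : (A.dir u).1 =
      -∑ j, if (p j).2 ≤ (A.pos (A.root u)).2 then A.edgeWeight i j else 0 := by
  have hv : A.IsFloorVertex (A.root u) := ⟨u, rfl, hu.ne'⟩
  have hi := (hA.isFloorVertex_iff hp hs).1 hv
  let y := (A.pos (A.root u)).2
  have e1 : ∀ j, (if (p j).2 ≤ y then A.edgeWeight i j else 0) =
      ∑ h with A.Connects i j h, if (A.pos (A.root h)).2 ≤ y then (A.dir h).1 else 0 := by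
    intro j
    rw [edgeWeight]
    split_ifs with hj
    · refine Finset.sum_congr rfl fun h hh => (if_pos ?_).symm
      rw [hA.connects_height hp (Finset.mem_filter.1 hh).2 hi]
      exact hj
    · refine (Finset.sum_eq_zero fun h hh => if_neg ?_).symm
      rw [hA.connects_height hp (Finset.mem_filter.1 hh).2 hi]
      exact hj
  rw [Finset.sum_congr rfl fun j _ => e1 j, hA.sum_connects hp]
  -- Horizontal flux out of the part of the floor at height at most that of `u`.
  let S : Finset A.V := Finset.univ.filter fun w => A.SameFloor (A.root u) w ∧ (A.pos w).2 ≤ y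
  have hflux := congrArg Prod.fst (A.flux S)
  rw [Prod.fst_sum, Prod.fst_zero, Finset.sum_filter] at hflux
  have hS : ∀ w, w ∈ S ↔ A.SameFloor (A.root u) w ∧ (A.pos w).2 ≤ y := fun w => by simp [S]
  -- The flags leaving this part are `u`, the level flags on it, and possibly the down end, whose
  -- first coordinate is zero. Horizontal edges do leave the floor, since they lead to a marked
  -- point off the floors.
  have key : ∀ h, (if A.root h ∈ S ∧ (A.opp h = h ∨ A.root (A.opp h) ∉ S) then (A.dir h).1 else 0) =
      (if h = u then (A.dir h).1 else 0) +
      (if A.IsHorizontal h ∧ A.SameFloor (A.root h) (A.root (A.mark i)) then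
        (if (A.pos (A.root h)).2 ≤ y then (A.dir h).1 else 0) else 0) := by
    intro h
    have hcu := crosses_of_pos hu
    simp only [hS]
    have hfl : A.SameFloor (A.root u) (A.root h) ↔ A.SameFloor (A.root h) (A.root (A.mark i)) :=
      ⟨fun h1 => h1.symm.trans hs, fun h1 => hs.trans h1.symm⟩
    rcases lt_trichotomy (A.dir h).2 0 with hd | hd | hd
    · have n1 : h ≠ u := by
        rintro rfl
        omega
      rw [if_neg n1, if_neg (fun h1 : A.IsHorizontal h ∧ _ => hd.ne h1.1.1), add_zero]
      split_ifs with h1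
      · have he : A.opp h = h := by
          by_contra e
          have h2 := A.height_lt (ε := -1) e (by omega)
          push_cast at h2
          refine h1.2.resolve_left e ⟨h1.1.1.trans (sameFloor_opp hd.ne), ?_⟩
          linarith [h1.1.2]
        rcases hA.leaky.verticalEnd_cases ⟨he, hd.ne⟩ with h2 | h2
        · rw [h2]
        · omega
      · rfl
    · have n1 : h ≠ u := by
        rintro rfl
        omega
      rw [if_neg n1, zero_add, ← ite_and]
      by_cases h0 : (A.dir h).1 = 0
      · rw [h0, ite_self, ite_self]
      · refine if_congr ?_ rfl rfl
        have hh : A.IsHorizontal h := ⟨hd, h0⟩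
        rw [hfl]
        refine ⟨fun h1 => ⟨⟨hh, h1.1.1⟩, h1.1.2⟩, fun h1 => ⟨⟨h1.1.2, h1.2⟩, ?_⟩⟩
        by_cases e : A.opp h = h
        · exact Or.inl e
        · refine Or.inr fun h2 => ?_
          have h3 := hA.linked_floor_iff hp (linked_opp hh e)
          rw [hA.isFloorVertex_iff hp h1.1.2, ← hA.isFloorVertex_iff hp hs,
            hA.isFloorVertex_iff hp h2.1] at h3
          tauto
    · rw [if_neg (fun h1 : A.IsHorizontal h ∧ _ => hd.ne' h1.1.1), add_zero]
      refine if_congr ⟨fun h1 => ?_, ?_⟩ rfl rfl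
      · refine hA.crosses_unique hp h1.1.1.symm ⟨hd, h1.1.2, h1.2.imp_right fun h2 => ?_⟩ hcu
        by_contra hlt
        exact h2 ⟨h1.1.1.trans (sameFloor_opp hd.ne'), not_lt.1 hlt⟩
      · rintro rfl
        refine ⟨⟨sameFloor_refl _, le_rfl⟩, hcu.2.2.imp_right fun h1 h2 => absurd h2.2 (not_le.2 h1)⟩
  rw [Finset.sum_congr rfl fun h _ => key h, Finset.sum_add_distrib, Finset.sum_ite_eq' Finset.univ u,
    if_pos (Finset.mem_univ u), ← Finset.sum_filter] at hflux
  linarith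

/-- The up ends correspond to the floors. -/
theorem exists_upEnds : ∃ E : Fin n → A.H,
    (∀ i, A.IsFloorVertex (A.root (A.mark i)) → A.opp (E i) = E i ∧ (A.dir (E i)).2 = 1 ∧
      A.SameFloor (A.root (E i)) (A.root (A.mark i))) ∧
    Set.InjOn E {i | A.IsFloorVertex (A.root (A.mark i))} ∧
    (Finset.univ.filter fun h => A.opp h = h ∧ (A.dir h).2 = 1) =
      (Finset.univ.filter fun i => A.IsFloorVertex (A.root (A.mark i))).image E := by
  have hex : ∀ i, ∃ e, A.IsFloorVertex (A.root (A.mark i)) → A.opp e = e ∧ (A.dir e).2 = 1 ∧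
      A.SameFloor (A.root e) (A.root (A.mark i)) := by
    intro i
    by_cases hi : A.IsFloorVertex (A.root (A.mark i))
    · obtain ⟨e, he, hd, hs⟩ := hA.exists_floor_end hp hi (ε := 1) (Or.inl rfl)
      exact ⟨e, fun _ => ⟨he.1, hA.snd_eq_one hp (by omega), hs.symm⟩⟩
    · exact ⟨A.mark i, fun h => absurd h hi⟩
  choose E hE using hex
  refine ⟨E, hE, ?_, ?_⟩
  · intro i hi j hj he
    have h1 := (hE i hi).2.2
    rw [he] at h1
    exact hA.mark_unique hp h1 (hE j hj).2.2
  · ext h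
    simp only [Finset.mem_filter, Finset.mem_univ, true_and, Finset.mem_image]
    constructor
    · rintro ⟨h1, h2⟩
      obtain ⟨i, hi⟩ := hA.exists_sameFloor_mark hp (A.root h)
      have hv := (hA.isFloorVertex_iff hp hi).1 ⟨h, rfl, by omega⟩
      obtain ⟨e1, e2, e3⟩ := hE i hv
      exact ⟨i, hv, hA.floor_end_unique hp (ε := 1) (Or.inl rfl) ⟨e1, by omega⟩ ⟨h1, by omega⟩
        (by omega) (by omega) (e3.trans hi.symm)⟩
    · rintro ⟨i, hi, rfl⟩
      exact ⟨(hE i hi).1, (hE i hi).2.1⟩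

/-- All horizontal edges of a floor attach below its up end, so the leaking is minus the total
weight at the floor. -/
theorem sum_edgeWeight_floor {i : Fin n} {e : A.H} (he : A.opp e = e) (hd : 0 < (A.dir e).2)
    (hs : A.SameFloor (A.root e) (A.root (A.mark i))) :
    (A.dir e).1 = -∑ j, A.edgeWeight i j := by
  rw [hA.dir_fst_up hp hd hs]
  refine congrArg _ (Finset.sum_congr rfl fun j _ => ?_)
  by_cases hc : ∃ h, A.Connects i j h
  · obtain ⟨h, hc⟩ := hc
    have hi := (hA.isFloorVertex_iff hp hs).1 ⟨e, rfl, hd.ne'⟩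
    refine if_pos ?_
    by_contra hlt
    rw [← hA.connects_height hp hc hi] at hlt
    exact (hA.not_between hp hd (hs.trans hc.choose_spec.2.1.symm) (not_le.1 hlt)).1 he
  · rw [not_not.1 (mt (hA.edgeWeight_ne_zero hp).1 hc), ite_self]

theorem sum_edgeWeight_point {i : Fin n} (hi : ¬ A.IsFloorVertex (A.root (A.mark i))) :
    ∑ j, A.edgeWeight i j = 0 := by
  have h1 := congrArg Prod.fst (A.balanced (A.root (A.mark i)))
  rw [Prod.fst_sum, Prod.fst_zero] at h1
  simp only [edgeWeight]
  rw [hA.sum_connects hp, ← h1]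
  refine Finset.sum_subset_zero_on_sdiff ?_ ?_ fun _ _ => rfl
  · intro h hh
    obtain ⟨-, -, hs⟩ := Finset.mem_filter.1 hh
    exact Finset.mem_filter.2 ⟨Finset.mem_univ _, hA.eq_of_sameFloor hp hi hs.symm⟩
  · intro h hh
    obtain ⟨h2, h3⟩ := Finset.mem_sdiff.1 hh
    have h4 := (Finset.mem_filter.1 h2).2
    by_contra h0
    refine h3 (Finset.mem_filter.2 ⟨Finset.mem_univ _, ⟨?_, h0⟩, h4 ▸ sameFloor_refl _⟩)
    by_contra h5
    exact hi ⟨h, h4, h5⟩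

end IsCounted

end CutMap

end TropEP

end

/-! ### The diagram of a map -/

section

open scoped Classical

namespace TropEP

variable {d₂ g : ℕ} {Δ : Multiset ℤ} {d₁ : ℕ} {p : Fin (2 * d₂ + g - 1) → ℝ × ℝ}
  {A : CutMap (2 * d₂ + g - 1)}

namespace CutMap

/-- The diagram of a map: the horizontal edges of the glued graph with their expansion factors and
their numbers of crossings of the cut. -/
structure Realizes (A : CutMap (2 * d₂ + g - 1)) {Q : PearlChain d₂ g} {Δ : Multiset ℤ}
    {x : Fin (2 * d₂ + g - 1) → ℝ} (D : Diagram Q Δ x) : Prop where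
  white : ∀ i, i ∈ Q.white ↔ A.IsFloorVertex (A.root (A.mark i))
  adj : ∀ i j, Q.graph.Adj i j ↔ ∃ h, A.Connects i j h
  weight : ∀ i j h, A.Connects i j h → D.weight i j = (A.dir h).1
  wind : ∀ i j h, A.Connects i j h → A.IsRight h → D.wind i j = A.crossings h

theorem Realizes.unique {Q Q' : PearlChain d₂ g} {x : Fin (2 * d₂ + g - 1) → ℝ} {D : Diagram Q Δ x}
    {D' : Diagram Q' Δ x} (h : A.Realizes D) (h' : A.Realizes D') :
    (⟨Q, D⟩ : Σ Q, Diagram Q Δ x) = ⟨Q', D'⟩ := by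
  obtain rfl : Q = Q' := PearlChain.ext
    (by ext i j; rw [h.adj, h'.adj]) (by ext i; rw [h.white, h'.white])
  have hw : D.weight = D'.weight := by
    funext i j
    by_cases hc : Q.graph.Adj i j
    · obtain ⟨k, hk⟩ := (h.adj i j).1 hc
      rw [h.weight i j k hk, h'.weight i j k hk]
    · rw [D.weight_eq_zero hc, D'.weight_eq_zero hc]
  have ht : D.wind = D'.wind := by
    funext i j
    by_cases hc : Q.graph.Adj i j
    · obtain ⟨k, hk⟩ := (h.adj i j).1 hc
      obtain ⟨k', hl, hk'⟩ := hk.swap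
      rcases isRight_or_of_linked hl with ⟨hr, -⟩ | ⟨hr, -⟩
      · rw [h.wind i j k hk hr, h'.wind i j k hk hr]
      · rw [← D.wind_swap, ← D'.wind_swap, h.wind j i k' hk' hr, h'.wind j i k' hk' hr]
    · rw [D.wind_eq_zero i j hc, D'.wind_eq_zero i j hc]
  cases D
  cases D'
  simp only at hw ht
  subst hw ht
  rfl

namespace IsCounted

variable (hp : Admissible Δ d₁ g p) (hA : A.IsCounted Δ d₁ g p)

include hA hp

theorem degree_realized {Q : PearlChain d₂ g} {x : Fin (2 * d₂ + g - 1) → ℝ} {D : Diagram Q Δ x}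
    (h : A.Realizes D) : D.degree = d₁ := by
  have : Nonempty A.V := ⟨A.root (hA.exists_verticalEnd hp).choose⟩
  rw [← hA.2.2.1, degree_eq_sum_crossings hA.connected, ← D.weight_mul_wind_le]
  have h1 : ∀ i j, (if 0 < D.weight i j then (D.weight i j).natAbs * D.wind i j else 0) =
      ∑ k with A.Connects i j k, if A.IsRight k then (A.dir k).1.natAbs * A.crossings k else 0 := by
    intro i j
    by_cases hc : Q.graph.Adj i j
    · obtain ⟨k, hk⟩ := (h.adj i j).1 hc
      rw [hA.filter_connects hp hk, Finset.sum_singleton, h.weight i j k hk]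
      by_cases hr : A.IsRight k
      · rw [if_pos hr, if_pos hr.2, h.wind i j k hk hr]
      · rw [if_neg hr, if_neg fun h0 => hr ⟨hk.isHorizontal.1, h0⟩]
    · rw [D.weight_eq_zero hc, if_neg (lt_irrefl _)]
      exact (Finset.sum_eq_zero fun k hk =>
        absurd ((h.adj i j).2 ⟨k, (Finset.mem_filter.1 hk).2⟩) hc).symm
  simp only [h1]
  rw [hA.sum_sum_connects hp, Finset.sum_filter, ← Finset.sum_filter_add_sum_filter_not Finset.univ
    (fun k => A.IsRight k), Finset.sum_eq_zero (s := Finset.univ.filter fun k => ¬ A.IsRight k)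
    fun k hk => by rw [if_neg (Finset.mem_filter.1 hk).2, ite_self], add_zero]
  rw [← Finset.sum_subtype (p := fun k => A.IsRight k) (Finset.univ.filter fun k => A.IsRight k)
    (fun k => by simp) (fun k => (A.dir k).1.natAbs * A.crossings k)]
  refine Finset.sum_congr rfl fun k hk => ?_
  have hr := (Finset.mem_filter.1 hk).2
  rw [if_pos hr.isHorizontal, if_pos hr]

/-- A marked vertex off the floors has two horizontal flags. They lead to different floors, as two
vertices are joined by at most one edge. -/
theorem black_neighbors {i : Fin (2 * d₂ + g - 1)} (hi : ¬ A.IsFloorVertex (A.root (A.mark i))) :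
    {j | ∃ h, A.Connects i j h}.ncard = 2 := by
  obtain ⟨a, b, hab, ha, hb, ra, rb, hall, -, -⟩ := hA.mark_flags hp i
  have hor : ∀ k, A.root k = A.root (A.mark i) → (∀ j, A.mark j ≠ k) → A.IsHorizontal k := by
    intro k hk hm
    have h1 := hA.dir_ne_zero hp hm
    have h2 : (A.dir k).2 = 0 := by
      by_contra h2
      exact hi ⟨k, hk, h2⟩
    exact ⟨h2, fun h3 => h1 (Prod.ext h3 h2)⟩
  have hex : ∀ k, A.root k = A.root (A.mark i) → (∀ j, A.mark j ≠ k) → ∃ j, A.Connects i j k := by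
    intro k hk hm
    obtain ⟨i', j, hc⟩ := hA.exists_connects hp (hor k hk hm)
    have hs : A.SameFloor (A.root k) (A.root (A.mark i)) := by
      rw [hk]
      exact sameFloor_refl _
    obtain rfl := hA.mark_unique hp hs hc.choose_spec.2.1
    exact ⟨j, hc⟩
  obtain ⟨j, hj⟩ := hex a ra ha
  obtain ⟨k, hk⟩ := hex b rb hb
  have : {j | ∃ h, A.Connects i j h} = {j, k} := by
    ext l
    simp only [Set.mem_ofPred_eq, Set.mem_insert_iff, Set.mem_singleton_iff]
    constructor
    · rintro ⟨h, hc⟩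
      have hr := hA.eq_of_sameFloor hp hi hc.choose_spec.2.1.symm
      rcases hall h hr with rfl | rfl | rfl
      · exact absurd (by rw [A.mark_contracted]; rfl) hc.isHorizontal.2
      · exact Or.inl (hA.connects_marks_unique hp hc hj).2
      · exact Or.inr (hA.connects_marks_unique hp hc hk).2
    · rintro (rfl | rfl)
      · exact ⟨a, hj⟩
      · exact ⟨b, hk⟩
  rw [this, Set.ncard_pair]
  rintro rfl
  exact hab (hA.connects_unique hp hj hk)

/-- The vertices are the labels of the marked points, since each floor contains exactly one. White
vertices are counted by the up ends. -/
theorem exists_pearlChain (hcard : Δ.card = d₂) : ∃ Q : PearlChain d₂ g,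
    (∀ i, i ∈ Q.white ↔ A.IsFloorVertex (A.root (A.mark i))) ∧
    ∀ i j, Q.graph.Adj i j ↔ ∃ h, A.Connects i j h := by
  let W : Set (Fin (2 * d₂ + g - 1)) := {i | A.IsFloorVertex (A.root (A.mark i))}
  let G : SimpleGraph (Fin (2 * d₂ + g - 1)) :=
    { Adj := fun i j => ∃ h, A.Connects i j h
      symm := ⟨fun i j ⟨h, hc⟩ => by
        obtain ⟨h', -, hc'⟩ := hc.swap
        exact ⟨h', hc'⟩⟩
      loopless := ⟨fun i ⟨h, hc⟩ => hA.connects_ne hp hc rfl⟩ }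
  have hbip : ∀ i j, G.Adj i j → (i ∈ W ↔ j ∉ W) := fun i j ⟨h, hc⟩ => hA.connects_floor_iff hp hc
  have hval : ∀ i, i ∉ W → (G.neighborSet i).ncard = 2 := fun i hi => hA.black_neighbors hp hi
  have hn := hp.card_points
  have hpos := hp.card_pos
  have hW : W.ncard = d₂ := by
    obtain ⟨E, -, hinj, himg⟩ := hA.exists_upEnds hp
    have h1 := hA.leaky.card_up
    rw [himg, Finset.card_image_of_injOn (by simpa using hinj), hcard] at h1
    refine Eq.trans ?_ h1
    rw [← Set.ncard_coe_finset]
    simp [W]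
  have hB : Wᶜ.ncard = d₂ + g - 1 := by
    rw [Set.ncard_compl, hW, Nat.card_eq_fintype_card, Fintype.card_fin]
    omega
  have hcon : G.Connected := by
    have : Nonempty (Fin (2 * d₂ + g - 1)) := ⟨⟨0, by omega⟩⟩
    refine ⟨fun i j => ?_⟩
    -- Reachability is transported along the curve: a step inside a floor keeps the label, a
    -- horizontal edge is an edge of `G`.
    have link : ∀ v w, (∀ k l, A.SameFloor v (A.root (A.mark k)) →
        A.SameFloor w (A.root (A.mark l)) → k = l ∨ G.Adj k l) →
        (∀ k, A.SameFloor v (A.root (A.mark k)) → G.Reachable i k) →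
        ∀ k, A.SameFloor w (A.root (A.mark k)) → G.Reachable i k := by
      intro v w hvw hv k hk
      obtain ⟨l, hl⟩ := hA.exists_sameFloor_mark hp v
      rcases hvw l k hl hk with rfl | hadj
      · exact hv _ hl
      · exact (hv l hl).trans hadj.reachable
    have hlink : ∀ h h', A.Linked h h' → (∀ k, A.SameFloor (A.root h) (A.root (A.mark k)) →
        G.Reachable i k) → ∀ k, A.SameFloor (A.root h') (A.root (A.mark k)) → G.Reachable i k :=
      fun h h' hl => link _ _ fun k l hk hkl => Or.inr ⟨h, h', hl, hk, hkl⟩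
    refine hA.connected.closed_of_linked
      (S := fun v => ∀ k, A.SameFloor v (A.root (A.mark k)) → G.Reachable i k) ?_ hlink
      (A.root (A.mark i)) (A.root (A.mark j)) ?_ j (sameFloor_refl _)
    · intro h hh
      by_cases hd : A.IsHorizontal h
      · exact hlink _ _ (linked_opp hd hh)
      · exact link _ _ fun k l hk hl => Or.inl (hA.mark_unique hp
          ((sameFloor_opp (hA.snd_ne_zero hp hh hd)).symm.trans hk) hl)
    · intro k hk
      rw [hA.eq_of_sameFloor_mark hp hk]
  -- Counting at the black vertices gives `2 * (d₂ + g - 1)` edges, hence first Betti number `g`.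
  have hgen : (G.edgeSet.ncard : ℤ) - (2 * d₂ + g - 1 : ℕ) + 1 = g := by
    have h1 : G.IsBipartiteWith (Finset.univ.filter fun i => i ∉ W) (Finset.univ.filter fun i => i ∈ W) := by
      refine ⟨?_, fun i j hij => ?_⟩
      · rw [Finset.disjoint_coe]
        exact (Finset.disjoint_filter_filter_not _ _ _).symm
      · have := hbip i j hij
        simp only [Finset.coe_filter, Finset.mem_univ, true_and, Set.mem_ofPred_eq]
        tauto
    have h2 := SimpleGraph.isBipartiteWith_sum_degrees_eq_card_edges h1
    have h3 : ∀ i ∈ Finset.univ.filter fun i => i ∉ W, G.degree i = 2 := fun i hi => by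
      refine Eq.trans ?_ (hval i (Finset.mem_filter.1 hi).2)
      rw [Set.ncard_eq_toFinset_card', ← SimpleGraph.card_neighborSet_eq_degree, Set.toFinset_card]
    have h4 : (Finset.univ.filter fun i => i ∉ W).card = d₂ + g - 1 := by
      refine Eq.trans ?_ hB
      rw [← Set.ncard_coe_finset]
      congr 1
      ext i
      simp
    rw [Finset.sum_congr rfl h3, Finset.sum_const, h4, smul_eq_mul] at h2
    have h5 : G.edgeSet.ncard = G.edgeFinset.card := by
      rw [← SimpleGraph.coe_edgeFinset, Set.ncard_coe_finset]
    rw [h5, ← h2]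
    omega
  exact ⟨⟨G, W, hcon, hgen, hW, hB, hbip, hval⟩, fun i => Iff.rfl, fun i j => Iff.rfl⟩

theorem isLeaking_edgeWeight {Q : PearlChain d₂ g}
    (hw : ∀ i, i ∈ Q.white ↔ A.IsFloorVertex (A.root (A.mark i))) :
    Q.IsLeaking Δ fun i => -∑ j, A.edgeWeight i j := by
  refine ⟨fun i hi => ?_, ?_⟩
  · simp only
    rw [hA.sum_edgeWeight_point hp (fun h => hi ((hw i).2 h)), neg_zero]
  · obtain ⟨E, hE, hinj, himg⟩ := hA.exists_upEnds hp
    have h1 := hA.leaky.2.1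
    rw [himg, Finset.image_val_of_injOn (by simpa using hinj), Multiset.map_map] at h1
    rw [← h1]
    have h2 : (Finset.univ.filter fun i => i ∈ Q.white) =
        Finset.univ.filter fun i => A.IsFloorVertex (A.root (A.mark i)) :=
      Finset.filter_congr fun i _ => hw i
    rw [h2]
    refine Multiset.map_congr rfl fun i hi => ?_
    obtain ⟨e1, e2, e3⟩ := hE i (by simpa using hi)
    exact (hA.sum_edgeWeight_floor hp e1 (by omega) e3).symm

/-- One vertex of the edge is a marked point, the other lies on a floor whose distance in `x` from
its own marked point is smaller than the distance of the two marked points. So the marked points are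
in the same order as the vertices. -/
theorem lt_of_connects {i j : Fin (2 * d₂ + g - 1)} {h : A.H} (hc : A.Connects i j h)
    (hr : A.IsRight h) (h0 : A.crossings h = 0) : (p i).1 < (p j).1 := by
  have hb := hr.crossings_eq_zero_iff.1 h0
  have hne := hA.connects_ne hp hc
  have hfl := hA.connects_floor_iff hp hc
  obtain ⟨h', hl, h1, h2⟩ := hc
  obtain rfl := (linked_opp hr.isHorizontal hb).unique hl
  have h3 : (A.pos (A.root h)).1 < (A.pos (A.root (A.opp h))).1 := by
    rw [A.pos_opp_fst h hb, lt_add_iff_pos_right]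
    exact mul_pos (A.len_toReal_pos hb) (by exact_mod_cast hr.2)
  have h4 := hA.abs_fst_sub_lt hp h1 hne
  have h5 := hA.abs_fst_sub_lt hp h2 hne
  rw [hA.pos_mark] at h4 h5
  by_contra hle
  rw [abs_of_nonneg (sub_nonneg.2 (not_lt.1 hle))] at h4 h5
  by_cases hi : A.IsFloorVertex (A.root (A.mark i))
  · have h6 := hA.eq_of_sameFloor hp (hfl.1 hi) h2.symm
    rw [h6, hA.pos_mark] at h3
    have := (abs_lt.1 h4).2
    linarith
  · have h6 := hA.eq_of_sameFloor hp hi h1.symm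
    rw [h6, hA.pos_mark] at h3
    have := (abs_lt.1 h5).1
    linarith

theorem exists_realizes (hcard : Δ.card = d₂) :
    ∃ Q : PearlChain d₂ g, ∃ D : Diagram Q Δ (fun i => (p i).1), A.Realizes D := by
  obtain ⟨Q, hw, hadj⟩ := hA.exists_pearlChain hp hcard
  have hsum : ∀ i j h, A.Connects i j h → A.IsRight h → A.rightWind i j + A.rightWind j i =
      A.crossings h := by
    intro i j h hc hr
    obtain ⟨h', hl, hc'⟩ := hc.swap
    have hr' : ¬ A.IsRight h' := by
      rcases isRight_or_of_linked hl with ⟨-, h1⟩ | ⟨-, h1⟩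
      · exact h1
      · exact absurd hr h1
    have e1 : (Finset.univ.filter fun k => A.Connects i j k ∧ A.IsRight k) = {h} := by
      rw [← Finset.filter_filter, hA.filter_connects hp hc, Finset.filter_singleton, if_pos hr]
    have e2 : (Finset.univ.filter fun k => A.Connects j i k ∧ A.IsRight k) = ∅ := by
      rw [← Finset.filter_filter, hA.filter_connects hp hc', Finset.filter_singleton, if_neg hr']
    rw [rightWind, rightWind, e1, e2, Finset.sum_singleton, Finset.sum_empty, add_zero]
  refine ⟨Q, ⟨A.edgeWeight, fun i j => A.rightWind i j + A.rightWind j i, fun i j => ?_,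
    fun i j => add_comm _ _, fun i j => ?_, fun i j hij => ?_, fun i j h0 hpos => ?_,
    hA.isLeaking_edgeWeight hp hw⟩, hw, hadj, fun i j h hc => hA.edgeWeight_eq hp hc, hsum⟩
  · by_cases hc : ∃ h, A.Connects i j h
    · obtain ⟨h, hc⟩ := hc
      obtain ⟨h', hl, hc'⟩ := hc.swap
      rw [hA.edgeWeight_eq hp hc, hA.edgeWeight_eq hp hc', hl.dir_eq, Prod.fst_neg]
    · have hc' : ¬ ∃ h, A.Connects j i h := fun ⟨h, h1⟩ => hc (by
        obtain ⟨h', -, h2⟩ := h1.swap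
        exact ⟨h', h2⟩)
      rw [not_not.1 (mt (hA.edgeWeight_ne_zero hp).1 hc),
        not_not.1 (mt (hA.edgeWeight_ne_zero hp).1 hc'), neg_zero]
  · rw [hA.edgeWeight_ne_zero hp, hadj]
  · have none : ∀ i j, ¬ Q.graph.Adj i j → A.rightWind i j = 0 := fun i j hij =>
      Finset.sum_eq_zero fun h hh =>
        absurd ((hadj i j).2 ⟨h, (Finset.mem_filter.1 hh).2.1⟩) hij
    change _ + _ = 0
    rw [none i j hij, none j i fun h => hij h.symm]
  · obtain ⟨h, hc⟩ := (hA.edgeWeight_ne_zero hp).1 hpos.ne'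
    rw [hA.edgeWeight_eq hp hc] at hpos
    have hr : A.IsRight h := ⟨hc.isHorizontal.1, hpos⟩
    exact hA.lt_of_connects hp hc hr ((hsum i j h hc hr).symm.trans h0)

end IsCounted

end CutMap

end TropEP

end

/-! ### Vertices and flags encoded by a pearl chain, and the shape of the floors -/

section

open scoped Classical

namespace TropEP

section Involution

variable {H : Type*} {R : H → H → Prop}

/-- The involution that exchanges the elements in a symmetric functional relation. -/
noncomputable def involution (R : H → H → Prop) (h : H) : H := if e : ∃ h', R h h' then e.choose else h

theorem involution_of_not {h : H} (e : ¬ ∃ h', R h h') : involution R h = h := dif_neg e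

theorem involution_eq (hfun : ∀ a b c, R a b → R a c → b = c) {a b : H} (h : R a b) :
    involution R a = b := by
  have e : ∃ h', R a h' := ⟨b, h⟩
  rw [involution, dif_pos e]
  exact hfun _ _ _ e.choose_spec h

theorem rel_involution {h : H} (hh : involution R h ≠ h) : R h (involution R h) := by
  by_cases e : ∃ h', R h h'
  · rw [involution, dif_pos e]
    exact e.choose_spec
  · exact absurd (involution_of_not e) hh

theorem involution_involution (hsymm : ∀ a b, R a b → R b a) (hfun : ∀ a b c, R a b → R a c → b = c)
    (h : H) : involution R (involution R h) = h := by
  by_cases e : involution R h = h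
  · rw [e, e]
  · exact involution_eq hfun (hsymm _ _ (rel_involution e))

end Involution

/-- The segment from `a` to `b` has direction `u`. -/
def IsSegment (a b : ℝ × ℝ) (u : ℤ × ℤ) : Prop :=
  u ≠ 0 ∧ ∃ s : ℝ, 0 < s ∧ b.1 = a.1 + s * u.1 ∧ b.2 = a.2 + s * u.2

theorem IsSegment.symm {a b : ℝ × ℝ} {u : ℤ × ℤ} (h : IsSegment a b u) : IsSegment b a (-u) := by
  obtain ⟨h0, s, hs, h1, h2⟩ := h
  refine ⟨neg_ne_zero.2 h0, s, hs, ?_, ?_⟩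
  · rw [h1]
    push_cast [Prod.fst_neg]
    ring
  · rw [h2]
    push_cast [Prod.snd_neg]
    ring

/-- Lengths are chosen separately for the two flags of an edge; they agree because the direction is
nonzero and determines the length from the two positions. -/
theorem exists_length {V H : Type*} (root : H → V) (opp : H → H) (pos : V → ℝ × ℝ) (dir : H → ℤ × ℤ)
    (hopp : ∀ h, opp (opp h) = h) (hdir : ∀ h, opp h ≠ h → dir (opp h) = - dir h)
    (hseg : ∀ h, opp h ≠ h → IsSegment (pos (root h)) (pos (root (opp h))) (dir h)) :
    ∃ len : H → ENNReal, (∀ h, 0 < len h) ∧ (∀ h, len (opp h) = len h) ∧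
      (∀ h, len h = ⊤ ↔ opp h = h) ∧
      (∀ h, opp h ≠ h → (pos (root (opp h))).1 = (pos (root h)).1 + (len h).toReal * ((dir h).1 : ℝ)) ∧
      ∀ h, opp h ≠ h →
        (pos (root (opp h))).2 = (pos (root h)).2 + (len h).toReal * ((dir h).2 : ℝ) := by
  have hex : ∀ h, ∃ s : ℝ, opp h ≠ h → 0 < s ∧
      (pos (root (opp h))).1 = (pos (root h)).1 + s * ((dir h).1 : ℝ) ∧
      (pos (root (opp h))).2 = (pos (root h)).2 + s * ((dir h).2 : ℝ) := by
    intro h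
    by_cases e : opp h = h
    · exact ⟨0, fun h => absurd e h⟩
    · obtain ⟨-, s, h1⟩ := hseg h e
      exact ⟨s, fun _ => h1⟩
  choose s hs using hex
  have hne : ∀ h, opp h ≠ h → opp (opp h) ≠ opp h := fun h e e' => e (by rw [hopp] at e'; exact e'.symm)
  have hlen : ∀ h, opp h ≠ h →
      (if opp h = h then (⊤ : ENNReal) else ENNReal.ofReal (s h)).toReal = s h := fun h e => by
    rw [if_neg e, ENNReal.toReal_ofReal (hs h e).1.le]
  refine ⟨fun h => if opp h = h then ⊤ else ENNReal.ofReal (s h), fun h => ?_, fun h => ?_,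
    fun h => ?_, fun h e => ?_, fun h e => ?_⟩
  · simp only
    split_ifs with e
    · exact ENNReal.zero_lt_top
    · exact ENNReal.ofReal_pos.2 (hs h e).1
  · simp only
    by_cases e : opp h = h
    · rw [if_pos e, if_pos (by rw [e, e])]
    · rw [if_neg e, if_neg (hne h e)]
      congr 1
      obtain ⟨-, h1, h2⟩ := hs h e
      obtain ⟨-, h3, h4⟩ := hs _ (hne h e)
      rw [hopp, hdir h e, Prod.fst_neg] at h3
      rw [hopp, hdir h e, Prod.snd_neg] at h4
      push_cast at h3 h4
      by_cases h5 : (dir h).1 = 0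
      · have h6 : (dir h).2 ≠ 0 := fun h6 => (hseg h e).1 (Prod.ext h5 h6)
        exact mul_right_cancel₀ (b := ((dir h).2 : ℝ)) (by exact_mod_cast h6) (by linarith)
      · exact mul_right_cancel₀ (b := ((dir h).1 : ℝ)) (by exact_mod_cast h5) (by linarith)
  · simp only
    split_ifs with e
    · simp [e]
    · simp [e]
  · simp only
    rw [hlen h e]
    exact (hs h e).2.1
  · simp only
    rw [hlen h e]
    exact (hs h e).2.2

namespace PearlChain

variable {d₂ g : ℕ} (Q : PearlChain d₂ g)

/-- The vertices of a map with pearl chain `Q`: the marked points, and the ends of the horizontal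
edges on the floors. -/
abbrev Code : Type :=
  {c : Fin (2 * d₂ + g - 1) × Fin (2 * d₂ + g - 1) // c.1 = c.2 ∨ Q.graph.Adj c.1 c.2 ∧ c.1 ∈ Q.white}

/-- The oriented edges of a pearl chain. -/
abbrev Dart : Type :=
  {k : Fin (2 * d₂ + g - 1) × Fin (2 * d₂ + g - 1) // Q.graph.Adj k.1 k.2}

/-- The vertices on the floors. -/
abbrev FloorCode : Type := {c : Q.Code // c.1.1 ∈ Q.white}

/-- The flags of a map with pearl chain `Q`: the marked ends, the flags of horizontal edges and the
flags on the floors, upward or downward. -/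
abbrev CodeFlag : Type := Fin (2 * d₂ + g - 1) ⊕ Q.Dart ⊕ (Q.FloorCode × Bool)

variable {Q}

abbrev Code.diag (i : Fin (2 * d₂ + g - 1)) : Q.Code := ⟨(i, i), Or.inl rfl⟩

abbrev Dart.swap (k : Q.Dart) : Q.Dart := ⟨k.1.swap, k.2.symm⟩

/-- An edge starts on the floor of its white vertex at the height of its black vertex, and at the
marked point of its black vertex. -/
noncomputable def Dart.root (k : Q.Dart) : Q.Code :=
  if h : k.1.1 ∈ Q.white then ⟨k.1, Or.inr ⟨k.2, h⟩⟩ else Code.diag k.1.1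

abbrev CodeFlag.mark (i : Fin (2 * d₂ + g - 1)) : Q.CodeFlag := Sum.inl i

abbrev CodeFlag.hor (k : Q.Dart) : Q.CodeFlag := Sum.inr (Sum.inl k)

abbrev CodeFlag.up (c : Q.FloorCode) : Q.CodeFlag := Sum.inr (Sum.inr (c, true))

abbrev CodeFlag.down (c : Q.FloorCode) : Q.CodeFlag := Sum.inr (Sum.inr (c, false))

noncomputable def CodeFlag.root : Q.CodeFlag → Q.Code :=
  Sum.elim Code.diag (Sum.elim Dart.root fun c => c.1.1)

theorem Dart.root_white {k : Q.Dart} (h : k.1.1 ∈ Q.white) : k.root = ⟨k.1, Or.inr ⟨k.2, h⟩⟩ :=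
  dif_pos h

theorem Dart.root_black {k : Q.Dart} (h : k.1.1 ∉ Q.white) : k.root = Code.diag k.1.1 := dif_neg h

theorem Dart.root_fst (k : Q.Dart) : k.root.1.1 = k.1.1 := by
  by_cases h : k.1.1 ∈ Q.white
  · rw [root_white h]
  · rw [root_black h]

/-- There are `2 * d₂ + g - 1` diagonal codes and one code for each edge. This is the number of
inner vertices of a counted map. -/
theorem card_code : Fintype.card Q.Code + 2 = (2 * d₂ + g - 1) + 2 * (d₂ + g - 1) + 2 := by
  have h1 : Disjoint (fun c : Fin (2 * d₂ + g - 1) × Fin (2 * d₂ + g - 1) => c.1 = c.2)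
      fun c => Q.graph.Adj c.1 c.2 ∧ c.1 ∈ Q.white := by
    rw [Pi.disjoint_iff]
    intro c
    rw [Prop.disjoint_iff]
    rintro ⟨h, h', -⟩
    exact h'.ne h
  have h2 := Fintype.card_subtype_or_disjoint _ _ h1
  have h3 : Fintype.card {c : Fin (2 * d₂ + g - 1) × Fin (2 * d₂ + g - 1) // c.1 = c.2} =
      2 * d₂ + g - 1 := by
    rw [← Fintype.card_of_bijective (f := fun i : Fin (2 * d₂ + g - 1) =>
      (⟨(i, i), rfl⟩ : {c : Fin (2 * d₂ + g - 1) × Fin (2 * d₂ + g - 1) // c.1 = c.2}))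
      ⟨fun i j h => by simpa using h, fun ⟨⟨i, j⟩, h⟩ => ⟨i, by simpa using h⟩⟩, Fintype.card_fin]
  rw [h3] at h2
  have h4 := Q.card_whitePair
  rw [h2, ← h4]

end PearlChain

namespace Diagram

open PearlChain

variable {d₂ g : ℕ} {Q : PearlChain d₂ g} {Δ : Multiset ℤ} {p : Fin (2 * d₂ + g - 1) → ℝ × ℝ}
  (D : Diagram Q Δ fun i => (p i).1)

/-- The negative of the slope of the floor `i` above the height `y`. -/
noncomputable def slope (i : Fin (2 * d₂ + g - 1)) (y : ℝ) : ℤ :=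
  ∑ u, if (p u).2 ≤ y then D.weight i u else 0

/-- The `x`-coordinate of the floor `i` at height `y`. -/
noncomputable def floorX (i : Fin (2 * d₂ + g - 1)) (y : ℝ) : ℝ :=
  -- Integrates the negative of `slope` from the height of the marked point to `y`: an edge `u` acts
  -- along the part of the way above its height. The second maximum normalises the value at the
  -- marked point.
  (p i).1 - ∑ u, (D.weight i u : ℝ) * (max (y - (p u).2) 0 - max ((p i).2 - (p u).2) 0)

noncomputable def codePos (c : Q.Code) : ℝ × ℝ := (D.floorX c.1.1 (p c.1.2).2, (p c.1.2).2)

/-- Below `c` the edge attached at `c` does not yet act, so its weight is subtracted in the downward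
direction. At a diagonal code this weight is zero and the floor goes straight through its marked
point. -/
noncomputable def codeDir : Q.CodeFlag → ℤ × ℤ :=
  Sum.elim (fun _ => 0) (Sum.elim (fun k => (D.weight k.1.1 k.1.2, 0)) fun c =>
    if c.2 then (-D.slope c.1.1.1.1 (p c.1.1.1.2).2, 1)
    else (D.slope c.1.1.1.1 (p c.1.1.1.2).2 - D.weight c.1.1.1.1 c.1.1.1.2, -1))

/-- `c'` is the next vertex above `c` on the same floor. -/
def Covers (p : Fin (2 * d₂ + g - 1) → ℝ × ℝ) (c c' : Q.FloorCode) : Prop :=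
  c.1.1.1 = c'.1.1.1 ∧ (p c.1.1.2).2 < (p c'.1.1.2).2 ∧
    ∀ b : Q.FloorCode, b.1.1.1 = c.1.1.1 → (p c.1.1.2).2 < (p b.1.1.2).2 →
      (p c'.1.1.2).2 ≤ (p b.1.1.2).2

/-- Two flags of a bounded edge. -/
inductive Joined : Q.CodeFlag → Q.CodeFlag → Prop
  | hor (k : Q.Dart) (hk : D.wind k.1.1 k.1.2 = 0) : Joined (.hor k) (.hor k.swap)
  | up (c c' : Q.FloorCode) (h : Covers p c c') : Joined (.up c) (.down c')
  | down (c c' : Q.FloorCode) (h : Covers p c c') : Joined (.down c') (.up c)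

variable {D}

theorem Joined.symm {a b : Q.CodeFlag} (h : D.Joined a b) : D.Joined b a := by
  cases h with
  | hor k hk => exact .hor k.swap (by rw [← hk]; exact D.wind_swap _ _)
  | up c c' h => exact .down c c' h
  | down c c' h => exact .up c c' h

theorem Joined.irrefl {a : Q.CodeFlag} : ¬ D.Joined a a := by
  have key : ∀ a b, D.Joined a b → a ≠ b := by
    rintro a b (⟨k, hk⟩ | ⟨c, c', h⟩ | ⟨c, c', h⟩) e
    · have := congrArg (fun k : Q.Dart => k.1.1) (Sum.inl_injective (Sum.inr_injective e))
      exact k.2.ne this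
    · simpa using congrArg (fun x => x.2) (Sum.inr_injective (Sum.inr_injective e))
    · simpa using congrArg (fun x => x.2) (Sum.inr_injective (Sum.inr_injective e))
  exact fun h => key a a h rfl

theorem floorCode_ext (hy : Function.Injective fun i => (p i).2) {c c' : Q.FloorCode} (h1 : c.1.1.1 = c'.1.1.1)
    (h2 : (p c.1.1.2).2 = (p c'.1.1.2).2) : c = c' :=
  Subtype.ext (Subtype.ext (Prod.ext h1 (hy h2)))

theorem Covers.right_unique (hy : Function.Injective fun i => (p i).2) {c a b : Q.FloorCode} (ha : Covers p c a) (hb : Covers p c b) : a = b :=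
  floorCode_ext hy (ha.1.symm.trans hb.1)
    (le_antisymm (ha.2.2 b hb.1.symm hb.2.1) (hb.2.2 a ha.1.symm ha.2.1))

theorem Covers.left_unique (hy : Function.Injective fun i => (p i).2) {c a b : Q.FloorCode} (ha : Covers p a c) (hb : Covers p b c) : a = b := by
  have h1 := ha.1.trans hb.1.symm
  refine floorCode_ext hy h1 (le_antisymm ?_ ?_)
  · by_contra h
    exact absurd (hb.2.2 a h1 (not_le.1 h)) (not_le.2 ha.2.1)
  · by_contra h
    exact absurd (ha.2.2 b h1.symm (not_le.1 h)) (not_le.2 hb.2.1)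

theorem Joined.right_unique (hy : Function.Injective fun i => (p i).2) {a b c : Q.CodeFlag} (h : D.Joined a b) (h' : D.Joined a c) : b = c := by
  cases h with
  | hor k hk => cases h'; rfl
  | up c c' h => cases h' with | up _ _ h' => rw [h.right_unique hy h']
  | down c c' h => cases h' with | down _ _ h' => rw [h.left_unique hy h']

theorem exists_covers {c b : Q.FloorCode} (hb : b.1.1.1 = c.1.1.1)
    (hlt : (p c.1.1.2).2 < (p b.1.1.2).2) : ∃ c', Covers p c c' := by
  let T := {b : Q.FloorCode // b.1.1.1 = c.1.1.1 ∧ (p c.1.1.2).2 < (p b.1.1.2).2}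
  have : Nonempty T := ⟨⟨b, hb, hlt⟩⟩
  obtain ⟨⟨m, h1, h2⟩, hm⟩ := Finite.exists_min fun b : T => (p b.1.1.1.2).2
  exact ⟨m, h1.symm, h2, fun b hb hlt => hm ⟨b, hb, hlt⟩⟩

theorem exists_covered {c b : Q.FloorCode} (hb : b.1.1.1 = c.1.1.1)
    (hlt : (p b.1.1.2).2 < (p c.1.1.2).2) : ∃ c', Covers p c' c := by
  let T := {b : Q.FloorCode // b.1.1.1 = c.1.1.1 ∧ (p b.1.1.2).2 < (p c.1.1.2).2}
  have : Nonempty T := ⟨⟨b, hb, hlt⟩⟩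
  obtain ⟨⟨m, h1, h2⟩, hm⟩ := Finite.exists_max fun b : T => (p b.1.1.1.2).2
  refine ⟨m, h1, h2, fun b hb hlt => ?_⟩
  by_contra h
  exact absurd (hm ⟨b, hb.trans h1, not_le.1 h⟩) (not_le.2 hlt)

/-- The code of a horizontal edge at a floor, as a vertex of the floor. -/
theorem exists_floorCode {i u : Fin (2 * d₂ + g - 1)} (hi : i ∈ Q.white) (h0 : D.weight i u ≠ 0) :
    ∃ c : Q.FloorCode, c.1.1 = (i, u) :=
  ⟨⟨⟨(i, u), Or.inr ⟨(D.weight_ne_zero i u).1 h0, hi⟩⟩, hi⟩, rfl⟩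

/-- No horizontal edge attaches strictly between consecutive vertices of a floor, so only the weight
at the upper one is added. -/
theorem slope_covers (hy : Function.Injective fun i => (p i).2) {c c' : Q.FloorCode} (h : Covers p c c') :
    D.slope c'.1.1.1 (p c'.1.1.2).2 = D.slope c.1.1.1 (p c.1.1.2).2 +
      D.weight c'.1.1.1 c'.1.1.2 := by
  rw [slope, slope, h.1, ← Finset.sum_ite_eq Finset.univ c'.1.1.2 (fun u => D.weight c'.1.1.1 u) |>.trans
    (if_pos (Finset.mem_univ _)), ← Finset.sum_add_distrib]
  refine Finset.sum_congr rfl fun u _ => ?_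
  by_cases h0 : D.weight c'.1.1.1 u = 0
  · simp [h0]
  obtain ⟨b, hb⟩ := exists_floorCode c'.2 h0
  have h1 := h.2.2 b (by rw [hb, h.1])
  rw [hb] at h1
  have h2 := h.2.1
  by_cases h3 : (p u).2 ≤ (p c.1.1.2).2
  · have h4 : c'.1.1.2 ≠ u := by
      rintro rfl
      linarith
    rw [if_pos h3, if_pos (h3.trans h2.le), if_neg h4, add_zero]
  · have h5 := h1 (not_le.1 h3)
    rw [if_neg h3, zero_add]
    refine if_congr ⟨fun h6 => hy (le_antisymm h5 h6), ?_⟩ rfl rfl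
    rintro rfl
    exact le_rfl

/-- Between consecutive vertices of a floor every summand of `floorX` is linear in the height. -/
theorem floorX_covers {c c' : Q.FloorCode} (h : Covers p c c') :
    D.floorX c'.1.1.1 (p c'.1.1.2).2 = D.floorX c.1.1.1 (p c.1.1.2).2 +
      ((p c'.1.1.2).2 - (p c.1.1.2).2) * ((-D.slope c.1.1.1 (p c.1.1.2).2 : ℤ) : ℝ) := by
  rw [floorX, floorX, slope, ← h.1]
  push_cast
  rw [mul_neg, Finset.mul_sum, ← sub_eq_add_neg, sub_sub, ← Finset.sum_add_distrib]
  congr 1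
  refine Finset.sum_congr rfl fun u _ => ?_
  by_cases h0 : D.weight c.1.1.1 u = 0
  · simp [h0]
  obtain ⟨b, hb⟩ := exists_floorCode c.2 h0
  have h1 := h.2.2 b (by rw [hb])
  rw [hb] at h1
  have h2 := h.2.1
  by_cases h3 : (p u).2 ≤ (p c.1.1.2).2
  · rw [if_pos h3, max_eq_left (by linarith : 0 ≤ (p c'.1.1.2).2 - (p u).2),
      max_eq_left (by linarith : 0 ≤ (p c.1.1.2).2 - (p u).2)]
    ring
  · have h5 := h1 (not_le.1 h3)
    simp only at h5
    rw [if_neg h3, max_eq_right (by linarith : (p c'.1.1.2).2 - (p u).2 ≤ 0),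
      max_eq_right (by linarith : (p c.1.1.2).2 - (p u).2 ≤ 0)]
    ring

end Diagram

end TropEP

end

/-! ### Positions, segments and stars of the map given by a diagram -/

section

open scoped Classical

namespace TropEP

namespace Diagram

open PearlChain

variable {d₂ g : ℕ} {Q : PearlChain d₂ g} {Δ : Multiset ℤ} {p : Fin (2 * d₂ + g - 1) → ℝ × ℝ}
  {D : Diagram Q Δ fun i => (p i).1} {d₁ : ℕ}

/-- Each summand of `floorX` is a weight times a function with Lipschitz constant one of the height.
The weights are bounded by the degree, and the stretching beats the sum of these bounds. -/
theorem abs_floorX_sub_lt (hp : Admissible Δ d₁ g p) (hd : D.degree = d₁)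
    {i k : Fin (2 * d₂ + g - 1)} (hik : i ≠ k) (j : Fin (2 * d₂ + g - 1)) :
    |D.floorX i (p j).2 - (p i).1| < |(p i).1 - (p k).1| := by
  refine lt_of_le_of_lt ?_ (hp.stretched i k j i hik)
  rw [floorX, sub_sub_cancel_left, abs_neg]
  calc |∑ u, (D.weight i u : ℝ) * (max ((p j).2 - (p u).2) 0 - max ((p i).2 - (p u).2) 0)|
      ≤ ∑ u, |(D.weight i u : ℝ) * (max ((p j).2 - (p u).2) 0 - max ((p i).2 - (p u).2) 0)| :=
        Finset.abs_sum_le_sum_abs _ _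
    _ ≤ ∑ _u : Fin (2 * d₂ + g - 1), (dirBound Δ d₁ : ℝ) * |(p j).2 - (p i).2| := by
        refine Finset.sum_le_sum fun u _ => ?_
        rw [abs_mul]
        refine mul_le_mul ?_ ?_ (abs_nonneg _) (by positivity)
        · have h1 := D.abs_weight_le i u
          rw [hd] at h1
          have h2 : |D.weight i u| ≤ dirBound Δ d₁ := by
            rw [dirBound]
            push_cast
            push_cast at h1
            omega
          exact_mod_cast h2
        · have h1 := abs_max_sub_max_le_abs ((p j).2 - (p u).2) ((p i).2 - (p u).2) 0
          rwa [sub_sub_sub_cancel_right] at h1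
    _ = ((2 * d₂ + g - 1) * dirBound Δ d₁ : ℕ) * |(p j).2 - (p i).2| := by
        rw [Finset.sum_const, Finset.card_univ, Fintype.card_fin, nsmul_eq_mul, ← mul_assoc]
        push_cast
        ring
    _ ≤ _ := by
        refine mul_le_mul_of_nonneg_right ?_ (abs_nonneg _)
        have h5 := hp.card_points
        have : (2 * d₂ + g - 1) * dirBound Δ d₁ ≤ pointBound Δ d₁ g := by
          rw [pointBound, mul_comm]
          exact Nat.mul_le_mul (Nat.le_succ _) (by omega)
        exact_mod_cast this

theorem floorX_self (i : Fin (2 * d₂ + g - 1)) : D.floorX i (p i).2 = (p i).1 := by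
  simp [floorX]

theorem codePos_diag (i : Fin (2 * d₂ + g - 1)) : D.codePos (Code.diag i) = p i :=
  Prod.ext (floorX_self i) rfl

theorem codeDir_mark (i : Fin (2 * d₂ + g - 1)) : D.codeDir (.mark i) = 0 := rfl

theorem codeDir_hor (k : Q.Dart) : D.codeDir (.hor k) = (D.weight k.1.1 k.1.2, 0) := rfl

theorem codeDir_up (c : Q.FloorCode) :
    D.codeDir (.up c) = (-D.slope c.1.1.1 (p c.1.1.2).2, 1) := rfl

theorem codeDir_down (c : Q.FloorCode) :
    D.codeDir (.down c) = (D.slope c.1.1.1 (p c.1.1.2).2 - D.weight c.1.1.1 c.1.1.2, -1) := rfl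

theorem dart_weight_ne_zero (k : Q.Dart) : D.weight k.1.1 k.1.2 ≠ 0 := (D.weight_ne_zero _ _).2 k.2

/-- Floors are narrow, so at the height of the black point the floor is on the same side of it as
the marked point of the floor. For a straight edge this is the side prescribed by the sign of the
weight, and the length is positive. -/
theorem isSegment_of_straight (hp : Admissible Δ d₁ g p) (hd : D.degree = d₁) {k : Q.Dart}
    (hw : k.1.1 ∈ Q.white) (hk : D.wind k.1.1 k.1.2 = 0) :
    IsSegment (D.codePos k.root) (D.codePos k.swap.root) (D.codeDir (.hor k)) := by
  have hb : k.swap.1.1 ∉ Q.white := (Q.bipartite _ _ k.2).1 hw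
  rw [Dart.root_white hw, Dart.root_black hb, codePos_diag, codeDir_hor]
  have hne : k.1.1 ≠ k.1.2 := k.2.ne
  have h0 := dart_weight_ne_zero (D := D) k
  have h1 := abs_lt.1 (abs_floorX_sub_lt hp hd hne k.1.2)
  set X := D.floorX k.1.1 (p k.1.2).2 with hX
  refine ⟨fun e => h0 (congrArg Prod.fst e), ((p k.1.2).1 - X) / D.weight k.1.1 k.1.2, ?_, ?_, ?_⟩
  · rcases lt_or_gt_of_ne h0 with h2 | h2
    · have h3 := D.lt_of_straight k.1.2 k.1.1 (by rw [← hk]; exact D.wind_swap _ _)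
        (by rw [D.weight_swap k.1.1 k.1.2]; omega)
      rw [abs_of_pos (sub_pos.2 h3)] at h1
      exact div_pos_of_neg_of_neg (by linarith) (by exact_mod_cast h2)
    · have h3 := D.lt_of_straight k.1.1 k.1.2 hk h2
      rw [abs_of_neg (sub_neg.2 h3)] at h1
      exact div_pos (by linarith) (by exact_mod_cast h2)
  · have h0' : (D.weight k.1.1 k.1.2 : ℝ) ≠ 0 := by exact_mod_cast h0
    simp only [codePos, Prod.fst_swap]
    rw [div_mul_cancel₀ _ h0', ← hX]
    ring
  · simp [codePos]

theorem Joined.isSegment (hp : Admissible Δ d₁ g p) (hd : D.degree = d₁) {a b : Q.CodeFlag}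
    (h : D.Joined a b) : IsSegment (D.codePos a.root) (D.codePos b.root) (D.codeDir a) ∧
      D.codeDir b = -D.codeDir a := by
  have hy : Function.Injective fun i => (p i).2 := fun i j h => hp.snd_injective h
  have key : ∀ c c', Covers p c c' →
      IsSegment (D.codePos c.1) (D.codePos c'.1) (D.codeDir (.up c)) ∧
      D.codeDir (.down c') = -D.codeDir (.up c) := by
    intro c c' h
    refine ⟨⟨fun e => by simpa [codeDir_up] using congrArg Prod.snd e,
      (p c'.1.1.2).2 - (p c.1.1.2).2, sub_pos.2 h.2.1, ?_, ?_⟩, ?_⟩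
    · rw [codePos, codePos, codeDir_up]
      exact floorX_covers h
    · simp [codePos, codeDir_up]
    · rw [codeDir_down, codeDir_up, slope_covers hy h]
      simp
  have straight : ∀ k : Q.Dart, D.wind k.1.1 k.1.2 = 0 → k.1.1 ∈ Q.white →
      IsSegment (D.codePos k.root) (D.codePos k.swap.root) (D.codeDir (.hor k)) :=
    fun k hk hw => isSegment_of_straight hp hd hw hk
  have hsw : ∀ k : Q.Dart, D.codeDir (.hor k.swap) = -D.codeDir (.hor k) := fun k => by
    rw [codeDir_hor, codeDir_hor]
    exact Prod.ext (D.weight_swap _ _) neg_zero.symm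
  cases h with
  | hor k hk =>
    refine ⟨?_, hsw k⟩
    by_cases hw : k.1.1 ∈ Q.white
    · exact straight k hk hw
    · have h1 := (straight k.swap (by rw [← hk]; exact D.wind_swap _ _) (by
        by_contra hw'
        exact hw ((Q.bipartite _ _ k.2).2 hw'))).symm
      rwa [hsw, neg_neg] at h1
  | up c c' h => exact key c c' h
  | down c c' h =>
    obtain ⟨h1, h2⟩ := key c c' h
    refine ⟨?_, by rw [h2, neg_neg]⟩
    rw [h2]
    exact h1.symm

noncomputable def codeOpp (D : Diagram Q Δ fun i => (p i).1) : Q.CodeFlag → Q.CodeFlag :=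
  involution D.Joined

theorem codeOpp_eq (hy : Function.Injective fun i => (p i).2) {a b : Q.CodeFlag}
    (h : D.Joined a b) : D.codeOpp a = b :=
  involution_eq (fun _ _ _ h h' => h.right_unique hy h') h

theorem joined_codeOpp {a : Q.CodeFlag} (h : D.codeOpp a ≠ a) : D.Joined a (D.codeOpp a) :=
  rel_involution h

theorem codeOpp_ne (hy : Function.Injective fun i => (p i).2) {a b : Q.CodeFlag}
    (h : D.Joined a b) : D.codeOpp a ≠ a := by
  rw [codeOpp_eq hy h]
  rintro rfl
  exact h.irrefl

theorem codeOpp_mark (i : Fin (2 * d₂ + g - 1)) : D.codeOpp (.mark i) = .mark i :=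
  involution_of_not fun ⟨b, h⟩ => by cases h

/-- The horizontal or contracted flag at a vertex on a floor. -/
noncomputable def _root_.TropEP.PearlChain.FloorCode.level (c : Q.FloorCode) : Q.CodeFlag :=
  if h : c.1.1.1 = c.1.1.2 then .mark c.1.1.1 else .hor ⟨c.1.1, (c.1.2.resolve_left h).1⟩

theorem root_hor (k : Q.Dart) : CodeFlag.root (.hor k) = k.root := rfl

theorem root_eq_floor_iff (c : Q.FloorCode) (h : Q.CodeFlag) :
    h.root = c.1 ↔ h = FloorCode.level c ∨ h = .up c ∨ h = .down c := by
  constructor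
  · intro hr
    rcases h with i | k | ⟨c', b⟩
    · left
      have h1 : c.1.1 = (i, i) := congrArg Subtype.val hr.symm
      have h2 : c.1.1.1 = c.1.1.2 := by rw [h1]
      rw [FloorCode.level, dif_pos h2, h1]
    · left
      have h1 : k.root = c.1 := hr
      have hw : k.1.1 ∈ Q.white := by
        rw [← k.root_fst, h1]
        exact c.2
      rw [Dart.root_white hw] at h1
      have h2 : k.1 = c.1.1 := congrArg Subtype.val h1
      have h3 : ¬ c.1.1.1 = c.1.1.2 := by
        rw [← h2]
        exact k.2.ne
      rw [FloorCode.level, dif_neg h3]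
      exact congrArg CodeFlag.hor (Subtype.ext h2)
    · right
      obtain rfl : c' = c := Subtype.ext hr
      rcases b with _ | _
      · exact Or.inr rfl
      · exact Or.inl rfl
  · rintro (rfl | rfl | rfl)
    · rw [FloorCode.level]
      split_ifs with h
      · exact Subtype.ext (Prod.ext rfl h)
      · rw [root_hor, Dart.root_white (show _ ∈ Q.white from c.2)]
    · rfl
    · rfl

theorem codeDir_level (c : Q.FloorCode) :
    D.codeDir (FloorCode.level c) = (D.weight c.1.1.1 c.1.1.2, 0) := by
  rw [FloorCode.level]
  split_ifs with h
  · rw [codeDir_mark, ← h, D.weight_self]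
    rfl
  · rw [codeDir_hor]

theorem level_ne_vert (c : Q.FloorCode) (x : Q.FloorCode × Bool) :
    FloorCode.level c ≠ Sum.inr (Sum.inr x) := by
  rw [FloorCode.level]
  split_ifs <;> simp

theorem exists_black_darts {i : Fin (2 * d₂ + g - 1)} (hi : i ∉ Q.white) : ∃ j k, ∃ hj : Q.graph.Adj i j,
    ∃ hk : Q.graph.Adj i k, j ≠ k ∧ D.weight i j + D.weight i k = 0 ∧
      ∀ h : Q.CodeFlag, h.root = Code.diag i ↔
        h = .mark i ∨ h = .hor ⟨(i, j), hj⟩ ∨ h = .hor ⟨(i, k), hk⟩ := by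
  obtain ⟨j, k, hjk, hN⟩ := Set.ncard_eq_two.1 (Q.black_valence i hi)
  have hadj : ∀ l, Q.graph.Adj i l ↔ l = j ∨ l = k := fun l => by
    rw [← SimpleGraph.mem_neighborSet, hN]
    simp
  refine ⟨j, k, (hadj j).2 (Or.inl rfl), (hadj k).2 (Or.inr rfl), hjk, ?_, fun h => ⟨fun hr => ?_, ?_⟩⟩
  · have h1 := D.leaking.1 i hi
    simp only [neg_eq_zero] at h1
    rw [← Finset.sum_pair hjk, ← h1]
    refine Finset.sum_subset (Finset.subset_univ _) fun l _ hl => D.weight_eq_zero fun h => hl ?_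
    simpa using (hadj l).1 h
  · rcases h with i' | l | ⟨c, b⟩
    · exact Or.inl (congrArg CodeFlag.mark (congrArg (fun c : Q.Code => c.1.1) hr))
    · right
      have h1 : l.1.1 = i := by
        rw [← l.root_fst]
        exact congrArg (fun c : Q.Code => c.1.1) hr
      obtain ⟨⟨a, b⟩, hab⟩ := l
      obtain rfl : a = i := h1
      rcases (hadj b).1 hab with rfl | rfl
      · exact Or.inl rfl
      · exact Or.inr rfl
    · have h1 : c.1 = Code.diag i := hr
      have h2 := c.2
      rw [h1] at h2
      exact absurd h2 hi
  · rintro (rfl | rfl | rfl)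
    · rfl
    · exact Dart.root_black hi
    · exact Dart.root_black hi

/-- Every vertex has three flags, and they are balanced. -/
theorem exists_star (c : Q.Code) : ∃ a b e : Q.CodeFlag, a ≠ b ∧ a ≠ e ∧ b ≠ e ∧
    (∀ h : Q.CodeFlag, h.root = c ↔ h = a ∨ h = b ∨ h = e) ∧
    D.codeDir a + D.codeDir b + D.codeDir e = 0 := by
  by_cases hc : c.1.1 ∈ Q.white
  · refine ⟨FloorCode.level ⟨c, hc⟩, .up ⟨c, hc⟩, .down ⟨c, hc⟩, level_ne_vert _ _, level_ne_vert _ _,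
      by simp, root_eq_floor_iff ⟨c, hc⟩, ?_⟩
    rw [codeDir_level, codeDir_up, codeDir_down]
    refine Prod.ext ?_ (by simp)
    simp only [Prod.fst_add, Prod.fst_zero]
    ring
  · have h1 : c.1.1 = c.1.2 := c.2.resolve_right fun h => hc h.2
    obtain ⟨j, k, hj, hk, hjk, hs, hall⟩ := exists_black_darts (D := D) hc
    have h2 : c = Code.diag c.1.1 := Subtype.ext (Prod.ext rfl h1.symm)
    refine ⟨.mark c.1.1, .hor ⟨(c.1.1, j), hj⟩, .hor ⟨(c.1.1, k), hk⟩, by simp, by simp,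
      by simpa using hjk, fun h => by rw [← hall h, ← h2], ?_⟩
    rw [codeDir_mark, codeDir_hor, codeDir_hor, zero_add]
    exact Prod.ext hs (add_zero 0)

theorem filter_star {c : Q.Code} [DecidablePred fun h : Q.CodeFlag => h.root = c] {a b e : Q.CodeFlag}
    (h : ∀ h : Q.CodeFlag, h.root = c ↔ h = a ∨ h = b ∨ h = e) :
    (Finset.univ.filter fun h : Q.CodeFlag => h.root = c) = {a, b, e} := by
  ext x
  simp [h]

end Diagram

end TropEP

end

/-! ### The cut map of a diagram: lines and gluing -/

section

open scoped Classical

namespace TropEP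

namespace Diagram

open PearlChain

variable {d₂ g : ℕ} {Q : PearlChain d₂ g} {Δ : Multiset ℤ} {p : Fin (2 * d₂ + g - 1) → ℝ × ℝ}
  {d₁ : ℕ}

theorem exists_codeLen (D : Diagram Q Δ fun i => (p i).1) (hp : Admissible Δ d₁ g p)
    (hd : D.degree = d₁) :
    ∃ len : Q.CodeFlag → ENNReal, (∀ h, 0 < len h) ∧ (∀ h, len (D.codeOpp h) = len h) ∧
      (∀ h, len h = ⊤ ↔ D.codeOpp h = h) ∧
      (∀ h, D.codeOpp h ≠ h → (D.codePos (D.codeOpp h).root).1 =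
        (D.codePos h.root).1 + (len h).toReal * ((D.codeDir h).1 : ℝ)) ∧
      ∀ h, D.codeOpp h ≠ h → (D.codePos (D.codeOpp h).root).2 =
        (D.codePos h.root).2 + (len h).toReal * ((D.codeDir h).2 : ℝ) :=
  exists_length CodeFlag.root D.codeOpp D.codePos D.codeDir
    (involution_involution (fun _ _ h => h.symm)
      fun _ _ _ h h' => h.right_unique (fun _ _ h => hp.snd_injective h) h')
    (fun _ e => ((joined_codeOpp e).isSegment hp hd).2)
    fun _ e => ((joined_codeOpp e).isSegment hp hd).1

/-- The oriented edges that go to the right. -/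
abbrev RightDart (D : Diagram Q Δ fun i => (p i).1) : Type :=
  {k : Q.Dart // 0 < D.weight k.1.1 k.1.2}

/-- The lines: an edge that crosses the cut `t` times passes through `t - 1` lines. -/
abbrev Line (D : Diagram Q Δ fun i => (p i).1) : Type :=
  Σ k : D.RightDart, Fin (D.wind k.1.1.1 k.1.1.2 - 1)

/-- The crossings of edges with the cut. -/
abbrev Slot (D : Diagram Q Δ fun i => (p i).1) : Type :=
  Σ k : D.RightDart, Fin (D.wind k.1.1.1 k.1.1.2)

/-- The curve in the plane given by a diagram. -/
noncomputable abbrev toPlaneMap (D : Diagram Q Δ fun i => (p i).1) (hp : Admissible Δ d₁ g p)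
    (hd : D.degree = d₁) : PlaneMap (2 * d₂ + g - 1) where
  V := Q.Code
  H := Q.CodeFlag
  Ln := D.Line
  root := CodeFlag.root
  opp := D.codeOpp
  opp_opp := involution_involution (fun _ _ h => h.symm)
      fun _ _ _ h h' => h.right_unique (fun _ _ h => hp.snd_injective h) h'
  len := (D.exists_codeLen hp hd).choose
  len_pos := (D.exists_codeLen hp hd).choose_spec.1
  len_opp := (D.exists_codeLen hp hd).choose_spec.2.1
  len_eq_top := (D.exists_codeLen hp hd).choose_spec.2.2.1
  three_le_valence := fun v => by
    obtain ⟨a, b, e, hab, hae, hbe, hall, -⟩ := exists_star (D := D) v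
    refine Eq.ge ?_
    convert Finset.card_eq_three.2 ⟨a, b, e, hab, hae, hbe, filter_star hall⟩
  pos := D.codePos
  dir := D.codeDir
  dir_opp := fun _ e => ((joined_codeOpp e).isSegment hp hd).2
  pos_opp_fst := (D.exists_codeLen hp hd).choose_spec.2.2.2.1
  pos_opp_snd := (D.exists_codeLen hp hd).choose_spec.2.2.2.2
  balanced := fun v => by
    obtain ⟨a, b, e, hab, hae, hbe, hall, hs⟩ := exists_star (D := D) v
    have : ∑ h ∈ {a, b, e}, D.codeDir h = 0 := by
      rw [Finset.sum_insert (by simp [hab, hae]), Finset.sum_pair hbe, ← hs, add_assoc]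
    rw [← filter_star hall] at this
    convert this
  mark := CodeFlag.mark
  mark_injective := Sum.inl_injective
  mark_end := codeOpp_mark
  mark_contracted := codeDir_mark
  lineWeight := fun l => (D.weight l.1.1.1.1 l.1.1.1.2).natAbs
  lineWeight_pos := fun l => Int.natAbs_pos.2 l.1.2.ne'
  lineHeight := fun l => (D.codePos (CodeFlag.hor l.1.1).root).2

variable {D : Diagram Q Δ fun i => (p i).1}

theorem codeOpp_hor_ne_iff (hp : Admissible Δ d₁ g p) (k : Q.Dart) :
    D.codeOpp (.hor k) ≠ .hor k ↔ D.wind k.1.1 k.1.2 = 0 := by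
  have hy : Function.Injective fun i => (p i).2 := fun i j h => hp.snd_injective h
  constructor
  · intro h
    generalize hx : CodeFlag.hor k = x at h
    have h1 := joined_codeOpp h
    generalize D.codeOpp x = y at h1
    cases h1 with
    | hor k' hk' =>
      obtain rfl : k = k' := Sum.inl_injective (Sum.inr_injective hx)
      exact hk'
    | up c c' h => simp at hx
    | down c c' h => simp at hx
  · exact fun h => codeOpp_ne hy (.hor k h)

theorem codeOpp_hor (hp : Admissible Δ d₁ g p) {k : Q.Dart} (h : D.wind k.1.1 k.1.2 = 0) :
    D.codeOpp (.hor k) = .hor k.swap :=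
  codeOpp_eq (fun _ _ h => hp.snd_injective h) (.hor k h)

/-- Where an edge leaves the plane at its crossing number `s`: at its initial flag for `s = 0`, and
at the line number `s - 1` afterwards. -/
def slotRight (s : D.Slot) : Q.CodeFlag ⊕ D.Line :=
  if h : s.2.1 = 0 then Sum.inl (.hor s.1.1) else Sum.inr ⟨s.1, ⟨s.2.1 - 1, by omega⟩⟩

/-- Where the edge enters again after its crossing number `s`: on the line number `s`, or at its
final flag if this was the last crossing. Hence there is one line fewer than crossings. -/
def slotLeft (s : D.Slot) : Q.CodeFlag ⊕ D.Line :=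
  if h : s.2.1 + 1 < D.wind s.1.1.1.1 s.1.1.1.2 then Sum.inr ⟨s.1, ⟨s.2.1, by omega⟩⟩
  else Sum.inl (.hor s.1.1.swap)

theorem slot_ext {s s' : D.Slot} (h : s.1.1 = s'.1.1) (h' : s.2.1 = s'.2.1) : s = s' := by
  obtain ⟨⟨k, hk⟩, s⟩ := s
  obtain ⟨⟨k', hk'⟩, s'⟩ := s'
  simp only at h
  subst h
  simp only [Sigma.mk.injEq, heq_eq_eq, true_and]
  exact Fin.ext h'

theorem line_ext {l l' : D.Line} (h : l = l') : l.1.1 = l'.1.1 ∧ l.2.1 = l'.2.1 := by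
  rw [h]
  exact ⟨rfl, rfl⟩

theorem slotRight_injective : Function.Injective (slotRight (D := D)) := by
  intro s s' h
  simp only [slotRight] at h
  split_ifs at h with h1 h2 h2
  · exact slot_ext (Sum.inl_injective (Sum.inr_injective (Sum.inl_injective h))) (h1.trans h2.symm)
  · obtain ⟨h3, h4⟩ := line_ext (Sum.inr_injective h)
    simp only at h4
    exact slot_ext h3 (by omega)

theorem slotLeft_injective : Function.Injective (slotLeft (D := D)) := by
  intro s s' h
  simp only [slotLeft] at h
  have key : ∀ s : D.Slot, s.2.1 < D.wind s.1.1.1.1 s.1.1.1.2 := fun s => s.2.2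
  split_ifs at h with h1 h2 h2
  · obtain ⟨h3, h4⟩ := line_ext (Sum.inr_injective h)
    exact slot_ext h3 h4
  · have h3 : s.1.1.swap = s'.1.1.swap :=
      Sum.inl_injective (Sum.inr_injective (Sum.inl_injective h))
    have h4 : s.1.1 = s'.1.1 := Subtype.ext (Prod.swap_injective (congrArg Subtype.val h3))
    have h5 := key s
    have h6 := key s'
    have h7 : D.wind s.1.1.1.1 s.1.1.1.2 = D.wind s'.1.1.1.1 s'.1.1.1.2 := by rw [h4]
    exact slot_ext h4 (by omega)

variable (hp : Admissible Δ d₁ g p) (hd : D.degree = d₁)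

theorem slotRight_mem (s : D.Slot) : slotRight s ∈ (D.toPlaneMap hp hd).rightEnds := by
  rw [slotRight]
  split_ifs with h
  · refine ⟨?_, s.1.2, rfl⟩
    by_contra h1
    have h2 := (codeOpp_hor_ne_iff hp s.1.1).1 h1
    have := s.2.2
    omega
  · exact PlaneMap.inr_mem_rightEnds _

theorem slotLeft_mem (s : D.Slot) : slotLeft s ∈ (D.toPlaneMap hp hd).leftEnds := by
  rw [slotLeft]
  split_ifs with h
  · exact PlaneMap.inr_mem_leftEnds _
  · refine ⟨?_, ?_, rfl⟩
    · by_contra h1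
      have h2 : D.wind _ _ = 0 := (codeOpp_hor_ne_iff hp s.1.1.swap).1 h1
      rw [Prod.fst_swap, Prod.snd_swap, D.wind_swap] at h2
      have := s.2.2
      omega
    · have h1 := D.weight_swap s.1.1.1.1 s.1.1.1.2
      have h2 := s.1.2
      change D.weight s.1.1.1.2 s.1.1.1.1 < 0
      omega

theorem exists_dart_of_level {h : Q.CodeFlag} (h2 : (D.codeDir h).2 = 0) (h1 : (D.codeDir h).1 ≠ 0) :
    ∃ k, h = .hor k := by
  rcases h with i | k | ⟨c, b⟩
  · exact absurd rfl h1
  · exact ⟨k, rfl⟩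
  · rcases b with _ | _
    · rw [codeDir_down] at h2
      omega
    · rw [codeDir_up] at h2
      omega

theorem slotRight_surjective {x : Q.CodeFlag ⊕ D.Line} (hx : x ∈ (D.toPlaneMap hp hd).rightEnds) :
    ∃ s, slotRight s = x := by
  rcases x with h | ⟨k, l⟩
  · obtain ⟨h1, h2, h3⟩ := hx
    obtain ⟨k, rfl⟩ := exists_dart_of_level h3 h2.ne'
    have h4 : D.wind k.1.1 k.1.2 ≠ 0 := fun h4 => (codeOpp_hor_ne_iff hp k).2 h4 h1
    exact ⟨⟨⟨k, h2⟩, ⟨0, by simp only; omega⟩⟩, dif_pos rfl⟩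
  · exact ⟨⟨k, ⟨l.1 + 1, by omega⟩⟩, dif_neg (by simp)⟩

theorem slotLeft_surjective {x : Q.CodeFlag ⊕ D.Line} (hx : x ∈ (D.toPlaneMap hp hd).leftEnds) :
    ∃ s, slotLeft s = x := by
  rcases x with h | ⟨k, l⟩
  · obtain ⟨h1, h2, h3⟩ := hx
    obtain ⟨k, rfl⟩ := exists_dart_of_level h3 h2.ne
    have h4 : D.wind k.1.1 k.1.2 ≠ 0 := fun h4 => (codeOpp_hor_ne_iff hp k).2 h4 h1
    have h5 : 0 < D.weight k.swap.1.1 k.swap.1.2 := by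
      have h6 := D.weight_swap k.1.1 k.1.2
      change D.weight k.1.1 k.1.2 < 0 at h2
      change 0 < D.weight k.1.2 k.1.1
      omega
    have h6 : D.wind k.swap.1.1 k.swap.1.2 = D.wind k.1.1 k.1.2 := D.wind_swap _ _
    have h7 : D.wind k.swap.1.1 k.swap.1.2 ≠ 0 := h6 ▸ h4
    refine ⟨⟨⟨k.swap, h5⟩, ⟨D.wind k.swap.1.1 k.swap.1.2 - 1,
      Nat.sub_lt (Nat.pos_of_ne_zero h7) one_pos⟩⟩, ?_⟩
    exact dif_neg (Nat.not_lt.2 (Nat.sub_add_cancel (Nat.pos_of_ne_zero h7)).ge)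
  · exact ⟨⟨k, ⟨l.1, by omega⟩⟩, dif_pos (by simp only; omega)⟩

noncomputable def rightEquiv : D.Slot ≃ (D.toPlaneMap hp hd).rightEnds :=
  Equiv.ofBijective (fun s => ⟨slotRight s, slotRight_mem hp hd s⟩)
    ⟨fun _ _ h => slotRight_injective (congrArg Subtype.val h), fun x => by
      obtain ⟨s, hs⟩ := slotRight_surjective hp hd x.2
      exact ⟨s, Subtype.ext hs⟩⟩

noncomputable def leftEquiv : D.Slot ≃ (D.toPlaneMap hp hd).leftEnds :=
  Equiv.ofBijective (fun s => ⟨slotLeft s, slotLeft_mem hp hd s⟩)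
    ⟨fun _ _ h => slotLeft_injective (congrArg Subtype.val h), fun x => by
      obtain ⟨s, hs⟩ := slotLeft_surjective hp hd x.2
      exact ⟨s, Subtype.ext hs⟩⟩

theorem height_swap (k : Q.Dart) : (D.codePos (Dart.root k.swap)).2 = (D.codePos k.root).2 := by
  have key : ∀ k : Q.Dart, k.1.1 ∈ Q.white → (D.codePos (Dart.root k.swap)).2 = (D.codePos k.root).2 := by
    intro k hw
    have hb : k.swap.1.1 ∉ Q.white := (Q.bipartite _ _ k.2).1 hw
    rw [Dart.root_white hw, Dart.root_black hb]
    rfl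
  by_cases hw : k.1.1 ∈ Q.white
  · exact key k hw
  · refine (key k.swap ?_).symm
    by_contra hw'
    exact hw ((Q.bipartite _ _ k.2).2 hw')

theorem endWeight_slotRight (s : D.Slot) : (D.toPlaneMap hp hd).endWeight (slotRight s) =
    (D.weight s.1.1.1.1 s.1.1.1.2).natAbs := by
  rw [slotRight]
  split_ifs <;> rfl

theorem endWeight_slotLeft (s : D.Slot) : (D.toPlaneMap hp hd).endWeight (slotLeft s) =
    (D.weight s.1.1.1.1 s.1.1.1.2).natAbs := by
  rw [slotLeft]
  split_ifs
  · rfl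
  · change (D.weight s.1.1.1.2 s.1.1.1.1).natAbs = _
    rw [D.weight_swap s.1.1.1.1 s.1.1.1.2, Int.natAbs_neg]

theorem endHeight_slotRight (s : D.Slot) : (D.toPlaneMap hp hd).endHeight (slotRight s) =
    (D.codePos s.1.1.root).2 := by
  rw [slotRight]
  split_ifs <;> rfl

theorem endHeight_slotLeft (s : D.Slot) : (D.toPlaneMap hp hd).endHeight (slotLeft s) =
    (D.codePos s.1.1.root).2 := by
  rw [slotLeft]
  split_ifs
  · rfl
  · exact height_swap s.1.1

/-- The cut tropical stable map given by a diagram. -/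
noncomputable abbrev toCutMap : CutMap (2 * d₂ + g - 1) where
  toPlaneMap := D.toPlaneMap hp hd
  -- Both kinds of ends are indexed by the crossings, and the two ends of one crossing are glued.
  glue := (rightEquiv hp hd).symm.trans (leftEquiv hp hd)
  glue_weight := fun e => by
    obtain ⟨s, rfl⟩ := (rightEquiv hp hd).surjective e
    rw [Equiv.trans_apply, Equiv.symm_apply_apply]
    exact (endWeight_slotLeft hp hd s).trans (endWeight_slotRight hp hd s).symm
  glue_height := fun e => by
    obtain ⟨s, rfl⟩ := (rightEquiv hp hd).surjective e
    rw [Equiv.trans_apply, Equiv.symm_apply_apply]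
    exact (endHeight_slotLeft hp hd s).trans (endHeight_slotRight hp hd s).symm

theorem advance_slotRight (s : D.Slot) :
    advance (toCutMap hp hd).glue (slotRight s) = slotLeft s := by
  rw [advance_of_mem _ (slotRight_mem hp hd s)]
  have : (⟨slotRight s, slotRight_mem hp hd s⟩ : (D.toPlaneMap hp hd).rightEnds) =
    rightEquiv hp hd s := rfl
  exact congrArg Subtype.val ((congrArg (leftEquiv hp hd) ((rightEquiv hp hd).symm_apply_apply s)))

theorem follow_hor (k : D.RightDart) {s : ℕ} (hs : s < D.wind k.1.1.1 k.1.1.2) :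
    (toCutMap hp hd).follow (.hor k.1) s = slotRight ⟨k, ⟨s, hs⟩⟩ := by
  induction s with
  | zero => rw [slotRight, dif_pos rfl]; rfl
  | succ s ih =>
    rw [CutMap.follow_succ, ih (by omega)]
    refine (advance_slotRight hp hd _).trans ?_
    rw [slotLeft, dif_pos hs, slotRight, dif_neg (by simp)]
    rfl

theorem follow_wind (k : D.RightDart) (h0 : D.wind k.1.1.1 k.1.1.2 ≠ 0) :
    (toCutMap hp hd).follow (.hor k.1) (D.wind k.1.1.1 k.1.1.2) = Sum.inl (.hor k.1.swap) := by
  obtain ⟨s, hs⟩ := Nat.exists_eq_succ_of_ne_zero h0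
  rw [hs, Nat.succ_eq_add_one, CutMap.follow_succ, follow_hor hp hd k (by omega)]
  refine (advance_slotRight hp hd _).trans ?_
  rw [slotLeft, dif_neg (by simp only; omega)]

theorem crossings_hor (k : D.RightDart) :
    (toCutMap hp hd).crossings (.hor k.1) = D.wind k.1.1.1 k.1.1.2 := by
  have hr : (toCutMap hp hd).IsRight (.hor k.1) := ⟨rfl, k.2⟩
  by_cases h0 : D.wind k.1.1.1 k.1.1.2 = 0
  · rw [h0, hr.crossings_eq_zero_iff]
    exact (codeOpp_hor_ne_iff hp k.1).2 h0
  · refine le_antisymm (Nat.sInf_le ?_) (le_csInf ⟨_, hr.crossings_spec⟩ fun s hs => ?_)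
    · intro h1
      have h2 := follow_wind hp hd k h0
      rw [CutMap.follow] at h2
      rw [h2] at h1
      have h3 : 0 < D.weight k.1.1.2 k.1.1.1 := h1.2.1
      have h4 := D.weight_swap k.1.1.1 k.1.1.2
      have h5 := k.2
      omega
    · by_contra hlt
      refine hs ?_
      have h2 := follow_hor hp hd k (not_le.1 hlt)
      rw [CutMap.follow] at h2
      rw [h2]
      exact slotRight_mem hp hd _

theorem elevator_hor (k : D.RightDart) :
    (toCutMap hp hd).Elevator (.hor k.1) (.hor k.1.swap) := by
  have hr : (toCutMap hp hd).IsRight (.hor k.1) := ⟨rfl, k.2⟩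
  by_cases h0 : D.wind k.1.1.1 k.1.1.2 = 0
  · exact Or.inl ⟨(codeOpp_hor_ne_iff hp k.1).2 h0, (codeOpp_hor hp h0).symm⟩
  · refine Or.inr (hr.transGen ?_ ?_)
    · rw [crossings_hor]
      exact follow_wind hp hd k h0
    · by_contra h1
      exact h0 ((codeOpp_hor_ne_iff hp k.1).1 h1)

theorem linked_hor (k : Q.Dart) : (toCutMap hp hd).Linked (.hor k) (.hor k.swap) := by
  rcases lt_or_gt_of_ne (dart_weight_ne_zero (D := D) k) with h | h
  · have h1 : 0 < D.weight k.swap.1.1 k.swap.1.2 := by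
      have h6 := D.weight_swap k.1.1 k.1.2
      change 0 < D.weight k.1.2 k.1.1
      omega
    exact Or.inr ⟨⟨rfl, h1⟩, elevator_hor hp hd ⟨k.swap, h1⟩⟩
  · exact Or.inl ⟨⟨rfl, h⟩, elevator_hor hp hd ⟨k, h⟩⟩

theorem exists_of_linked {h h' : Q.CodeFlag} (hl : (toCutMap hp hd).Linked h h') :
    ∃ k, h = .hor k ∧ h' = .hor k.swap := by
  obtain ⟨h1, h2⟩ := hl.isHorizontal
  obtain ⟨k, rfl⟩ := exists_dart_of_level h1 h2
  exact ⟨k, rfl, hl.unique (linked_hor hp hd k)⟩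

end Diagram

end TropEP

end

/-! ### The map of a diagram is connected, simple and of the right leaky degree -/

section

open scoped Classical

namespace TropEP

namespace CutMap

variable {n : ℕ} {A : CutMap n}

theorem reachable_of_gluedAdj {a b : A.V ⊕ A.Ln} (h : A.gluedAdj a b) : A.gluedGraph.Reachable a b := by
  by_cases e : a = b
  · rw [e]
  · exact SimpleGraph.Adj.reachable ((SimpleGraph.fromRel_adj _ _ _).2 ⟨e, Or.inl h⟩)

theorem SameFloor.reachable {v w : A.V} (h : A.SameFloor v w) :
    A.gluedGraph.Reachable (Sum.inl v) (Sum.inl w) :=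
  h.induction (P := fun w => A.gluedGraph.Reachable (Sum.inl v) (Sum.inl w)) (.refl _)
    fun k hk _ _ h => h.trans (reachable_of_gluedAdj (Or.inl ⟨k, hk, rfl, rfl⟩))

theorem reachable_follow {h : A.H} {k : ℕ} (hk : k ≤ A.crossings h) :
    A.gluedGraph.Reachable (Sum.inl (A.root h)) (A.endNode (A.follow h k)) := by
  induction k with
  | zero => exact .refl _
  | succ k ih =>
    refine (ih (by omega)).trans (reachable_of_gluedAdj (Or.inr ⟨⟨_, follow_mem hk⟩, rfl, ?_⟩))
    rw [follow_succ, advance_of_mem _ (follow_mem hk)]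

theorem Elevator.reachable {h h' : A.H} (hr : A.IsRight h) (he : A.Elevator h h') :
    A.gluedGraph.Reachable (Sum.inl (A.root h)) (Sum.inl (A.root h')) := by
  by_cases h0 : A.crossings h = 0
  · have h1 := hr.crossings_eq_zero_iff.1 h0
    obtain rfl := elevator_unique_right he (Or.inl ⟨h1, rfl⟩)
    exact reachable_of_gluedAdj (Or.inl ⟨h, h1, rfl, rfl⟩)
  · have h1 := reachable_follow (A := A) (h := h) le_rfl
    rwa [follow_crossings hr h0 he] at h1

theorem Linked.reachable {h h' : A.H} (hl : A.Linked h h') :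
    A.gluedGraph.Reachable (Sum.inl (A.root h)) (Sum.inl (A.root h')) := by
  rcases hl with ⟨h1, h2⟩ | ⟨h1, h2⟩
  · exact h2.reachable h1
  · exact (h2.reachable h1).symm

end CutMap

theorem not_sameRay {u w : ℤ × ℤ} (hu : u ≠ 0) (hw : w ≠ 0)
    (h : ∀ r s : ℤ, 0 < r → 0 < s → r * u.2 ≠ s * w.2) : ¬ SameRay ℤ u w := by
  rintro (h1 | h1 | ⟨r, s, hr, hs, h1⟩)
  · exact hu h1
  · exact hw h1
  · exact h r s hr hs (congrArg Prod.snd h1)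

namespace Diagram

open PearlChain

variable {d₂ g : ℕ} {Q : PearlChain d₂ g} {Δ : Multiset ℤ} {p : Fin (2 * d₂ + g - 1) → ℝ × ℝ}
  {d₁ : ℕ} {D : Diagram Q Δ fun i => (p i).1} (hp : Admissible Δ d₁ g p) (hd : D.degree = d₁)

theorem floorAdj_fst {v w : Q.Code} (h : (toCutMap hp hd).FloorAdj v w) : v.1.1 = w.1.1 := by
  obtain ⟨k, h1, h2, rfl, rfl⟩ := h
  have h3 : D.Joined k (D.codeOpp k) := joined_codeOpp h1
  change ¬ ((D.codeDir k).2 = 0 ∧ (D.codeDir k).1 ≠ 0) at h2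
  change k.root.1.1 = (D.codeOpp k).root.1.1
  generalize D.codeOpp k = k' at h3
  cases h3 with
  | hor k hk => exact absurd ⟨rfl, dart_weight_ne_zero k⟩ h2
  | up c c' h => exact h.1
  | down c c' h => exact h.1.symm

theorem floorAdj_of_covers {c c' : Q.FloorCode} (h : Covers p c c') :
    (toCutMap hp hd).FloorAdj c.1 c'.1 := by
  have hy : Function.Injective fun i => (p i).2 := fun i j h => hp.snd_injective h
  have h1 : D.Joined (.up c) (.down c') := .up c c' h
  refine ⟨.up c, codeOpp_ne hy h1, fun h2 => ?_, rfl, ?_⟩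
  · have h3 : (1 : ℤ) = 0 := h2.1
    omega
  · change CodeFlag.root (D.codeOpp (.up c)) = _
    rw [codeOpp_eq hy h1]
    rfl

theorem exists_bottom (p : Fin (2 * d₂ + g - 1) → ℝ × ℝ) {i : Fin (2 * d₂ + g - 1)}
    (hi : i ∈ Q.white) : ∃ c : Q.FloorCode, c.1.1.1 = i ∧
      ∀ b : Q.FloorCode, b.1.1.1 = i → (p c.1.1.2).2 ≤ (p b.1.1.2).2 := by
  have : Nonempty {c : Q.FloorCode // c.1.1.1 = i} := ⟨⟨⟨Code.diag i, hi⟩, rfl⟩⟩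
  obtain ⟨m, hm⟩ := Finite.exists_min fun c : {c : Q.FloorCode // c.1.1.1 = i} => (p c.1.1.1.2).2
  exact ⟨m.1, m.2, fun b hb => hm ⟨b, hb⟩⟩

theorem exists_top (p : Fin (2 * d₂ + g - 1) → ℝ × ℝ) {i : Fin (2 * d₂ + g - 1)}
    (hi : i ∈ Q.white) : ∃ c : Q.FloorCode, c.1.1.1 = i ∧
      ∀ b : Q.FloorCode, b.1.1.1 = i → (p b.1.1.2).2 ≤ (p c.1.1.2).2 := by
  have : Nonempty {c : Q.FloorCode // c.1.1.1 = i} := ⟨⟨⟨Code.diag i, hi⟩, rfl⟩⟩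
  obtain ⟨m, hm⟩ := Finite.exists_max fun c : {c : Q.FloorCode // c.1.1.1 = i} => (p c.1.1.1.2).2
  exact ⟨m.1, m.2, fun b hb => hm ⟨b, hb⟩⟩

/-- From any code on a floor one descends along covering relations to the lowest one; a lowest
counterexample would have a code right below it that is connected. -/
theorem sameFloor_iff_fst {v w : Q.Code} : (toCutMap hp hd).SameFloor v w ↔ v.1.1 = w.1.1 := by
  constructor
  · intro h
    refine h.induction (P := fun w : Q.Code => v.1.1 = w.1.1) rfl fun k hk hk' _ ih => ih.trans ?_
    exact floorAdj_fst hp hd ⟨k, hk, hk', rfl, rfl⟩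
  · intro h
    by_cases hw : v.1.1 ∈ Q.white
    · have key : ∀ b : Q.FloorCode, (∀ a : Q.FloorCode, a.1.1.1 = b.1.1.1 →
          (p b.1.1.2).2 ≤ (p a.1.1.2).2) → ∀ c : Q.FloorCode, c.1.1.1 = b.1.1.1 →
          (toCutMap hp hd).SameFloor c.1 b.1 := by
        intro b hb
        by_contra! hex
        let T := {c : Q.FloorCode // c.1.1.1 = b.1.1.1 ∧ ¬ (toCutMap hp hd).SameFloor c.1 b.1}
        have : Nonempty T := by
          obtain ⟨c, hc⟩ := hex
          exact ⟨⟨c, hc⟩⟩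
        obtain ⟨⟨m, h1, h2⟩, hm⟩ := Finite.exists_min fun c : T => (p c.1.1.1.2).2
        have h3 : (p b.1.1.2).2 < (p m.1.1.2).2 := by
          refine lt_of_le_of_ne (hb m h1) fun e => h2 ?_
          rw [floorCode_ext (fun i j h => hp.snd_injective h) h1 e.symm]
          exact CutMap.sameFloor_refl _
        obtain ⟨c', hc'⟩ := exists_covered h1.symm h3
        have h4 := (floorAdj_of_covers hp hd hc').sameFloor
        refine absurd (hm ⟨c', hc'.1.trans h1, fun h5 => h2 (h4.symm.trans h5)⟩) (not_le.2 hc'.2.1)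
      obtain ⟨b, hb1, hb2⟩ := exists_bottom p hw
      have k1 := key b (fun a ha => hb2 a (ha.trans hb1)) ⟨v, hw⟩ hb1.symm
      have k2 := key b (fun a ha => hb2 a (ha.trans hb1)) ⟨w, h ▸ hw⟩ (h.symm.trans hb1.symm)
      exact k1.trans k2.symm
    · have h1 : v.1.1 = v.1.2 := v.2.resolve_right fun h => hw h.2
      have h2 : w.1.1 = w.1.2 := w.2.resolve_right fun h' => hw (h ▸ h'.2)
      have : v = w := Subtype.ext (Prod.ext h (by rw [← h1, ← h2, h]))
      rw [this]
      exact CutMap.sameFloor_refl _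

theorem isFloorVertex_iff_white {v : Q.Code} : (toCutMap hp hd).IsFloorVertex v ↔ v.1.1 ∈ Q.white := by
  constructor
  · rintro ⟨k, rfl, h⟩
    rcases k with i | k | c
    · exact absurd rfl h
    · exact absurd rfl h
    · exact c.1.2
  · intro h
    exact ⟨.up ⟨v, h⟩, rfl, one_ne_zero⟩

/-- The pearl chain is connected, all codes with the same first entry lie on one floor or are one
point, and every line lies on a horizontal edge. -/
theorem toCutMap_connected : (toCutMap hp hd).IsConnected := by
  have hN : 0 < 2 * d₂ + g - 1 := by
    have := hp.card_points
    have := hp.card_pos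
    omega
  let r : Q.Code := Code.diag ⟨0, hN⟩
  have h1 : ∀ i j, Q.graph.Adj i j → (toCutMap hp hd).gluedGraph.Reachable
      (Sum.inl (Code.diag i)) (Sum.inl (Code.diag j)) := by
    intro i j h
    have h2 := (linked_hor hp hd ⟨(i, j), h⟩).reachable
    refine SimpleGraph.Reachable.trans (CutMap.SameFloor.reachable ?_)
      (h2.trans (CutMap.SameFloor.reachable ?_))
    · exact (sameFloor_iff_fst hp hd).2 (Dart.root_fst (Q := Q) ⟨(i, j), h⟩).symm
    · exact (sameFloor_iff_fst hp hd).2 (Dart.root_fst (Q := Q) (Dart.swap ⟨(i, j), h⟩))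
  have h2 : ∀ i j, (toCutMap hp hd).gluedGraph.Reachable
      (Sum.inl (Code.diag i)) (Sum.inl (Code.diag j)) := by
    intro i j
    obtain ⟨w⟩ := Q.connected.preconnected i j
    induction w with
    | nil => exact .refl _
    | cons h _ ih => exact (h1 _ _ h).trans ih
  have h3 : ∀ v : Q.Code, (toCutMap hp hd).gluedGraph.Reachable (Sum.inl r) (Sum.inl v) := fun v =>
    (h2 _ v.1.1).trans (CutMap.SameFloor.reachable ((sameFloor_iff_fst hp hd).2 rfl))
  have h4 : ∀ x, (toCutMap hp hd).gluedGraph.Reachable (Sum.inl r) x := by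
    rintro (v | ⟨k, s⟩)
    · exact h3 v
    · have hs : s.1 + 1 < D.wind k.1.1.1 k.1.1.2 := by omega
      have h5 := CutMap.reachable_follow (A := toCutMap hp hd) (h := .hor k.1) (k := s.1 + 1)
        (by rw [crossings_hor]; omega)
      rw [follow_hor hp hd k hs, slotRight, dif_neg (by simp)] at h5
      exact (h3 _).trans h5
  have : Nonempty ((toCutMap hp hd).V ⊕ (toCutMap hp hd).Ln) := ⟨Sum.inl r⟩
  exact ⟨fun a b => (h4 a).symm.trans (h4 b)⟩

theorem isMarked_iff_diag {v : Q.Code} : (toCutMap hp hd).IsMarked v ↔ v.1.1 = v.1.2 := by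
  constructor
  · rintro ⟨i, rfl⟩
    rfl
  · intro h
    exact ⟨v.1.1, Subtype.ext (Prod.ext rfl h)⟩

/-- At an unmarked vertex the three flags have second coordinates `0`, `1` and `-1`, and the level
one is nonzero as it carries the weight of an edge. -/
theorem toCutMap_simple : (toCutMap hp hd).IsSimple := by
  constructor
  · intro v
    obtain ⟨a, b, e, hab, hae, hbe, hall, -⟩ := exists_star (D := D) v
    rw [Nat.card_eq_fintype_card, Fintype.card_subtype]
    convert Finset.card_eq_three.2 ⟨a, b, e, hab, hae, hbe, filter_star hall⟩
  · intro h h' hr hne hm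
    rw [isMarked_iff_diag] at hm
    obtain ⟨v, hv⟩ : ∃ v : Q.Code, v = h.root := ⟨_, rfl⟩
    change ¬ h.root.1.1 = h.root.1.2 at hm
    change h.root = h'.root at hr
    change ¬ SameRay ℤ (D.codeDir h) (D.codeDir h')
    rw [← hv] at hr hm
    have hw := (v.2.resolve_left hm).2
    have e1 := (root_eq_floor_iff ⟨v, hw⟩ h).1 hv.symm
    have e2 := (root_eq_floor_iff ⟨v, hw⟩ h').1 hr.symm
    have hl : D.codeDir (FloorCode.level ⟨v, hw⟩) = (D.weight v.1.1 v.1.2, 0) := codeDir_level _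
    have hwt : D.weight v.1.1 v.1.2 ≠ 0 := (D.weight_ne_zero _ _).2 (v.2.resolve_left hm).1
    have hu : (D.codeDir (.up ⟨v, hw⟩)).2 = 1 := rfl
    have hdn : (D.codeDir (.down ⟨v, hw⟩)).2 = -1 := rfl
    have n1 : D.codeDir (FloorCode.level ⟨v, hw⟩) ≠ 0 := fun e => hwt (by rw [hl] at e; exact congrArg Prod.fst e)
    have n2 : D.codeDir (.up ⟨v, hw⟩) ≠ 0 := fun e => by rw [e] at hu; exact absurd hu (by simp)
    have n3 : D.codeDir (.down ⟨v, hw⟩) ≠ 0 := fun e => by rw [e] at hdn; exact absurd hdn (by simp)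
    have hl2 : (D.codeDir (FloorCode.level ⟨v, hw⟩)).2 = 0 := by rw [hl]
    rcases e1 with rfl | rfl | rfl <;> rcases e2 with rfl | rfl | rfl <;>
      first
      | exact absurd rfl hne
      | refine not_sameRay (by assumption) (by assumption) fun r s hr hs => ?_
        simp only [hl2, hu, hdn]
        omega

theorem toCutMap_passesThrough : (toCutMap hp hd).PassesThrough p := codePos_diag

include hp in
theorem codeOpp_up_iff {c : Q.FloorCode} :
    D.codeOpp (.up c) = .up c ↔ ∀ b : Q.FloorCode, b.1.1.1 = c.1.1.1 → (p b.1.1.2).2 ≤ (p c.1.1.2).2 := by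
  constructor
  · intro h b hb
    by_contra hlt
    obtain ⟨c', hc⟩ := exists_covers hb (not_le.1 hlt)
    exact (codeOpp_ne (fun i j h => hp.snd_injective h) (.up c c' hc)) h
  · intro h
    by_contra h1
    generalize hx : CodeFlag.up c = x at h1
    have h2 := joined_codeOpp h1
    generalize D.codeOpp x = y at h2
    cases h2 with
    | hor k hk => simp at hx
    | up a b hc =>
      obtain rfl : c = a := by simpa using hx
      exact absurd (h b hc.1.symm) (not_le.2 hc.2.1)
    | down a b hc => simp at hx

include hp in
theorem codeOpp_down_iff {c : Q.FloorCode} :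
    D.codeOpp (.down c) = .down c ↔
      ∀ b : Q.FloorCode, b.1.1.1 = c.1.1.1 → (p c.1.1.2).2 ≤ (p b.1.1.2).2 := by
  constructor
  · intro h b hb
    by_contra hlt
    obtain ⟨c', hc⟩ := exists_covered hb (not_le.1 hlt)
    exact (codeOpp_ne (fun i j h => hp.snd_injective h) (.down c' c hc)) h
  · intro h
    by_contra h1
    generalize hx : CodeFlag.down c = x at h1
    have h2 := joined_codeOpp h1
    generalize D.codeOpp x = y at h2
    cases h2 with
    | hor k hk => simp at hx
    | up a b hc => simp at hx
    | down a b hc =>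
      obtain rfl : c = b := by simpa using hx
      exact absurd (h a hc.1) (not_le.2 hc.2.1)

/-- At the highest vertex all edges of the floor attach at or below, so the up end has the leaking
as first coordinate. -/
theorem slope_top {c : Q.FloorCode}
    (h : ∀ b : Q.FloorCode, b.1.1.1 = c.1.1.1 → (p b.1.1.2).2 ≤ (p c.1.1.2).2) :
    D.slope c.1.1.1 (p c.1.1.2).2 = ∑ j, D.weight c.1.1.1 j := by
  refine Finset.sum_congr rfl fun u _ => ?_
  by_cases h0 : D.weight c.1.1.1 u = 0
  · rw [h0, ite_self]
  · obtain ⟨b, hb⟩ := exists_floorCode c.2 h0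
    have h1 := h b (by rw [hb])
    rw [hb] at h1
    exact if_pos h1

include hp in
-- At the lowest vertex only its own edge counts, so the down end has direction `(0, -1)`.
theorem slope_bottom {c : Q.FloorCode}
    (h : ∀ b : Q.FloorCode, b.1.1.1 = c.1.1.1 → (p c.1.1.2).2 ≤ (p b.1.1.2).2) :
    D.slope c.1.1.1 (p c.1.1.2).2 = D.weight c.1.1.1 c.1.1.2 := by
  rw [slope, Finset.sum_eq_single c.1.1.2, if_pos le_rfl]
  · intro u _ hu
    by_cases h0 : D.weight c.1.1.1 u = 0
    · rw [h0, ite_self]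
    · obtain ⟨b, hb⟩ := exists_floorCode c.2 h0
      have h1 := h b (by rw [hb])
      rw [hb] at h1
      exact if_neg fun h2 => hu (hp.snd_injective (le_antisymm h2 h1))
  · exact fun h => absurd (Finset.mem_univ _) h

theorem toCutMap_leaky : (toCutMap hp hd).HasLeakyDegree Δ := by
  have hW : (Finset.univ.filter fun i => i ∈ Q.white).card = Δ.card := by
    have := congrArg Multiset.card D.leaking.2
    rwa [Multiset.card_map] at this
  have hy : Function.Injective fun i => (p i).2 := fun i j h => hp.snd_injective h
  refine ⟨?_, ?_, ?_⟩
  · have hex : ∀ i, ∃ e : Q.CodeFlag, i ∈ Q.white → ∃ c : Q.FloorCode, e = .down c ∧ c.1.1.1 = i ∧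
        ∀ b : Q.FloorCode, b.1.1.1 = i → (p c.1.1.2).2 ≤ (p b.1.1.2).2 := by
      intro i
      by_cases hi : i ∈ Q.white
      · obtain ⟨c, hc⟩ := exists_bottom p hi
        exact ⟨_, fun _ => ⟨c, rfl, hc⟩⟩
      · exact ⟨.mark i, fun h => absurd h hi⟩
    choose E hE using hex
    change Nat.card {h : Q.CodeFlag // D.codeOpp h = h ∧ D.codeDir h = (0, -1)} = _
    rw [← hW, ← Finset.card_image_of_injOn (f := E)]
    · refine Nat.subtype_card _ fun h => Iff.symm ?_
      simp only [Finset.mem_filter, Finset.mem_univ, true_and, Finset.mem_image]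
      constructor
      · rintro ⟨h1, h2⟩
        rcases h with i | k | ⟨c, b⟩
        · exact absurd (congrArg Prod.snd h2) (by simp [codeDir_mark])
        · exact absurd (congrArg Prod.snd h2) (by simp [codeDir_hor])
        · rcases b with _ | _
          · obtain ⟨c', e1, e2, e3⟩ := hE c.1.1.1 c.2
            have h3 := (codeOpp_down_iff hp).1 h1
            refine ⟨c.1.1.1, c.2, ?_⟩
            rw [e1, floorCode_ext hy e2 (le_antisymm (e3 c rfl) (h3 c' e2))]
          · exact absurd (congrArg Prod.snd h2) (by simp [codeDir_up])
      · rintro ⟨i, hi, rfl⟩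
        obtain ⟨c, e1, rfl, e3⟩ := hE i hi
        rw [e1]
        refine ⟨(codeOpp_down_iff hp).2 e3, ?_⟩
        rw [codeDir_down, slope_bottom hp e3, sub_self]
    · intro i hi j hj he
      obtain ⟨c, e1, rfl, -⟩ := hE i (by simpa using hi)
      obtain ⟨c', e1', rfl, -⟩ := hE j (by simpa using hj)
      rw [e1, e1'] at he
      have : c = c' := by simpa using he
      rw [this]
  · have hex : ∀ i, ∃ e : Q.CodeFlag, i ∈ Q.white → ∃ c : Q.FloorCode, e = .up c ∧ c.1.1.1 = i ∧
        ∀ b : Q.FloorCode, b.1.1.1 = i → (p b.1.1.2).2 ≤ (p c.1.1.2).2 := by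
      intro i
      by_cases hi : i ∈ Q.white
      · obtain ⟨c, hc⟩ := exists_top p hi
        exact ⟨_, fun _ => ⟨c, rfl, hc⟩⟩
      · exact ⟨.mark i, fun h => absurd h hi⟩
    choose E hE using hex
    have himg : (Finset.univ.filter fun h : Q.CodeFlag => D.codeOpp h = h ∧ (D.codeDir h).2 = 1) =
        (Finset.univ.filter fun i => i ∈ Q.white).image E := by
      ext h
      simp only [Finset.mem_filter, Finset.mem_univ, true_and, Finset.mem_image]
      constructor
      · rintro ⟨h1, h2⟩
        rcases h with i | k | ⟨c, b⟩
        · exact absurd h2 (by simp [codeDir_mark])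
        · exact absurd h2 (by simp [codeDir_hor])
        · rcases b with _ | _
          · exact absurd h2 (by simp [codeDir_down])
          · obtain ⟨c', e1, e2, e3⟩ := hE c.1.1.1 c.2
            have h3 := (codeOpp_up_iff hp).1 h1
            refine ⟨c.1.1.1, c.2, ?_⟩
            rw [e1, floorCode_ext hy e2 (le_antisymm (h3 c' e2) (e3 c rfl))]
      · rintro ⟨i, hi, rfl⟩
        obtain ⟨c, e1, rfl, e3⟩ := hE i hi
        rw [e1]
        exact ⟨(codeOpp_up_iff hp).2 e3, rfl⟩
    have hinj : Set.InjOn E (Finset.univ.filter fun i => i ∈ Q.white) := by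
      intro i hi j hj he
      obtain ⟨c, e1, rfl, -⟩ := hE i (by simpa using hi)
      obtain ⟨c', e1', rfl, -⟩ := hE j (by simpa using hj)
      rw [e1, e1'] at he
      have : c = c' := by simpa using he
      rw [this]
    have h1 : (Finset.univ.filter fun h : Q.CodeFlag => D.codeOpp h = h ∧ (D.codeDir h).2 = 1).val.map
        (fun h => (D.codeDir h).1) = Δ := by
      rw [himg, Finset.image_val_of_injOn hinj, Multiset.map_map]
      refine Eq.trans (Multiset.map_congr rfl fun i hi => ?_) D.leaking.2
      obtain ⟨c, e1, rfl, e3⟩ := hE i (by simpa using hi)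
      rw [Function.comp_apply, e1, codeDir_up, slope_top e3]
    convert h1
  · intro h h1 h2
    rcases h with i | k | ⟨c, b⟩
    · exact absurd rfl (h2 i)
    · exact Or.inr (Or.inr ⟨rfl, dart_weight_ne_zero k⟩)
    · rcases b with _ | _
      · refine Or.inl ?_
        change D.codeDir (.down c) = _
        rw [codeDir_down, slope_bottom hp ((codeOpp_down_iff hp).1 h1), sub_self]
      · exact Or.inr (Or.inl rfl)

end Diagram

end TropEP

end

/-! ### Degree, genus, pearl chain and multiplicity of the map of a diagram -/

section

open scoped Classical

namespace TropEP

namespace Diagram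

open PearlChain

variable {d₂ g : ℕ} {Q : PearlChain d₂ g} {Δ : Multiset ℤ} {p : Fin (2 * d₂ + g - 1) → ℝ × ℝ}
  {d₁ : ℕ} {D : Diagram Q Δ fun i => (p i).1}

/-- The edges of the pearl chain, oriented to the right. -/
noncomputable def edgeEquiv (D : Diagram Q Δ fun i => (p i).1) : D.RightDart ≃ Q.graph.edgeSet :=
  Equiv.ofBijective (fun k => ⟨s(k.1.1.1, k.1.1.2), k.1.2⟩) (by
    constructor
    · rintro ⟨⟨⟨i, j⟩, h⟩, hw⟩ ⟨⟨⟨i', j'⟩, h'⟩, hw'⟩ e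
      have e1 := congrArg Subtype.val e
      simp only [Sym2.eq_iff] at e1
      rcases e1 with ⟨rfl, rfl⟩ | ⟨rfl, rfl⟩
      · rfl
      · have h3 := D.weight_swap i j
        simp only at hw hw'
        omega
    · rintro ⟨e, he⟩
      induction e with | _ i j
      have he' : Q.graph.Adj i j := he
      have h0 := (D.weight_ne_zero i j).2 he'
      rcases lt_or_gt_of_ne h0 with h | h
      · refine ⟨⟨⟨(j, i), he'.symm⟩, ?_⟩, Subtype.ext Sym2.eq_swap⟩
        have := D.weight_swap i j
        change 0 < D.weight j i
        omega
      · exact ⟨⟨⟨(i, j), he'⟩, h⟩, rfl⟩)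

variable (hp : Admissible Δ d₁ g p) (hd : D.degree = d₁)

theorem connects_iff {i j : Fin (2 * d₂ + g - 1)} {h : Q.CodeFlag} :
    (toCutMap hp hd).Connects i j h ↔ ∃ hk : Q.graph.Adj i j, h = .hor ⟨(i, j), hk⟩ := by
  constructor
  · rintro ⟨h', hl, h1, h2⟩
    obtain ⟨k, rfl, rfl⟩ := exists_of_linked hp hd hl
    have h3 : k.1.1 = i := (Dart.root_fst k).symm.trans ((sameFloor_iff_fst hp hd).1 h1)
    have h4 : k.1.2 = j := (Dart.root_fst k.swap).symm.trans ((sameFloor_iff_fst hp hd).1 h2)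
    subst h3 h4
    exact ⟨k.2, rfl⟩
  · rintro ⟨hk, rfl⟩
    exact ⟨_, linked_hor hp hd _, (sameFloor_iff_fst hp hd).2 (Dart.root_fst (Q := Q) ⟨(i, j), hk⟩),
      (sameFloor_iff_fst hp hd).2 (Dart.root_fst (Q := Q) (Dart.swap ⟨(i, j), hk⟩))⟩

theorem toCutMap_realizes : (toCutMap hp hd).Realizes D where
  white := fun i => (isFloorVertex_iff_white hp hd (v := Code.diag i)).symm
  adj := fun i j => by
    simp only [connects_iff]
    exact ⟨fun h => ⟨_, h, rfl⟩, fun ⟨_, h, _⟩ => h⟩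
  weight := fun i j h hc => by
    obtain ⟨hk, rfl⟩ := (connects_iff hp hd).1 hc
    rfl
  wind := fun i j h hc hr => by
    obtain ⟨hk, rfl⟩ := (connects_iff hp hd).1 hc
    exact (crossings_hor hp hd ⟨⟨(i, j), hk⟩, hr.2⟩).symm

/-- The flags to the right of the map given by a diagram. -/
noncomputable def rightFlagEquiv : D.RightDart ≃ (toCutMap hp hd).RightFlag :=
  Equiv.ofBijective (fun k => ⟨.hor k.1, rfl, k.2⟩)
    ⟨fun k k' h => Subtype.ext (Sum.inl_injective (Sum.inr_injective (congrArg Subtype.val h))),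
      fun ⟨h, h2, h1⟩ => by
        obtain ⟨k, rfl⟩ := exists_dart_of_level (D := D) h2 h1.ne'
        exact ⟨⟨k, h1⟩, rfl⟩⟩

theorem toCutMap_degree : (toCutMap hp hd).degree = d₁ := by
  have : Nonempty (toCutMap hp hd).V :=
    ⟨Code.diag ⟨0, by have := hp.card_points; have := hp.card_pos; omega⟩⟩
  refine Eq.trans ?_ hd
  rw [CutMap.degree_eq_sum_crossings (toCutMap_connected hp hd), ← D.weight_mul_wind_le,
    ← Fintype.sum_prod_type' (fun i j => if 0 < D.weight i j then
      (D.weight i j).natAbs * D.wind i j else 0), ← Finset.sum_filter]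
  refine Finset.sum_bij' (fun h _ => ((rightFlagEquiv hp hd).symm h).1.1)
    (fun k hk => rightFlagEquiv hp hd ⟨⟨k, (D.weight_ne_zero _ _).1 (Finset.mem_filter.1 hk).2.ne'⟩,
      (Finset.mem_filter.1 hk).2⟩) (fun h _ => ?_) (fun k hk => Finset.mem_univ _) (fun h _ => ?_)
    (fun k hk => ?_) fun h _ => ?_
  · exact Finset.mem_filter.2 ⟨Finset.mem_univ _, ((rightFlagEquiv hp hd).symm h).2⟩
  · exact (rightFlagEquiv hp hd).apply_symm_apply h
  · rw [Equiv.symm_apply_apply]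
  · obtain ⟨k, rfl⟩ := (rightFlagEquiv hp hd).surjective h
    rw [Equiv.symm_apply_apply]
    exact congrArg _ (crossings_hor hp hd k)

theorem toCutMap_genus : (toCutMap hp hd).genus = g := by
  rw [CutMap.genus_eq_iff (toCutMap_connected hp hd) (toCutMap_leaky hp hd) (toCutMap_simple hp hd)]
  have h1 := Q.card_code
  have h2 := hp.card_points
  rw [← Nat.card_eq_fintype_card] at h1
  change Nat.card Q.Code + 2 = _
  omega

theorem toCutMap_isCounted : (toCutMap hp hd).IsCounted Δ d₁ g p :=
  ⟨toCutMap_connected hp hd, toCutMap_leaky hp hd, toCutMap_degree hp hd, toCutMap_genus hp hd,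
    toCutMap_passesThrough hp hd, toCutMap_simple hp hd⟩

theorem toCutMap_hasPearlChain : (toCutMap hp hd).HasPearlChain Q := by
  refine ⟨fun c => c.1.1, fun i => ⟨Code.diag i, rfl⟩, fun v w => ?_, fun v => ?_,
    (rightFlagEquiv hp hd).symm.trans (edgeEquiv D), fun h h' he => ?_⟩
  · exact (sameFloor_iff_fst hp hd).symm.trans (CutMap.sameFloor_iff (A := toCutMap hp hd))
  · exact (isFloorVertex_iff_white hp hd (v := v)).symm
  · obtain ⟨k, rfl⟩ := (rightFlagEquiv hp hd).surjective h
    have h1 : (toCutMap hp hd).Linked (.hor k.1) h' := Or.inl ⟨⟨rfl, k.2⟩, he⟩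
    rw [h1.unique (linked_hor hp hd k.1), Equiv.trans_apply, Equiv.symm_apply_apply]
    change s(k.1.1.1, k.1.1.2) = s(k.1.root.1.1, (Dart.root k.1.swap).1.1)
    rw [Dart.root_fst, Dart.root_fst]
    rfl

/-- Any two different flags at a floor vertex have determinant plus or minus the weight of the level
flag; equal flags give zero. -/
theorem vertexMult_code (c : Q.FloorCode) :
    (toCutMap hp hd).vertexMult c.1 = (D.weight c.1.1.1 c.1.1.2).natAbs := by
  let det : Q.CodeFlag → Q.CodeFlag → ℤ := fun a b =>
    (D.codeDir a).1 * (D.codeDir b).2 - (D.codeDir a).2 * (D.codeDir b).1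
  have h0 : (toCutMap hp hd).vertexMult c.1 = Finset.univ.sup fun k : Q.CodeFlag × Q.CodeFlag =>
      if k.1.root = c.1 ∧ k.2.root = c.1 then (det k.1 k.2).natAbs else 0 := by
    unfold PlaneMap.vertexMult
    refine Finset.sup_congr rfl fun k _ => ?_
    by_cases h : k.1.root = c.1 ∧ k.2.root = c.1
    · exact (if_pos h).trans (if_pos h).symm
    · exact (if_neg h).trans (if_neg h).symm
  rw [h0]
  refine le_antisymm (Finset.sup_le ?_) ?_
  · rintro ⟨a, b⟩ -
    simp only
    split_ifs with h
    · rcases (root_eq_floor_iff c a).1 h.1 with rfl | rfl | rfl <;>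
        rcases (root_eq_floor_iff c b).1 h.2 with rfl | rfl | rfl <;>
        · simp only [det, codeDir_level, codeDir_up, codeDir_down]
          ring_nf
          omega
    · exact Nat.zero_le _
  · refine le_trans (le_of_eq ?_) (Finset.le_sup (Finset.mem_univ (FloorCode.level c, CodeFlag.up c)))
    rw [if_pos ⟨(root_eq_floor_iff c _).2 (Or.inl rfl), rfl⟩]
    simp only [det, codeDir_level, codeDir_up]
    ring_nf

/-- Every horizontal edge has exactly one vertex on a floor, and these are the unmarked vertices. -/
theorem toCutMap_mult : (toCutMap hp hd).mult = D.mult := by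
  have h0 : (toCutMap hp hd).mult = ∏ v : Q.Code,
    if (toCutMap hp hd).IsMarked v then 1 else (toCutMap hp hd).vertexMult v := rfl
  have h1 : ∀ v : Q.Code, (if (toCutMap hp hd).IsMarked v then 1 else (toCutMap hp hd).vertexMult v) =
      if v.1.1 ≠ v.1.2 then (D.weight v.1.1 v.1.2).natAbs else 1 := by
    intro v
    simp only [isMarked_iff_diag hp hd, ne_eq]
    rw [ite_not]
    split_ifs with h
    · rfl
    · exact vertexMult_code hp hd ⟨v, (v.2.resolve_left h).2⟩
  rw [h0, Finset.prod_congr rfl fun v _ => h1 v, ← Finset.prod_filter]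
  refine (Finset.prod_bij' (s := Finset.univ) (fun (k : Q.WhitePair) _ => (⟨k.1, Or.inr k.2⟩ : Q.Code))
    (fun v hv => ⟨v.1, v.2.resolve_left (Finset.mem_filter.1 hv).2⟩) (fun k _ => ?_)
    (fun v _ => Finset.mem_univ _) (fun k _ => rfl) (fun v _ => rfl) fun k _ => rfl).symm
  exact Finset.mem_filter.2 ⟨Finset.mem_univ _, k.2.1.ne⟩

end Diagram

end TropEP

end

/-! ### A map is determined by its diagram -/

section

open scoped Classical

namespace TropEP

open PearlChain

variable {d₂ g : ℕ} {Δ : Multiset ℤ} {d₁ : ℕ} {p : Fin (2 * d₂ + g - 1) → ℝ × ℝ}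
  {A : CutMap (2 * d₂ + g - 1)} {Q : PearlChain d₂ g}

namespace CutMap

/-- The vertex `v` lies on the floor or at the marked point `c.1`, at the height of the marked
point `c.2`. -/
def VertexCode (A : CutMap (2 * d₂ + g - 1)) (p : Fin (2 * d₂ + g - 1) → ℝ × ℝ) (v : A.V)
    (c : Q.Code) : Prop :=
  A.SameFloor v (A.root (A.mark c.1.1)) ∧ (A.pos v).2 = (p c.1.2).2

/-- The flags of a map that correspond to the flags of its pearl chain. -/
inductive FlagCode (A : CutMap (2 * d₂ + g - 1)) (p : Fin (2 * d₂ + g - 1) → ℝ × ℝ) :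
    A.H → Q.CodeFlag → Prop
  | mark (i : Fin (2 * d₂ + g - 1)) : FlagCode A p (A.mark i) (.mark i)
  | hor (k : Q.Dart) (h : A.H) (hc : A.Connects k.1.1 k.1.2 h) : FlagCode A p h (.hor k)
  | up (c : Q.FloorCode) (h : A.H) (hv : A.VertexCode p (A.root h) c.1) (hd : 0 < (A.dir h).2) :
      FlagCode A p h (.up c)
  | down (c : Q.FloorCode) (h : A.H) (hv : A.VertexCode p (A.root h) c.1) (hd : (A.dir h).2 < 0) :
      FlagCode A p h (.down c)

namespace IsCounted

variable (hp : Admissible Δ d₁ g p) (hA : A.IsCounted Δ d₁ g p)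
  {D : Diagram Q Δ fun i => (p i).1} (hR : A.Realizes D)

include hA hp

theorem vertexCode_unique {v : A.V} {c c' : Q.Code} (h : A.VertexCode p v c)
    (h' : A.VertexCode p v c') : c = c' :=
  Subtype.ext (Prod.ext (hA.mark_unique hp h.1 h'.1) (hp.snd_injective (h.2.symm.trans h'.2)))

theorem vertexCode_injective {v v' : A.V} {c : Q.Code} (h : A.VertexCode p v c)
    (h' : A.VertexCode p v' c) : v = v' := by
  by_cases hi : A.IsFloorVertex (A.root (A.mark c.1.1))
  · exact hA.eq_of_height_eq hp ((hA.isFloorVertex_iff hp h.1).2 hi) (h.1.trans h'.1.symm)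
      (h.2.trans h'.2.symm)
  · rw [hA.eq_of_sameFloor hp hi h.1.symm, hA.eq_of_sameFloor hp hi h'.1.symm]

omit hp in
theorem vertexCode_diag (i : Fin (2 * d₂ + g - 1)) :
    A.VertexCode p (A.root (A.mark i)) (Code.diag (Q := Q) i) :=
  ⟨sameFloor_refl _, by rw [hA.pos_mark]⟩

include hR

/-- An unmarked vertex lies on a floor and carries a horizontal edge; the marked point at the other
end of this edge provides its height. -/
theorem exists_vertexCode (v : A.V) : ∃ c : Q.Code, A.VertexCode p v c := by
  by_cases hm : A.IsMarked v
  · obtain ⟨i, rfl⟩ := hm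
    exact ⟨_, hA.vertexCode_diag i⟩
  · have hv := hA.isFloorVertex_of_unmarked hp hm
    obtain ⟨u, d, k, -, -, rfl, -, -, hk, -, -⟩ := hA.floor_flags hp hv
    have hh : A.IsHorizontal k := by
      refine ⟨hk, fun h0 => hA.dir_ne_zero hp (h := k) ?_ (Prod.ext h0 hk)⟩
      rintro i rfl
      exact hm ⟨i, rfl⟩
    obtain ⟨i, j, hc⟩ := hA.exists_connects hp hh
    have hs := hc.choose_spec.2.1
    have hi := (hA.isFloorVertex_iff hp hs).1 hv
    exact ⟨⟨(i, j), Or.inr ⟨(hR.adj i j).2 ⟨k, hc⟩, (hR.white i).2 hi⟩⟩, hs,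
      hA.connects_height hp hc hi⟩

theorem flagCode_root {h : A.H} {x : Q.CodeFlag} (hx : A.FlagCode p h x) :
    A.VertexCode p (A.root h) x.root := by
  cases hx with
  | mark i => exact hA.vertexCode_diag i
  | hor k h hc =>
    have hs := hc.choose_spec.2.1
    by_cases hw : k.1.1 ∈ Q.white
    · change A.VertexCode p _ k.root
      rw [Dart.root_white hw]
      exact ⟨hs, hA.connects_height hp hc ((hR.white _).1 hw)⟩
    · change A.VertexCode p _ k.root
      rw [Dart.root_black hw, hA.eq_of_sameFloor hp (fun h => hw ((hR.white _).2 h)) hs.symm]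
      exact hA.vertexCode_diag _
  | up c h hv hd => exact hv
  | down c h hv hd => exact hv

theorem exists_flagCode (h : A.H) : ∃ x : Q.CodeFlag, A.FlagCode p h x := by
  by_cases hm : ∃ i, A.mark i = h
  · obtain ⟨i, rfl⟩ := hm
    exact ⟨_, .mark i⟩
  · have h0 := hA.dir_ne_zero hp (not_exists.1 hm)
    obtain ⟨c, hc⟩ := hA.exists_vertexCode hp hR (A.root h)
    have hw : (A.dir h).2 ≠ 0 → c.1.1 ∈ Q.white := fun hd =>
      (hR.white _).2 ((hA.isFloorVertex_iff hp hc.1).1 ⟨h, rfl, hd⟩)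
    rcases lt_trichotomy (A.dir h).2 0 with hd | hd | hd
    · exact ⟨_, .down ⟨c, hw hd.ne⟩ h hc hd⟩
    · obtain ⟨i, j, hc⟩ := hA.exists_connects hp (h := h) ⟨hd, fun h1 => h0 (Prod.ext h1 hd)⟩
      exact ⟨_, .hor ⟨(i, j), (hR.adj i j).2 ⟨h, hc⟩⟩ h hc⟩
    · exact ⟨_, .up ⟨c, hw hd.ne'⟩ h hc hd⟩

omit hR

theorem flagCode_injective {h h' : A.H} {x : Q.CodeFlag} (hx : A.FlagCode p h x)
    (hx' : A.FlagCode p h' x) : h = h' := by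
  cases hx with
  | mark i => cases hx'; rfl
  | hor k h hc => cases hx' with | hor _ _ hc' => exact hA.connects_unique hp hc hc'
  | up c h hv hd =>
    cases hx' with
    | up _ _ hv' hd' => exact hA.up_unique hp hd hd' (hv.1.trans hv'.1.symm) (hv.2.trans hv'.2.symm)
  | down c h hv hd =>
    cases hx' with
    | down _ _ hv' hd' => exact hA.down_unique hp hd hd' (hA.vertexCode_injective hp hv hv')

theorem flagCode_unique {h : A.H} {x y : Q.CodeFlag} (hx : A.FlagCode p h x)
    (hy : A.FlagCode p h y) : x = y := by
  have mk : ∀ i, A.dir (A.mark i) = 0 := A.mark_contracted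
  cases hx with
  | mark i =>
    generalize hh : A.mark i = h at hy
    cases hy with
    | mark j => rw [A.mark_injective hh]
    | hor k _ hc => exact absurd (by rw [← hh, mk]; rfl) hc.isHorizontal.2
    | up c _ hv hd => rw [← hh, mk] at hd; exact absurd hd (lt_irrefl _)
    | down c _ hv hd => rw [← hh, mk] at hd; exact absurd hd (lt_irrefl _)
  | hor k h hc =>
    cases hy with
    | mark j => exact absurd (by rw [mk]; rfl) hc.isHorizontal.2
    | hor k' _ hc' =>
      obtain ⟨e1, e2⟩ := hA.connects_marks_unique hp hc hc'
      exact congrArg CodeFlag.hor (Subtype.ext (Prod.ext e1 e2))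
    | up c _ hv hd => exact absurd hc.isHorizontal.1 hd.ne'
    | down c _ hv hd => exact absurd hc.isHorizontal.1 hd.ne
  | up c h hv hd =>
    cases hy with
    | mark j => rw [mk] at hd; exact absurd hd (lt_irrefl _)
    | hor k _ hc => exact absurd hc.isHorizontal.1 hd.ne'
    | up c' _ hv' hd' => rw [Subtype.ext (hA.vertexCode_unique hp hv hv')]
    | down c' _ hv' hd' => omega
  | down c h hv hd =>
    cases hy with
    | mark j => rw [mk] at hd; exact absurd hd (lt_irrefl _)
    | hor k _ hc => exact absurd hc.isHorizontal.1 hd.ne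
    | up c' _ hv' hd' => omega
    | down c' _ hv' hd' => rw [Subtype.ext (hA.vertexCode_unique hp hv hv')]

include hR

/-- Codes separate vertices, and there are as many codes as vertices by the genus count. -/
theorem exists_vertex_of_code (c : Q.Code) : ∃ v, A.VertexCode p v c := by
  choose f hf using fun v => hA.exists_vertexCode hp hR v
  have hinj : Function.Injective f := fun v v' e =>
    hA.vertexCode_injective hp (hf v) (e ▸ hf v')
  have hcard : Nat.card A.V = Nat.card Q.Code := by
    have h1 := hA.card_vertices
    have h2 := Q.card_code
    have h3 := hp.card_points
    rw [← Nat.card_eq_fintype_card] at h2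
    omega
  have hsurj := ((Nat.bijective_iff_injective_and_card f).2 ⟨hinj, hcard⟩).2
  obtain ⟨v, rfl⟩ := hsurj c
  exact ⟨v, hf v⟩

theorem edgeWeight_realized (i j : Fin (2 * d₂ + g - 1)) : A.edgeWeight i j = D.weight i j := by
  by_cases hc : ∃ h, A.Connects i j h
  · obtain ⟨h, hc⟩ := hc
    rw [hA.edgeWeight_eq hp hc, hR.weight i j h hc]
  · rw [not_not.1 (mt (hA.edgeWeight_ne_zero hp).1 hc),
      D.weight_eq_zero fun h => hc ((hR.adj i j).1 h)]

theorem codeDir_up_realized {c : Q.FloorCode} {h : A.H} (hv : A.VertexCode p (A.root h) c.1)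
    (hd : 0 < (A.dir h).2) : D.codeDir (.up c) = A.dir h := by
  rw [Diagram.codeDir_up]
  refine Prod.ext ?_ (hA.snd_eq_one hp hd).symm
  rw [hA.dir_fst_up hp hd hv.1, hv.2]
  simp only [hA.edgeWeight_realized hp hR]
  rfl

theorem dir_fst_level {c : Q.FloorCode} {k : A.H} (hv : A.VertexCode p (A.root k) c.1)
    (hk : (A.dir k).2 = 0) : (A.dir k).1 = D.weight c.1.1.1 c.1.1.2 := by
  have hi := (hR.white _).1 c.2
  have hfl := (hA.isFloorVertex_iff hp hv.1).2 hi
  by_cases hm : ∃ i, A.mark i = k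
  · obtain ⟨i, rfl⟩ := hm
    rw [hA.vertexCode_unique hp hv (hA.vertexCode_diag i), D.weight_self, A.mark_contracted]
    rfl
  · have hh : A.IsHorizontal k :=
      ⟨hk, fun h0 => hA.dir_ne_zero hp (not_exists.1 hm) (Prod.ext h0 hk)⟩
    obtain ⟨i, j, hc⟩ := hA.exists_connects hp hh
    have e1 := hA.mark_unique hp hc.choose_spec.2.1 hv.1
    subst e1
    have e2 := hp.snd_injective ((hA.connects_height hp hc hi).symm.trans hv.2)
    subst e2
    exact (hR.weight _ _ k hc).symm

theorem flagCode_dir {h : A.H} {x : Q.CodeFlag} (hx : A.FlagCode p h x) :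
    D.codeDir x = A.dir h := by
  cases hx with
  | mark i => rw [A.mark_contracted, Diagram.codeDir_mark]
  | hor k h hc => exact Prod.ext (hR.weight _ _ h hc) hc.isHorizontal.1.symm
  | up c h hv hd => exact hA.codeDir_up_realized hp hR hv hd
  | down c h hv hd =>
    -- The flag down is determined by balancing from the up flag and the level flag, which are
    -- known.
    obtain ⟨u, d, k, ru, rd, rk, hu, hdn, hk, hsum, hall⟩ :=
      hA.floor_flags hp (v := A.root h) ⟨h, rfl, hd.ne⟩
    have e : h = d := by
      rcases hall h rfl with rfl | rfl | rfl
      · omega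
      · rfl
      · omega
    subst e
    have h1 := congrArg Prod.fst (hA.codeDir_up_realized hp hR (h := u) (ru ▸ hv) (by omega))
    have h2 := hA.dir_fst_level hp hR (k := k) (rk ▸ hv) hk
    rw [Diagram.codeDir_up] at h1
    rw [Diagram.codeDir_down]
    simp only at h1
    refine Prod.ext ?_ hdn.symm
    simp only
    omega

omit hp hA in
theorem wind_eq_zero_iff {k : Q.Dart} {h : A.H} (hc : A.Connects k.1.1 k.1.2 h) :
    D.wind k.1.1 k.1.2 = 0 ↔ A.opp h ≠ h := by
  obtain ⟨h', hl, hc'⟩ := hc.swap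
  rcases isRight_or_of_linked hl with ⟨hr, -⟩ | ⟨hr, -⟩
  · rw [hR.wind _ _ h hc hr, hr.crossings_eq_zero_iff]
  · rw [← D.wind_swap, hR.wind _ _ h' hc' hr, hr.crossings_eq_zero_iff]
    have key : ∀ a b, A.Linked a b → A.opp a ≠ a → A.opp b ≠ b := by
      intro a b hab ha
      rw [hab.unique (linked_opp hab.isHorizontal ha)]
      exact A.opp_opp_ne ha
    exact ⟨key _ _ hl.symm, key _ _ hl⟩

omit hp hA hR in
theorem flagCode_swap {k : Q.Dart} {h h' : A.H} (hc : A.Connects k.1.1 k.1.2 h)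
    (hl : A.Linked h h') : A.FlagCode p h' (.hor k.swap) := by
  obtain ⟨h'', hl', hc'⟩ := hc.swap
  obtain rfl := hl.unique hl'
  exact .hor k.swap _ hc'

/-- Every code is realised by a vertex, and no vertex of the floor lies strictly between `h` and its
other end. So the other end has the covering code, and there is none above if `h` is unbounded. -/
theorem flagCode_opp_up {c : Q.FloorCode} {h : A.H} (hv : A.VertexCode p (A.root h) c.1)
    (hd : 0 < (A.dir h).2) : A.FlagCode p (A.opp h) (D.codeOpp (.up c)) := by
  have hy : Function.Injective fun i => (p i).2 := fun i j h => hp.snd_injective h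
  have above : ∀ b : Q.FloorCode, b.1.1.1 = c.1.1.1 → (p c.1.1.2).2 < (p b.1.1.2).2 →
      A.opp h ≠ h ∧ (A.pos (A.root (A.opp h))).2 ≤ (p b.1.1.2).2 := by
    intro b hb hlt
    obtain ⟨w, hw⟩ := hA.exists_vertex_of_code hp hR b.1
    rw [← hw.2]
    refine hA.not_between hp hd ?_ ?_
    · have h1 := hw.1
      rw [hb] at h1
      exact hv.1.trans h1.symm
    · rw [hv.2, hw.2]
      exact hlt
  by_cases e : A.opp h = h
  · have h1 : D.codeOpp (.up c) = .up c := by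
      rw [Diagram.codeOpp_up_iff hp]
      intro b hb
      by_contra hlt
      exact (above b hb (not_le.1 hlt)).1 e
    rw [e, h1]
    exact .up c h hv hd
  · have hs := sameFloor_opp (A := A) (h := h) hd.ne'
    obtain ⟨c', hc'⟩ := hA.exists_vertexCode hp hR (A.root (A.opp h))
    have h1 := hA.mark_unique hp hv.1 (hs.trans hc'.1)
    have hw : c'.1.1 ∈ Q.white := h1 ▸ c.2
    have hlt := A.height_lt (ε := 1) e (by omega)
    push_cast at hlt
    have hcov : Diagram.Covers p c ⟨c', hw⟩ := by
      refine ⟨h1, ?_, fun b hb hlt => ?_⟩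
      · rw [← hc'.2, ← hv.2]
        linarith
      · rw [← hc'.2]
        exact (above b hb hlt).2
    rw [Diagram.codeOpp_eq hy (.up c ⟨c', hw⟩ hcov)]
    refine .down ⟨c', hw⟩ _ hc' ?_
    rw [A.dir_opp h e, Prod.snd_neg]
    omega

theorem flagCode_opp {h : A.H} {x : Q.CodeFlag} (hx : A.FlagCode p h x) :
    A.FlagCode p (A.opp h) (D.codeOpp x) := by
  have hy : Function.Injective fun i => (p i).2 := fun i j h => hp.snd_injective h
  cases hx with
  | mark i =>
    rw [A.mark_end, Diagram.codeOpp_mark]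
    exact .mark i
  | hor k h hc =>
    by_cases e : A.opp h = h
    · have h1 : D.codeOpp (.hor k) = .hor k := by
        by_contra h1
        exact (wind_eq_zero_iff hR hc).1 ((Diagram.codeOpp_hor_ne_iff hp k).1 h1) e
      rw [e, h1]
      exact .hor k h hc
    · rw [Diagram.codeOpp_hor hp ((wind_eq_zero_iff hR hc).2 e)]
      exact flagCode_swap hc (linked_opp hc.isHorizontal e)
  | up c h hv hd => exact hA.flagCode_opp_up hp hR hv hd
  | down c h hv hd =>
    by_cases e : A.opp h = h
    · have h1 : D.codeOpp (.down c) = .down c := by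
        -- If there were a code below, the up flag of its vertex would have `h` as its opposite
        -- flag, although `h` is an end.
        rw [Diagram.codeOpp_down_iff hp]
        intro b hb
        by_contra hlt
        obtain ⟨c', hc'⟩ := Diagram.exists_covered hb (not_le.1 hlt)
        obtain ⟨w, hw⟩ := hA.exists_vertex_of_code hp hR c'.1
        obtain ⟨u, -, -, rfl, -, -, hu, -⟩ := hA.floor_flags hp (v := w)
          ((hA.isFloorVertex_iff hp hw.1).2 ((hR.white _).1 c'.2))
        have h2 := hA.flagCode_opp_up hp hR hw (by omega)
        rw [Diagram.codeOpp_eq hy (.up c' c hc')] at h2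
        have h3 := hA.flagCode_injective hp h2 (.down c h hv hd)
        have h4 : h = u := by rw [← A.opp_opp u, h3, e]
        rw [h4] at hd
        omega
      rw [e, h1]
      exact .down c h hv hd
    · have hd' : 0 < (A.dir (A.opp h)).2 := by
        rw [A.dir_opp h e, Prod.snd_neg]
        omega
      obtain ⟨c', hc'⟩ := hA.exists_vertexCode hp hR (A.root (A.opp h))
      have hw : c'.1.1 ∈ Q.white := (hR.white _).2 ((hA.isFloorVertex_iff hp hc'.1).1 ⟨_, rfl, hd'.ne'⟩)
      have h1 := hA.flagCode_opp_up hp hR (c := ⟨c', hw⟩) hc' hd'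
      rw [A.opp_opp] at h1
      have h2 := hA.flagCode_unique hp h1 (.down c h hv hd)
      have h3 : D.codeOpp (.down c) = .up ⟨c', hw⟩ := by
        rw [← h2]
        exact involution_involution (fun _ _ h => h.symm) (fun _ _ _ h h' => h.right_unique hy h') _
      rw [h3]
      exact .up ⟨c', hw⟩ _ hc' hd'

/-- A map is determined by its diagram. -/
theorem nonempty_iso_toCutMap (hd : D.degree = d₁) :
    Nonempty (A.Iso (Diagram.toCutMap hp hd)) := by
  let B := Diagram.toCutMap hp hd
  have hB : B.IsCounted Δ d₁ g p := Diagram.toCutMap_isCounted hp hd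
  choose f hf using fun v => hA.exists_vertexCode hp hR v
  choose F hF using fun h => hA.exists_flagCode hp hR h
  have hf' : ∀ {v c}, A.VertexCode p v c → f v = c := fun h => hA.vertexCode_unique hp (hf _) h
  have hF' : ∀ {h x}, A.FlagCode p h x → F h = x := fun h => hA.flagCode_unique hp (hF _) h
  -- Equal numbers of vertices and, by trivalence, of flags turn the injective codings into
  -- bijections.
  have hcardV : Nat.card A.V = Nat.card B.V := by
    have h1 := hA.card_vertices
    have h2 := hB.card_vertices
    omega
  have hcardH : Nat.card A.H = Nat.card B.H := by
    rw [hA.simple.card_flags, hB.simple.card_flags, hcardV]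
  have hfb : Function.Bijective (f : A.V → B.V) := (Nat.bijective_iff_injective_and_card _).2
    ⟨fun v v' e => hA.vertexCode_injective hp (hf v) (e ▸ hf v'), hcardV⟩
  have hFb : Function.Bijective (F : A.H → B.H) := (Nat.bijective_iff_injective_and_card _).2
    ⟨fun h h' e => hA.flagCode_injective hp (hF h) (e ▸ hF h'), hcardH⟩
  have hroot : ∀ h, B.root (F h) = f (A.root h) := fun h =>
    (hf' (hA.flagCode_root hp hR (hF h))).symm
  have hopp : ∀ h, B.opp (F h) = F (A.opp h) := fun h => (hF' (hA.flagCode_opp hp hR (hF h))).symm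
  have hdir : ∀ h, B.dir (F h) = A.dir h := fun h => hA.flagCode_dir hp hR (hF h)
  have hmark : ∀ i, B.mark i = F (A.mark i) := fun i => (hF' (.mark i)).symm
  have hsnd : ∀ v, (B.pos (f v)).2 = (A.pos v).2 := fun v => (hf v).2.symm
  -- Positions agree at the marked points and propagate along floors: the heights agree at both ends
  -- of an edge, so its length is the same because its vertical speed is nonzero.
  have hpos : ∀ v, B.pos (f v) = A.pos v := by
    intro v
    obtain ⟨i, hi⟩ := hA.exists_sameFloor_mark hp v
    refine hi.symm.induction (P := fun w => B.pos (f w) = A.pos w) ?_ fun k hk hk' _ ih => ?_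
    · rw [← hroot, ← hmark, hA.pos_mark, hB.pos_mark]
    · refine Prod.ext ?_ (hsnd _)
      have hk2 : B.opp (F k) ≠ F k := by
        rw [hopp]
        exact fun e => hk (hFb.1 e)
      have a1 := A.pos_opp_fst k hk
      have a2 := A.pos_opp_snd k hk
      have b1 := B.pos_opp_fst _ hk2
      have b2 := B.pos_opp_snd _ hk2
      rw [hopp, hroot, hroot, hdir, ih] at b1 b2
      rw [hsnd] at b2
      have h0 : ((A.dir k).2 : ℝ) ≠ 0 := by exact_mod_cast hA.snd_ne_zero hp hk hk'
      have hlen : (B.len (F k)).toReal = (A.len k).toReal := mul_right_cancel₀ h0 (by linarith)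
      rw [b1, a1, hlen]
  have hlink : ∀ h h', A.IsRight h → A.Elevator h h' → ∃ k : D.RightDart,
      A.Connects k.1.1.1 k.1.1.2 h ∧ F h = .hor k.1 ∧ F h' = .hor k.1.swap := by
    intro h h' hr he
    obtain ⟨i, j, hc⟩ := hA.exists_connects hp hr.isHorizontal
    have hw : 0 < D.weight i j := by
      rw [hR.weight i j h hc]
      exact hr.2
    refine ⟨⟨⟨(i, j), (hR.adj i j).2 ⟨h, hc⟩⟩, hw⟩, hc, hF' (.hor _ h hc), hF' ?_⟩
    exact flagCode_swap (k := ⟨(i, j), (hR.adj i j).2 ⟨h, hc⟩⟩) hc (Or.inl ⟨hr, he⟩)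
  have : Nonempty A.V := ⟨A.root (hA.exists_verticalEnd hp).choose⟩
  have : Nonempty B.V := ⟨f (Classical.arbitrary _)⟩
  refine nonempty_iso hA.connected hB.connected (Equiv.ofBijective _ hfb) (Equiv.ofBijective _ hFb)
    hroot hopp hdir hpos hmark (fun h hh => ?_) (fun h h' hr he => ?_) fun h hr => ?_
  · refine hA.dir_ne_zero hp ?_
    rintro i rfl
    exact hh (A.mark_end i)
  · obtain ⟨k, -, h1, h2⟩ := hlink h h' hr he
    rw [Equiv.ofBijective_apply, Equiv.ofBijective_apply, h1, h2]
    exact Diagram.elevator_hor hp hd k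
  · obtain ⟨h', he⟩ := exists_elevator hr
    obtain ⟨k, hc, h1, -⟩ := hlink h h' hr he
    rw [Equiv.ofBijective_apply, h1, ← hR.wind _ _ h hc hr]
    exact Diagram.crossings_hor hp hd k

end IsCounted

end CutMap

end TropEP

end

/-! ### Invariance under isomorphisms, and the counts as sums over diagrams -/

section

open scoped Classical

namespace TropEP

namespace CutMap

variable {n : ℕ} {A B : CutMap n}

/-- The inverse of an isomorphism. -/
def Iso.symm (φ : A.Iso B) : B.Iso A where
  onV := φ.onV.symm
  onH := φ.onH.symm
  onLn := φ.onLn.symm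
  root_eq := fun h => by
    obtain ⟨h, rfl⟩ := φ.onH.surjective h
    rw [φ.root_eq, Equiv.symm_apply_apply, Equiv.symm_apply_apply]
  opp_eq := fun h => by
    obtain ⟨h, rfl⟩ := φ.onH.surjective h
    rw [φ.opp_eq, Equiv.symm_apply_apply, Equiv.symm_apply_apply]
  len_eq := fun h => by
    obtain ⟨h, rfl⟩ := φ.onH.surjective h
    rw [φ.len_eq, Equiv.symm_apply_apply]
  dir_eq := fun h => by
    obtain ⟨h, rfl⟩ := φ.onH.surjective h
    rw [φ.dir_eq, Equiv.symm_apply_apply]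
  pos_eq := fun v => by
    obtain ⟨v, rfl⟩ := φ.onV.surjective v
    rw [φ.pos_eq, Equiv.symm_apply_apply]
  mark_eq := fun i => by rw [φ.mark_eq, Equiv.symm_apply_apply]
  lineWeight_eq := fun l => by
    obtain ⟨l, rfl⟩ := φ.onLn.surjective l
    rw [φ.lineWeight_eq, Equiv.symm_apply_apply]
  lineHeight_eq := fun l => by
    obtain ⟨l, rfl⟩ := φ.onLn.surjective l
    rw [φ.lineHeight_eq, Equiv.symm_apply_apply]
  glue_eq := fun e e' h => by
    have h1 := φ.glue_eq e' e (by rw [h, Sum.map_map]; simp)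
    rw [h1, Sum.map_map]
    simp

theorem Iso.mem_rightEnds_iff (φ : A.Iso B) {x : A.H ⊕ A.Ln} :
    Sum.map φ.onH φ.onLn x ∈ B.rightEnds ↔ x ∈ A.rightEnds := by
  rcases x with h | l
  · change (B.opp (φ.onH h) = φ.onH h ∧ 0 < (B.dir (φ.onH h)).1 ∧ (B.dir (φ.onH h)).2 = 0) ↔
      (A.opp h = h ∧ 0 < (A.dir h).1 ∧ (A.dir h).2 = 0)
    rw [φ.opp_eq, φ.dir_eq, φ.onH.injective.eq_iff]
  · exact Iff.rfl

theorem Iso.advance_eq (φ : A.Iso B) (x : A.H ⊕ A.Ln) :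
    advance B.glue (Sum.map φ.onH φ.onLn x) = Sum.map φ.onH φ.onLn (advance A.glue x) := by
  by_cases hx : x ∈ A.rightEnds
  · rw [advance_of_mem _ hx, advance_of_mem _ (φ.mem_rightEnds_iff.2 hx)]
    exact φ.glue_eq ⟨x, hx⟩ _ rfl
  · rw [advance, dif_neg (fun h => hx (φ.mem_rightEnds_iff.1 h)), advance, dif_neg hx]

theorem Iso.crossings_eq (φ : A.Iso B) (h : A.H) : B.crossings (φ.onH h) = A.crossings h := by
  have key : ∀ k, (advance B.glue)^[k] (Sum.inl (φ.onH h)) =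
      Sum.map φ.onH φ.onLn ((advance A.glue)^[k] (Sum.inl h)) := by
    intro k
    induction k with
    | zero => rfl
    | succ k ih => rw [Function.iterate_succ_apply', ih, φ.advance_eq, Function.iterate_succ_apply']
  unfold crossings
  simp only [key, φ.mem_rightEnds_iff]

theorem Iso.isRight_iff (φ : A.Iso B) {h : A.H} : B.IsRight (φ.onH h) ↔ A.IsRight h := by
  rw [IsRight, φ.dir_eq, IsRight]

theorem Iso.elevator (φ : A.Iso B) {h h' : A.H} (he : A.Elevator h h') :
    B.Elevator (φ.onH h) (φ.onH h') := by
  rcases he with ⟨h1, rfl⟩ | h1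
  · refine Or.inl ⟨?_, (φ.opp_eq h).symm⟩
    rw [φ.opp_eq]
    exact fun e => h1 (φ.onH.injective e)
  · refine Or.inr (Relation.TransGen.lift (Sum.map φ.onH φ.onLn) ?_ _ _ h1)
    rintro _ _ ⟨e, rfl, rfl⟩
    exact ⟨⟨_, φ.mem_rightEnds_iff.2 e.2⟩, rfl, φ.glue_eq e _ rfl⟩

theorem Iso.linked (φ : A.Iso B) {h h' : A.H} (hl : A.Linked h h') :
    B.Linked (φ.onH h) (φ.onH h') :=
  hl.imp (fun h => ⟨φ.isRight_iff.2 h.1, φ.elevator h.2⟩)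
    fun h => ⟨φ.isRight_iff.2 h.1, φ.elevator h.2⟩

theorem Iso.sameFloor (φ : A.Iso B) {v w : A.V} (h : A.SameFloor v w) :
    B.SameFloor (φ.onV v) (φ.onV w) := by
  refine h.induction (P := fun w => B.SameFloor (φ.onV v) (φ.onV w)) (sameFloor_refl _)
    fun k hk hk' _ ih => ih.trans (FloorAdj.sameFloor ⟨φ.onH k, ?_, ?_, φ.root_eq k, ?_⟩)
  · rw [φ.opp_eq]
    exact fun e => hk (φ.onH.injective e)
  · rw [PlaneMap.IsHorizontal, φ.dir_eq]
    exact hk'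
  · rw [φ.opp_eq, φ.root_eq]

theorem Iso.connects (φ : A.Iso B) {i j : Fin n} {h : A.H} (hc : A.Connects i j h) :
    B.Connects i j (φ.onH h) := by
  obtain ⟨h', hl, h1, h2⟩ := hc
  refine ⟨φ.onH h', φ.linked hl, ?_, ?_⟩
  · rw [φ.root_eq, φ.mark_eq, φ.root_eq]
    exact φ.sameFloor h1
  · rw [φ.root_eq, φ.mark_eq, φ.root_eq]
    exact φ.sameFloor h2

theorem Iso.connects_iff (φ : A.Iso B) {i j : Fin n} {h : A.H} :
    B.Connects i j (φ.onH h) ↔ A.Connects i j h := by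
  refine ⟨fun hc => ?_, φ.connects⟩
  have := φ.symm.connects hc
  rwa [show φ.symm.onH (φ.onH h) = h from φ.onH.symm_apply_apply h] at this

theorem Iso.isFloorVertex (φ : A.Iso B) {v : A.V} (h : A.IsFloorVertex v) :
    B.IsFloorVertex (φ.onV v) := by
  obtain ⟨k, rfl, hk⟩ := h
  exact ⟨φ.onH k, φ.root_eq k, by rwa [φ.dir_eq]⟩

theorem Iso.isFloorVertex_iff (φ : A.Iso B) {v : A.V} :
    B.IsFloorVertex (φ.onV v) ↔ A.IsFloorVertex v := by
  refine ⟨fun h => ?_, φ.isFloorVertex⟩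
  have := φ.symm.isFloorVertex h
  rwa [show φ.symm.onV (φ.onV v) = v from φ.onV.symm_apply_apply v] at this

section Realizes

variable {d₂ g : ℕ} {Δ : Multiset ℤ} {A B : CutMap (2 * d₂ + g - 1)} {Q : PearlChain d₂ g}
  {x : Fin (2 * d₂ + g - 1) → ℝ} {D : Diagram Q Δ x}

theorem Iso.realizes (φ : A.Iso B) (h : A.Realizes D) : B.Realizes D where
  white := fun i => by rw [h.white, φ.mark_eq, φ.root_eq, φ.isFloorVertex_iff]
  adj := fun i j => by
    rw [h.adj, φ.onH.surjective.exists]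
    exact exists_congr fun k => φ.connects_iff.symm
  weight := fun i j k hc => by
    obtain ⟨k, rfl⟩ := φ.onH.surjective k
    rw [h.weight i j k (φ.connects_iff.1 hc), φ.dir_eq]
  wind := fun i j k hc hr => by
    obtain ⟨k, rfl⟩ := φ.onH.surjective k
    rw [h.wind i j k (φ.connects_iff.1 hc) (φ.isRight_iff.1 hr), φ.crossings_eq]

/-- Realizing a given diagram is invariant under isomorphisms and therefore a property of the class.
-/
theorem realizes_of_mk_eq (h : (Quot.mk _ A : MapClass (2 * d₂ + g - 1)) = Quot.mk _ B)
    (hA : A.Realizes D) : B.Realizes D := by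
  have h1 : ∀ A B : CutMap (2 * d₂ + g - 1), Nonempty (A.Iso B) → A.Realizes D = B.Realizes D :=
    fun A B ⟨φ⟩ => propext ⟨φ.realizes, φ.symm.realizes⟩
  have h2 := congrArg (Quot.lift (fun A : CutMap (2 * d₂ + g - 1) => A.Realizes D) h1) h
  exact h2.mp hA

variable {p : Fin (2 * d₂ + g - 1) → ℝ × ℝ} {d₁ : ℕ}

/-- Sending a label to the image in `P` of its marked vertex is the isomorphism: every floor and
every point off the floors contains exactly one marked vertex. -/
theorem IsCounted.equiv_of_hasPearlChain (hp : Admissible Δ d₁ g p) (hA : A.IsCounted Δ d₁ g p)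
    (hR : A.Realizes D) {P : PearlChain d₂ g} (hP : A.HasPearlChain P) : P ≈ Q := by
  obtain ⟨φ, -, hφ, hw, ψ, hψ⟩ := hP
  have hs : ∀ v w, φ v = φ w ↔ A.SameFloor v w := fun v w => (hφ v w).trans sameFloor_iff.symm
  let f : Fin (2 * d₂ + g - 1) → Fin (2 * d₂ + g - 1) := fun i => φ (A.root (A.mark i))
  have hf : Function.Bijective f := Finite.injective_iff_bijective.1 fun i j e =>
    hA.eq_of_sameFloor_mark hp ((hs _ _).1 e)
  have hadj : ∀ i j, P.graph.Adj (f i) (f j) ↔ Q.graph.Adj i j := by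
    intro i j
    rw [hR.adj]
    constructor
    · intro h
      obtain ⟨⟨k, hk⟩, e⟩ := ψ.surjective ⟨s(f i, f j), h⟩
      obtain ⟨k', he⟩ := exists_elevator (A := A) hk
      have h1 := hψ ⟨k, hk⟩ k' he
      rw [e, Sym2.eq_iff] at h1
      have hl : A.Linked k k' := Or.inl ⟨hk, he⟩
      rcases h1 with ⟨h2, h3⟩ | ⟨h2, h3⟩
      · exact ⟨k, k', hl, (hs _ _).1 h2.symm, (hs _ _).1 h3.symm⟩
      · exact ⟨k', k, hl.symm, (hs _ _).1 h2.symm, (hs _ _).1 h3.symm⟩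
    · rintro ⟨k, k', hl, h1, h2⟩
      have h1' : φ (A.root k) = f i := (hs _ _).2 h1
      have h2' : φ (A.root k') = f j := (hs _ _).2 h2
      rcases hl with ⟨hr, he⟩ | ⟨hr, he⟩
      · have h3 := (ψ ⟨k, hr⟩).2
        rwa [hψ ⟨k, hr⟩ k' he, h1', h2', SimpleGraph.mem_edgeSet] at h3
      · have h3 := (ψ ⟨k', hr⟩).2
        rw [hψ ⟨k', hr⟩ k he, h1', h2', SimpleGraph.mem_edgeSet] at h3
        exact h3.symm
  refine Setoid.symm ⟨⟨⟨Equiv.ofBijective f hf, fun {i j} => hadj i j⟩, fun i => ?_⟩⟩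
  exact (hw _).trans (hR.white i).symm

theorem HasPearlChain.congr {P : PearlChain d₂ g} (hQ : A.HasPearlChain Q) (h : P ≈ Q) :
    A.HasPearlChain P := by
  obtain ⟨σ, hσ⟩ := Setoid.symm h
  obtain ⟨φ, hsurj, hφ, hw, ψ, hψ⟩ := hQ
  refine ⟨fun v => σ (φ v), σ.surjective.comp hsurj, fun v w => ?_, fun v => ?_,
    ψ.trans σ.mapEdgeSet, fun k k' he => ?_⟩
  · rw [← hφ, σ.injective.eq_iff]
  · rw [hσ, hw]
  · rw [Equiv.trans_apply]
    change Sym2.map σ (ψ k : Sym2 _) = _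
    rw [hψ k k' he]
    rfl

end Realizes

end CutMap

section Count

variable {d₂ g : ℕ} {Δ : Multiset ℤ} {p : Fin (2 * d₂ + g - 1) → ℝ × ℝ} {d₁ : ℕ}

/-- The diagrams that are counted, for all pearl chains. -/
abbrev DiagramSpace (d₂ g : ℕ) (Δ : Multiset ℤ) (x : Fin (2 * d₂ + g - 1) → ℝ) (d₁ : ℕ) : Type :=
  Σ Q : PearlChain d₂ g, {D : Diagram Q Δ x // D.degree = d₁}

/-- The class of the map given by a diagram. -/
noncomputable def diagramClass (hp : Admissible Δ d₁ g p)
    (E : DiagramSpace d₂ g Δ (fun i => (p i).1) d₁) : MapClass (2 * d₂ + g - 1) :=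
  Quot.mk _ (Diagram.toCutMap hp E.2.2)

/-- The diagram, including its labelled pearl chain, can be read off from the class. -/
theorem diagramClass_injective (hp : Admissible Δ d₁ g p) :
    Function.Injective (diagramClass (d₂ := d₂) hp) := by
  rintro ⟨Q, D, hD⟩ ⟨Q', D', hD'⟩ h
  have h1 := CutMap.realizes_of_mk_eq h (Diagram.toCutMap_realizes hp hD)
  have h2 := h1.unique (Diagram.toCutMap_realizes hp hD')
  cases h2
  rfl

theorem mult_diagramClass (hp : Admissible Δ d₁ g p)
    (E : DiagramSpace d₂ g Δ (fun i => (p i).1) d₁) : (diagramClass hp E).mult = E.2.1.mult :=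
  Diagram.toCutMap_mult hp E.2.2

theorem exists_diagramClass (hp : Admissible Δ d₁ g p) (hcard : Δ.card = d₂)
    {A : CutMap (2 * d₂ + g - 1)} (hA : A.IsCounted Δ d₁ g p) :
    ∃ E : DiagramSpace d₂ g Δ (fun i => (p i).1) d₁,
      diagramClass hp E = Quot.mk _ A ∧ A.Realizes E.2.1 := by
  obtain ⟨Q, D, hR⟩ := hA.exists_realizes hp hcard
  have hd := hA.degree_realized hp hR
  exact ⟨⟨Q, D, hd⟩, (Quot.sound (hA.nonempty_iso_toCutMap hp hR hd)).symm, hR⟩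

theorem countedClasses_eq_range (hp : Admissible Δ d₁ g p) (hcard : Δ.card = d₂) :
    countedClasses Δ d₁ g p = Set.range (diagramClass (d₂ := d₂) hp) := by
  ext c
  constructor
  · rintro ⟨A, hA, rfl⟩
    obtain ⟨E, hE, -⟩ := exists_diagramClass hp hcard hA
    exact ⟨E, hE⟩
  · rintro ⟨E, rfl⟩
    exact ⟨_, Diagram.toCutMap_isCounted hp E.2.2, rfl⟩

theorem countedClasses_pearlChain (hp : Admissible Δ d₁ g p) (hcard : Δ.card = d₂)
    (P : PearlChain d₂ g) :
    (Quot.mk _ '' {A | A.IsCounted Δ d₁ g p ∧ A.HasPearlChain P} : Set (MapClass (2 * d₂ + g - 1))) =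
      diagramClass hp '' {E | P ≈ E.1} := by
  ext c
  constructor
  · rintro ⟨A, ⟨hA, hP⟩, rfl⟩
    obtain ⟨E, hE, hR⟩ := exists_diagramClass hp hcard hA
    exact ⟨E, hA.equiv_of_hasPearlChain hp hR hP, hE⟩
  · rintro ⟨E, hE, rfl⟩
    exact ⟨_, ⟨Diagram.toCutMap_isCounted hp E.2.2,
      (Diagram.toCutMap_hasPearlChain hp E.2.2).congr hE⟩, rfl⟩

theorem tropCount_eq (hp : Admissible Δ d₁ g p) (hcard : Δ.card = d₂) :
    tropCount Δ d₁ g p = ∑ Q : PearlChain d₂ g, Diagram.count Q Δ (fun i => (p i).1) d₁ := by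
  rw [tropCount, countedClasses_eq_range hp hcard, finsum_mem_range (diagramClass_injective hp),
    finsum_eq_sum_of_fintype, Fintype.sum_sigma]
  simp only [mult_diagramClass]
  rfl

theorem tropCountOf_eq (hp : Admissible Δ d₁ g p) (hcard : Δ.card = d₂) (P : PearlChain d₂ g) :
    tropCountOf P Δ d₁ p = ∑ Q with P ≈ Q, Diagram.count Q Δ (fun i => (p i).1) d₁ := by
  rw [tropCountOf, countedClasses_pearlChain hp hcard,
    finsum_mem_image (diagramClass_injective hp).injOn]
  simp only [mult_diagramClass]
  rw [finsum_mem_def, finsum_eq_sum_of_fintype, Fintype.sum_sigma, Finset.sum_filter]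
  refine Finset.sum_congr rfl fun Q _ => ?_
  split_ifs with h
  · exact Finset.sum_congr rfl fun D _ =>
      Set.indicator_of_mem (s := {E : DiagramSpace d₂ g Δ (fun i => (p i).1) d₁ | P ≈ E.1}) h _
  · exact Finset.sum_eq_zero fun D _ =>
      Set.indicator_of_notMem (s := {E : DiagramSpace d₂ g Δ (fun i => (p i).1) d₁ | P ≈ E.1}) h _

end Count

end TropEP

end

/-! ### Summation over isomorphism classes, and the theorem -/

section

open scoped Classical

namespace TropEP

theorem sum_quotient {d₂ g : ℕ} (f : PearlChain d₂ g → ℚ) :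
    ∑ c : Quotient (PearlChain.isoSetoid d₂ g), ∑ Q with c.out ≈ Q, f Q = ∑ Q, f Q := by
  rw [← Finset.sum_fiberwise Finset.univ (fun Q => (Quotient.mk _ Q :
    Quotient (PearlChain.isoSetoid d₂ g))) f]
  refine Finset.sum_congr rfl fun c _ => Finset.sum_congr (Finset.filter_congr fun Q _ => ?_)
    fun _ _ => rfl
  rw [← Quotient.eq_iff_equiv, Quotient.out_eq]
  exact eq_comm

end TropEP

end

theorem mainTheorem5 (d₂ g : ℕ) (hd₂ : 0 < d₂) (hg : 0 < g) (Δ : Multiset ℤ)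
    (hcard : Δ.card = d₂) (hsum : Δ.sum = 0) :
    ∃ B : ℕ → ℕ, ∀ p : ℕ → Fin (2 * d₂ + g - 1) → ℝ × ℝ,
      (∀ d₁, TropEP.InGeneralPosition (B d₁) (p d₁) ∧
        TropEP.HorizontallyStretched (B d₁) (p d₁)) →
      (∀ d₁, (TropEP.countedClasses Δ d₁ g (p d₁)).Finite) ∧
      PowerSeries.mk (fun d₁ => (TropEP.tropCount Δ d₁ g (p d₁) : ℚ)) =
        ∑ c : Quotient (TropEP.PearlChain.isoSetoid d₂ g), c.out.feynmanSum Δ ∧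
      ∀ P : TropEP.PearlChain d₂ g,
        PowerSeries.mk (fun d₁ => (TropEP.tropCountOf P Δ d₁ (p d₁) : ℚ)) = P.feynmanSum Δ := by
  -- The equalities hold coefficient by coefficient in `q`, so the points may vary with `d₁`: for
  -- every degree both sides are the same count of diagrams.
  refine ⟨fun d₁ => TropEP.pointBound Δ d₁ g, fun p h => ?_⟩
  have hp : ∀ d₁, TropEP.Admissible Δ d₁ g (p d₁) := fun d₁ =>
    ⟨by omega, by omega, (h d₁).1, (h d₁).2⟩
  have hx : ∀ d₁, Function.Injective fun i => (p d₁ i).1 := fun d₁ i j e => (hp d₁).fst_injective e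
  refine ⟨fun d₁ => ?_, ?_, fun P => ?_⟩
  · rw [TropEP.countedClasses_eq_range (hp d₁) hcard]
    exact Set.finite_range _
  · ext d₁
    rw [PowerSeries.coeff_mk, TropEP.tropCount_eq (hp d₁) hcard, map_sum, Nat.cast_sum,
      ← TropEP.sum_quotient]
    exact Finset.sum_congr rfl fun c _ =>
      (TropEP.Diagram.coeff_feynmanSum c.out Δ (hx d₁) d₁).symm
  · ext d₁
    rw [PowerSeries.coeff_mk, TropEP.tropCountOf_eq (hp d₁) hcard,
      TropEP.Diagram.coeff_feynmanSum P Δ (hx d₁) d₁, Nat.cast_sum]
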